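/- Let $d\ge 2$, $\mathbb T^d=\mathbb R^d/2\pi\mathbb Z^d$, $S\mathbb T^d=\mathbb T^d\times\mathbb S^{d-1}$, $V=\theta\cdot\partial_x$ the geodesic vector field and $e^{tV}(x,\theta)=(x+t\theta,\theta)$ its flow. Let $e^{-tV*}\psi=\psi\circ e^{-tV}$, extended to $\mathcal D'(S\mathbb T^d)$ by duality with respect to $dx\,d\mathrm{Vol}(\theta)$: $\langle e^{-tV*}u,\varphi\rangle=\langle u,\varphi\circ e^{tV}\rangle$. For $M\in\mathbb Z$ and $N\in\mathbb R$ let $\mathcal H^{M,N}(S\mathbb T^d)$ be the space of the distributions $u=\sum_{\xi\in\mathbb Z^d}\widehat u_\xi(\theta)\frac{e^{i\xi\cdot x}}{(2\pi)^{d/2}}$ with $\|u\|^2_{\mathcal H^{M,N}}=\sum_\xi(1+|\xi|^2)^{N}\|\widehat u_\xi\|^2_{H^M(\mathbb S^{d-1})}<\infty$. For $\operatorname{Re}s>0$ let $$\mathcal L(s)=(V+s)^{-1}=\int_0^\infty e^{-st}e^{-tV*}\,dt$$ (a weakly convergent integral in $\mathcal D'(S\mathbb T^d)$, which inverts $V+s$).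 **Theorem.** Let $\chi\in C^\infty_c([0,\infty))$ with $\chi=1$ in a neighbourhood of $0$, and let $N=2k+d$ with an integer $k\ge1$. Then for $\operatorname{Re}s>0$ $$\mathcal L(s)=\mathcal L_0(s)+\mathcal L_\infty(s),\qquad \mathcal L_0(s)=\int_0^\infty\chi(t)e^{-st}e^{-tV*}dt,\qquad \mathcal L_\infty(s)=\int_0^\infty(1-\chi(t))e^{-st}e^{-tV*}dt,$$ where: 1. for every $\sigma\in\mathbb R$, $\mathcal L_0(s):\mathcal H^{N,\sigma}\to\mathcal H^{N,\sigma-N}$, $s\in\mathbb C$, is a holomorphic family of bounded operators on $\mathbb C$; 2. $\mathcal L_\infty(s):\mathcal H^{N,-N/2}\to\mathcal H^{-N,N/2}$ is bounded for $\operatorname{Re}s>0$ and extends, continuously for the operator norm, from $\{\operatorname{Re}s>0\}$ to $\{\operatorname{Re}s\ge0\}\setminus\{0\}$ if $d\ge4$, and to $\{\operatorname{Re}s\ge0\}\setminus\{\pm i|\xi|:\xi\in\mathbb Z^d\}$ if $d=2,3$. 3. For every $\psi\in C^\infty(S\mathbb T^d)$, as $s\to0$ with $\operatorname{Re}s>0$,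 $$(V+s)^{-1}\psi(x,\theta)=\frac1{(2\pi)^d s}\int_{\mathbb T^d}\psi(y,\theta)\,dy+\mathcal O_{\mathcal D'}(1).$$ 4. If $d=2$ or $d=3$, then for every $\psi\in C^\infty(S\mathbb T^d)$, every $\xi_0\in\mathbb Z^d\setminus\{0\}$ and each choice of the sign $\pm$, as $s\to\pm i|\xi_0|$ with $\operatorname{Re}s>0$, $$(V+s)^{-1}\psi(x,\theta)=\frac{e^{\mp i\pi\frac{d-1}4}\,g_d(s\mp i|\xi_0|)}{(2\pi)^{\frac{d+1}2}|\xi_0|^{\frac{d-1}2}}\sum_{\xi\in\mathbb Z^d:\,|\xi|=|\xi_0|}e^{-i\xi\cdot x}\,\delta_0\Big(\theta\mp\frac{\xi}{|\xi|}\Big)\int_{\mathbb T^d}\psi\Big(y,\pm\frac{\xi}{|\xi|}\Big)e^{i\xi\cdot y}\,dy+\mathcal O_{\mathcal D'}(1),$$ where $g_2(z)=\sqrt{\pi}/\sqrt z$ and $g_3(z)=-\ln z$ (principal branches), and $\delta_0(\theta-\theta_0)$ is the Dirac mass at $\theta_0$ with respect to $d\mathrm{Vol}$ on $\mathbb S^{d-1}$.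 Here $r(s)=\mathcal O_{\mathcal D'}(1)$ means that, for $s$ close to the limit point, $|\langle r(s),\varphi\rangle|$ is bounded by a fixed multiple of a fixed $C^m$ norm of $\varphi\in C^\infty(S\mathbb T^d)$. -/

import Mathlib

open MeasureTheory Set Filter Topology
open scoped ContDiff ENNReal

noncomputable section

namespace TorusFlow

/-- The Euclidean space `ℝ^d`. -/
abbrev Euc (d : ℕ) : Type := EuclideanSpace ℝ (Fin d)

/-- The torus `𝕋^d = ℝ^d / 2πℤ^d`. -/
abbrev Torus (d : ℕ) : Type := Fin d → AddCircle (2 * Real.pi)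

/-- The unit sphere `𝕊^{d-1}` of `ℝ^d`. -/
abbrev Sph (d : ℕ) : Type := Metric.sphere (0 : Euc d) 1

/-- The unit tangent bundle `S𝕋^d = 𝕋^d × 𝕊^{d-1}`. -/
abbrev ST (d : ℕ) : Type := Torus d × Sph d

instance factTwoPiPos : Fact (0 < 2 * Real.pi) := ⟨Real.two_pi_pos⟩

/-- The surface measure on the unit sphere. -/
def surf (d : ℕ) : Measure (Sph d) := (volume : Measure (Euc d)).toSphere

instance surf_finite (d : ℕ) : IsFiniteMeasure (surf d) := by
  unfold surf; infer_instance

/-- The canonical projection `ℝ^d → 𝕋^d`. -/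
def torusMk {d : ℕ} (x : Euc d) : Torus d := fun i => ((x i : ℝ) : AddCircle (2 * Real.pi))

lemma torusMk_add {d : ℕ} (x y : Euc d) : torusMk (x + y) = torusMk x + torusMk y := by
  funext i; simp [torusMk]

lemma torusMk_surjective {d : ℕ} : Function.Surjective (torusMk : Euc d → Torus d) := by
  intro y
  have h : ∀ i, ∃ r : ℝ, (r : AddCircle (2 * Real.pi)) = y i := fun i =>
    QuotientAddGroup.mk_surjective (y i)
  choose r hr using h
  exact ⟨WithLp.toLp 2 r, funext fun i => hr i⟩

/-- Smooth functions on `𝕋^d × 𝕊^{d-1}`: those whose lift to `ℝ^d × 𝕊^{d-1}` is the restriction of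
a smooth function on `ℝ^d × ℝ^d` (the sphere being a closed submanifold of `ℝ^d`). -/
def IsSmoothST {d : ℕ} (f : ST d → ℂ) : Prop :=
  ∃ g : Euc d × Euc d → ℂ, ContDiff ℝ ∞ g ∧
    ∀ (x : Euc d) (θ : Sph d), f (torusMk x, θ) = g (x, (θ : Euc d))

/-- Smooth functions on `𝕊^{d-1}`: the restrictions of smooth functions on `ℝ^d`. -/
def IsSmoothSph {d : ℕ} (f : Sph d → ℂ) : Prop :=
  ∃ g : Euc d → ℂ, ContDiff ℝ ∞ g ∧ ∀ θ : Sph d, f θ = g (θ : Euc d)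

/-- The space `C^∞(S𝕋^d)`. -/
def CInf (d : ℕ) : Submodule ℂ (ST d → ℂ) where
  carrier := {f | IsSmoothST f}
  add_mem' := by
    rintro f f' ⟨g, hg, h⟩ ⟨g', hg', h'⟩
    exact ⟨fun p => g p + g' p, hg.add hg', fun x θ => by simp [h, h']⟩
  zero_mem' := ⟨fun _ => 0, contDiff_const, fun _ _ => rfl⟩
  smul_mem' := by
    rintro c f ⟨g, hg, h⟩
    exact ⟨fun p => c * g p, contDiff_const.mul hg, fun x θ => by simp [h]⟩

/-- The space `C^∞(𝕊^{d-1})`. -/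
def CInfSph (d : ℕ) : Submodule ℂ (Sph d → ℂ) where
  carrier := {f | IsSmoothSph f}
  add_mem' := by
    rintro f f' ⟨g, hg, h⟩ ⟨g', hg', h'⟩
    exact ⟨fun p => g p + g' p, hg.add hg', fun θ => by simp [h, h']⟩
  zero_mem' := ⟨fun _ => 0, contDiff_const, fun _ => rfl⟩
  smul_mem' := by
    rintro c f ⟨g, hg, h⟩
    exact ⟨fun p => c * g p, contDiff_const.mul hg, fun θ => by simp [h]⟩

/-! ### Vector fields -/

/-- The vector `v_i e_j - v_j e_i`: the value at `v` of the field `v_i ∂_j - v_j ∂_i`. -/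
def rotField {d : ℕ} (i j : Fin d) (v : Euc d) : Euc d :=
  v i • EuclideanSpace.single j (1 : ℝ) - v j • EuclideanSpace.single i (1 : ℝ)

lemma inner_rotField {d : ℕ} (i j : Fin d) (v : Euc d) : inner ℝ v (rotField i j v) = 0 := by
  simp [rotField, inner_sub_right, inner_smul_right, EuclideanSpace.inner_single_right, mul_comm]

lemma rotField_contDiff {d : ℕ} (i j : Fin d) : ContDiff ℝ ∞ (rotField i j) := by
  unfold rotField
  fun_prop

lemma sph_norm {d : ℕ} (θ : Sph d) : ‖(θ : Euc d)‖ = 1 := by simp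

lemma sph_line_ne_zero {d : ℕ} (i j : Fin d) (t : ℝ) (θ : Sph d) :
    (θ : Euc d) + t • rotField i j θ ≠ 0 := by
  intro h
  have h1 : inner ℝ (θ : Euc d) ((θ : Euc d) + t • rotField i j θ) = (1 : ℝ) := by
    rw [inner_add_right, inner_smul_right, inner_rotField, real_inner_self_eq_norm_sq, sph_norm]
    norm_num
  rw [h, inner_zero_right] at h1
  exact zero_ne_one h1

/-- A curve on the sphere through `θ` with velocity `θ_i e_j - θ_j e_i` at time `0`. -/
def sphCurve {d : ℕ} (i j : Fin d) (t : ℝ) (θ : Sph d) : Sph d :=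
  ⟨‖(θ : Euc d) + t • rotField i j θ‖⁻¹ • ((θ : Euc d) + t • rotField i j θ), by
    rw [mem_sphere_zero_iff_norm, norm_smul, norm_inv, norm_norm]
    exact inv_mul_cancel₀ (norm_ne_zero_iff.2 (sph_line_ne_zero i j t θ))⟩

lemma hasDerivAt_sphCurve {d : ℕ} (i j : Fin d) (θ : Sph d) :
    HasDerivAt (fun t : ℝ => (sphCurve i j t θ : Euc d)) (rotField i j θ) 0 := by
  have h1 : HasDerivAt (fun t : ℝ => (θ : Euc d) + t • rotField i j θ) (rotField i j θ) 0 := by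
    simpa using ((hasDerivAt_id (0 : ℝ)).smul_const (rotField i j (θ : Euc d))).const_add (θ : Euc d)
  have h2 : ∀ t : ℝ, ‖(θ : Euc d) + t • rotField i j θ‖⁻¹
      = (Real.sqrt (1 + t ^ 2 * ‖rotField i j (θ : Euc d)‖ ^ 2))⁻¹ := by
    intro t
    congr 1
    rw [eq_comm, Real.sqrt_eq_iff_mul_self_eq (by positivity) (by positivity), ← pow_two,
      norm_add_sq_real, inner_smul_right, inner_rotField, sph_norm, norm_smul, mul_pow]
    simp
  have h3 : HasDerivAt (fun t : ℝ => ‖(θ : Euc d) + t • rotField i j θ‖⁻¹) 0 0 := by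
    simp_rw [h2]
    have h4 : HasDerivAt (fun t : ℝ => 1 + t ^ 2 * ‖rotField i j (θ : Euc d)‖ ^ 2) 0 0 := by
      simpa using (((hasDerivAt_id (0 : ℝ)).pow 2).mul_const
        (‖rotField i j (θ : Euc d)‖ ^ 2)).const_add 1
    have h5 := (h4.sqrt (by simp)).inv (by simp)
    refine (h5.congr_deriv (by simp)).congr_of_eventuallyEq (Eventually.of_forall fun t => ?_)
    simp
  refine ((h3.smul h1).congr_deriv (by simp)).congr_of_eventuallyEq
    (Eventually.of_forall fun t => ?_)
  simp only [sphCurve, Pi.smul_apply']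

/-- The derivative of a function on the sphere along the rotation field `θ_i ∂_j - θ_j ∂_i`. -/
def rotDerivSphFun {d : ℕ} (i j : Fin d) (f : Sph d → ℂ) (θ : Sph d) : ℂ :=
  deriv (fun t : ℝ => f (sphCurve i j t θ)) 0

/-- The derivative `∂_{x_j}` of a function on `S𝕋^d`. -/
def transDerivFun {d : ℕ} (j : Fin d) (f : ST d → ℂ) (p : ST d) : ℂ :=
  deriv (fun t : ℝ => f (p.1 + torusMk (t • EuclideanSpace.single j (1 : ℝ)), p.2)) 0

/-- The derivative along the rotation field `θ_i ∂_j - θ_j ∂_i` of a function on `S𝕋^d`. -/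
def rotDerivFun {d : ℕ} (i j : Fin d) (f : ST d → ℂ) (p : ST d) : ℂ :=
  deriv (fun t : ℝ => f (p.1, sphCurve i j t p.2)) 0

/-- The geodesic flow `e^{tV} (x, θ) = (x + tθ, θ)`. -/
def flow {d : ℕ} (t : ℝ) (p : ST d) : ST d := (p.1 + torusMk (t • (p.2 : Euc d)), p.2)

/-- The derivative along the geodesic vector field `V = θ · ∂_x`. -/
def geodDerivFun {d : ℕ} (f : ST d → ℂ) (p : ST d) : ℂ :=
  deriv (fun t : ℝ => f (flow t p)) 0

lemma hasDerivAt_along {d : ℕ} {f : ST d → ℂ} {g : Euc d × Euc d → ℂ} (hg : ContDiff ℝ ∞ g)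
    (h : ∀ (x : Euc d) (θ : Sph d), f (torusMk x, θ) = g (x, (θ : Euc d)))
    {γ : ℝ → Euc d} {η : ℝ → Sph d} {a b x v : Euc d} (hγ : HasDerivAt γ a 0)
    (hη : HasDerivAt (fun t => (η t : Euc d)) b 0) (hx : γ 0 = x) (hv : (η 0 : Euc d) = v) :
    HasDerivAt (fun t : ℝ => f (torusMk (γ t), η t)) (fderiv ℝ g (x, v) (a, b)) 0 := by
  simp_rw [h]
  have hd : HasFDerivAt g (fderiv ℝ g (x, v)) (γ 0, (η 0 : Euc d)) := by
    rw [hx, hv]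
    exact (hg.differentiable (by simp) _).hasFDerivAt
  exact hd.comp_hasDerivAt (0 : ℝ) (hγ.prodMk hη)

lemma sphCurve_zero {d : ℕ} (i j : Fin d) (θ : Sph d) : sphCurve i j 0 θ = θ := by
  ext1; simp [sphCurve]

lemma hasDerivAt_rotSph {d : ℕ} {f : Sph d → ℂ} {g : Euc d → ℂ} (hg : ContDiff ℝ ∞ g)
    (h : ∀ θ : Sph d, f θ = g (θ : Euc d)) (i j : Fin d) (θ : Sph d) :
    HasDerivAt (fun t : ℝ => f (sphCurve i j t θ)) (fderiv ℝ g θ (rotField i j θ)) 0 := by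
  simp_rw [h]
  have hd : HasFDerivAt g (fderiv ℝ g θ) (sphCurve i j 0 θ : Euc d) := by
    rw [sphCurve_zero]
    exact (hg.differentiable (by simp) _).hasFDerivAt
  exact hd.comp_hasDerivAt (0 : ℝ) (hasDerivAt_sphCurve i j θ)

lemma hasDerivAt_rot {d : ℕ} {f : ST d → ℂ} {g : Euc d × Euc d → ℂ} (hg : ContDiff ℝ ∞ g)
    (h : ∀ (x : Euc d) (θ : Sph d), f (torusMk x, θ) = g (x, (θ : Euc d)))
    (i j : Fin d) (x : Euc d) (θ : Sph d) :
    HasDerivAt (fun t : ℝ => f (torusMk x, sphCurve i j t θ))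
      (fderiv ℝ g (x, θ) (0, rotField i j θ)) 0 :=
  hasDerivAt_along hg h (γ := fun _ => x) (hasDerivAt_const _ _) (hasDerivAt_sphCurve i j θ) rfl
    (by rw [sphCurve_zero])

lemma hasDerivAt_shift {d : ℕ} {f : ST d → ℂ} {g : Euc d × Euc d → ℂ} (hg : ContDiff ℝ ∞ g)
    (h : ∀ (x : Euc d) (θ : Sph d), f (torusMk x, θ) = g (x, (θ : Euc d)))
    (w x : Euc d) (θ : Sph d) :
    HasDerivAt (fun t : ℝ => f (torusMk x + torusMk (t • w), θ))
      (fderiv ℝ g (x, θ) (w, 0)) 0 := by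
  simp_rw [← torusMk_add]
  refine hasDerivAt_along hg h (γ := fun t => x + t • w) (η := fun _ => θ) ?_
    (hasDerivAt_const _ _) (by simp) rfl
  simpa using ((hasDerivAt_id (0 : ℝ)).smul_const w).const_add x

/-- The operator `Ω_{ij} = θ_i ∂_j - θ_j ∂_i` on `C^∞(𝕊^{d-1})`. -/
def rotDerivSph {d : ℕ} (i j : Fin d) : CInfSph d →ₗ[ℂ] CInfSph d where
  toFun f := ⟨rotDerivSphFun i j f, by
    obtain ⟨g, hg, h⟩ := f.2
    refine ⟨fun v => fderiv ℝ g v (rotField i j v),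
      (hg.fderiv_right (m := ∞) (by simp)).clm_apply (rotField_contDiff i j), fun θ => ?_⟩
    exact (hasDerivAt_rotSph hg h i j θ).deriv⟩
  map_add' f f' := by
    obtain ⟨g, hg, h⟩ := f.2
    obtain ⟨g', hg', h'⟩ := f'.2
    ext θ
    exact ((hasDerivAt_rotSph hg h i j θ).differentiableAt.hasDerivAt.add
      (hasDerivAt_rotSph hg' h' i j θ).differentiableAt.hasDerivAt).deriv
  map_smul' c f := by
    obtain ⟨g, hg, h⟩ := f.2
    ext θ
    exact ((hasDerivAt_rotSph hg h i j θ).differentiableAt.hasDerivAt.const_mul c).deriv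

/-- The operator `Ω_{ij} = θ_i ∂_j - θ_j ∂_i` on `C^∞(S𝕋^d)`. -/
def rotDeriv {d : ℕ} (i j : Fin d) : CInf d →ₗ[ℂ] CInf d where
  toFun f := ⟨rotDerivFun i j f, by
    obtain ⟨g, hg, h⟩ := f.2
    refine ⟨fun p => fderiv ℝ g p (0, rotField i j p.2),
      (hg.fderiv_right (m := ∞) (by simp)).clm_apply
        (contDiff_const.prodMk ((rotField_contDiff i j).comp contDiff_snd)), fun x θ => ?_⟩
    exact (hasDerivAt_rot hg h i j x θ).deriv⟩
  map_add' f f' := by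
    obtain ⟨g, hg, h⟩ := f.2
    obtain ⟨g', hg', h'⟩ := f'.2
    ext ⟨y, θ⟩
    obtain ⟨x, rfl⟩ := torusMk_surjective y
    exact ((hasDerivAt_rot hg h i j x θ).differentiableAt.hasDerivAt.add
      (hasDerivAt_rot hg' h' i j x θ).differentiableAt.hasDerivAt).deriv
  map_smul' c f := by
    obtain ⟨g, hg, h⟩ := f.2
    ext ⟨y, θ⟩
    obtain ⟨x, rfl⟩ := torusMk_surjective y
    exact ((hasDerivAt_rot hg h i j x θ).differentiableAt.hasDerivAt.const_mul c).deriv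

/-- The operator `∂_{x_j}` on `C^∞(S𝕋^d)`. -/
def transDeriv {d : ℕ} (j : Fin d) : CInf d →ₗ[ℂ] CInf d where
  toFun f := ⟨transDerivFun j f, by
    obtain ⟨g, hg, h⟩ := f.2
    refine ⟨fun p => fderiv ℝ g p (EuclideanSpace.single j (1 : ℝ), 0),
      (hg.fderiv_right (m := ∞) (by simp)).clm_apply contDiff_const, fun x θ => ?_⟩
    exact (hasDerivAt_shift hg h _ x θ).deriv⟩
  map_add' f f' := by
    obtain ⟨g, hg, h⟩ := f.2
    obtain ⟨g', hg', h'⟩ := f'.2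
    ext ⟨y, θ⟩
    obtain ⟨x, rfl⟩ := torusMk_surjective y
    exact ((hasDerivAt_shift hg h _ x θ).differentiableAt.hasDerivAt.add
      (hasDerivAt_shift hg' h' _ x θ).differentiableAt.hasDerivAt).deriv
  map_smul' c f := by
    obtain ⟨g, hg, h⟩ := f.2
    ext ⟨y, θ⟩
    obtain ⟨x, rfl⟩ := torusMk_surjective y
    exact ((hasDerivAt_shift hg h _ x θ).differentiableAt.hasDerivAt.const_mul c).deriv

/-- The geodesic vector field `V = θ · ∂_x` acting on `C^∞(S𝕋^d)`. -/
def geodDeriv {d : ℕ} : CInf d →ₗ[ℂ] CInf d where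
  toFun f := ⟨geodDerivFun f, by
    obtain ⟨g, hg, h⟩ := f.2
    refine ⟨fun p => fderiv ℝ g p (p.2, 0),
      (hg.fderiv_right (m := ∞) (by simp)).clm_apply (contDiff_snd.prodMk contDiff_const),
      fun x θ => ?_⟩
    exact (hasDerivAt_shift hg h _ x θ).deriv⟩
  map_add' f f' := by
    obtain ⟨g, hg, h⟩ := f.2
    obtain ⟨g', hg', h'⟩ := f'.2
    ext ⟨y, θ⟩
    obtain ⟨x, rfl⟩ := torusMk_surjective y
    exact ((hasDerivAt_shift hg h _ x θ).differentiableAt.hasDerivAt.add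
      (hasDerivAt_shift hg' h' _ x θ).differentiableAt.hasDerivAt).deriv
  map_smul' c f := by
    obtain ⟨g, hg, h⟩ := f.2
    ext ⟨y, θ⟩
    obtain ⟨x, rfl⟩ := torusMk_surjective y
    exact ((hasDerivAt_shift hg h _ x θ).differentiableAt.hasDerivAt.const_mul c).deriv

/-- The pullback `φ ↦ φ ∘ e^{tV}` on `C^∞(S𝕋^d)`. -/
def flowPull {d : ℕ} (t : ℝ) : CInf d →ₗ[ℂ] CInf d where
  toFun f := ⟨fun p => (f : ST d → ℂ) (flow t p), by
    obtain ⟨g, hg, h⟩ := f.2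
    refine ⟨fun p => g (p.1 + t • p.2, p.2), hg.comp (by fun_prop), fun x θ => ?_⟩
    simp only [flow]
    rw [← torusMk_add, h]⟩
  map_add' f f' := rfl
  map_smul' c f := rfl

/-! ### Distributions -/

/-- `CkBound k φ B`: all the iterated derivatives of order at most `k` of `φ` along the fields
`∂_{x_j}` and `Ω_{ij}` (which span all tangent spaces) are bounded by `B`. -/
def CkBound {d : ℕ} : ℕ → CInf d → ℝ → Prop
  | 0, φ, B => ∀ p, ‖(φ : ST d → ℂ) p‖ ≤ B
  | k + 1, φ, B => (∀ p, ‖(φ : ST d → ℂ) p‖ ≤ B) ∧ (∀ j, CkBound k (transDeriv j φ) B) ∧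
      ∀ i j, CkBound k (rotDeriv i j φ) B

lemma CkBound.zero {d : ℕ} {k : ℕ} {φ : CInf d} {B : ℝ} (h : CkBound k φ B) : CkBound 0 φ B := by
  cases k with
  | zero => exact h
  | succ k => exact h.1

lemma CkBound.of_succ {d : ℕ} {k : ℕ} : ∀ {φ : CInf d} {B : ℝ}, CkBound (k + 1) φ B →
    CkBound k φ B := by
  induction k with
  | zero => intro φ B h; exact h.1
  | succ k ih => intro φ B h; exact ⟨h.1, fun j => ih (h.2.1 j), fun i j => ih (h.2.2 i j)⟩

lemma CkBound.mono {d : ℕ} {k l : ℕ} (hkl : k ≤ l) {φ : CInf d} {B : ℝ} (h : CkBound l φ B) :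
    CkBound k φ B := by
  induction l, hkl using Nat.le_induction with
  | base => exact h
  | succ l _ ih => exact ih h.of_succ

/-- The space `𝓓'(S𝕋^d)` of distributions: linear forms on `C^∞(S𝕋^d)` that are continuous for the
`C^k` norms. -/
def DistST (d : ℕ) : Submodule ℂ (CInf d →ₗ[ℂ] ℂ) where
  carrier := {u | ∃ (k : ℕ) (C : ℝ), ∀ φ B, CkBound k φ B → ‖u φ‖ ≤ C * B}
  add_mem' := by
    rintro u v ⟨k, C, h⟩ ⟨k', C', h'⟩
    refine ⟨max k k', C + C', fun φ B hB => ?_⟩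
    have h1 := h φ B (hB.mono (le_max_left _ _))
    have h2 := h' φ B (hB.mono (le_max_right _ _))
    calc ‖u φ + v φ‖ ≤ ‖u φ‖ + ‖v φ‖ := norm_add_le _ _
      _ ≤ (C + C') * B := by linarith
  zero_mem' := ⟨0, 0, fun φ B _ => by simp⟩
  smul_mem' := by
    rintro c u ⟨k, C, h⟩
    refine ⟨k, ‖c‖ * C, fun φ B hB => ?_⟩
    simp only [LinearMap.smul_apply, smul_eq_mul, norm_mul, mul_assoc]
    exact mul_le_mul_of_nonneg_left (h φ B hB) (norm_nonneg c)

lemma CInf.continuous {d : ℕ} (φ : CInf d) : Continuous (φ : ST d → ℂ) := by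
  obtain ⟨g, hg, h⟩ := φ.2
  have hq : IsOpenQuotientMap (torusMk : Euc d → Torus d) := by
    have h1 : IsOpenQuotientMap
        (Pi.map (fun _ : Fin d => ((↑) : ℝ → AddCircle (2 * Real.pi)))) :=
      IsOpenQuotientMap.piMap fun _ => QuotientAddGroup.isOpenQuotientMap_mk
    exact h1.comp (Homeomorph.isOpenQuotientMap (EuclideanSpace.equiv (Fin d) ℝ).toHomeomorph)
  have hq2 := (hq.prodMap (IsOpenQuotientMap.id (X := Sph d))).isQuotientMap
  rw [hq2.continuous_iff]
  have : (φ : ST d → ℂ) ∘ Prod.map torusMk id = fun p : Euc d × Sph d => g (p.1, (p.2 : Euc d)) := by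
    funext p; exact h p.1 p.2
  rw [this]
  exact hg.continuous.comp (by fun_prop)

lemma CInf.integrable {d : ℕ} (φ : CInf d) :
    Integrable (φ : ST d → ℂ) ((volume : Measure (Torus d)).prod (surf d)) :=
  (CInf.continuous φ).integrable_of_hasCompactSupport (HasCompactSupport.of_compactSpace _)

lemma CInf.integrable_mul {d : ℕ} (ψ φ : CInf d) :
    Integrable (fun p => (ψ : ST d → ℂ) p * (φ : ST d → ℂ) p)
      ((volume : Measure (Torus d)).prod (surf d)) :=
  ((CInf.continuous ψ).mul (CInf.continuous φ)).integrable_of_hasCompactSupport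
    (HasCompactSupport.of_compactSpace _)

/-- The embedding `C^∞(S𝕋^d) ⊆ 𝓓'(S𝕋^d)`, `ψ ↦ (φ ↦ ∫ ψ φ dx dVol(θ))`. -/
def toDistrib {d : ℕ} (ψ : CInf d) : DistST d :=
  ⟨{ toFun := fun φ => ∫ p, (ψ : ST d → ℂ) p * (φ : ST d → ℂ) p
        ∂((volume : Measure (Torus d)).prod (surf d))
     map_add' := fun φ φ' => by
        rw [← integral_add (CInf.integrable_mul ψ φ) (CInf.integrable_mul ψ φ')]
        simp [mul_add]
     map_smul' := fun c φ => by
        rw [RingHom.id_apply, smul_eq_mul, ← integral_const_mul]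
        congr 1; funext p; simp [mul_left_comm] },
    0, ∫ p, ‖(ψ : ST d → ℂ) p‖ ∂((volume : Measure (Torus d)).prod (surf d)), fun φ B hB => by
      rw [← integral_mul_const]
      refine norm_integral_le_of_norm_le ((CInf.integrable ψ).norm.mul_const B)
        (Eventually.of_forall fun p => ?_)
      rw [norm_mul]
      exact mul_le_mul_of_nonneg_left (hB p) (norm_nonneg _)⟩


/-! ### Sobolev norms on the sphere -/

/-- `‖φ‖²_{H^k}` for `φ ∈ C^∞(𝕊^{d-1})`: the sum of `‖Ω_w φ‖²_{L²}` over all words `w` of length at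
most `k` in the fields `Ω_{ij}`. -/
def sobSqFun {d : ℕ} : ℕ → CInfSph d → ℝ≥0∞
  | 0, φ => ∫⁻ θ, ‖(φ : Sph d → ℂ) θ‖ₑ ^ 2 ∂(surf d)
  | k + 1, φ => (∫⁻ θ, ‖(φ : Sph d → ℂ) θ‖ₑ ^ 2 ∂(surf d)) +
      ∑ i : Fin d, ∑ j : Fin d, sobSqFun k (rotDerivSph i j φ)

/-- The norm of a linear form on `C^∞(𝕊^{d-1})` that is dual to the `H^k` norm, i.e. its `H^{-k}`
norm; it is `∞` if the form is not continuous for the `H^k` norm. For `k = 0` this is the `L²` norm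
of the form (`∞` if the form is not given by a function of `L²`). -/
def dualNorm {d : ℕ} (k : ℕ) (u : CInfSph d →ₗ[ℂ] ℂ) : ℝ≥0∞ :=
  ⨆ (φ : CInfSph d) (_ : sobSqFun k φ ≤ 1), ‖u φ‖ₑ

/-- `‖u‖²_{H^k}` for a distribution `u` on `𝕊^{d-1}`: the sum of `‖Ω_w u‖²_{L²}` over all words `w`
of length at most `k`, the derivative `Ω_{ij} u` being `φ ↦ -u(Ω_{ij} φ)`. -/
def sobSqDist {d : ℕ} : ℕ → (CInfSph d →ₗ[ℂ] ℂ) → ℝ≥0∞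
  | 0, u => dualNorm 0 u ^ 2
  | k + 1, u => dualNorm 0 u ^ 2 +
      ∑ i : Fin d, ∑ j : Fin d, sobSqDist k (-(u ∘ₗ rotDerivSph i j))

/-- The square of the Sobolev norm `‖u‖_{H^M(𝕊^{d-1})}`, `M ∈ ℤ`, of a distribution on the sphere:
through weak derivatives if `M ≥ 0`, by duality if `M < 0`. -/
def sphSobSq {d : ℕ} : ℤ → (CInfSph d →ₗ[ℂ] ℂ) → ℝ≥0∞
  | Int.ofNat k, u => sobSqDist k u
  | Int.negSucc k, u => dualNorm (k + 1) u ^ 2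

/-! ### Fourier coefficients and anisotropic Sobolev spaces -/

/-- `|ξ|²` for `ξ ∈ ℤ^d`. -/
def latSq {d : ℕ} (ξ : Fin d → ℤ) : ℝ := ∑ i, (ξ i : ℝ) ^ 2

/-- The Euclidean norm `|ξ|` of `ξ ∈ ℤ^d`. -/
def latNorm {d : ℕ} (ξ : Fin d → ℤ) : ℝ := Real.sqrt (latSq ξ)

/-- The character `x ↦ e^{i ξ · x}` of `𝕋^d`, `ξ ∈ ℤ^d`. -/
def torusChar {d : ℕ} (ξ : Fin d → ℤ) (x : Torus d) : ℂ := ∏ i, fourier (ξ i) (x i)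

lemma torusChar_mk {d : ℕ} (ξ : Fin d → ℤ) (x : Euc d) :
    torusChar ξ (torusMk x) = Complex.exp (Complex.I * ((∑ i, (ξ i : ℝ) * x i : ℝ) : ℂ)) := by
  unfold torusChar torusMk
  rw [Complex.ofReal_sum, Finset.mul_sum, Complex.exp_sum]
  refine Finset.prod_congr rfl fun i _ => ?_
  rw [fourier_coe_apply]
  congr 1
  have : (Real.pi : ℂ) ≠ 0 := by exact_mod_cast Real.pi_ne_zero
  push_cast
  field_simp

/-- `φ ↦ e^{i ξ · x} φ(θ)`, from `C^∞(𝕊^{d-1})` to `C^∞(S𝕋^d)`. -/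
def charTensor {d : ℕ} (ξ : Fin d → ℤ) : CInfSph d →ₗ[ℂ] CInf d where
  toFun φ := ⟨fun p => torusChar ξ p.1 * (φ : Sph d → ℂ) p.2, by
    obtain ⟨g, hg, h⟩ := φ.2
    have h1 : ContDiff ℝ ∞ (fun p : Euc d × Euc d => ∑ i, (ξ i : ℝ) * p.1 i) :=
      ContDiff.sum fun i _ => by fun_prop
    refine ⟨fun p => Complex.exp (Complex.I * ((∑ i, (ξ i : ℝ) * p.1 i : ℝ) : ℂ)) * g p.2,
      ContDiff.mul (ContDiff.cexp (contDiff_const.mul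
        (Complex.ofRealCLM.contDiff.comp h1))) (hg.comp contDiff_snd),
      fun x θ => by simp only [torusChar_mk, h]⟩⟩
  map_add' φ φ' := by ext p; simp [mul_add]
  map_smul' c φ := by ext p; simp [mul_left_comm]

/-- The Fourier coefficient `û_ξ` of a distribution `u` on `S𝕋^d`, a distribution on `𝕊^{d-1}`, in
the normalization `u(x,θ) = ∑_ξ û_ξ(θ) e^{i ξ · x} / (2π)^{d/2}`. -/
def fourierCoef {d : ℕ} (ξ : Fin d → ℤ) : DistST d →ₗ[ℂ] (CInfSph d →ₗ[ℂ] ℂ) where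
  toFun u := (((2 * Real.pi) ^ (-(d : ℝ) / 2) : ℝ) : ℂ) • ((u : CInf d →ₗ[ℂ] ℂ) ∘ₗ charTensor (-ξ))
  map_add' u v := by ext φ; simp
  map_smul' c u := by ext φ; simp [mul_left_comm]

/-- `‖u‖²_{𝓗^{M,N}} = ∑_ξ ⟨ξ⟩^{2N} ‖û_ξ‖²_{H^M(𝕊^{d-1})}`. -/
def anisoSq {d : ℕ} (M : ℤ) (N : ℝ) (u : DistST d) : ℝ≥0∞ :=
  ∑' ξ : Fin d → ℤ, ENNReal.ofReal ((1 + latSq ξ) ^ N) * sphSobSq M (fourierCoef ξ u)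

/-- A function on a complex vector space that is the square of a seminorm (with values in
`[0,∞]`). -/
structure IsSqSeminorm {F : Type*} [AddCommGroup F] [Module ℂ F] (S : F → ℝ≥0∞) : Prop where
  add_le : ∀ u v, S (u + v) ^ (1 / 2 : ℝ) ≤ S u ^ (1 / 2 : ℝ) + S v ^ (1 / 2 : ℝ)
  smul_eq : ∀ (c : ℂ) u, S (c • u) = ‖c‖ₑ ^ 2 * S u

namespace IsSqSeminorm

variable {F G : Type*} [AddCommGroup F] [Module ℂ F] [AddCommGroup G] [Module ℂ G]

lemma sum {ι : Type*} {S : ι → F → ℝ≥0∞} (s : Finset ι) (h : ∀ i, IsSqSeminorm (S i)) :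
    IsSqSeminorm (fun u => ∑ i ∈ s, S i u) where
  add_le u v := by
    have hsq : ∀ a : ℝ≥0∞, (a ^ (1 / 2 : ℝ)) ^ (2 : ℝ) = a := fun a => by
      rw [← ENNReal.rpow_mul]; norm_num
    have h1 := ENNReal.Lp_add_le s (fun i => S i u ^ (1 / 2 : ℝ)) (fun i => S i v ^ (1 / 2 : ℝ))
      (p := 2) (by norm_num)
    simp only [hsq] at h1
    refine le_trans (ENNReal.rpow_le_rpow (Finset.sum_le_sum fun i _ => ?_) (by norm_num)) h1
    rw [← hsq (S i (u + v))]
    exact ENNReal.rpow_le_rpow ((h i).add_le u v) (by norm_num)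
  smul_eq c u := by
    simp only [(h _).smul_eq, Finset.mul_sum]

lemma add {S T : F → ℝ≥0∞} (hS : IsSqSeminorm S) (hT : IsSqSeminorm T) :
    IsSqSeminorm (fun u => S u + T u) := by
  have h := sum (S := fun b : Bool => if b then S else T) Finset.univ
    (fun b => by cases b <;> simpa)
  simpa using h

lemma comp {S : G → ℝ≥0∞} (hS : IsSqSeminorm S) (f : F →ₗ[ℂ] G) :
    IsSqSeminorm (fun u => S (f u)) where
  add_le u v := by rw [map_add]; exact hS.add_le _ _
  smul_eq c u := by rw [map_smul]; exact hS.smul_eq _ _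

lemma const_mul {S : F → ℝ≥0∞} (hS : IsSqSeminorm S) (a : ℝ≥0∞) :
    IsSqSeminorm (fun u => a * S u) where
  add_le u v := by
    simp only [ENNReal.mul_rpow_of_nonneg _ _ (show (0 : ℝ) ≤ 1 / 2 by norm_num), ← mul_add]
    exact mul_le_mul_right (hS.add_le u v) _
  smul_eq c u := by rw [hS.smul_eq, mul_left_comm]

lemma tsum {ι : Type*} {S : ι → F → ℝ≥0∞} (h : ∀ i, IsSqSeminorm (S i)) :
    IsSqSeminorm (fun u => ∑' i, S i u) where
  add_le u v := by
    have hsq : ∀ a : ℝ≥0∞, (a ^ (1 / 2 : ℝ)) ^ (2 : ℝ) = a := fun a => by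
      rw [← ENNReal.rpow_mul]; norm_num
    have hsq' : ∀ a : ℝ≥0∞, (a ^ (2 : ℝ)) ^ (1 / 2 : ℝ) = a := fun a => by
      rw [← ENNReal.rpow_mul]; norm_num
    rw [← hsq' ((∑' i, S i u) ^ (1 / 2 : ℝ) + (∑' i, S i v) ^ (1 / 2 : ℝ))]
    refine ENNReal.rpow_le_rpow ?_ (by norm_num)
    rw [ENNReal.tsum_eq_iSup_sum]
    refine iSup_le fun s => ?_
    rw [← hsq (∑ i ∈ s, S i (u + v))]
    refine ENNReal.rpow_le_rpow (((sum s h).add_le u v).trans ?_) (by norm_num)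
    exact add_le_add (ENNReal.rpow_le_rpow (ENNReal.sum_le_tsum s) (by norm_num))
      (ENNReal.rpow_le_rpow (ENNReal.sum_le_tsum s) (by norm_num))
  smul_eq c u := by
    simp only [(h _).smul_eq, ENNReal.tsum_mul_left]

lemma map_zero {S : F → ℝ≥0∞} (hS : IsSqSeminorm S) : S 0 = 0 := by
  have := hS.smul_eq 0 0
  simpa using this

end IsSqSeminorm

lemma isSqSeminorm_dualNorm {d : ℕ} (k : ℕ) :
    IsSqSeminorm (fun u : CInfSph d →ₗ[ℂ] ℂ => dualNorm k u ^ 2) where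
  add_le u v := by
    have hsq : ∀ a : ℝ≥0∞, (a ^ 2) ^ (1 / 2 : ℝ) = a := fun a => by
      rw [← ENNReal.rpow_natCast, ← ENNReal.rpow_mul]; norm_num
    simp only [hsq]
    refine iSup₂_le fun φ hφ => ?_
    rw [LinearMap.add_apply]
    refine (enorm_add_le _ _).trans (add_le_add ?_ ?_)
    · exact le_iSup₂ (f := fun (φ : CInfSph d) (_ : sobSqFun k φ ≤ 1) => ‖u φ‖ₑ) φ hφ
    · exact le_iSup₂ (f := fun (φ : CInfSph d) (_ : sobSqFun k φ ≤ 1) => ‖v φ‖ₑ) φ hφ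
  smul_eq c u := by
    rw [← mul_pow]
    congr 1
    simp only [dualNorm, LinearMap.smul_apply, smul_eq_mul, enorm_mul, ENNReal.mul_iSup]

lemma isSqSeminorm_sobSqDist {d : ℕ} (k : ℕ) :
    IsSqSeminorm (sobSqDist k : (CInfSph d →ₗ[ℂ] ℂ) → ℝ≥0∞) := by
  induction k with
  | zero => exact isSqSeminorm_dualNorm 0
  | succ k ih =>
    exact (isSqSeminorm_dualNorm 0).add (IsSqSeminorm.sum _ fun i => IsSqSeminorm.sum _ fun j =>
      ih.comp (-(LinearMap.lcomp ℂ ℂ (rotDerivSph i j))))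

lemma isSqSeminorm_sphSobSq {d : ℕ} (M : ℤ) :
    IsSqSeminorm (sphSobSq M : (CInfSph d →ₗ[ℂ] ℂ) → ℝ≥0∞) := by
  cases M with
  | ofNat k => exact isSqSeminorm_sobSqDist k
  | negSucc k => exact isSqSeminorm_dualNorm (k + 1)

lemma isSqSeminorm_anisoSq {d : ℕ} (M : ℤ) (N : ℝ) :
    IsSqSeminorm (anisoSq M N : DistST d → ℝ≥0∞) :=
  IsSqSeminorm.tsum fun ξ => ((isSqSeminorm_sphSobSq M).comp (fourierCoef ξ)).const_mul _

/-- The anisotropic Sobolev space `𝓗^{M,N}(S𝕋^d)` for `M ∈ ℤ` and `N ∈ ℝ`: the distributions with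
`∑_ξ ⟨ξ⟩^{2N} ‖û_ξ‖²_{H^M} < ∞`. -/
def Aniso (d : ℕ) (M : ℤ) (N : ℝ) : Submodule ℂ (DistST d) where
  carrier := {u | anisoSq M N u < ⊤}
  add_mem' := by
    intro u v hu hv
    have h := (isSqSeminorm_anisoSq M N).add_le u v
    have h2 : anisoSq M N (u + v) ^ (1 / 2 : ℝ) < ⊤ := lt_of_le_of_lt h
      (ENNReal.add_lt_top.2 ⟨ENNReal.rpow_lt_top_of_nonneg (by norm_num) (ne_of_lt hu),
        ENNReal.rpow_lt_top_of_nonneg (by norm_num) (ne_of_lt hv)⟩)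
    exact (ENNReal.rpow_lt_top_iff_of_pos (by norm_num)).1 h2
  zero_mem' := by
    simp [(isSqSeminorm_anisoSq M N).map_zero]
  smul_mem' := by
    intro c u hu
    simp only [Set.mem_ofPred_eq, (isSqSeminorm_anisoSq M N).smul_eq]
    exact ENNReal.mul_lt_top (by simp) hu

instance {d : ℕ} {M : ℤ} {N : ℝ} : Norm (Aniso d M N) :=
  ⟨fun u => (anisoSq M N (u : DistST d)).toReal ^ (1 / 2 : ℝ)⟩

lemma aniso_norm_def {d : ℕ} {M : ℤ} {N : ℝ} (u : Aniso d M N) :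
    ‖u‖ = (anisoSq M N (u : DistST d) ^ (1 / 2 : ℝ)).toReal := by
  rw [← ENNReal.toReal_rpow]; rfl

lemma aniso_core (d : ℕ) (M : ℤ) (N : ℝ) : SeminormedSpace.Core ℂ (Aniso d M N) where
  norm_nonneg u := by rw [aniso_norm_def]; positivity
  norm_smul c u := by
    simp only [aniso_norm_def, Submodule.coe_smul, (isSqSeminorm_anisoSq M N).smul_eq]
    rw [ENNReal.mul_rpow_of_nonneg _ _ (by norm_num), ENNReal.toReal_mul,
      ← ENNReal.rpow_natCast, ← ENNReal.rpow_mul]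
    norm_num
  norm_triangle u v := by
    have hf : ∀ w : Aniso d M N, anisoSq M N (w : DistST d) ^ (1 / 2 : ℝ) ≠ ⊤ := fun w =>
      ENNReal.rpow_ne_top_of_nonneg (by norm_num) (ne_of_lt w.2)
    simp only [aniso_norm_def, ← ENNReal.toReal_add (hf u) (hf v)]
    exact ENNReal.toReal_mono (ENNReal.add_ne_top.2 ⟨hf u, hf v⟩)
      ((isSqSeminorm_anisoSq M N).add_le _ _)

instance {d : ℕ} {M : ℤ} {N : ℝ} : SeminormedAddCommGroup (Aniso d M N) :=
  SeminormedAddCommGroup.ofCore (aniso_core d M N)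

instance {d : ℕ} {M : ℤ} {N : ℝ} : NormedSpace ℂ (Aniso d M N) where
  norm_smul_le c u := le_of_eq ((aniso_core d M N).norm_smul c u)

/-! ### Operators -/

/-- `w = ∫_0^∞ a(t) e^{-tV*} u dt` as a weakly convergent integral in `𝓓'(S𝕋^d)`. Here `e^{-tV*}` is
the pullback by `e^{-tV}`, extended to distributions by duality: as the flow preserves
`dx dVol(θ)`, `⟨e^{-tV*} u, φ⟩ = ⟨u, φ ∘ e^{tV}⟩`. -/
def IsFlowIntegral {d : ℕ} (a : ℝ → ℂ) (u w : DistST d) : Prop :=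
  ∀ φ : CInf d,
    IntegrableOn (fun t : ℝ => a t * (u : CInf d →ₗ[ℂ] ℂ) (flowPull t φ)) (Ioi 0) ∧
    (w : CInf d →ₗ[ℂ] ℂ) φ = ∫ t in Ioi (0 : ℝ), a t * (u : CInf d →ₗ[ℂ] ℂ) (flowPull t φ)

/-- `w` solves `(V + s) w = u` in the sense of distributions (`V` is divergence free). -/
def SolvesTransport {d : ℕ} (s : ℂ) (u w : DistST d) : Prop :=
  ∀ φ : CInf d, (w : CInf d →ₗ[ℂ] ℂ) (s • φ - geodDeriv φ) = (u : CInf d →ₗ[ℂ] ℂ) φ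

/-- `r(s) = 𝒪_{𝓓'}(1)` along the filter `l`: the pairings `⟨r(s), φ⟩` are bounded by a fixed multiple
of a fixed `C^k` norm of `φ`. -/
def IsBoundedDist {d : ℕ} (l : Filter ℂ) (r : ℂ → CInf d → ℂ) : Prop :=
  ∃ (k : ℕ) (C : ℝ), ∀ᶠ s in l, ∀ φ B, CkBound k φ B → ‖r s φ‖ ≤ C * B

/-- The pairing with `φ` of the distribution `(x, θ) ↦ ∫_{𝕋^d} ψ(y, θ) dy`. -/
def averagePairing {d : ℕ} (ψ φ : CInf d) : ℂ :=
  ∫ θ, (∫ y : Torus d, (ψ : ST d → ℂ) (y, θ)) * (∫ x : Torus d, (φ : ST d → ℂ) (x, θ)) ∂(surf d)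

/-- The point `ε ξ / |ξ|` of the sphere, for `ξ ∈ ℤ^d \ {0}` and a sign `ε`. -/
def latDir {d : ℕ} (ε : ℤˣ) (ξ : Fin d → ℤ) (hξ : ξ ≠ 0) : Sph d :=
  ⟨WithLp.toLp 2 fun i => ((ε : ℤ) : ℝ) * (ξ i : ℝ) / latNorm ξ, by
    have h0 : 0 < latSq ξ := by
      obtain ⟨i, hi⟩ := Function.ne_iff.1 hξ
      exact Finset.sum_pos' (fun i _ => sq_nonneg _) ⟨i, Finset.mem_univ _,
        by have : (ξ i : ℝ) ≠ 0 := by exact_mod_cast hi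
           positivity⟩
    have hε : (((ε : ℤ) : ℝ)) ^ 2 = 1 := by
      rcases Int.units_eq_one_or ε with h | h <;> simp [h]
    rw [mem_sphere_zero_iff_norm, EuclideanSpace.norm_eq, Real.sqrt_eq_one]
    simp only [Real.norm_eq_abs, sq_abs, div_pow, mul_pow, hε, one_mul, latNorm,
      Real.sq_sqrt h0.le]
    rw [← Finset.sum_div]
    exact div_self h0.ne'⟩

/-- The pairing with `φ` of the distribution
`∑_{|ξ| = |ξ₀|, ξ ≠ 0} e^{-i ξ · x} δ_0(θ - ε ξ/|ξ|) ∫_{𝕋^d} ψ(y, ε ξ/|ξ|) e^{i ξ · y} dy`. -/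
def modePairing {d : ℕ} (ε : ℤˣ) (ξ₀ : Fin d → ℤ) (ψ φ : CInf d) : ℂ :=
  ∑ᶠ ξ : {ξ : Fin d → ℤ // ξ ≠ 0 ∧ latNorm ξ = latNorm ξ₀},
    (∫ x : Torus d, torusChar (-ξ.1) x * (φ : ST d → ℂ) (x, latDir ε ξ.1 ξ.2.1)) *
      ∫ y : Torus d, (ψ : ST d → ℂ) (y, latDir ε ξ.1 ξ.2.1) * torusChar ξ.1 y

/-- The profile of the singularity: `√π / √z` for `d = 2` and `-log z` for `d = 3` (principal
branches). -/
def singProfile (d : ℕ) (z : ℂ) : ℂ :=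
  if d = 2 then (Real.sqrt Real.pi : ℂ) / z ^ (1 / 2 : ℂ) else -Complex.log z

end TorusFlow

end

noncomputable section

namespace TorusFlow

open scoped Real
open Complex (I exp norm_real)
open Finset (sum_le_sum sum_nonneg sum_congr single_le_sum mul_sum sum_mul sum_add_distrib
  sum_sub_distrib sum_const card_univ)
open Real (norm_of_nonneg rpow_add sqrt_nonneg sqrt_le_sqrt rpow_natCast two_pi_pos norm_eq_abs)

/-! ### The algebra of smooth functions on the sphere -/

section SphereAlgebra

variable {d : ℕ}

lemma hasDerivAt_sphCurve_apply (f : CInfSph d) (i j : Fin d) (θ : Sph d) :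
    HasDerivAt (fun t : ℝ => f.1 (sphCurve i j t θ)) ((rotDerivSph i j f).1 θ) 0 := by
  obtain ⟨g, hg, h⟩ := f.2
  exact (hasDerivAt_rotSph hg h i j θ).differentiableAt.hasDerivAt

lemma rotDerivSph_eq_fderiv {f : CInfSph d} {g : Euc d → ℂ} (hg : ContDiff ℝ ∞ g)
    (h : ∀ θ : Sph d, f.1 θ = g (θ : Euc d)) (i j : Fin d) (θ : Sph d) :
    (rotDerivSph i j f).1 θ = fderiv ℝ g θ (rotField i j θ) :=
  (hasDerivAt_rotSph hg h i j θ).deriv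

lemma CInfSph.continuous (f : CInfSph d) : Continuous f.1 := by
  obtain ⟨g, hg, h⟩ := f.2
  have : f.1 = fun θ : Sph d => g (θ : Euc d) := funext h
  rw [this]
  exact hg.continuous.comp continuous_subtype_val

lemma integrable_of_continuous_sph {E : Type*} [NormedAddCommGroup E] {f : Sph d → E}
    (hf : Continuous f) : Integrable f (surf d) :=
  hf.integrable_of_hasCompactSupport (HasCompactSupport.of_compactSpace _)

lemma CInfSph.integrable (f : CInfSph d) : Integrable f.1 (surf d) :=
  integrable_of_continuous_sph (CInfSph.continuous f)

instance : Mul (CInfSph d) where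
  mul f g := ⟨fun θ => f.1 θ * g.1 θ, by
    obtain ⟨a, ha, h⟩ := f.2
    obtain ⟨b, hb, h'⟩ := g.2
    exact ⟨fun v => a v * b v, ha.mul hb, fun θ => by simp [h, h']⟩⟩

instance : One (CInfSph d) where
  one := ⟨fun _ => 1, fun _ => 1, contDiff_const, fun _ => rfl⟩

@[simp] lemma CInfSph.mul_apply (f g : CInfSph d) (θ : Sph d) : (f * g).1 θ = f.1 θ * g.1 θ := rfl
@[simp] lemma CInfSph.one_apply (θ : Sph d) : (1 : CInfSph d).1 θ = 1 := rfl
@[simp] lemma CInfSph.add_apply (f g : CInfSph d) (θ : Sph d) : (f + g).1 θ = f.1 θ + g.1 θ := rfl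
@[simp] lemma CInfSph.sub_apply (f g : CInfSph d) (θ : Sph d) : (f - g).1 θ = f.1 θ - g.1 θ := rfl
@[simp] lemma CInfSph.neg_apply (f : CInfSph d) (θ : Sph d) : (-f).1 θ = - f.1 θ := rfl
@[simp] lemma CInfSph.zero_apply (θ : Sph d) : (0 : CInfSph d).1 θ = 0 := rfl
@[simp] lemma CInfSph.smul_apply (c : ℂ) (f : CInfSph d) (θ : Sph d) :
    (c • f).1 θ = c * f.1 θ := rfl
@[simp] lemma CInfSph.sum_apply {ι : Type*} (s : Finset ι) (f : ι → CInfSph d) (θ : Sph d) :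
    (∑ i ∈ s, f i).1 θ = ∑ i ∈ s, (f i).1 θ := by
  rw [Submodule.coe_sum, Finset.sum_apply]

lemma CInfSph.ext' {f g : CInfSph d} (h : ∀ θ, f.1 θ = g.1 θ) : f = g := Subtype.ext (funext h)

instance : CommMonoid (CInfSph d) where
  mul_assoc _ _ _ := CInfSph.ext' fun _ => mul_assoc _ _ _
  mul_comm _ _ := CInfSph.ext' fun _ => mul_comm _ _
  one_mul _ := CInfSph.ext' fun _ => one_mul _
  mul_one _ := CInfSph.ext' fun _ => mul_one _

@[simp] lemma CInfSph.pow_apply (f : CInfSph d) (n : ℕ) (θ : Sph d) :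
    (f ^ n).1 θ = f.1 θ ^ n := by
  induction n with
  | zero => simp
  | succ n ih => simp [pow_succ, ih]

lemma rotDerivSph_mul (i j : Fin d) (f g : CInfSph d) :
    rotDerivSph i j (f * g) = rotDerivSph i j f * g + f * rotDerivSph i j g := by
  refine CInfSph.ext' fun θ => ?_
  have h := (hasDerivAt_sphCurve_apply f i j θ).mul (hasDerivAt_sphCurve_apply g i j θ)
  rw [sphCurve_zero] at h
  exact (hasDerivAt_sphCurve_apply (f * g) i j θ).unique h

/-- Integration over the sphere. -/
def sphInt : CInfSph d →ₗ[ℂ] ℂ where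
  toFun f := ∫ θ, f.1 θ ∂(surf d)
  map_add' f g := integral_add (CInfSph.integrable f) (CInfSph.integrable g)
  map_smul' c _ := integral_const_mul c _

lemma sphInt_apply (f : CInfSph d) : sphInt f = ∫ θ, f.1 θ ∂(surf d) := rfl

/-- The value of `θ_i ∂_j - θ_j ∂_i` on the linear function `⟨v, ·⟩`. -/
def rotCoef (v : Euc d) (i j : Fin d) (θ : Sph d) : ℝ := θ.1 i * v j - θ.1 j * v i

lemma inner_rotField_right (v w : Euc d) (i j : Fin d) :
    inner ℝ v (rotField i j w) = w i * v j - w j * v i := by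
  simp [rotField, inner_sub_right, inner_smul_right, EuclideanSpace.inner_single_right]

lemma hasDerivAt_inner_sphCurve (v : Euc d) (i j : Fin d) (θ : Sph d) :
    HasDerivAt (fun t : ℝ => inner ℝ v (sphCurve i j t θ : Euc d)) (rotCoef v i j θ) 0 := by
  have h := (hasDerivAt_const (0 : ℝ) v).inner ℝ (hasDerivAt_sphCurve i j θ)
  simpa [inner_rotField_right, rotCoef] using h

lemma rotDerivSph_radial {h : ℝ → ℂ} {h' : ℂ} (v : Euc d) (f : CInfSph d)
    (hf : ∀ θ : Sph d, f.1 θ = h (inner ℝ v (θ : Euc d))) (i j : Fin d) (θ : Sph d)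
    (hh : HasDerivAt h h' (inner ℝ v (θ : Euc d))) :
    (rotDerivSph i j f).1 θ = h' * rotCoef v i j θ := by
  have h1 := hasDerivAt_sphCurve_apply f i j θ
  simp_rw [hf] at h1
  have h2 : HasDerivAt h h' (inner ℝ v (sphCurve i j 0 θ : Euc d)) := by rwa [sphCurve_zero]
  have h3 := h2.scomp (0 : ℝ) (hasDerivAt_inner_sphCurve v i j θ)
  have h4 := h1.unique h3
  rw [h4, mul_comm, Complex.real_smul]

/-- The function `h (⟨v, θ⟩)` on the sphere. -/
def sphRadial (h : ℝ → ℂ) (hh : ContDiff ℝ ∞ h) (v : Euc d) : CInfSph d :=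
  ⟨fun θ => h (inner ℝ v (θ : Euc d)), fun w => h (inner ℝ v w),
    hh.comp (contDiff_const.inner ℝ contDiff_id), fun _ => rfl⟩

/-- The linear function `⟨v, θ⟩` on the sphere. -/
def sphLin (v : Euc d) : CInfSph d := sphRadial (fun x => (x : ℂ)) Complex.ofRealCLM.contDiff v

/-- The exponential `exp (- i ⟨v, θ⟩)` on the sphere. -/
def sphExp (v : Euc d) : CInfSph d :=
  sphRadial (fun x => exp (-(I * x)))
    ((contDiff_const.mul Complex.ofRealCLM.contDiff).neg.cexp) v

lemma sphLin_apply (v : Euc d) (θ : Sph d) :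
    (sphLin v).1 θ = ((inner ℝ v (θ : Euc d) : ℝ) : ℂ) := rfl

lemma sphExp_apply (v : Euc d) (θ : Sph d) :
    (sphExp v).1 θ = exp (-(I * ((inner ℝ v (θ : Euc d) : ℝ) : ℂ))) := rfl

@[simp] lemma norm_sphExp_apply (v : Euc d) (θ : Sph d) : ‖(sphExp v).1 θ‖ = 1 := by
  rw [sphExp_apply, Complex.norm_exp]
  simp

/-- The vector `v_j e_i - v_i e_j`. -/
def rotVec (v : Euc d) (i j : Fin d) : Euc d :=
  v j • EuclideanSpace.single i (1 : ℝ) - v i • EuclideanSpace.single j (1 : ℝ)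

lemma inner_rotVec (v w : Euc d) (i j : Fin d) :
    inner ℝ (rotVec v i j) w = w i * v j - w j * v i := by
  simp [rotVec, inner_sub_left, inner_smul_left, EuclideanSpace.inner_single_left, mul_comm]

lemma rotDerivSph_sphLin (v : Euc d) (i j : Fin d) :
    rotDerivSph i j (sphLin v) = sphLin (rotVec v i j) := by
  refine CInfSph.ext' fun θ => ?_
  rw [rotDerivSph_radial v (sphLin v) (fun _ => rfl) i j θ
    (Complex.ofRealCLM.hasDerivAt (x := inner ℝ v (θ : Euc d)))]
  rw [sphLin_apply, inner_rotVec]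
  simp [rotCoef]

lemma rotDerivSph_sphExp (v : Euc d) (i j : Fin d) :
    rotDerivSph i j (sphExp v) = (-I) • (sphLin (rotVec v i j) * sphExp v) := by
  refine CInfSph.ext' fun θ => ?_
  have h1 : HasDerivAt (fun x : ℝ => exp (-(I * x)))
      (exp (-(I * ((inner ℝ v (θ : Euc d) : ℝ) : ℂ))) * (-(I * 1)))
      (inner ℝ v (θ : Euc d)) :=
    ((Complex.ofRealCLM.hasDerivAt (x := inner ℝ v (θ : Euc d))).const_mul I).neg.cexp
  rw [rotDerivSph_radial v (sphExp v) (fun _ => rfl) i j θ h1]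
  simp only [CInfSph.smul_apply, CInfSph.mul_apply, sphLin_apply, inner_rotVec, sphExp_apply,
    rotCoef]
  ring

lemma rotDerivSph_one (i j : Fin d) : rotDerivSph i j (1 : CInfSph d) = 0 := by
  have := rotDerivSph_mul i j (1 : CInfSph d) 1
  simpa using this

/-- The complex conjugate of a smooth function on the sphere. -/
def sphConj (f : CInfSph d) : CInfSph d :=
  ⟨fun θ => (starRingEnd ℂ) (f.1 θ), by
    obtain ⟨g, hg, h⟩ := f.2
    exact ⟨fun v => (starRingEnd ℂ) (g v), Complex.conjCLE.contDiff.comp hg, fun θ => by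
      simp only [h]⟩⟩

@[simp] lemma sphConj_apply (f : CInfSph d) (θ : Sph d) :
    (sphConj f).1 θ = (starRingEnd ℂ) (f.1 θ) := rfl

lemma rotDerivSph_sphConj (i j : Fin d) (f : CInfSph d) :
    rotDerivSph i j (sphConj f) = sphConj (rotDerivSph i j f) :=
  CInfSph.ext' fun θ =>
    (hasDerivAt_sphCurve_apply (sphConj f) i j θ).unique (hasDerivAt_sphCurve_apply f i j θ).star

end SphereAlgebra

/-! ### Rotation invariance -/

section Rotation

variable {d : ℕ}

/-- The map of the sphere induced by a linear isometry. -/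
def sphMap (A : Euc d ≃ₗᵢ[ℝ] Euc d) (θ : Sph d) : Sph d := ⟨A θ, by simp⟩

@[simp] lemma coe_sphMap (A : Euc d ≃ₗᵢ[ℝ] Euc d) (θ : Sph d) : (sphMap A θ : Euc d) = A θ := rfl

lemma continuous_sphMap (A : Euc d ≃ₗᵢ[ℝ] Euc d) : Continuous (sphMap A) :=
  (A.continuous.comp continuous_subtype_val).subtype_mk _

open scoped Pointwise in
lemma measurePreserving_sphMap (A : Euc d ≃ₗᵢ[ℝ] Euc d) :
    MeasurePreserving (sphMap A) (surf d) (surf d) := by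
  refine ⟨(continuous_sphMap A).measurable, Measure.ext fun s hs => ?_⟩
  rw [Measure.map_apply (continuous_sphMap A).measurable hs]
  unfold surf
  rw [Measure.toSphere_apply' _ hs,
    Measure.toSphere_apply' _ ((continuous_sphMap A).measurable hs)]
  congr 1
  have h : Set.Ioo (0 : ℝ) 1 • (Subtype.val '' (sphMap A ⁻¹' s)) =
      A ⁻¹' (Set.Ioo (0 : ℝ) 1 • (Subtype.val '' s)) := by
    ext x
    simp only [Set.mem_smul, Set.mem_image, Set.mem_preimage, exists_exists_and_eq_and]
    constructor
    · rintro ⟨r, hr, θ, hθ, rfl⟩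
      exact ⟨r, hr, sphMap A θ, hθ, by simp⟩
    · rintro ⟨r, hr, θ, hθ, h⟩
      refine ⟨r, hr, sphMap A.symm θ, ?_, ?_⟩
      · have : sphMap A (sphMap A.symm θ) = θ := by ext1; simp
        simpa [this] using hθ
      · apply A.injective
        simp [← h]
  rw [h]
  exact A.measurePreserving.measure_preimage_emb A.toHomeomorph.measurableEmbedding _

lemma integral_sphMap {E : Type*} [NormedAddCommGroup E] [NormedSpace ℝ E]
    (A : Euc d ≃ₗᵢ[ℝ] Euc d) (f : Sph d → E) :
    ∫ θ, f (sphMap A θ) ∂(surf d) = ∫ θ, f θ ∂(surf d) := by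
  refine (measurePreserving_sphMap A).integral_comp ?_ f
  refine Topology.IsClosedEmbedding.measurableEmbedding ?_
  refine (continuous_sphMap A).isClosedEmbedding fun x y h => ?_
  have := congrArg Subtype.val h
  ext1
  exact A.injective this

/-- The rotation by the angle `t` in the plane of the coordinates `i` and `j`. -/
def rotLin (i j : Fin d) (t : ℝ) : Euc d →ₗ[ℝ] Euc d where
  toFun v := v + ((Real.cos t - 1) * v i - Real.sin t * v j) • EuclideanSpace.single i (1 : ℝ) +
    ((Real.cos t - 1) * v j + Real.sin t * v i) • EuclideanSpace.single j (1 : ℝ)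
  map_add' v w := by ext k; simp; split_ifs <;> ring
  map_smul' c v := by ext k; simp; split_ifs <;> ring

lemma rotLin_apply (i j : Fin d) (t : ℝ) (v : Euc d) :
    rotLin i j t v =
      v + ((Real.cos t - 1) * v i - Real.sin t * v j) • EuclideanSpace.single i (1 : ℝ) +
    ((Real.cos t - 1) * v j + Real.sin t * v i) • EuclideanSpace.single j (1 : ℝ) := rfl

lemma rotLin_add {i j : Fin d} (hij : i ≠ j) (s t : ℝ) (v : Euc d) :
    rotLin i j s (rotLin i j t v) = rotLin i j (s + t) v := by
  ext k
  simp only [rotLin_apply, Real.cos_add, Real.sin_add, PiLp.add_apply, PiLp.smul_apply,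
    PiLp.single_apply, smul_eq_mul]
  by_cases h1 : k = i
  · subst h1; simp [hij, hij.symm]; ring
  · by_cases h2 : k = j
    · subst h2; simp [hij, hij.symm]; ring
    · simp [h1, h2]

lemma norm_rotLin {i j : Fin d} (hij : i ≠ j) (t : ℝ) (v : Euc d) : ‖rotLin i j t v‖ = ‖v‖ := by
  rw [← sq_eq_sq₀ (norm_nonneg _) (norm_nonneg _), rotLin_apply, add_assoc, norm_add_sq_real,
    norm_add_sq_real]
  simp [inner_add_right, inner_smul_right, inner_smul_left, EuclideanSpace.inner_single_right,
    norm_smul, hij.symm]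
  have := Real.sin_sq_add_cos_sq t
  linear_combination ((v i)^2 + (v j)^2) * this

/-- The rotation by the angle `t` in the plane of the coordinates `i ≠ j` as an isometry. -/
def rotIso {i j : Fin d} (hij : i ≠ j) (t : ℝ) : Euc d ≃ₗᵢ[ℝ] Euc d where
  toLinearEquiv := LinearEquiv.ofLinearMap (rotLin i j t) (rotLin i j (-t))
    (LinearMap.ext fun v => by
      rw [LinearMap.comp_apply, rotLin_add hij, add_neg_cancel]; simp [rotLin_apply])
    (LinearMap.ext fun v => by
      rw [LinearMap.comp_apply, rotLin_add hij, neg_add_cancel]; simp [rotLin_apply])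
  norm_map' v := norm_rotLin hij t v

lemma coe_sphMap_rotIso {i j : Fin d} (hij : i ≠ j) (t : ℝ) (θ : Sph d) :
    (sphMap (rotIso hij t) θ : Euc d) = rotLin i j t θ := rfl

lemma hasDerivAt_rotLin {i j : Fin d} (hij : i ≠ j) (t : ℝ) (v : Euc d) :
    HasDerivAt (fun t => rotLin i j t v) (rotField i j (rotLin i j t v)) t := by
  have h1 : HasDerivAt (fun t => (Real.cos t - 1) * v i - Real.sin t * v j)
      (-Real.sin t * v i - Real.cos t * v j) t :=
    (((Real.hasDerivAt_cos t).sub_const 1).mul_const _).sub ((Real.hasDerivAt_sin t).mul_const _)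
  have h2 : HasDerivAt (fun t => (Real.cos t - 1) * v j + Real.sin t * v i)
      (-Real.sin t * v j + Real.cos t * v i) t :=
    (((Real.hasDerivAt_cos t).sub_const 1).mul_const _).add ((Real.hasDerivAt_sin t).mul_const _)
  have h3 := ((h1.smul_const (EuclideanSpace.single i (1 : ℝ))).const_add v).add
    (h2.smul_const (EuclideanSpace.single j (1 : ℝ)))
  refine h3.congr_deriv ?_
  rw [rotField, rotLin_apply]
  ext k
  simp [hij, hij.symm]
  split_ifs <;> ring

lemma hasDerivAt_rotIso (f : CInfSph d) {i j : Fin d} (hij : i ≠ j) (t : ℝ) (θ : Sph d) :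
    HasDerivAt (fun t => f.1 (sphMap (rotIso hij t) θ))
      ((rotDerivSph i j f).1 (sphMap (rotIso hij t) θ)) t := by
  obtain ⟨g, hg, h⟩ := f.2
  rw [rotDerivSph_eq_fderiv hg h]
  simp_rw [h, coe_sphMap_rotIso]
  have hd : HasFDerivAt g (fderiv ℝ g (rotLin i j t θ)) (rotLin i j t θ) :=
    (hg.differentiable (by simp) _).hasFDerivAt
  exact hd.comp_hasDerivAt t (hasDerivAt_rotLin hij t θ)

lemma CInfSph.exists_bound (f : CInfSph d) : ∃ C : ℝ, 0 ≤ C ∧ ∀ θ, ‖f.1 θ‖ ≤ C := by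
  obtain ⟨C, hC⟩ := (isCompact_univ (X := Sph d)).exists_bound_of_continuousOn
    (CInfSph.continuous f).continuousOn
  exact ⟨max C 0, le_max_right _ _, fun θ => (hC θ (mem_univ _)).trans (le_max_left _ _)⟩

lemma rotDerivSph_self (i : Fin d) (f : CInfSph d) : rotDerivSph i i f = 0 := by
  obtain ⟨g, hg, h⟩ := f.2
  refine CInfSph.ext' fun θ => ?_
  rw [rotDerivSph_eq_fderiv hg h]
  simp [rotField]

lemma integral_rotDerivSph (i j : Fin d) (f : CInfSph d) :
    sphInt (rotDerivSph i j f) = 0 := by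
  by_cases hij : i = j
  · subst hij; simp [rotDerivSph_self]
  obtain ⟨C, -, hC⟩ := CInfSph.exists_bound (rotDerivSph i j f)
  have h := hasDerivAt_integral_of_dominated_loc_of_deriv_le (μ := surf d) (𝕜 := ℝ)
    (F := fun t θ => f.1 (sphMap (rotIso hij t) θ)) (x₀ := 0) (s := univ) (bound := fun _ => C)
    (F' := fun t θ => (rotDerivSph i j f).1 (sphMap (rotIso hij t) θ)) univ_mem
    (.of_forall fun t =>
      ((CInfSph.continuous f).comp (continuous_sphMap _)).aestronglyMeasurable)
    (integrable_of_continuous_sph ((CInfSph.continuous f).comp (continuous_sphMap _)))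
    ((CInfSph.continuous (rotDerivSph i j f)).comp (continuous_sphMap _)).aestronglyMeasurable
    (.of_forall fun θ t _ => hC _) (integrable_const _)
    (.of_forall fun θ t _ => hasDerivAt_rotIso f hij t θ)
  have h2 := h.2
  simp only [integral_sphMap] at h2
  exact h2.unique (hasDerivAt_const _ _)

lemma integral_mul_rotDerivSph (i j : Fin d) (f g : CInfSph d) :
    sphInt (f * rotDerivSph i j g) = - sphInt (rotDerivSph i j f * g) := by
  have h := integral_rotDerivSph i j (f * g)
  rw [rotDerivSph_mul, map_add] at h
  rw [eq_neg_iff_add_eq_zero, add_comm]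
  exact h

end Rotation

/-! ### The gradient field of a linear function -/

section Radial

variable {d : ℕ}

/-- The gradient field on the sphere of the function `⟨v, ·⟩`. -/
def gradField (v : Euc d) (f : CInfSph d) : CInfSph d :=
  (1 / 2 : ℂ) • ∑ i, ∑ j, sphLin (rotVec v i j) * rotDerivSph i j f

lemma gradField_apply (v : Euc d) (f : CInfSph d) (θ : Sph d) :
    (gradField v f).1 θ =
      1 / 2 * ∑ i, ∑ j, (sphLin (rotVec v i j)).1 θ * (rotDerivSph i j f).1 θ := by
  simp [gradField]

lemma gradField_mul (v : Euc d) (f g : CInfSph d) :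
    gradField v (f * g) = gradField v f * g + f * gradField v g := by
  refine CInfSph.ext' fun θ => ?_
  simp only [gradField_apply, rotDerivSph_mul, CInfSph.add_apply, CInfSph.mul_apply, mul_add,
    sum_add_distrib, mul_sum, sum_mul]
  congr 1 <;> exact sum_congr rfl fun i _ => sum_congr rfl fun j _ => by ring

lemma sum_rotCoef_sq (v : Euc d) (θ : Sph d) :
    ∑ i, ∑ j, rotCoef v i j θ ^ 2 = 2 * (‖v‖ ^ 2 - inner ℝ v (θ : Euc d) ^ 2) := by
  have h1 : ∑ i, θ.1 i ^ 2 = 1 := by rw [← EuclideanSpace.real_norm_sq_eq, sph_norm]; norm_num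
  have h2 : ∑ i, v i ^ 2 = ‖v‖ ^ 2 := by rw [← EuclideanSpace.real_norm_sq_eq]
  have h3 : inner ℝ v (θ : Euc d) = ∑ i, v i * θ.1 i := by
    simp [PiLp.inner_apply, mul_comm]
  have h4 : ∀ i j, rotCoef v i j θ ^ 2 =
      θ.1 i ^ 2 * v j ^ 2 + v i ^ 2 * θ.1 j ^ 2 - 2 * ((v i * θ.1 i) * (v j * θ.1 j)) := by
    intro i j; rw [rotCoef]; ring
  simp_rw [h4, sum_sub_distrib, sum_add_distrib, ← mul_sum, ← sum_mul,
    h1, h2, ← h3]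
  ring

lemma gradField_radial {h : ℝ → ℂ} {h' : ℂ} {v : Euc d} (hv : ‖v‖ = 1) (f : CInfSph d)
    (hf : ∀ θ : Sph d, f.1 θ = h (inner ℝ v (θ : Euc d))) (θ : Sph d)
    (hh : HasDerivAt h h' (inner ℝ v (θ : Euc d))) :
    (gradField v f).1 θ = (1 - inner ℝ v (θ : Euc d) ^ 2 : ℝ) * h' := by
  have h1 := sum_rotCoef_sq v θ
  rw [hv] at h1
  have h2 : ∀ i j, (sphLin (rotVec v i j)).1 θ * (rotDerivSph i j f).1 θ =
      ((rotCoef v i j θ ^ 2 : ℝ) : ℂ) * h' := by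
    intro i j
    rw [rotDerivSph_radial v f hf i j θ hh, sphLin_apply, inner_rotVec, rotCoef]
    push_cast; ring
  rw [gradField_apply]
  simp_rw [h2, ← sum_mul, ← Complex.ofReal_sum]
  rw [h1]
  push_cast; ring

lemma gradField_sphLin {v : Euc d} (hv : ‖v‖ = 1) :
    gradField v (sphLin v) = 1 - sphLin v ^ 2 := by
  refine CInfSph.ext' fun θ => ?_
  rw [gradField_radial hv (sphLin v) (fun _ => rfl) θ
    (Complex.ofRealCLM.hasDerivAt (x := inner ℝ v (θ : Euc d)))]
  simp [sphLin_apply]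

lemma sum_rotVec_rotVec (v : Euc d) :
    ∑ i, ∑ j, rotVec (rotVec v i j) i j = (-(2 * ((d : ℝ) - 1))) • v := by
  have h : ∀ i j : Fin d, rotVec (rotVec v i j) i j =
      (-v i) • EuclideanSpace.single i (1 : ℝ) + (-v j) • EuclideanSpace.single j (1 : ℝ) +
        (if i = j then (2 * v i) • EuclideanSpace.single i (1 : ℝ) else 0) := by
    intro i j
    ext k
    by_cases hij : i = j
    · subst hij; simp [rotVec]; split_ifs <;> ring
    · simp [rotVec, hij, Ne.symm hij]; ring
  simp_rw [h, sum_add_distrib]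
  ext k
  simp [Finset.sum_ite_eq, Pi.single_apply]
  ring

lemma integral_gradField (v : Euc d) (f : CInfSph d) :
    sphInt (gradField v f) = ((d : ℂ) - 1) * sphInt (sphLin v * f) := by
  have h5 : ∀ θ, ∑ i, ∑ j, (sphLin (rotVec (rotVec v i j) i j)).1 θ =
      -(2 * ((d : ℂ) - 1)) * (sphLin v).1 θ := by
    intro θ
    simp_rw [sphLin_apply, ← Complex.ofReal_sum, ← sum_inner]
    rw [sum_rotVec_rotVec, inner_smul_left]
    push_cast; simp
  have h6 : ∑ i, ∑ j, sphLin (rotVec (rotVec v i j) i j) * f =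
      (-(2 * ((d : ℂ) - 1))) • (sphLin v * f) := by
    refine CInfSph.ext' fun θ => ?_
    simp only [CInfSph.sum_apply, CInfSph.mul_apply, CInfSph.smul_apply, ← sum_mul, h5]
    ring
  rw [gradField, map_smul, map_sum]
  simp_rw [map_sum, integral_mul_rotDerivSph, rotDerivSph_sphLin, Finset.sum_neg_distrib,
    ← map_sum]
  rw [h6, map_smul]
  simp only [smul_eq_mul]
  ring

end Radial



open CInfSph (ext' mul_apply smul_apply add_apply sub_apply one_apply)
/-! ### Norms of smooth functions on the sphere -/

section SphereNorms

variable {d : ℕ}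

/-- The sum of `n (Ω_w f)` over all words `w` of length at most `k` in the fields `Ω_{ij}`. -/
def wordSum (n : CInfSph d → ℝ) : ℕ → CInfSph d → ℝ
  | 0, f => n f
  | k + 1, f => n f + ∑ i : Fin d, ∑ j : Fin d, wordSum n k (rotDerivSph i j f)

section WordSum

variable {n : CInfSph d → ℝ}

lemma wordSum_nonneg (hn : ∀ f, 0 ≤ n f) (k : ℕ) (f : CInfSph d) : 0 ≤ wordSum n k f := by
  induction k generalizing f with
  | zero => exact hn f
  | succ k ih => exact add_nonneg (hn f) (sum_nonneg fun i _ => sum_nonneg fun j _ => ih _)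

lemma le_wordSum (hn : ∀ f, 0 ≤ n f) (k : ℕ) (f : CInfSph d) : n f ≤ wordSum n k f := by
  cases k with
  | zero => exact le_rfl
  | succ k =>
    exact le_add_of_nonneg_right
      (sum_nonneg fun i _ => sum_nonneg fun j _ => wordSum_nonneg hn _ _)

lemma wordSum_succ_le (hn : ∀ f, 0 ≤ n f) (k : ℕ) (f : CInfSph d) :
    wordSum n k f ≤ wordSum n (k + 1) f := by
  induction k generalizing f with
  | zero => exact le_wordSum hn _ f
  | succ k ih =>
    exact add_le_add le_rfl (sum_le_sum fun i _ => sum_le_sum fun j _ => ih _)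

lemma wordSum_mono (hn : ∀ f, 0 ≤ n f) {k l : ℕ} (hkl : k ≤ l) (f : CInfSph d) :
    wordSum n k f ≤ wordSum n l f := by
  induction l, hkl using Nat.le_induction with
  | base => exact le_rfl
  | succ l _ ih => exact ih.trans (wordSum_succ_le hn l f)

lemma wordSum_rotDerivSph_le (hn : ∀ f, 0 ≤ n f) (k : ℕ) (f : CInfSph d) (i j : Fin d) :
    wordSum n k (rotDerivSph i j f) ≤ wordSum n (k + 1) f := by
  refine le_trans ?_ (le_add_of_nonneg_left (hn f))
  refine le_trans ?_ (single_le_sum (f := fun i => ∑ j, wordSum n k (rotDerivSph i j f))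
    (fun i _ => sum_nonneg fun j _ => wordSum_nonneg hn _ _) (Finset.mem_univ i))
  exact single_le_sum (f := fun j => wordSum n k (rotDerivSph i j f))
    (fun j _ => wordSum_nonneg hn _ _) (Finset.mem_univ j)

lemma wordSum_add_le (hadd : ∀ f g, n (f + g) ≤ n f + n g) (k : ℕ) (f g : CInfSph d) :
    wordSum n k (f + g) ≤ wordSum n k f + wordSum n k g := by
  induction k generalizing f g with
  | zero => exact hadd f g
  | succ k ih =>
    simp only [wordSum, map_add]
    have h := sum_le_sum (s := Finset.univ) fun (i : Fin d) _ =>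
      sum_le_sum (s := Finset.univ) fun (j : Fin d) _ =>
        ih (rotDerivSph i j f) (rotDerivSph i j g)
    simp only [sum_add_distrib] at h
    linarith [hadd f g]

lemma wordSum_smul {c : ℂ} {a : ℝ} (h : ∀ f, n (c • f) = a * n f) (k : ℕ) (f : CInfSph d) :
    wordSum n k (c • f) = a * wordSum n k f := by
  induction k generalizing f with
  | zero => exact h f
  | succ k ih => simp only [wordSum, map_smul, ih, h, mul_add, mul_sum]

end WordSum

/-- The `L¹` norm on the sphere. -/
def lOne (f : CInfSph d) : ℝ := ∫ θ, ‖f.1 θ‖ ∂(surf d)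

/-- The square of the `L²` norm on the sphere. -/
def lTwoSq (f : CInfSph d) : ℝ := ∫ θ, ‖f.1 θ‖ ^ 2 ∂(surf d)

lemma lOne_nonneg (f : CInfSph d) : 0 ≤ lOne f := integral_nonneg fun _ => norm_nonneg _

lemma lTwoSq_nonneg (f : CInfSph d) : 0 ≤ lTwoSq f := integral_nonneg fun _ => by positivity

lemma lOne_add_le (f g : CInfSph d) : lOne (f + g) ≤ lOne f + lOne g := by
  unfold lOne
  rw [← integral_add (CInfSph.integrable f).norm (CInfSph.integrable g).norm]
  exact integral_mono (CInfSph.integrable (f + g)).norm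
    ((CInfSph.integrable f).norm.add (CInfSph.integrable g).norm) fun θ => norm_add_le _ _

lemma lOne_smul (c : ℂ) (f : CInfSph d) : lOne (c • f) = ‖c‖ * lOne f := by
  simp [lOne, integral_const_mul]

lemma lTwoSq_smul (c : ℂ) (f : CInfSph d) : lTwoSq (c • f) = ‖c‖ ^ 2 * lTwoSq f := by
  simp [lTwoSq, mul_pow, integral_const_mul]

lemma norm_sphInt_le (f : CInfSph d) : ‖sphInt f‖ ≤ lOne f := norm_integral_le_integral_norm _

lemma integrable_norm_sq (f : CInfSph d) : Integrable (fun θ => ‖f.1 θ‖ ^ 2) (surf d) :=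
  integrable_of_continuous_sph ((CInfSph.continuous f).norm.pow 2)

lemma lOne_mul_le_of_bound {a : CInfSph d} {B : ℝ} (ha : ∀ θ, ‖a.1 θ‖ ≤ B) (f : CInfSph d) :
    lOne (a * f) ≤ B * lOne f := by
  unfold lOne
  rw [← integral_const_mul]
  refine integral_mono (CInfSph.integrable (a * f)).norm ((CInfSph.integrable f).norm.const_mul B)
    fun θ => ?_
  simp only [mul_apply, norm_mul]
  exact mul_le_mul_of_nonneg_right (ha θ) (norm_nonneg _)

lemma lTwoSq_mul_le_of_bound {a : CInfSph d} {B : ℝ} (ha : ∀ θ, ‖a.1 θ‖ ≤ B) (f : CInfSph d) :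
    lTwoSq (a * f) ≤ B ^ 2 * lTwoSq f := by
  unfold lTwoSq
  rw [← integral_const_mul]
  refine integral_mono (integrable_norm_sq (a * f)) ((integrable_norm_sq f).const_mul _)
    fun θ => ?_
  simp only [mul_apply, norm_mul, mul_pow]
  have := ha θ
  gcongr

lemma lOne_mul_le (f g : CInfSph d) : lOne (f * g) ≤ √(lTwoSq f) * √(lTwoSq g) := by
  have h := integral_mul_le_Lp_mul_Lq_of_nonneg (μ := surf d) (p := 2) (q := 2)
    (f := fun θ => ‖f.1 θ‖) (g := fun θ => ‖g.1 θ‖) Real.HolderConjugate.two_two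
    (.of_forall fun _ => norm_nonneg _) (.of_forall fun _ => norm_nonneg _)
    ((CInfSph.continuous f).norm.memLp_of_hasCompactSupport (HasCompactSupport.of_compactSpace _))
    ((CInfSph.continuous g).norm.memLp_of_hasCompactSupport (HasCompactSupport.of_compactSpace _))
  simp only [Real.rpow_two] at h
  rw [← Real.sqrt_eq_rpow, ← Real.sqrt_eq_rpow] at h
  simpa [lOne, lTwoSq] using h

/-- The `L¹` Sobolev norm of order `k` on the sphere. -/
def sobOne (k : ℕ) (f : CInfSph d) : ℝ := wordSum lOne k f

/-- The square of the `L²` Sobolev norm of order `k` on the sphere. -/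
def sobTwoSq (k : ℕ) (f : CInfSph d) : ℝ := wordSum lTwoSq k f

lemma sobOne_nonneg (k : ℕ) (f : CInfSph d) : 0 ≤ sobOne k f := wordSum_nonneg lOne_nonneg k f

lemma sobTwoSq_nonneg (k : ℕ) (f : CInfSph d) : 0 ≤ sobTwoSq k f :=
  wordSum_nonneg lTwoSq_nonneg k f

lemma sobOne_add_le (k : ℕ) (f g : CInfSph d) : sobOne k (f + g) ≤ sobOne k f + sobOne k g :=
  wordSum_add_le lOne_add_le k f g

lemma sobOne_smul (k : ℕ) (c : ℂ) (f : CInfSph d) : sobOne k (c • f) = ‖c‖ * sobOne k f :=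
  wordSum_smul (lOne_smul c) k f

lemma sobOne_zero (k : ℕ) : sobOne k (0 : CInfSph d) = 0 := by
  simpa using sobOne_smul k 0 (0 : CInfSph d)

lemma sobOne_sum_le {ι : Type*} (k : ℕ) (s : Finset ι) (f : ι → CInfSph d) :
    sobOne k (∑ i ∈ s, f i) ≤ ∑ i ∈ s, sobOne k (f i) :=
  Finset.le_sum_of_subadditive _ (sobOne_zero k).le (sobOne_add_le k) s f

lemma sobOne_mono {k l : ℕ} (hkl : k ≤ l) (f : CInfSph d) : sobOne k f ≤ sobOne l f :=
  wordSum_mono lOne_nonneg hkl f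

lemma lOne_le_sobOne (k : ℕ) (f : CInfSph d) : lOne f ≤ sobOne k f := le_wordSum lOne_nonneg k f

lemma sobOne_succ (k : ℕ) (f : CInfSph d) :
    sobOne (k + 1) f = lOne f + ∑ i, ∑ j, sobOne k (rotDerivSph i j f) := rfl

/-- All the derivatives of order at most `k` of `f` along the fields `Ω_{ij}` are bounded by `B`. -/
def SphBound : ℕ → CInfSph d → ℝ → Prop
  | 0, f, B => ∀ θ, ‖f.1 θ‖ ≤ B
  | k + 1, f, B => (∀ θ, ‖f.1 θ‖ ≤ B) ∧ ∀ i j, SphBound k (rotDerivSph i j f) B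

lemma SphBound.zero {k : ℕ} {f : CInfSph d} {B : ℝ} (h : SphBound k f B) (θ : Sph d) :
    ‖f.1 θ‖ ≤ B := by
  cases k with
  | zero => exact h θ
  | succ k => exact h.1 θ

lemma SphBound.of_succ {k : ℕ} {f : CInfSph d} {B : ℝ} (h : SphBound (k + 1) f B) :
    SphBound k f B := by
  induction k generalizing f with
  | zero => exact h.1
  | succ k ih => exact ⟨h.1, fun i j => ih (h.2 i j)⟩

lemma SphBound.le_bound {k : ℕ} {f : CInfSph d} {B B' : ℝ} (h : SphBound k f B) (hB : B ≤ B') :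
    SphBound k f B' := by
  induction k generalizing f with
  | zero => exact fun θ => (h θ).trans hB
  | succ k ih => exact ⟨fun θ => (h.1 θ).trans hB, fun i j => ih (h.2 i j)⟩

lemma SphBound.mono {k l : ℕ} (hkl : k ≤ l) {f : CInfSph d} {B : ℝ} (h : SphBound l f B) :
    SphBound k f B := by
  induction l, hkl using Nat.le_induction with
  | base => exact h
  | succ l _ ih => exact ih h.of_succ

lemma SphBound.add {k : ℕ} {f g : CInfSph d} {B B' : ℝ} (h : SphBound k f B)
    (h' : SphBound k g B') : SphBound k (f + g) (B + B') := by
  induction k generalizing f g with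
  | zero => exact fun θ => (norm_add_le _ _).trans (add_le_add (h θ) (h' θ))
  | succ k ih =>
    refine ⟨fun θ => (norm_add_le _ _).trans (add_le_add (h.1 θ) (h'.1 θ)), fun i j => ?_⟩
    rw [map_add]
    exact ih (h.2 i j) (h'.2 i j)

lemma SphBound.smul {k : ℕ} {f : CInfSph d} {B : ℝ} (c : ℂ) (h : SphBound k f B) :
    SphBound k (c • f) (‖c‖ * B) := by
  have hc : ∀ {f : CInfSph d} θ, ‖f.1 θ‖ ≤ B → ‖(c • f).1 θ‖ ≤ ‖c‖ * B := fun θ h => by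
    rw [smul_apply, norm_mul]; exact mul_le_mul_of_nonneg_left h (norm_nonneg _)
  induction k generalizing f with
  | zero => exact fun θ => hc θ (h θ)
  | succ k ih =>
    refine ⟨fun θ => hc θ (h.1 θ), fun i j => ?_⟩
    rw [map_smul]
    exact ih (h.2 i j)

lemma SphBound.exists (k : ℕ) (f : CInfSph d) : ∃ B : ℝ, 0 ≤ B ∧ SphBound k f B := by
  induction k generalizing f with
  | zero => exact CInfSph.exists_bound f
  | succ k ih =>
    obtain ⟨B, hB, h⟩ := CInfSph.exists_bound f
    choose b hb hb' using fun p : Fin d × Fin d => ih (rotDerivSph p.1 p.2 f)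
    refine ⟨B + ∑ p, b p, add_nonneg hB (sum_nonneg fun p _ => hb p), fun θ =>
      (h θ).trans (le_add_of_nonneg_right (sum_nonneg fun p _ => hb p)), fun i j =>
      (hb' (i, j)).le_bound ?_⟩
    have := single_le_sum (f := b) (fun p _ => hb p) (Finset.mem_univ (i, j))
    linarith

lemma SphBound.mul (k : ℕ) : ∃ C : ℝ, 0 ≤ C ∧ ∀ (f g : CInfSph d) (B B' : ℝ), SphBound k f B →
    SphBound k g B' → SphBound k (f * g) (C * (B * B')) := by
  induction k with
  | zero =>
    refine ⟨1, zero_le_one, fun f g B B' h h' θ => ?_⟩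
    rw [one_mul, mul_apply, norm_mul]
    exact mul_le_mul (h θ) (h' θ) (norm_nonneg _) ((norm_nonneg _).trans (h θ))
  | succ k ih =>
    obtain ⟨C, hC, ih⟩ := ih
    refine ⟨1 + (C + C), by positivity, fun f g B B' h h' => ⟨fun θ => ?_, fun i j => ?_⟩⟩
    · have hB : 0 ≤ B := (norm_nonneg _).trans (h.1 θ)
      have hB' : 0 ≤ B' := (norm_nonneg _).trans (h'.1 θ)
      have h1 : ‖(f * g).1 θ‖ ≤ B * B' := by
        rw [mul_apply, norm_mul]
        exact mul_le_mul (h.1 θ) (h'.1 θ) (norm_nonneg _) hB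
      nlinarith [mul_nonneg hB hB']
    · rw [rotDerivSph_mul]
      by_cases hS : Nonempty (Sph d)
      · obtain ⟨θ⟩ := hS
        have hB : 0 ≤ B := (norm_nonneg _).trans (h.1 θ)
        have hB' : 0 ≤ B' := (norm_nonneg _).trans (h'.1 θ)
        refine ((ih _ _ _ _ (h.2 i j) h'.of_succ).add (ih _ _ _ _ h.of_succ (h'.2 i j))).le_bound ?_
        nlinarith [mul_nonneg hB hB']
      · have : ∀ (k : ℕ) (f : CInfSph d) (B : ℝ), SphBound k f B := by
          intro k
          induction k with
          | zero => exact fun f B θ => (hS ⟨θ⟩).elim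
          | succ k ih => exact fun f B => ⟨fun θ => (hS ⟨θ⟩).elim, fun i j => ih _ _⟩
        exact this _ _ _

lemma sobOne_mul_le (k : ℕ) : ∃ C : ℝ, 0 ≤ C ∧ ∀ (a f : CInfSph d) (B : ℝ), 0 ≤ B →
    SphBound k a B → sobOne k (a * f) ≤ C * B * sobOne k f := by
  induction k with
  | zero =>
    exact ⟨1, zero_le_one, fun a f B _ ha => by rw [one_mul]; exact lOne_mul_le_of_bound ha f⟩
  | succ k ih =>
    obtain ⟨C, hC, ih⟩ := ih
    refine ⟨1 + (d * d) * C + C, by positivity, fun a f B hB ha => ?_⟩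
    have h1 : ∀ i j, sobOne k (rotDerivSph i j (a * f)) ≤
        C * B * sobOne k f + C * B * sobOne k (rotDerivSph i j f) := by
      intro i j
      rw [rotDerivSph_mul]
      exact (sobOne_add_le _ _ _).trans (add_le_add (ih _ _ B hB (ha.2 i j)) (ih _ _ B hB ha.of_succ))
    have h2 := sum_le_sum (s := Finset.univ) fun (i : Fin d) _ =>
      sum_le_sum (s := Finset.univ) fun (j : Fin d) _ => h1 i j
    simp only [sum_add_distrib, sum_const, card_univ, Fintype.card_fin,
      nsmul_eq_mul, ← mul_sum] at h2
    have h3 := lOne_mul_le_of_bound ha.1 f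
    have h4 : sobOne k f ≤ sobOne (k + 1) f := sobOne_mono (Nat.le_succ k) f
    have h5 : lOne f ≤ sobOne (k + 1) f := lOne_le_sobOne _ f
    have h6 : ∑ i, ∑ j, sobOne k (rotDerivSph i j f) ≤ sobOne (k + 1) f :=
      le_add_of_nonneg_left (lOne_nonneg f)
    rw [sobOne_succ]
    have e1 : B * lOne f ≤ B * sobOne (k + 1) f := by gcongr
    have e2 : (d : ℝ) * (d * (C * B * sobOne k f)) ≤ d * (d * (C * B * sobOne (k + 1) f)) := by gcongr
    have e3 : C * B * ∑ i, ∑ j, sobOne k (rotDerivSph i j f) ≤ C * B * sobOne (k + 1) f := by gcongr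
    nlinarith

lemma norm_rotVec_le (v : Euc d) (i j : Fin d) : ‖rotVec v i j‖ ≤ ‖v‖ := by
  by_cases hij : i = j
  · subst hij; simp [rotVec]
  rw [← sq_le_sq₀ (norm_nonneg _) (norm_nonneg _), rotVec, norm_sub_sq_real,
    EuclideanSpace.real_norm_sq_eq v]
  have h : v i ^ 2 + v j ^ 2 ≤ ∑ k, v k ^ 2 := by
    rw [← Finset.sum_pair (f := fun k => v k ^ 2) hij]
    exact Finset.sum_le_sum_of_subset_of_nonneg (Finset.subset_univ _) fun _ _ _ => sq_nonneg _
  simp [norm_smul, inner_smul_left, inner_smul_right, EuclideanSpace.inner_single_left, hij]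
  linarith

lemma norm_sphLin_le (v : Euc d) (θ : Sph d) : ‖(sphLin v).1 θ‖ ≤ ‖v‖ := by
  rw [sphLin_apply, norm_real]
  simpa using norm_inner_le_norm (𝕜 := ℝ) v (θ : Euc d)

lemma sphBound_sphLin (k : ℕ) (v : Euc d) : SphBound k (sphLin v) ‖v‖ := by
  have h : ∀ (k : ℕ) (B : ℝ) (v : Euc d), ‖v‖ ≤ B → SphBound k (sphLin v) B := by
    intro k B
    induction k with
    | zero => exact fun v hv θ => (norm_sphLin_le v θ).trans hv
    | succ k ih =>
      refine fun v hv => ⟨fun θ => (norm_sphLin_le v θ).trans hv, fun i j => ?_⟩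
      rw [rotDerivSph_sphLin]
      exact ih _ ((norm_rotVec_le v i j).trans hv)
  exact h k _ v le_rfl

lemma sobOne_gradField_le (k : ℕ) : ∃ C : ℝ, 0 ≤ C ∧ ∀ (v : Euc d) (f : CInfSph d), ‖v‖ = 1 →
    sobOne k (gradField v f) ≤ C * sobOne (k + 1) f := by
  obtain ⟨C, hC, h⟩ := sobOne_mul_le (d := d) k
  refine ⟨C, hC, fun v f hv => ?_⟩
  rw [gradField, sobOne_smul]
  have h1 : ∀ i j, sobOne k (sphLin (rotVec v i j) * rotDerivSph i j f) ≤
      C * sobOne k (rotDerivSph i j f) := fun i j => by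
    simpa using h _ (rotDerivSph i j f) 1 zero_le_one
      ((sphBound_sphLin k (rotVec v i j)).le_bound ((norm_rotVec_le v i j).trans hv.le))
  have h2 : sobOne k (∑ i, ∑ j, sphLin (rotVec v i j) * rotDerivSph i j f) ≤
      C * ∑ i, ∑ j, sobOne k (rotDerivSph i j f) := by
    simp only [mul_sum]
    exact (sobOne_sum_le _ _ _).trans (sum_le_sum fun i _ => (sobOne_sum_le _ _ _).trans
      (sum_le_sum fun j _ => h1 i j))
  have h6 : ∑ i, ∑ j, sobOne k (rotDerivSph i j f) ≤ sobOne (k + 1) f :=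
    le_add_of_nonneg_left (lOne_nonneg f)
  have h7 : 0 ≤ sobOne k (∑ i, ∑ j, sphLin (rotVec v i j) * rotDerivSph i j f) := sobOne_nonneg _ _
  have h8 : ‖(1 / 2 : ℂ)‖ = 1 / 2 := by norm_num
  rw [h8]
  nlinarith [mul_le_mul_of_nonneg_left h6 hC]

lemma sobOne_mul_le_sobTwo (k : ℕ) : ∃ C : ℝ, 0 ≤ C ∧ ∀ f g : CInfSph d,
    sobOne k (f * g) ≤ C * (√(sobTwoSq k f) * √(sobTwoSq k g)) := by
  induction k with
  | zero => exact ⟨1, zero_le_one, fun f g => by rw [one_mul]; exact lOne_mul_le f g⟩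
  | succ k ih =>
    obtain ⟨C, hC, ih⟩ := ih
    refine ⟨1 + d * (d * (C + C)), by positivity, fun f g => ?_⟩
    have hm : ∀ f : CInfSph d, √(sobTwoSq k f) ≤ √(sobTwoSq (k + 1) f) := fun f =>
      sqrt_le_sqrt (wordSum_succ_le lTwoSq_nonneg k f)
    have hd : ∀ (f : CInfSph d) i j, √(sobTwoSq k (rotDerivSph i j f)) ≤ √(sobTwoSq (k + 1) f) :=
      fun f i j => sqrt_le_sqrt (wordSum_rotDerivSph_le lTwoSq_nonneg k f i j)
    have h0 : lOne (f * g) ≤ √(sobTwoSq (k + 1) f) * √(sobTwoSq (k + 1) g) :=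
      (lOne_mul_le f g).trans (mul_le_mul
        (sqrt_le_sqrt (le_wordSum lTwoSq_nonneg _ f))
        (sqrt_le_sqrt (le_wordSum lTwoSq_nonneg _ g)) (sqrt_nonneg _) (sqrt_nonneg _))
    set S := √(sobTwoSq (k + 1) f) * √(sobTwoSq (k + 1) g)
    have h1 : ∀ i j, sobOne k (rotDerivSph i j (f * g)) ≤ (C + C) * S := by
      intro i j
      rw [rotDerivSph_mul, add_mul]
      refine (sobOne_add_le _ _ _).trans (add_le_add ((ih _ _).trans ?_) ((ih _ _).trans ?_))
      · exact mul_le_mul_of_nonneg_left (mul_le_mul (hd f i j) (hm g) (sqrt_nonneg _)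
          (sqrt_nonneg _)) hC
      · exact mul_le_mul_of_nonneg_left (mul_le_mul (hm f) (hd g i j) (sqrt_nonneg _)
          (sqrt_nonneg _)) hC
    have h2 := sum_le_sum (s := Finset.univ) fun (i : Fin d) _ =>
      sum_le_sum (s := Finset.univ) fun (j : Fin d) _ => h1 i j
    simp only [sum_const, card_univ, Fintype.card_fin, nsmul_eq_mul] at h2
    rw [sobOne_succ]
    linarith

lemma sobSqFun_eq (k : ℕ) (f : CInfSph d) : sobSqFun k f = ENNReal.ofReal (sobTwoSq k f) := by
  have h0 : ∀ f : CInfSph d, ∫⁻ θ, ‖f.1 θ‖ₑ ^ 2 ∂(surf d) = ENNReal.ofReal (lTwoSq f) := by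
    intro f
    rw [lTwoSq, ofReal_integral_eq_lintegral_ofReal (integrable_norm_sq f)
      (.of_forall fun _ => by positivity)]
    refine lintegral_congr fun θ => ?_
    rw [ENNReal.ofReal_pow (norm_nonneg _), ofReal_norm]
  induction k generalizing f with
  | zero => exact h0 f
  | succ k ih =>
    have hnn : ∀ i, 0 ≤ ∑ j, sobTwoSq k (rotDerivSph i j f) := fun i =>
      sum_nonneg fun j _ => sobTwoSq_nonneg _ _
    change _ + _ = ENNReal.ofReal (lTwoSq f + ∑ i, ∑ j, sobTwoSq k (rotDerivSph i j f))
    rw [ENNReal.ofReal_add (lTwoSq_nonneg f) (sum_nonneg fun i _ => hnn i), h0,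
      ENNReal.ofReal_sum_of_nonneg fun i _ => hnn i]
    congr 1
    refine sum_congr rfl fun i _ => ?_
    rw [ENNReal.ofReal_sum_of_nonneg fun j _ => sobTwoSq_nonneg _ _]
    exact sum_congr rfl fun j _ => ih _

end SphereNorms


/-! ### Oscillatory integrals on the sphere -/

section Oscillatory

variable {d : ℕ}

/-- The function `1 - ⟨v, θ⟩²` on the sphere. -/
def sphP (v : Euc d) : CInfSph d := 1 - sphLin v ^ 2

lemma sphP_apply (v : Euc d) (θ : Sph d) :
    (sphP v).1 θ = ((1 - inner ℝ v (θ : Euc d) ^ 2 : ℝ) : ℂ) := by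
  simp [sphP, sphLin_apply]

lemma gradField_sphExp {v : Euc d} (hv : ‖v‖ = 1) (l : ℝ) :
    gradField v (sphExp (l • v)) = (-(I * l)) • (sphP v * sphExp (l • v)) := by
  refine ext' fun θ => ?_
  have h1 : HasDerivAt (fun x : ℝ => exp (-(I * ((l * x : ℝ) : ℂ))))
      (exp (-(I * ((l * inner ℝ v (θ : Euc d) : ℝ) : ℂ))) * (-(I * l)))
      (inner ℝ v (θ : Euc d)) := by
    have h2 : HasDerivAt (fun x : ℝ => ((l * x : ℝ) : ℂ)) (l : ℂ) (inner ℝ v (θ : Euc d)) := by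
      simpa using ((hasDerivAt_id (inner ℝ v (θ : Euc d))).const_mul l).ofReal_comp
    exact (h2.const_mul I).neg.cexp
  rw [gradField_radial hv (sphExp (l • v))
    (fun θ => by rw [sphExp_apply, real_inner_smul_left]) θ h1]
  simp only [smul_apply, mul_apply, sphP_apply, sphExp_apply, real_inner_smul_left]
  ring

lemma gradField_sphP {v : Euc d} (hv : ‖v‖ = 1) :
    gradField v (sphP v) = (-2 : ℂ) • (sphLin v * sphP v) := by
  refine ext' fun θ => ?_
  have h1 : HasDerivAt (fun x : ℝ => ((1 - x ^ 2 : ℝ) : ℂ))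
      ((-(2 * inner ℝ v (θ : Euc d)) : ℝ) : ℂ) (inner ℝ v (θ : Euc d)) := by
    have h := (((hasDerivAt_id (inner ℝ v (θ : Euc d))).pow 2).const_sub 1).ofReal_comp
    refine h.congr_deriv ?_
    simp
  rw [gradField_radial hv (sphP v) (fun θ => sphP_apply v θ) θ h1]
  simp only [smul_apply, mul_apply, sphP_apply, sphLin_apply]
  push_cast
  ring

lemma gradField_sphP_pow {v : Euc d} (hv : ‖v‖ = 1) (j : ℕ) :
    gradField v (sphP v ^ j) = (-(2 * j) : ℂ) • (sphLin v * sphP v ^ j) := by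
  induction j with
  | zero =>
    have := gradField_mul v (1 : CInfSph d) 1
    simp only [mul_one, one_mul] at this
    simpa using this
  | succ j ih =>
    rw [pow_succ, gradField_mul, ih, gradField_sphP hv]
    refine ext' fun θ => ?_
    simp only [add_apply, smul_apply, mul_apply, CInfSph.pow_apply]
    push_cast; ring

lemma sphInt_sphP_mul_sphExp {v : Euc d} (hv : ‖v‖ = 1) (l : ℝ) (G : CInfSph d) :
    (I * l) * sphInt (sphP v * G * sphExp (l • v)) =
      sphInt ((gradField v G - ((d : ℂ) - 1) • (sphLin v * G)) * sphExp (l • v)) := by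
  have h := integral_gradField v (G * sphExp (l • v))
  rw [gradField_mul, gradField_sphExp hv] at h
  have e1 : gradField v G * sphExp (l • v) +
      G * (-(I * l)) • (sphP v * sphExp (l • v)) =
      ((gradField v G - ((d : ℂ) - 1) • (sphLin v * G)) * sphExp (l • v)) +
      ((d : ℂ) - 1) • (sphLin v * (G * sphExp (l • v))) -
      (I * l) • (sphP v * G * sphExp (l • v)) := by
    refine ext' fun θ => ?_
    simp only [add_apply, smul_apply, mul_apply, sub_apply]
    ring
  rw [e1, map_sub, map_add, map_smul, map_smul, smul_eq_mul, smul_eq_mul] at h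
  linear_combination -h

lemma norm_sphInt_sphP_pow_le (j : ℕ) : ∃ C : ℝ, 0 ≤ C ∧ ∀ (v : Euc d) (l : ℝ) (G : CInfSph d),
    ‖v‖ = 1 → |l| ^ j * ‖sphInt (sphP v ^ j * G * sphExp (l • v))‖ ≤ C * sobOne j G := by
  have hbase : ∀ (w : Euc d) (G : CInfSph d), lOne (G * sphExp w) ≤ lOne G := fun w G => by
    rw [mul_comm]
    simpa using lOne_mul_le_of_bound (B := 1) (fun θ => (norm_sphExp_apply w θ).le) G
  induction j with
  | zero =>
    refine ⟨1, zero_le_one, fun v l G hv => ?_⟩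
    simp only [pow_zero, one_mul]
    exact (norm_sphInt_le _).trans (hbase _ _)
  | succ j ih =>
    obtain ⟨C, hC, ih⟩ := ih
    obtain ⟨C₁, hC₁, h₁⟩ := sobOne_gradField_le (d := d) j
    obtain ⟨C₂, hC₂, h₂⟩ := sobOne_mul_le (d := d) j
    refine ⟨C * (C₁ + |2 * (j : ℝ) + d - 1| * C₂), by positivity, fun v l G hv => ?_⟩
    set G' : CInfSph d := gradField v G - ((2 * j + d - 1 : ℝ) : ℂ) • (sphLin v * G) with hG'
    have e1 : (I * l) * sphInt (sphP v ^ (j + 1) * G * sphExp (l • v)) =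
        sphInt (sphP v ^ j * G' * sphExp (l • v)) := by
      have h := sphInt_sphP_mul_sphExp hv l (sphP v ^ j * G)
      rw [pow_succ', mul_assoc (sphP v) (sphP v ^ j) G, h, gradField_mul, gradField_sphP_pow hv]
      congr 1
      refine ext' fun θ => ?_
      simp only [hG', add_apply, smul_apply, mul_apply, sub_apply]
      push_cast; ring
    have e2 : |l| * ‖sphInt (sphP v ^ (j + 1) * G * sphExp (l • v))‖ =
        ‖sphInt (sphP v ^ j * G' * sphExp (l • v))‖ := by
      rw [← e1, norm_mul, norm_mul]; simp
    have e3 : sobOne j G' ≤ (C₁ + |2 * (j : ℝ) + d - 1| * C₂) * sobOne (j + 1) G := by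
      have h3 : G' = gradField v G + (-((2 * j + d - 1 : ℝ) : ℂ)) • (sphLin v * G) := by
        refine ext' fun θ => ?_
        simp only [hG', add_apply, smul_apply, sub_apply]
        ring
      rw [h3]
      refine (sobOne_add_le _ _ _).trans ?_
      rw [sobOne_smul, norm_neg, norm_real, norm_eq_abs, add_mul, mul_assoc]
      refine add_le_add (h₁ v G hv) (mul_le_mul_of_nonneg_left ?_ (abs_nonneg _))
      refine (h₂ (sphLin v) G 1 zero_le_one ((sphBound_sphLin j v).le_bound hv.le)).trans ?_
      rw [mul_one]
      exact mul_le_mul_of_nonneg_left (sobOne_mono (Nat.le_succ j) G) hC₂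
    rw [pow_succ, mul_assoc, e2]
    refine (ih v l G' hv).trans ?_
    rw [mul_assoc]
    exact mul_le_mul_of_nonneg_left e3 hC

end Oscillatory

/-! ### Laplace transforms -/

section Laplace

lemma integrableOn_one_add_mul_exp {c : ℝ} (hc : 0 < c) :
    IntegrableOn (fun t : ℝ => (1 + t) * Real.exp (-(c * t))) (Ioi 0) := by
  have h0 : IntegrableOn (fun t : ℝ => Real.exp (-(c * t))) (Ioi 0) := by
    simpa using integrableOn_exp_mul_Ioi (a := -c) (by linarith) 0
  have h1 : IntegrableOn (fun t : ℝ => t * Real.exp (-(c * t))) (Ioi 0) := by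
    have := Real.GammaIntegral_convergent (s := 2) (by norm_num)
    have h2 := integrableOn_rpow_mul_exp_neg_mul_rpow (p := 1) (s := 1) (b := c) (by norm_num)
      (by norm_num) hc
    refine h2.congr_fun (fun t _ => ?_) measurableSet_Ioi
    simp
  refine (h0.add h1).congr_fun (fun t _ => ?_) measurableSet_Ioi
  simp only [Pi.add_apply]
  ring

lemma norm_exp_neg_mul (w : ℂ) (t : ℝ) : ‖exp (-w * t)‖ = Real.exp (-(w.re * t)) := by
  rw [Complex.norm_exp]
  simp

lemma integrableOn_laplace {f : ℝ → ℂ} (hf : Continuous f) {C : ℝ}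
    (hC : ∀ t, 0 ≤ t → ‖f t‖ ≤ C * (1 + t)) {w : ℂ} (hw : 0 < w.re) :
    IntegrableOn (fun t : ℝ => f t * exp (-w * t)) (Ioi 0) := by
  refine Integrable.mono' ((integrableOn_one_add_mul_exp hw).const_mul C) ?_ ?_
  · exact (hf.mul (by fun_prop)).aestronglyMeasurable
  · refine (ae_restrict_iff' measurableSet_Ioi).2 (.of_forall fun t ht => ?_)
    rw [norm_mul, norm_exp_neg_mul, ← mul_assoc]
    exact mul_le_mul_of_nonneg_right (hC t (le_of_lt ht)) (Real.exp_pos _).le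

lemma tendsto_one_add_mul_exp {c : ℝ} (hc : 0 < c) :
    Tendsto (fun t : ℝ => (1 + t) * Real.exp (-(c * t))) atTop (𝓝 0) := by
  have h0 : Tendsto (fun t : ℝ => Real.exp (-(c * t))) atTop (𝓝 0) :=
    Real.tendsto_exp_neg_atTop_nhds_zero.comp (tendsto_id.const_mul_atTop hc)
  have h1 : Tendsto (fun t : ℝ => t * Real.exp (-(c * t))) atTop (𝓝 0) := by
    have := tendsto_rpow_mul_exp_neg_mul_atTop_nhds_zero 1 c hc
    simpa using this
  simpa [add_mul] using h0.add h1

lemma laplace_deriv {f f' : ℝ → ℂ} (hf : ∀ t, HasDerivAt f (f' t) t) (hf' : Continuous f')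
    (h0 : f 0 = 0) {C : ℝ} (hC : ∀ t, 0 ≤ t → ‖f t‖ ≤ C * (1 + t))
    (hC' : ∀ t, 0 ≤ t → ‖f' t‖ ≤ C * (1 + t)) {w : ℂ} (hw : 0 < w.re) :
    w * ∫ t in Ioi (0 : ℝ), f t * exp (-w * t) =
      ∫ t in Ioi (0 : ℝ), f' t * exp (-w * t) := by
  have hcf : Continuous f := continuous_iff_continuousAt.2 fun t => (hf t).continuousAt
  have i1 := integrableOn_laplace hcf hC hw
  have i2 := integrableOn_laplace hf' hC' hw
  have hd : ∀ t : ℝ, HasDerivAt (fun t : ℝ => f t * exp (-w * t))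
      (f' t * exp (-w * t) - w * (f t * exp (-w * t))) t := by
    intro t
    have h1 : HasDerivAt (fun t : ℝ => -w * (t : ℂ)) (-w) t := by
      simpa using (Complex.ofRealCLM.hasDerivAt (x := t)).const_mul (-w)
    refine ((hf t).mul h1.cexp).congr_deriv ?_
    ring
  have ht : Tendsto (fun t : ℝ => f t * exp (-w * t)) atTop (𝓝 0) := by
    refine squeeze_zero_norm' (a := fun t : ℝ => C * ((1 + t) * Real.exp (-(w.re * t)))) ?_ ?_
    · filter_upwards [eventually_ge_atTop (0 : ℝ)] with t ht
      rw [norm_mul, norm_exp_neg_mul, ← mul_assoc]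
      exact mul_le_mul_of_nonneg_right (hC t ht) (Real.exp_pos _).le
    · simpa using (tendsto_one_add_mul_exp hw).const_mul C
  have h := integral_Ioi_of_hasDerivAt_of_tendsto (a := 0) (hd 0).continuousAt.continuousWithinAt
    (fun t _ => hd t) (i2.sub (i1.const_mul w)) ht
  rw [integral_sub i2 (i1.const_mul w), integral_const_mul] at h
  simp only [h0, zero_mul, sub_zero] at h
  exact (sub_eq_zero.1 h).symm

/-- The amplitudes of the mode integrals: smooth functions that vanish near the negative half line,
grow at most linearly, and have an integrable `N`-th derivative. -/
structure IsAmp (N : ℕ) (a : ℝ → ℂ) : Prop where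
  smooth : ContDiff ℝ ∞ a
  eq_zero : ∃ δ : ℝ, 0 < δ ∧ ∀ t, t < δ → a t = 0
  growth : ∃ C : ℝ, 0 ≤ C ∧ ∀ k, k ≤ N → ∀ t, 0 ≤ t → ‖iteratedDeriv k a t‖ ≤ C * (1 + t)
  integrable_deriv : IntegrableOn (fun t => ‖iteratedDeriv N a t‖) (Ioi 0)
  integrable_weight : IntegrableOn (fun t => ‖a t‖ * (t ^ N)⁻¹) (Ioi 0)

lemma IsAmp.iteratedDeriv_zero {N : ℕ} {a : ℝ → ℂ} (ha : IsAmp N a) (k : ℕ) :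
    iteratedDeriv k a 0 = 0 := by
  obtain ⟨δ, hδ, h⟩ := ha.eq_zero
  have h1 : a =ᶠ[𝓝 0] fun _ => (0 : ℂ) := by
    filter_upwards [Iio_mem_nhds hδ] with t ht using h t ht
  rw [h1.iteratedDeriv_eq]
  simp

lemma IsAmp.laplace {N : ℕ} {a : ℝ → ℂ} (ha : IsAmp N a) {w : ℂ} (hw : 0 < w.re) :
    w ^ N * ∫ t in Ioi (0 : ℝ), a t * exp (-w * t) =
      ∫ t in Ioi (0 : ℝ), iteratedDeriv N a t * exp (-w * t) := by
  obtain ⟨C, hC, hg⟩ := ha.growth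
  have key : ∀ k, k ≤ N → w ^ k * ∫ t in Ioi (0 : ℝ), a t * exp (-w * t) =
      ∫ t in Ioi (0 : ℝ), iteratedDeriv k a t * exp (-w * t) := by
    intro k
    induction k with
    | zero => intro _; simp
    | succ k ih =>
      intro hk
      rw [pow_succ', mul_assoc, ih (by omega)]
      refine laplace_deriv (C := C) (fun t => ?_) (ha.smooth.continuous_iteratedDeriv _ (by
        exact_mod_cast le_top)) (ha.iteratedDeriv_zero k) (hg k (by omega)) (hg _ hk) hw
      rw [iteratedDeriv_succ]
      exact ((ha.smooth.differentiable_iteratedDeriv k (by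
        exact_mod_cast WithTop.coe_lt_top _)) t).hasDerivAt
  exact key N le_rfl

lemma IsAmp.norm_le {N : ℕ} {a : ℝ → ℂ} (ha : IsAmp N a) : ∃ C : ℝ, 0 ≤ C ∧
    ∀ t, 0 ≤ t → ‖a t‖ ≤ C * (1 + t) := by
  obtain ⟨C, hC, hg⟩ := ha.growth
  exact ⟨C, hC, fun t ht => by simpa using hg 0 (Nat.zero_le _) t ht⟩

lemma IsAmp.integrableOn {N : ℕ} {a : ℝ → ℂ} (ha : IsAmp N a) {w : ℂ} (hw : 0 < w.re) :
    IntegrableOn (fun t : ℝ => a t * exp (-w * t)) (Ioi 0) := by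
  obtain ⟨C, -, hC⟩ := ha.norm_le
  exact integrableOn_laplace ha.smooth.continuous hC hw

lemma IsAmp.norm_laplace_le {N : ℕ} {a : ℝ → ℂ} (ha : IsAmp N a) {w : ℂ} (hw : 0 < w.re) :
    ‖w ^ N * ∫ t in Ioi (0 : ℝ), a t * exp (-w * t)‖ ≤
      ∫ t in Ioi (0 : ℝ), ‖iteratedDeriv N a t‖ := by
  rw [ha.laplace hw]
  refine norm_integral_le_of_norm_le ha.integrable_deriv
    ((ae_restrict_iff' measurableSet_Ioi).2 (.of_forall fun t ht => ?_))
  rw [norm_mul, norm_exp_neg_mul]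
  refine mul_le_of_le_one_right (norm_nonneg _) (Real.exp_le_one_iff.2 ?_)
  have : 0 < w.re * t := mul_pos hw ht
  linarith

end Laplace


/-! ### Estimates of the modes away from the thresholds -/

section Modes

variable {d : ℕ}

/-- The mode integral `∫_0^∞ a(t) e^{-st} ∫ G(θ) e^{-i t r ⟨v, θ⟩} dθ dt`. -/
def modeInt (a : ℝ → ℂ) (v : Euc d) (r : ℝ) (s : ℂ) (G : CInfSph d) : ℂ :=
  ∫ t in Ioi (0 : ℝ), a t * exp (-s * t) * sphInt (G * sphExp ((r * t) • v))

lemma lOne_mul_sphExp (G : CInfSph d) (w : Euc d) : lOne (G * sphExp w) = lOne G := by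
  simp [lOne]

lemma norm_sphInt_mul_sphExp_le (G : CInfSph d) (w : Euc d) :
    ‖sphInt (G * sphExp w)‖ ≤ lOne G := by
  rw [← lOne_mul_sphExp G w]; exact norm_sphInt_le _

lemma continuous_sphInt_sphExp (G : CInfSph d) (v : Euc d) (r : ℝ) :
    Continuous fun t : ℝ => sphInt (G * sphExp ((r * t) • v)) := by
  simp only [sphInt_apply, mul_apply]
  refine continuous_of_dominated (bound := fun θ => ‖G.1 θ‖) (fun t => ?_) (fun t => ?_)
    (CInfSph.integrable G).norm ?_
  · exact (CInfSph.continuous (G * sphExp ((r * t) • v))).aestronglyMeasurable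
  · exact .of_forall fun θ => by simp
  · refine .of_forall fun θ => ?_
    simp only [sphExp_apply, real_inner_smul_left]
    fun_prop

lemma integrableOn_mode {a : ℝ → ℂ} {s : ℂ}
    (ha : IntegrableOn (fun t : ℝ => a t * exp (-s * t)) (Ioi 0)) (v : Euc d) (r : ℝ)
    (G : CInfSph d) : IntegrableOn
      (fun t : ℝ => a t * exp (-s * t) * sphInt (G * sphExp ((r * t) • v))) (Ioi 0) := by
  refine Integrable.mono' (ha.norm.mul_const (lOne G)) ?_ ?_
  · exact ha.aestronglyMeasurable.mul
      (continuous_sphInt_sphExp G v r).aestronglyMeasurable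
  · refine .of_forall fun t => ?_
    rw [norm_mul]
    exact mul_le_mul_of_nonneg_left (norm_sphInt_mul_sphExp_le _ _) (norm_nonneg _)

lemma modeInt_add {a : ℝ → ℂ} {s : ℂ}
    (ha : IntegrableOn (fun t : ℝ => a t * exp (-s * t)) (Ioi 0)) (v : Euc d) (r : ℝ)
    (F G : CInfSph d) :
    modeInt a v r s (F + G) = modeInt a v r s F + modeInt a v r s G := by
  unfold modeInt
  rw [← integral_add (integrableOn_mode ha v r F) (integrableOn_mode ha v r G)]
  congr 1
  funext t
  have : (F + G) * sphExp ((r * t) • v) = F * sphExp ((r * t) • v) + G * sphExp ((r * t) • v) :=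
    ext' fun θ => by simp [add_mul]
  rw [this, map_add, mul_add]

lemma modeInt_smul (a : ℝ → ℂ) (v : Euc d) (r : ℝ) (s c : ℂ) (G : CInfSph d) :
    modeInt a v r s (c • G) = c * modeInt a v r s G := by
  unfold modeInt
  rw [← integral_const_mul]
  congr 1
  funext t
  have : (c • G) * sphExp ((r * t) • v) = c • (G * sphExp ((r * t) • v)) :=
    ext' fun θ => by simp [mul_assoc]
  rw [this, map_smul, smul_eq_mul]
  ring

/-- The function `s / r + i ⟨v, θ⟩`. -/
def sphQ (v : Euc d) (z : ℂ) : CInfSph d := z • 1 + I • sphLin v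

/-- `∫_0^∞ a(t) e^{-st} ∫ G e^{-i t r ⟨v, θ⟩}` as an integral over the sphere of a Laplace
transform. -/
lemma modeInt_eq_sphere {a : ℝ → ℂ} (hc : Continuous a) {s : ℂ}
    (ha : IntegrableOn (fun t : ℝ => a t * exp (-s * t)) (Ioi 0)) (v : Euc d) (r : ℝ)
    (G : CInfSph d) :
    modeInt a v r s G = ∫ θ, G.1 θ * (∫ t in Ioi (0 : ℝ),
      a t * exp (-(s + I * r * (inner ℝ v (θ : Euc d) : ℝ)) * t)) ∂(surf d) := by
  have h1 : ∀ (t : ℝ) (θ : Sph d), a t * exp (-s * t) *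
      (G * sphExp ((r * t) • v)).1 θ =
      G.1 θ * (a t * exp (-(s + I * r * (inner ℝ v (θ : Euc d) : ℝ)) * t)) := by
    intro t θ
    have : exp (-(s + I * r * (inner ℝ v (θ : Euc d) : ℝ)) * t) =
        exp (-s * t) * (sphExp ((r * t) • v)).1 θ := by
      rw [sphExp_apply, ← Complex.exp_add, real_inner_smul_left]
      congr 1; push_cast; ring
    rw [this, mul_apply]; ring
  have hi : Integrable (Function.uncurry fun (t : ℝ) (θ : Sph d) =>
      a t * exp (-s * t) * (G * sphExp ((r * t) • v)).1 θ)
      ((volume.restrict (Ioi 0)).prod (surf d)) := by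
    refine Integrable.mono' (ha.norm.mul_prod (CInfSph.integrable G).norm) ?_ ?_
    · refine Continuous.aestronglyMeasurable ?_
      simp only [Function.uncurry_def, mul_apply, sphExp_apply, real_inner_smul_left]
      have := CInfSph.continuous G
      fun_prop
    · refine .of_forall fun p => ?_
      simp [Function.uncurry_def]
  unfold modeInt
  simp_rw [sphInt_apply, ← integral_const_mul]
  rw [integral_integral_swap hi]
  simp_rw [h1]

lemma norm_modeInt_sphQ_pow_le {N : ℕ} {a : ℝ → ℂ} (ha : IsAmp N a) (v : Euc d) {r : ℝ}
    (hr : 0 < r) {s : ℂ} (hs : 0 < s.re) (G : CInfSph d) :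
    r ^ N * ‖modeInt a v r s (sphQ v (s / r) ^ N * G)‖ ≤
      (∫ t in Ioi (0 : ℝ), ‖iteratedDeriv N a t‖) * lOne G := by
  have hr' : (r : ℂ) ≠ 0 := by exact_mod_cast hr.ne'
  have h1 : (r : ℂ) ^ N * modeInt a v r s (sphQ v (s / r) ^ N * G) = ∫ θ, G.1 θ *
      ((s + I * r * (inner ℝ v (θ : Euc d) : ℝ)) ^ N * ∫ t in Ioi (0 : ℝ),
      a t * exp (-(s + I * r * (inner ℝ v (θ : Euc d) : ℝ)) * t)) ∂(surf d) := by
    rw [modeInt_eq_sphere ha.smooth.continuous (ha.integrableOn hs) v r, ← integral_const_mul]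
    congr 1
    funext θ
    have h2 : s + I * r * (inner ℝ v (θ : Euc d) : ℝ) = r * (sphQ v (s / r)).1 θ := by
      simp only [sphQ, add_apply, smul_apply, one_apply, sphLin_apply]
      field_simp
    have h3 : (s + I * r * (inner ℝ v (θ : Euc d) : ℝ)) ^ N =
        (r : ℂ) ^ N * (sphQ v (s / r)).1 θ ^ N := by rw [h2, mul_pow]
    rw [h3, mul_apply, CInfSph.pow_apply]
    ring
  have h4 : r ^ N * ‖modeInt a v r s (sphQ v (s / r) ^ N * G)‖ =
      ‖(r : ℂ) ^ N * modeInt a v r s (sphQ v (s / r) ^ N * G)‖ := by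
    rw [norm_mul, norm_pow, norm_real, norm_of_nonneg hr.le]
  rw [h4, h1, lOne, ← integral_const_mul]
  refine norm_integral_le_of_norm_le ((CInfSph.integrable G).norm.const_mul _)
    (.of_forall fun θ => ?_)
  rw [norm_mul, mul_comm]
  refine mul_le_mul_of_nonneg_right (ha.norm_laplace_le ?_) (norm_nonneg _)
  simpa using hs

lemma norm_modeInt_sphP_pow_le (N : ℕ) : ∃ C : ℝ, 0 ≤ C ∧ ∀ (a : ℝ → ℂ) (v : Euc d) (r : ℝ) (s : ℂ)
    (G : CInfSph d), IsAmp N a → ‖v‖ = 1 → 0 < r → 0 < s.re →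
    r ^ N * ‖modeInt a v r s (sphP v ^ N * G)‖ ≤
      C * (∫ t in Ioi (0 : ℝ), ‖a t‖ * (t ^ N)⁻¹) * sobOne N G := by
  obtain ⟨C, hC, h⟩ := norm_sphInt_sphP_pow_le (d := d) N
  refine ⟨C, hC, fun a v r s G ha hv hr hs => ?_⟩
  have h1 : ‖modeInt a v r s (sphP v ^ N * G)‖ ≤
      ∫ t in Ioi (0 : ℝ), (‖a t‖ * (t ^ N)⁻¹) * ((r ^ N)⁻¹ * (C * sobOne N G)) := by
    refine norm_integral_le_of_norm_le (ha.integrable_weight.mul_const _)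
      ((ae_restrict_iff' measurableSet_Ioi).2 (.of_forall fun t ht => ?_))
    have ht' : (0 : ℝ) < t := ht
    have h2 := h v (r * t) G hv
    rw [abs_of_pos (mul_pos hr ht'), mul_pow] at h2
    have h3 : ‖sphInt (sphP v ^ N * G * sphExp ((r * t) • v))‖ ≤
        (t ^ N)⁻¹ * ((r ^ N)⁻¹ * (C * sobOne N G)) := by
      rw [← div_eq_inv_mul, ← div_eq_inv_mul, div_div, le_div_iff₀ (by positivity)]
      linarith
    rw [norm_mul, norm_mul, norm_exp_neg_mul, mul_assoc ‖a t‖ ((t ^ N)⁻¹)]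
    have h5 : Real.exp (-(s.re * t)) ≤ 1 := by
      refine Real.exp_le_one_iff.2 ?_
      have : 0 < s.re * t := mul_pos hs ht
      linarith
    exact mul_le_mul (mul_le_of_le_one_right (norm_nonneg _) h5) h3 (norm_nonneg _) (norm_nonneg _)
  rw [integral_mul_const] at h1
  have hrN : 0 < r ^ N := by positivity
  calc _ ≤ r ^ N * _ := mul_le_mul_of_nonneg_left h1 hrN.le
    _ = _ := by field_simp

lemma sobOne_sphP_mul_le (k : ℕ) : ∃ C : ℝ, 0 ≤ C ∧ ∀ (v : Euc d) (G : CInfSph d), ‖v‖ = 1 →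
    sobOne k (sphP v * G) ≤ C * sobOne k G := by
  obtain ⟨C, hC, h⟩ := sobOne_mul_le (d := d) k
  refine ⟨1 + C * C, by positivity, fun v G hv => ?_⟩
  have e : sphP v * G = G + (-1 : ℂ) • (sphLin v * (sphLin v * G)) := by
    refine ext' fun θ => ?_
    simp [sphP]; ring
  have h1 : ∀ G, sobOne k (sphLin v * G) ≤ C * sobOne k G := fun G => by
    simpa using h (sphLin v) G 1 zero_le_one ((sphBound_sphLin k v).le_bound hv.le)
  rw [e]
  refine (sobOne_add_le _ _ _).trans ?_
  rw [sobOne_smul, norm_neg, norm_one, one_mul, add_mul, one_mul, mul_assoc]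
  exact add_le_add le_rfl ((h1 _).trans (mul_le_mul_of_nonneg_left (h1 _) hC))

lemma sobOne_sphQ_mul_le (k : ℕ) (K : ℝ) (hK : 0 ≤ K) : ∃ C : ℝ, 0 ≤ C ∧
    ∀ (v : Euc d) (z w : ℂ) (G : CInfSph d), ‖v‖ = 1 → ‖z‖ ≤ K → ‖w‖ ≤ 1 →
    sobOne k ((z • 1 + w • sphLin v) * G) ≤ C * sobOne k G := by
  obtain ⟨C, hC, h⟩ := sobOne_mul_le (d := d) k
  refine ⟨K + C, by positivity, fun v z w G hv hz hw => ?_⟩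
  have e : (z • 1 + w • sphLin v) * G = z • G + w • (sphLin v * G) := by
    refine ext' fun θ => ?_
    simp; ring
  have h1 : ∀ G, sobOne k (sphLin v * G) ≤ C * sobOne k G := fun G => by
    simpa using h (sphLin v) G 1 zero_le_one ((sphBound_sphLin k v).le_bound hv.le)
  rw [e]
  refine (sobOne_add_le _ _ _).trans ?_
  rw [sobOne_smul, sobOne_smul, add_mul]
  have := sobOne_nonneg k G
  have := sobOne_nonneg k (sphLin v * G)
  refine add_le_add (by gcongr) ?_
  calc _ ≤ 1 * sobOne k (sphLin v * G) := by gcongr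
    _ ≤ _ := by rw [one_mul]; exact h1 G

lemma sobOne_pow_mul_le {k : ℕ} {A : CInfSph d} {C : ℝ} (hC : 0 ≤ C)
    (h : ∀ G, sobOne k (A * G) ≤ C * sobOne k G) (n : ℕ) (G : CInfSph d) :
    sobOne k (A ^ n * G) ≤ C ^ n * sobOne k G := by
  induction n generalizing G with
  | zero => simp
  | succ n ih =>
    rw [pow_succ, mul_assoc]
    refine (ih _).trans ?_
    rw [pow_succ, mul_assoc]
    exact mul_le_mul_of_nonneg_left (h G) (by positivity)

/-- The modes are of size `r^{-N}` away from the thresholds `s = ± i r`. -/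
theorem norm_modeInt_le {N : ℕ} {a : ℝ → ℂ} (ha : IsAmp N a) {K c : ℝ} (hK : 0 ≤ K) (hc : 0 < c) :
    ∃ C : ℝ, 0 ≤ C ∧ ∀ (v : Euc d) (r : ℝ) (s : ℂ) (G : CInfSph d), ‖v‖ = 1 → 0 < r → 0 < s.re →
      ‖s / r‖ ≤ K → c ≤ ‖1 + (s / r) ^ 2‖ → r ^ N * ‖modeInt a v r s G‖ ≤ C * sobOne N G := by
  obtain ⟨C₁, hC₁, h₁⟩ := norm_modeInt_sphP_pow_le (d := d) N
  obtain ⟨CP, hCP, hP⟩ := sobOne_sphP_mul_le (d := d) N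
  obtain ⟨CQ, hCQ, hQ⟩ := sobOne_sphQ_mul_le (d := d) N K hK
  set A := ∫ t in Ioi (0 : ℝ), ‖a t‖ * (t ^ N)⁻¹
  set D := ∫ t in Ioi (0 : ℝ), ‖iteratedDeriv N a t‖
  have hA : 0 ≤ A := setIntegral_nonneg measurableSet_Ioi fun t ht => by
    have : (0 : ℝ) < t := ht
    positivity
  have hD : 0 ≤ D := integral_nonneg fun _ => norm_nonneg _
  have key : ∀ n k l, N - k + (N - l) ≤ n → k ≤ N → l ≤ N → ∃ C : ℝ, 0 ≤ C ∧
      ∀ (v : Euc d) (r : ℝ) (s : ℂ) (G : CInfSph d), ‖v‖ = 1 → 0 < r → 0 < s.re →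
      ‖s / r‖ ≤ K → c ≤ ‖1 + (s / r) ^ 2‖ →
      r ^ N * ‖modeInt a v r s (sphP v ^ k * (sphQ v (s / r) ^ l * G))‖ ≤ C * sobOne N G := by
    intro n
    induction n with
    | zero =>
      intro k l hkl hk hl
      obtain rfl : k = N := by omega
      refine ⟨C₁ * A * CQ ^ l, by positivity, fun v r s G hv hr hs hz _ => ?_⟩
      refine (h₁ a v r s _ ha hv hr hs).trans ?_
      rw [mul_assoc (C₁ * A)]
      refine mul_le_mul_of_nonneg_left ?_ (by positivity)
      exact sobOne_pow_mul_le hCQ (fun G => hQ v _ I G hv hz (by simp)) l G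
    | succ n ih =>
      intro k l hkl hk hl
      rcases hk.eq_or_lt with rfl | hk'
      · refine ⟨C₁ * A * CQ ^ l, by positivity, fun v r s G hv hr hs hz _ => ?_⟩
        refine (h₁ a v r s _ ha hv hr hs).trans ?_
        rw [mul_assoc (C₁ * A)]
        refine mul_le_mul_of_nonneg_left ?_ (by positivity)
        exact sobOne_pow_mul_le hCQ (fun G => hQ v _ I G hv hz (by simp)) l G
      rcases hl.eq_or_lt with rfl | hl'
      · refine ⟨D * CP ^ k, by positivity, fun v r s G hv hr hs hz _ => ?_⟩
        rw [mul_left_comm]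
        refine (norm_modeInt_sphQ_pow_le ha v hr hs _).trans ?_
        rw [mul_assoc D]
        refine mul_le_mul_of_nonneg_left ((lOne_le_sobOne l _).trans ?_) hD
        exact sobOne_pow_mul_le hCP (fun G => hP v G hv) k G
      obtain ⟨D₁, hD₁, e₁⟩ := ih (k + 1) l (by omega) (by omega) (by omega)
      obtain ⟨D₂, hD₂, e₂⟩ := ih k (l + 1) (by omega) (by omega) (by omega)
      refine ⟨c⁻¹ * (D₁ + D₂ * CQ), by positivity, fun v r s G hv hr hs hz hcz => ?_⟩
      set z := s / r
      set Q' : CInfSph d := z • 1 + (-I) • sphLin v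
      have e : (1 + z ^ 2) • (sphP v ^ k * (sphQ v z ^ l * G)) =
          sphP v ^ (k + 1) * (sphQ v z ^ l * G) + sphP v ^ k * (sphQ v z ^ (l + 1) * (Q' * G)) := by
        refine ext' fun θ => ?_
        simp only [smul_apply, mul_apply, add_apply, CInfSph.pow_apply,
          pow_succ, Q', sphQ, one_apply, sphP, sub_apply, pow_zero, one_mul]
        linear_combination ((1 - (sphLin v).1 θ * (sphLin v).1 θ) ^ k *
          (z * 1 + I * (sphLin v).1 θ) ^ l * G.1 θ * (sphLin v).1 θ ^ 2) * Complex.I_sq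
      have h3 : (1 + z ^ 2) * modeInt a v r s (sphP v ^ k * (sphQ v z ^ l * G)) =
          modeInt a v r s (sphP v ^ (k + 1) * (sphQ v z ^ l * G)) +
          modeInt a v r s (sphP v ^ k * (sphQ v z ^ (l + 1) * (Q' * G))) := by
        rw [← modeInt_smul, e, modeInt_add (ha.integrableOn hs) v r]
      have h4 := e₁ v r s G hv hr hs hz hcz
      have h5 := e₂ v r s (Q' * G) hv hr hs hz hcz
      have h6 := hQ v z (-I) G hv hz (by simp)
      have h7 : c * (r ^ N * ‖modeInt a v r s (sphP v ^ k * (sphQ v z ^ l * G))‖) ≤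
          (D₁ + D₂ * CQ) * sobOne N G := by
        have hrN : 0 < r ^ N := by positivity
        calc c * (r ^ N * ‖modeInt a v r s (sphP v ^ k * (sphQ v z ^ l * G))‖)
            ≤ ‖1 + z ^ 2‖ * (r ^ N * ‖modeInt a v r s (sphP v ^ k * (sphQ v z ^ l * G))‖) := by
              gcongr
          _ = r ^ N * ‖(1 + z ^ 2) * modeInt a v r s (sphP v ^ k * (sphQ v z ^ l * G))‖ := by
              rw [norm_mul]; ring
          _ ≤ r ^ N * (‖modeInt a v r s (sphP v ^ (k + 1) * (sphQ v z ^ l * G))‖ +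
              ‖modeInt a v r s (sphP v ^ k * (sphQ v z ^ (l + 1) * (Q' * G)))‖) := by
              rw [h3]; gcongr; exact norm_add_le _ _
          _ ≤ D₁ * sobOne N G + D₂ * (CQ * sobOne N G) := by
              rw [mul_add]
              exact add_le_add h4 (h5.trans (mul_le_mul_of_nonneg_left h6 hD₂))
          _ = _ := by ring
      rw [mul_assoc, ← div_eq_inv_mul, le_div_iff₀ hc, mul_comm]
      exact h7
  obtain ⟨C, hC, h⟩ := key (N + N) 0 0 (by omega) (by omega) (by omega)
  exact ⟨C, hC, fun v r s G hv hr hs hz hcz => by simpa using h v r s G hv hr hs hz hcz⟩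

lemma hasDerivAt_modeInt {N : ℕ} {a : ℝ → ℂ} (ha : IsAmp N a) (ha' : IsAmp N fun t => t * a t)
    (v : Euc d) (r : ℝ) {s : ℂ} (hs : 0 < s.re) (G : CInfSph d) :
    HasDerivAt (fun s => modeInt a v r s G) (- modeInt (fun t => t * a t) v r s G) s := by
  have hs2 : (0 : ℝ) < (((s.re / 2 : ℝ) : ℂ)).re := by simpa using hs
  have h := hasDerivAt_integral_of_dominated_loc_of_deriv_le (μ := volume.restrict (Ioi (0 : ℝ)))
    (𝕜 := ℂ) (x₀ := s) (s := {w : ℂ | s.re / 2 < w.re})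
    (F := fun s t => a t * exp (-s * t) * sphInt (G * sphExp ((r * t) • v)))
    (F' := fun s t => -((t * a t) * exp (-s * t) * sphInt (G * sphExp ((r * t) • v))))
    (bound := fun t => ‖(t * a t) * exp (-((s.re / 2 : ℝ) : ℂ) * t)‖ * lOne G)
    ((isOpen_lt continuous_const Complex.continuous_re).mem_nhds (by
      simp only [Set.mem_ofPred_eq]; linarith))
    (.of_forall fun w => ?_) (integrableOn_mode (ha.integrableOn hs) v r G)
    (integrableOn_mode (ha'.integrableOn hs) v r G).neg.aestronglyMeasurable ?_
    ((ha'.integrableOn hs2).norm.mul_const _) ?_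
  · have := h.2
    rwa [integral_neg] at this
  · have := ha.smooth.continuous
    have := continuous_sphInt_sphExp G v r
    exact Continuous.aestronglyMeasurable (by fun_prop)
  · refine (ae_restrict_iff' measurableSet_Ioi).2 (.of_forall fun t ht w hw => ?_)
    rw [norm_neg, norm_mul]
    refine mul_le_mul ?_ (norm_sphInt_mul_sphExp_le _ _) (norm_nonneg _) (norm_nonneg _)
    rw [norm_mul, norm_mul _ (exp _)]
    refine mul_le_mul_of_nonneg_left ?_ (norm_nonneg _)
    rw [norm_exp_neg_mul, norm_exp_neg_mul]
    refine Real.exp_le_exp.2 (neg_le_neg ?_)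
    have ht' : (0 : ℝ) < t := ht
    have hw' : s.re / 2 < w.re := hw
    simp only [Complex.ofReal_re]
    gcongr
  · refine .of_forall fun t w _ => ?_
    have h1 : HasDerivAt (fun w : ℂ => -w * (t : ℂ)) (-t) w := by
      simpa using (hasDerivAt_id w).neg.mul_const (t : ℂ)
    refine ((h1.cexp.const_mul (a t)).mul_const _).congr_deriv ?_
    ring

/-- The modes are uniformly Lipschitz in `s` away from the thresholds. -/
theorem norm_modeInt_sub_le {N : ℕ} {a : ℝ → ℂ} (ha : IsAmp N a) (ha' : IsAmp N fun t => t * a t)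
    {K c : ℝ} (hK : 0 ≤ K) (hc : 0 < c) :
    ∃ C : ℝ, 0 ≤ C ∧ ∀ (v : Euc d) (r : ℝ) (S : Set ℂ) (G : CInfSph d), ‖v‖ = 1 → 0 < r →
      Convex ℝ S → (∀ s ∈ S, 0 < s.re ∧ ‖s / r‖ ≤ K ∧ c ≤ ‖1 + (s / r) ^ 2‖) →
      ∀ s ∈ S, ∀ s' ∈ S, r ^ N * ‖modeInt a v r s G - modeInt a v r s' G‖ ≤
        C * sobOne N G * ‖s - s'‖ := by
  obtain ⟨C, hC, h⟩ := norm_modeInt_le (d := d) ha' hK hc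
  refine ⟨C, hC, fun v r S G hv hr hS hSs s hs s' hs' => ?_⟩
  have hrN : 0 < r ^ N := by positivity
  have := hS.norm_image_sub_le_of_norm_hasDerivWithin_le (f := fun s => modeInt a v r s G)
    (f' := fun s => - modeInt (fun t => t * a t) v r s G) (C := (r ^ N)⁻¹ * (C * sobOne N G))
    (fun w hw => (hasDerivAt_modeInt ha ha' v r (hSs w hw).1 G).hasDerivWithinAt)
    (fun w hw => by
      rw [norm_neg, ← div_eq_inv_mul, le_div_iff₀ hrN, mul_comm]
      exact h v r w G hv hr (hSs w hw).1 (hSs w hw).2.1 (hSs w hw).2.2) hs' hs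
  calc _ ≤ r ^ N * ((r ^ N)⁻¹ * (C * sobOne N G) * ‖s - s'‖) :=
        mul_le_mul_of_nonneg_left this hrN.le
    _ = _ := by field_simp

end Modes


/-! ### A Hardy inequality on the sphere -/

section Hardy

variable {d : ℕ}

lemma wordSum_le_mul {n m : CInfSph d → ℝ} {C : ℝ} (h : ∀ f, n f ≤ C * m f) (k : ℕ)
    (f : CInfSph d) : wordSum n k f ≤ C * wordSum m k f := by
  induction k generalizing f with
  | zero => exact h f
  | succ k ih =>
    simp only [wordSum, mul_add, mul_sum]
    exact add_le_add (h f) (sum_le_sum fun i _ => sum_le_sum fun j _ => ih _)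

lemma lTwoSq_sum_le {ι : Type*} (s : Finset ι) (f : ι → CInfSph d) :
    lTwoSq (∑ i ∈ s, f i) ≤ s.card * ∑ i ∈ s, lTwoSq (f i) := by
  unfold lTwoSq
  rw [← integral_finsetSum s fun i _ => integrable_norm_sq (f i), ← integral_const_mul]
  refine integral_mono (integrable_norm_sq _)
    ((integrable_finsetSum s fun i _ => integrable_norm_sq (f i)).const_mul _) fun θ => ?_
  simp only [CInfSph.sum_apply]
  calc ‖∑ i ∈ s, (f i).1 θ‖ ^ 2 ≤ (∑ i ∈ s, ‖(f i).1 θ‖) ^ 2 := by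
        gcongr; exact norm_sum_le _ _
    _ ≤ _ := sq_sum_le_card_mul_sum_sq

lemma sobTwoSq_sum_le {ι : Type*} (k : ℕ) (s : Finset ι) (f : ι → CInfSph d) :
    sobTwoSq k (∑ i ∈ s, f i) ≤ s.card * ∑ i ∈ s, sobTwoSq k (f i) := by
  induction k generalizing f with
  | zero => exact lTwoSq_sum_le s f
  | succ k ih =>
    change lTwoSq _ + ∑ i, ∑ j, sobTwoSq k (rotDerivSph i j (∑ l ∈ s, f l)) ≤
      s.card * ∑ l ∈ s, (lTwoSq (f l) + ∑ i, ∑ j, sobTwoSq k (rotDerivSph i j (f l)))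
    have hc : ∑ l ∈ s, ∑ i, ∑ j, sobTwoSq k (rotDerivSph i j (f l)) =
        ∑ i, ∑ j, ∑ l ∈ s, sobTwoSq k (rotDerivSph i j (f l)) := by
      rw [Finset.sum_comm]
      exact sum_congr rfl fun i _ => Finset.sum_comm
    rw [sum_add_distrib, mul_add, hc, mul_sum (s := Finset.univ)]
    refine add_le_add (lTwoSq_sum_le s f) (sum_le_sum fun i _ => ?_)
    rw [mul_sum]
    refine sum_le_sum fun j _ => ?_
    rw [map_sum]
    exact ih _

lemma sobTwoSq_smul (k : ℕ) (c : ℂ) (f : CInfSph d) :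
    sobTwoSq k (c • f) = ‖c‖ ^ 2 * sobTwoSq k f := wordSum_smul (lTwoSq_smul c) k f

lemma sobTwoSq_add_le (k : ℕ) (f g : CInfSph d) :
    sobTwoSq k (f + g) ≤ 2 * (sobTwoSq k f + sobTwoSq k g) := by
  have := sobTwoSq_sum_le k Finset.univ fun b : Bool => if b then f else g
  simpa using this

lemma sobTwoSq_mul_le (k : ℕ) : ∃ C : ℝ, 0 ≤ C ∧ ∀ a f : CInfSph d, SphBound k a 1 →
    sobTwoSq k (a * f) ≤ C * sobTwoSq k f := by
  induction k with
  | zero =>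
    exact ⟨1, zero_le_one, fun a f ha => by
      have := lTwoSq_mul_le_of_bound ha f
      rwa [one_pow] at this⟩
  | succ k ih =>
    obtain ⟨C, hC, ih⟩ := ih
    refine ⟨1 + (d * (d * (2 * (C + C)))), by positivity, fun a f ha => ?_⟩
    have h1 : ∀ i j, sobTwoSq k (rotDerivSph i j (a * f)) ≤ 2 * (C + C) * sobTwoSq (k + 1) f := by
      intro i j
      rw [rotDerivSph_mul]
      refine (sobTwoSq_add_le _ _ _).trans ?_
      rw [mul_assoc, add_mul]
      gcongr
      · exact (ih _ _ (ha.2 i j)).trans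
          (mul_le_mul_of_nonneg_left (wordSum_succ_le lTwoSq_nonneg k f) hC)
      · exact (ih _ _ ha.of_succ).trans
          (mul_le_mul_of_nonneg_left (wordSum_rotDerivSph_le lTwoSq_nonneg k f i j) hC)
    have h2 := sum_le_sum (s := Finset.univ) fun (i : Fin d) _ =>
      sum_le_sum (s := Finset.univ) fun (j : Fin d) _ => h1 i j
    simp only [sum_const, card_univ, Fintype.card_fin, nsmul_eq_mul] at h2
    have h3 : lTwoSq (a * f) ≤ sobTwoSq (k + 1) f := by
      have := lTwoSq_mul_le_of_bound ha.1 f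
      rw [one_pow, one_mul] at this
      exact this.trans (le_wordSum lTwoSq_nonneg _ f)
    calc sobTwoSq (k + 1) (a * f)
        = lTwoSq (a * f) + ∑ i, ∑ j, sobTwoSq k (rotDerivSph i j (a * f)) := rfl
      _ ≤ _ := by linarith

lemma sobTwoSq_gradField_le (k : ℕ) : ∃ C : ℝ, 0 ≤ C ∧ ∀ (v : Euc d) (f : CInfSph d), ‖v‖ = 1 →
    sobTwoSq k (gradField v f) ≤ C * sobTwoSq (k + 1) f := by
  obtain ⟨C, hC, h⟩ := sobTwoSq_mul_le (d := d) k
  refine ⟨d * (d * (d * (d * C))), by positivity, fun v f hv => ?_⟩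
  rw [gradField, sobTwoSq_smul]
  have h1 : ∀ i j, sobTwoSq k (sphLin (rotVec v i j) * rotDerivSph i j f) ≤
      C * sobTwoSq (k + 1) f := fun i j =>
    (h _ (rotDerivSph i j f)
      ((sphBound_sphLin k (rotVec v i j)).le_bound ((norm_rotVec_le v i j).trans hv.le))).trans
      (mul_le_mul_of_nonneg_left (wordSum_rotDerivSph_le lTwoSq_nonneg k f i j) hC)
  have h2 : ∀ i, sobTwoSq k (∑ j, sphLin (rotVec v i j) * rotDerivSph i j f) ≤
      d * (d * (C * sobTwoSq (k + 1) f)) := fun i => by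
    refine (sobTwoSq_sum_le _ _ _).trans ?_
    have := sum_le_sum (s := Finset.univ) fun (j : Fin d) _ => h1 i j
    simp only [sum_const, card_univ, Fintype.card_fin, nsmul_eq_mul] at this ⊢
    exact mul_le_mul_of_nonneg_left this (Nat.cast_nonneg d)
  have h3 : sobTwoSq k (∑ i, ∑ j, sphLin (rotVec v i j) * rotDerivSph i j f) ≤
      d * (d * (d * (d * (C * sobTwoSq (k + 1) f)))) := by
    refine (sobTwoSq_sum_le _ _ _).trans ?_
    have := sum_le_sum (s := Finset.univ) fun (i : Fin d) _ => h2 i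
    simp only [sum_const, card_univ, Fintype.card_fin, nsmul_eq_mul] at this ⊢
    exact mul_le_mul_of_nonneg_left this (Nat.cast_nonneg d)
  have h4 := sobTwoSq_nonneg k (∑ i, ∑ j, sphLin (rotVec v i j) * rotDerivSph i j f)
  norm_num
  linarith

/-- The function `1 - ⟨v, θ⟩² + ε`. -/
def regP (v : Euc d) (ε : ℝ) (θ : Sph d) : ℝ := 1 - inner ℝ v (θ : Euc d) ^ 2 + ε

lemma inner_sq_le_one {v : Euc d} (hv : ‖v‖ = 1) (θ : Sph d) : inner ℝ v (θ : Euc d) ^ 2 ≤ 1 := by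
  have h := abs_real_inner_le_norm v (θ : Euc d)
  rw [hv, sph_norm, one_mul] at h
  exact (sq_le_one_iff_abs_le_one _).2 h

lemma regP_pos {v : Euc d} (hv : ‖v‖ = 1) {ε : ℝ} (hε : 0 < ε) (θ : Sph d) : 0 < regP v ε θ := by
  have := inner_sq_le_one hv θ
  unfold regP; linarith

/-- The function `(1 - ⟨v, θ⟩² + ε)^{-b}` on the sphere. -/
def sphReg {v : Euc d} (hv : ‖v‖ = 1) {ε : ℝ} (hε : 0 < ε) (b : ℝ) : CInfSph d :=
  ⟨fun θ => ((regP v ε θ ^ (-b) : ℝ) : ℂ), fun w => (((‖w‖ ^ 2 - inner ℝ v w ^ 2 + ε) ^ (-b) : ℝ) : ℂ),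
    by
      refine Complex.ofRealCLM.contDiff.comp (ContDiff.rpow_const_of_ne ?_ fun w => ?_)
      · exact ((contDiff_norm_sq ℝ).sub ((contDiff_const.inner ℝ contDiff_id).pow 2)).add
          contDiff_const
      · have h := abs_real_inner_le_norm v w
        rw [hv, one_mul] at h
        have : inner ℝ v w ^ 2 ≤ ‖w‖ ^ 2 := by
          rw [← sq_abs]; gcongr
        have : 0 < ‖w‖ ^ 2 - inner ℝ v w ^ 2 + ε := by linarith
        exact this.ne',
    fun θ => by simp [regP]⟩

lemma sphReg_apply {v : Euc d} (hv : ‖v‖ = 1) {ε : ℝ} (hε : 0 < ε) (b : ℝ) (θ : Sph d) :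
    (sphReg hv hε b).1 θ = ((regP v ε θ ^ (-b) : ℝ) : ℂ) := rfl

lemma gradField_sphReg {v : Euc d} (hv : ‖v‖ = 1) {ε : ℝ} (hε : 0 < ε) (b : ℝ) :
    gradField v (sphReg hv hε b) =
      (2 * b : ℂ) • (sphLin v * sphP v * sphReg hv hε (b + 1)) := by
  refine ext' fun θ => ?_
  have h1 : HasDerivAt (fun x : ℝ => (((1 - x ^ 2 + ε) ^ (-b) : ℝ) : ℂ))
      (((-(2 * inner ℝ v (θ : Euc d))) * (-b) * regP v ε θ ^ (-b - 1) : ℝ) : ℂ)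
      (inner ℝ v (θ : Euc d)) := by
    have h := ((((hasDerivAt_id (inner ℝ v (θ : Euc d))).pow 2).const_sub 1).add_const ε)
    have h2 := (h.rpow_const (p := -b) (Or.inl (regP_pos hv hε θ).ne')).ofReal_comp
    refine h2.congr_deriv ?_
    simp [regP]
  rw [gradField_radial hv (sphReg hv hε b) (fun θ => rfl) θ h1]
  simp only [smul_apply, mul_apply, sphP_apply, sphLin_apply, sphReg_apply]
  rw [show -b - 1 = -(b + 1) by ring]
  push_cast; ring

lemma norm_gradField_sq_le {v : Euc d} (hv : ‖v‖ = 1) (f : CInfSph d) (θ : Sph d) :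
    ‖(gradField v f).1 θ‖ ^ 2 ≤
      (1 - inner ℝ v (θ : Euc d) ^ 2) / 2 * ∑ i, ∑ j, ‖(rotDerivSph i j f).1 θ‖ ^ 2 := by
  have h1 : ‖(gradField v f).1 θ‖ ≤
      1 / 2 * ∑ p : Fin d × Fin d, |rotCoef v p.1 p.2 θ| * ‖(rotDerivSph p.1 p.2 f).1 θ‖ := by
    rw [gradField_apply, norm_mul, Fintype.sum_prod_type]
    norm_num
    refine (norm_sum_le _ _).trans (sum_le_sum fun i _ => (norm_sum_le _ _).trans
      (sum_le_sum fun j _ => ?_))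
    rw [norm_mul, sphLin_apply, inner_rotVec, norm_real, norm_eq_abs]
    rfl
  have h2 := Finset.sum_mul_sq_le_sq_mul_sq Finset.univ
    (fun p : Fin d × Fin d => |rotCoef v p.1 p.2 θ|)
    (fun p : Fin d × Fin d => ‖(rotDerivSph p.1 p.2 f).1 θ‖)
  simp only [sq_abs] at h2
  rw [Fintype.sum_prod_type (f := fun p : Fin d × Fin d => rotCoef v p.1 p.2 θ ^ 2),
    Fintype.sum_prod_type (f := fun p : Fin d × Fin d => ‖(rotDerivSph p.1 p.2 f).1 θ‖ ^ 2),
    sum_rotCoef_sq, hv] at h2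
  have h3 := pow_le_pow_left₀ (norm_nonneg _) h1 2
  rw [mul_pow] at h3
  linarith

lemma regP_rpow_succ {v : Euc d} (hv : ‖v‖ = 1) {ε : ℝ} (hε : 0 < ε) (b : ℝ) (θ : Sph d) :
    regP v ε θ ^ (-(b + 1)) * regP v ε θ = regP v ε θ ^ (-b) := by
  have hg := regP_pos hv hε θ
  rw [← Real.rpow_add_one hg.ne']
  congr 1; ring

/-- The weighted `L²` norm with the weight `(1 - ⟨v, θ⟩² + ε)^{-b}`. -/
def regSq (v : Euc d) (ε b : ℝ) (f : CInfSph d) : ℝ :=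
  ∫ θ, regP v ε θ ^ (-b) * ‖f.1 θ‖ ^ 2 ∂(surf d)

lemma continuous_regP_rpow {v : Euc d} (hv : ‖v‖ = 1) {ε : ℝ} (hε : 0 < ε) (b : ℝ) :
    Continuous fun θ : Sph d => regP v ε θ ^ (-b) := by
  refine Continuous.rpow_const ?_ fun θ => Or.inl (regP_pos hv hε θ).ne'
  unfold regP
  fun_prop

lemma hardy_pointwise {v : Euc d} (hv : ‖v‖ = 1) {ε : ℝ} (hε : 0 < ε) {b c : ℝ} (hb : 0 ≤ b)
    (hc : 0 < c) (hbc : 2 * b + c = d - 1) (f : CInfSph d) (θ : Sph d) :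
    c / 2 * (regP v ε θ ^ (-b) * ‖f.1 θ‖ ^ 2) -
      ((c + 1) * (regP v ε θ ^ (-(b - 1)) * ‖f.1 θ‖ ^ 2) +
      1 / c * ∑ i, ∑ j, regP v ε θ ^ (-(b - 1)) * ‖(rotDerivSph i j f).1 θ‖ ^ 2) ≤
    -((gradField v (sphLin v * (sphReg hv hε b * (f * sphConj f))) - ((d : ℂ) - 1) •
      (sphLin v * (sphLin v * (sphReg hv hε b * (f * sphConj f))))).1 θ).re := by
  set M : CInfSph d := f * sphConj f with hM
  set W : CInfSph d := sphReg hv hε b with hW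
  set Z : CInfSph d := gradField v (sphLin v * (W * M)) -
    ((d : ℂ) - 1) • (sphLin v * (sphLin v * (W * M))) with hZ
  set τ := inner ℝ v (θ : Euc d) with hτ
  set g := regP v ε θ with hg
  have hgpos : 0 < g := regP_pos hv hε θ
  set w := g ^ (-b) with hw
  have hwpos : 0 < w := Real.rpow_pos_of_pos hgpos _
  set m := ‖f.1 θ‖ with hm
  set S := ∑ i, ∑ j, ‖(rotDerivSph i j f).1 θ‖ ^ 2 with hS
  have hS0 : 0 ≤ S := sum_nonneg fun i _ => sum_nonneg fun j _ => sq_nonneg _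
  have hpg : 1 - τ ^ 2 = g - ε := by rw [hg, regP]; ring
  have hτ1 : τ ^ 2 ≤ 1 := inner_sq_le_one hv θ
  have hw1 : g ^ (-(b + 1)) * g = w := regP_rpow_succ hv hε b θ
  have hw2 : g ^ (-(b - 1)) = w * g := by
    have := regP_rpow_succ hv hε (b - 1) θ
    rw [sub_add_cancel] at this
    exact this.symm
  set x := (gradField v f).1 θ with hx
  have hX : ‖x‖ ^ 2 ≤ g / 2 * S := by
    refine (norm_gradField_sq_le hv f θ).trans ?_
    gcongr
    rw [← hτ, hpg]; linarith
  have hXM : (gradField v M).1 θ = ((2 * (x * (starRingEnd ℂ) (f.1 θ)).re : ℝ) : ℂ) := by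
    have hconj : (gradField v (sphConj f)).1 θ = (starRingEnd ℂ) x := by
      rw [hx, gradField_apply, gradField_apply]
      simp only [rotDerivSph_sphConj, sphConj_apply, map_mul, map_sum, sphLin_apply,
        Complex.conj_ofReal]
      congr 1
      simp only [map_div₀, map_one, map_ofNat]
    rw [hM, gradField_mul, add_apply, mul_apply, mul_apply, hconj,
      sphConj_apply, ← hx]
    have := Complex.add_conj (x * (starRingEnd ℂ) (f.1 θ))
    rw [map_mul, Complex.conj_conj] at this
    rw [← this]; ring
  set y := (x * (starRingEnd ℂ) (f.1 θ)).re with hy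
  have hy1 : |y| ≤ ‖x‖ * m := by
    refine (Complex.abs_re_le_norm _).trans ?_
    rw [norm_mul, RCLike.norm_conj]
  have hMθ : M.1 θ = ((m ^ 2 : ℝ) : ℂ) := by
    rw [hM, mul_apply, sphConj_apply, Complex.mul_conj, Complex.normSq_eq_norm_sq]
  have hZθ : (Z.1 θ).re = (1 - τ ^ 2) * (w * m ^ 2) +
      τ * (2 * b * (τ * (1 - τ ^ 2) * g ^ (-(b + 1))) * m ^ 2 + w * (2 * y)) -
      (d - 1) * (τ * (τ * (w * m ^ 2))) := by
    have : Z.1 θ = (((1 - τ ^ 2) * (w * m ^ 2) +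
      τ * (2 * b * (τ * (1 - τ ^ 2) * g ^ (-(b + 1))) * m ^ 2 + w * (2 * y)) -
      (d - 1) * (τ * (τ * (w * m ^ 2))) : ℝ) : ℂ) := by
      rw [hZ, gradField_mul, gradField_mul, hW, gradField_sphReg, gradField_sphLin hv]
      simp only [sub_apply, add_apply, mul_apply, smul_apply,
        one_apply, CInfSph.pow_apply, hXM, hMθ, sphLin_apply, sphReg_apply, sphP_apply]
      push_cast
      ring
    rw [this, Complex.ofReal_re]
  have hBθ : ∑ i, ∑ j, g ^ (-(b - 1)) * ‖(rotDerivSph i j f).1 θ‖ ^ 2 = w * g * S := by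
    simp only [hS, mul_sum, hw2]
  rw [hBθ, hZθ, hw2]
  have e1 : (1 - τ ^ 2) * g ^ (-(b + 1)) ≤ w := by
    rw [← hw1, mul_comm]
    exact mul_le_mul_of_nonneg_left (by linarith) (Real.rpow_pos_of_pos hgpos _).le
  have hm2 : 0 ≤ m ^ 2 := sq_nonneg _
  have hwm : 0 ≤ w * m ^ 2 := by positivity
  have e2 : 2 * b * (τ ^ 2 * m ^ 2) * ((1 - τ ^ 2) * g ^ (-(b + 1))) ≤
      2 * b * (τ ^ 2 * m ^ 2) * w := mul_le_mul_of_nonneg_left e1 (by positivity)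
  have e3 : τ * y ≤ ‖x‖ * m := by
    refine (le_abs_self _).trans ?_
    rw [abs_mul]
    have : |τ| ≤ 1 := abs_le_one_iff_mul_self_le_one.2 (by nlinarith)
    nlinarith [abs_nonneg y, abs_nonneg τ]
  have e4 : 2 * (‖x‖ * m) ≤ c / 2 * m ^ 2 + 1 / c * (g * S) := by
    have h1 : 2 * (‖x‖ * m) ≤ c / 2 * m ^ 2 + 2 / c * ‖x‖ ^ 2 := by
      have h5 : c / 2 * m ^ 2 + 2 / c * ‖x‖ ^ 2 - 2 * (‖x‖ * m) = (c * m - 2 * ‖x‖) ^ 2 / (2 * c) := by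
        field_simp; ring
      have h6 : 0 ≤ (c * m - 2 * ‖x‖) ^ 2 / (2 * c) := by positivity
      linarith
    have h2 : 2 / c * ‖x‖ ^ 2 ≤ 2 / c * (g / 2 * S) := by gcongr
    have h3 : 2 / c * (g / 2 * S) = 1 / c * (g * S) := by field_simp
    linarith
  have e5 : w * (2 * (τ * y)) ≤ w * (c / 2 * m ^ 2 + 1 / c * (g * S)) :=
    mul_le_mul_of_nonneg_left (by linarith) hwpos.le
  have e6 : (1 - τ ^ 2) * (w * m ^ 2) ≤ g * (w * m ^ 2) :=
    mul_le_mul_of_nonneg_right (by linarith) hwm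
  have e7 : c * ((1 - g) * (w * m ^ 2)) ≤ c * (τ ^ 2 * (w * m ^ 2)) := by
    refine mul_le_mul_of_nonneg_left (mul_le_mul_of_nonneg_right ?_ hwm) hc.le
    linarith
  have e8 : ((d : ℝ) - 1) * (τ * (τ * (w * m ^ 2))) =
      2 * b * (τ ^ 2 * m ^ 2) * w + c * (τ ^ 2 * (w * m ^ 2)) := by rw [← hbc]; ring
  rw [e8]
  linarith

lemma hardy_step {v : Euc d} (hv : ‖v‖ = 1) {ε : ℝ} (hε : 0 < ε) {b c : ℝ} (hb : 0 ≤ b)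
    (hc : 0 < c) (hbc : 2 * b + c = d - 1) (f : CInfSph d) :
    regSq v ε b f ≤ 2 / c * (c + 1 + 1 / c) * wordSum (regSq v ε (b - 1)) 1 f := by
  set M : CInfSph d := f * sphConj f with hM
  set W : CInfSph d := sphReg hv hε b with hW
  have hid := integral_gradField v (sphLin v * (W * M))
  have hsm : ((d : ℂ) - 1) * sphInt (sphLin v * (sphLin v * (W * M))) =
      sphInt (((d : ℂ) - 1) • (sphLin v * (sphLin v * (W * M)))) := by
    rw [map_smul, smul_eq_mul]
  rw [hsm, ← sub_eq_zero, ← map_sub, sphInt_apply] at hid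
  set Z : CInfSph d := gradField v (sphLin v * (W * M)) -
    ((d : ℂ) - 1) • (sphLin v * (sphLin v * (W * M))) with hZ
  have hre : ∫ θ, (Z.1 θ).re ∂(surf d) = 0 := by
    have := integral_re (𝕜 := ℂ) (CInfSph.integrable Z)
    simp only [RCLike.re_to_complex] at this
    rw [this, hid]; simp
  set B : Sph d → ℝ := fun θ => (c + 1) * (regP v ε θ ^ (-(b - 1)) * ‖f.1 θ‖ ^ 2) +
    1 / c * ∑ i, ∑ j, regP v ε θ ^ (-(b - 1)) * ‖(rotDerivSph i j f).1 θ‖ ^ 2 with hB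
  have hwi : ∀ (b : ℝ) (h : CInfSph d),
      Integrable (fun θ => regP v ε θ ^ (-b) * ‖h.1 θ‖ ^ 2) (surf d) := fun b h =>
    integrable_of_continuous_sph ((continuous_regP_rpow hv hε b).mul
      ((CInfSph.continuous h).norm.pow 2))
  have hpt : ∀ θ, c / 2 * (regP v ε θ ^ (-b) * ‖f.1 θ‖ ^ 2) - B θ ≤ -(Z.1 θ).re := by
    intro θ
    exact hardy_pointwise hv hε hb hc hbc f θ
  have hBi : Integrable B (surf d) := by
    refine ((hwi (b - 1) f).const_mul _).add (Integrable.const_mul ?_ _)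
    exact integrable_finsetSum _ fun i _ => integrable_finsetSum _ fun j _ => hwi (b - 1) _
  have h1 := integral_mono (((hwi b f).const_mul (c / 2)).sub hBi) (CInfSph.integrable Z).re.neg hpt
  simp only [Pi.sub_apply] at h1
  rw [integral_sub ((hwi b f).const_mul (c / 2)) hBi, integral_const_mul] at h1
  have h2 : ∫ θ, (-fun θ => RCLike.re (Z.1 θ)) θ ∂(surf d) = 0 := by
    simp only [Pi.neg_apply, RCLike.re_to_complex]
    rw [integral_neg, hre, neg_zero]
  rw [h2] at h1
  have h3 : ∫ θ, B θ ∂(surf d) = (c + 1) * regSq v ε (b - 1) f +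
      1 / c * ∑ i, ∑ j, regSq v ε (b - 1) (rotDerivSph i j f) := by
    simp only [hB]
    rw [integral_add ((hwi (b - 1) f).const_mul _) (Integrable.const_mul
      (integrable_finsetSum _ fun i _ => integrable_finsetSum _ fun j _ => hwi (b - 1) _) _),
      integral_const_mul, integral_const_mul, integral_finsetSum _ fun i _ =>
        integrable_finsetSum _ fun j _ => hwi (b - 1) _]
    simp_rw [fun i => integral_finsetSum (μ := surf d) Finset.univ (fun j _ =>
      hwi (b - 1) (rotDerivSph i j f))]
    rfl
  rw [h3] at h1
  have hnn : ∀ h : CInfSph d, 0 ≤ regSq v ε (b - 1) h := fun h => integral_nonneg fun θ =>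
    mul_nonneg (Real.rpow_nonneg (regP_pos hv hε θ).le _) (sq_nonneg _)
  have hs : 0 ≤ ∑ i, ∑ j, regSq v ε (b - 1) (rotDerivSph i j f) :=
    sum_nonneg fun i _ => sum_nonneg fun j _ => hnn _
  have hf := hnn f
  have hfin : c / 2 * regSq v ε b f ≤ (c + 1 + 1 / c) * wordSum (regSq v ε (b - 1)) 1 f := by
    have hc1 : 0 < 1 / c := by positivity
    have hws : wordSum (regSq v ε (b - 1)) 1 f = regSq v ε (b - 1) f +
      ∑ i, ∑ j, regSq v ε (b - 1) (rotDerivSph i j f) := rfl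
    have h4 : c / 2 * regSq v ε b f ≤ (c + 1) * regSq v ε (b - 1) f +
      1 / c * ∑ i, ∑ j, regSq v ε (b - 1) (rotDerivSph i j f) := by
      rw [regSq]; linarith
    rw [hws]
    have h5 := mul_nonneg hc1.le hf
    have h6 := mul_nonneg (by linarith : 0 ≤ c + 1) hs
    linarith
  calc regSq v ε b f = 2 / c * (c / 2 * regSq v ε b f) := by field_simp
    _ ≤ 2 / c * ((c + 1 + 1 / c) * wordSum (regSq v ε (b - 1)) 1 f) := by gcongr
    _ = _ := by ring

end Hardy


/-! ### Decay of oscillatory integrals in dimension at least four -/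

section Decay

variable {d : ℕ}

lemma wordSum_one_wordSum_one_le {n : CInfSph d → ℝ} (hn : ∀ f, 0 ≤ n f) (f : CInfSph d) :
    wordSum (wordSum n 1) 1 f ≤ 2 * wordSum n 2 f := by
  have h1 : wordSum n 1 f ≤ wordSum n 2 f := wordSum_mono hn (by norm_num) f
  have h2 : ∑ i, ∑ j, wordSum n 1 (rotDerivSph i j f) ≤ wordSum n 2 f :=
    le_add_of_nonneg_left (hn f)
  change wordSum n 1 f + ∑ i, ∑ j, wordSum n 1 (rotDerivSph i j f) ≤ _
  linarith

lemma regP_le_two {v : Euc d} {ε : ℝ} (hε1 : ε ≤ 1) (θ : Sph d) : regP v ε θ ≤ 2 := by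
  have : 0 ≤ inner ℝ v (θ : Euc d) ^ 2 := sq_nonneg _
  unfold regP; linarith

lemma regSq_five_fourths_le (hd : 4 ≤ d) : ∃ C : ℝ, 0 ≤ C ∧ ∀ (v : Euc d) (ε : ℝ) (f : CInfSph d),
    ‖v‖ = 1 → 0 < ε → ε ≤ 1 → regSq v ε (5 / 4) f ≤ C * sobTwoSq 2 f := by
  have hd' : (4 : ℝ) ≤ d := by exact_mod_cast hd
  set c₁ : ℝ := d - 1 - 5 / 2 with hc₁
  set c₂ : ℝ := d - 1 - 1 / 2 with hc₂
  have h1 : 0 < c₁ := by linarith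
  have h2 : 0 < c₂ := by linarith
  refine ⟨(2 / c₁ * (c₁ + 1 + 1 / c₁)) * ((2 / c₂ * (c₂ + 1 + 1 / c₂)) * (2 * 2)), by positivity,
    fun v ε f hv hε hε1 => ?_⟩
  have e3 : ∀ h : CInfSph d, regSq v ε (1 / 4 - 1) h ≤ 2 * lTwoSq h := by
    intro h
    rw [lTwoSq, ← integral_const_mul]
    refine integral_mono (integrable_of_continuous_sph ((continuous_regP_rpow hv hε _).mul
      ((CInfSph.continuous h).norm.pow 2))) ((integrable_norm_sq h).const_mul 2) fun θ => ?_
    refine mul_le_mul_of_nonneg_right ?_ (sq_nonneg _)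
    have hg := regP_pos hv hε θ
    have hg2 := regP_le_two (v := v) hε1 θ
    norm_num
    calc regP v ε θ ^ (3 / 4 : ℝ) ≤ 2 ^ (3 / 4 : ℝ) := by gcongr
      _ ≤ 2 ^ (1 : ℝ) := Real.rpow_le_rpow_of_exponent_le (by norm_num) (by norm_num)
      _ = 2 := by norm_num
  have e2 : ∀ h : CInfSph d, regSq v ε (5 / 4 - 1) h ≤
      (2 / c₂ * (c₂ + 1 + 1 / c₂) * 2) * wordSum lTwoSq 1 h := by
    intro h
    rw [show (5 / 4 - 1 : ℝ) = 1 / 4 by norm_num]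
    refine (hardy_step hv hε (by norm_num) h2 (by rw [hc₂]; ring) h).trans ?_
    rw [mul_assoc (2 / c₂ * (c₂ + 1 + 1 / c₂))]
    exact mul_le_mul_of_nonneg_left (wordSum_le_mul e3 1 h) (by positivity)
  refine (hardy_step hv hε (by norm_num) h1 (by rw [hc₁]; ring) f).trans ?_
  rw [mul_assoc (2 / c₁ * (c₁ + 1 + 1 / c₁))]
  refine mul_le_mul_of_nonneg_left ((wordSum_le_mul e2 1 f).trans ?_) (by positivity)
  have := wordSum_one_wordSum_one_le lTwoSq_nonneg f
  calc _ ≤ (2 / c₂ * (c₂ + 1 + 1 / c₂) * 2) * (2 * wordSum lTwoSq 2 f) := by gcongr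
    _ = _ := by rw [sobTwoSq]; ring

lemma gradField_add (v : Euc d) (f g : CInfSph d) :
    gradField v (f + g) = gradField v f + gradField v g := by
  refine ext' fun θ => ?_
  simp [gradField_apply, mul_add, sum_add_distrib]

lemma gradField_smul (v : Euc d) (c : ℂ) (f : CInfSph d) :
    gradField v (c • f) = c • gradField v f := by
  refine ext' fun θ => ?_
  simp only [gradField_apply, map_smul, smul_apply, mul_sum]
  exact sum_congr rfl fun i _ => sum_congr rfl fun j _ => by ring

lemma gradField_one (v : Euc d) : gradField v (1 : CInfSph d) = 0 := by
  refine ext' fun θ => ?_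
  simp [gradField_apply, rotDerivSph_one]

section Reg

variable {v : Euc d} (hv : ‖v‖ = 1) {ε : ℝ} (hε : 0 < ε)

/-- The function `(1 - ⟨v, θ⟩²) / (1 - ⟨v, θ⟩² + ε)`. -/
def regRatio : CInfSph d := sphP v * sphReg hv hε 1

/-- The zeroth order coefficient in the regularized integration by parts. -/
def regCoef : CInfSph d :=
  1 + (-I) • (sphLin v * ((2 : ℂ) • regRatio hv hε + (-((d : ℂ) - 1)) • 1))

/-- The first order operator in the regularized integration by parts. -/
def regOp (G : CInfSph d) : CInfSph d :=
  (-I) • gradField v G + regCoef hv hε * G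

lemma sphP_mul_sphReg (θ : Sph d) :
    (sphP v).1 θ * (sphReg hv hε 1).1 θ = 1 - ε * (sphReg hv hε 1).1 θ := by
  have hg := regP_pos hv hε θ
  have h : (sphP v).1 θ + ε = ((regP v ε θ : ℝ) : ℂ) := by
    rw [sphP_apply, regP]; push_cast; ring
  have h2 : ((regP v ε θ : ℝ) : ℂ) * (sphReg hv hε 1).1 θ = 1 := by
    rw [sphReg_apply, Real.rpow_neg_one, Complex.ofReal_inv]
    exact mul_inv_cancel₀ (by exact_mod_cast hg.ne')
  rw [← h] at h2
  linear_combination h2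

lemma gradField_sphReg_one :
    gradField v (sphReg hv hε 1) =
      (2 : ℂ) • (sphLin v * regRatio hv hε * sphReg hv hε 1) := by
  rw [gradField_sphReg]
  refine ext' fun θ => ?_
  have hg := regP_pos hv hε θ
  have : (sphReg hv hε (1 + 1)).1 θ = (sphReg hv hε 1).1 θ * (sphReg hv hε 1).1 θ := by
    simp only [sphReg_apply]
    rw [neg_add, rpow_add hg]
    push_cast; ring
  simp only [smul_apply, mul_apply, regRatio, this]
  push_cast; ring

lemma gradField_regRatio : gradField v (regRatio hv hε) =
    (-2 : ℂ) • (sphLin v * regRatio hv hε) +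
      (2 : ℂ) • (sphLin v * (regRatio hv hε * regRatio hv hε)) := by
  rw [regRatio, gradField_mul, gradField_sphP hv, gradField_sphReg_one]
  refine ext' fun θ => ?_
  simp only [add_apply, smul_apply, mul_apply, regRatio]
  ring

lemma sphInt_regOp (G : CInfSph d) :
    sphInt (G * sphExp (ε⁻¹ • v)) =
      ε * sphInt (sphReg hv hε 1 * regOp hv hε G * sphExp (ε⁻¹ • v)) := by
  set e := sphExp (ε⁻¹ • v)
  set R := sphReg hv hε 1 with hR
  have h : I * ((ε⁻¹ : ℝ) : ℂ) * sphInt (sphP v * (R * G) * e) =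
      sphInt ((gradField v (R * G) - ((d : ℂ) - 1) • (sphLin v * (R * G))) * e) :=
    sphInt_sphP_mul_sphExp hv ε⁻¹ (R * G)
  rw [gradField_mul, hR, gradField_sphReg_one, ← hR] at h
  have hε' : (ε : ℂ) ≠ 0 := by exact_mod_cast hε.ne'
  have e1 : G * e = sphP v * (R * G) * e + (ε : ℂ) • (R * G * e) := by
    refine ext' fun θ => ?_
    have := sphP_mul_sphReg hv hε θ
    simp only [add_apply, smul_apply, mul_apply]
    rw [← hR] at this
    linear_combination -(G.1 θ * e.1 θ) * this
  have e2 : R * regOp hv hε G * e = (-I) • (((2 : ℂ) • (sphLin v * regRatio hv hε * R) * G +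
      R * gradField v G - ((d : ℂ) - 1) • (sphLin v * (R * G))) * e) + R * G * e := by
    refine ext' fun θ => ?_
    simp only [regOp, regCoef, add_apply, smul_apply, mul_apply,
      sub_apply, one_apply]
    ring
  rw [e1, e2, map_add, map_add, map_smul, map_smul, ← h]
  simp only [smul_eq_mul]
  push_cast
  field_simp
  linear_combination (sphInt (sphP v * (R * G) * e)) * Complex.I_sq

lemma regOp_sphReg_mul (K : CInfSph d) :
    regOp hv hε (sphReg hv hε 1 * K) = sphReg hv hε 1 *
      (regOp hv hε K + (-(2 * I)) • (sphLin v * regRatio hv hε * K)) := by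
  rw [regOp, gradField_mul, gradField_sphReg_one, regOp]
  refine ext' fun θ => ?_
  simp only [add_apply, smul_apply, mul_apply]
  ring

lemma norm_sphReg_one_le (θ : Sph d) : ‖(sphReg hv hε 1).1 θ‖ = (regP v ε θ)⁻¹ := by
  rw [sphReg_apply, norm_real, Real.rpow_neg_one, norm_of_nonneg]
  exact (inv_pos.2 (regP_pos hv hε θ)).le

lemma norm_regRatio_le (θ : Sph d) : ‖(regRatio hv hε).1 θ‖ ≤ 1 := by
  have hg := regP_pos hv hε θ
  have h1 : 0 ≤ 1 - inner ℝ v (θ : Euc d) ^ 2 := by linarith [inner_sq_le_one hv θ]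
  rw [regRatio, mul_apply, norm_mul, norm_sphReg_one_le, sphP_apply, norm_real,
    norm_of_nonneg h1, ← div_eq_mul_inv, div_le_one hg]
  unfold regP; linarith

lemma norm_regCoef_le (θ : Sph d) : ‖(regCoef hv hε).1 θ‖ ≤ d + 11 := by
  have h1 := norm_regRatio_le hv hε θ
  have h2 := norm_sphLin_le v θ
  rw [hv] at h2
  have h3 : ‖(2 : ℂ) * (regRatio hv hε).1 θ + -((d : ℂ) - 1) * 1‖ ≤ 2 + (d + 1) := by
    refine (norm_add_le _ _).trans (add_le_add ?_ ?_)
    · rw [norm_mul]; norm_num; linarith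
    · rw [mul_one, norm_neg]
      refine (norm_sub_le _ _).trans ?_
      simp
  simp only [regCoef, add_apply, smul_apply, mul_apply, one_apply]
  refine (norm_add_le _ _).trans ?_
  rw [norm_mul, norm_mul, norm_neg, Complex.norm_I, norm_one, one_mul]
  have := mul_le_mul h2 h3 (norm_nonneg _) zero_le_one
  linarith

lemma norm_gradField_regCoef_le (θ : Sph d) : ‖(gradField v (regCoef hv hε)).1 θ‖ ≤ d + 11 := by
  have h1 := norm_regRatio_le hv hε θ
  have h2 := norm_sphLin_le v θ
  rw [hv] at h2
  set q := (regRatio hv hε).1 θ with hq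
  set t := (sphLin v).1 θ with ht
  have h0 : ‖(sphP v).1 θ‖ ≤ 1 := by
    have h1 : 0 ≤ 1 - inner ℝ v (θ : Euc d) ^ 2 := by linarith [inner_sq_le_one hv θ]
    rw [sphP_apply, norm_real, norm_of_nonneg h1]
    have : 0 ≤ inner ℝ v (θ : Euc d) ^ 2 := sq_nonneg _
    linarith
  have e : (gradField v (regCoef hv hε)).1 θ = -I * ((sphP v).1 θ * (2 * q + -((d : ℂ) - 1))
      + t * (2 * (t * (-2 * q + 2 * (q * q))))) := by
    rw [regCoef, gradField_add, gradField_one, zero_add, gradField_smul, gradField_mul,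
      gradField_add, gradField_smul, gradField_smul, gradField_one, gradField_regRatio,
      gradField_sphLin hv]
    simp only [add_apply, smul_apply, mul_apply, one_apply,
      CInfSph.zero_apply, sphP, ← hq, ← ht]
    ring
  have h3 : ‖2 * q + -((d : ℂ) - 1)‖ ≤ 2 + (d + 1) := by
    refine (norm_add_le _ _).trans (add_le_add ?_ ?_)
    · rw [norm_mul]; norm_num; linarith
    · rw [norm_neg]
      refine (norm_sub_le _ _).trans ?_
      simp
  have h4 : ‖2 * (t * (-2 * q + 2 * (q * q)))‖ ≤ 8 := by
    have h5 : ‖-2 * q + 2 * (q * q)‖ ≤ 4 := by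
      refine (norm_add_le _ _).trans ?_
      simp only [norm_mul, norm_neg, Complex.norm_ofNat]
      nlinarith [norm_nonneg q]
    simp only [norm_mul t, norm_mul (2 : ℂ), Complex.norm_ofNat]
    nlinarith [norm_nonneg t, mul_le_mul h2 h5 (norm_nonneg _) zero_le_one]
  rw [e, norm_mul, norm_neg, Complex.norm_I, one_mul]
  refine (norm_add_le _ _).trans ?_
  rw [norm_mul, norm_mul t]
  have e1 := mul_le_mul h0 h3 (norm_nonneg _) zero_le_one
  have e2 := mul_le_mul h2 h4 (norm_nonneg _) zero_le_one
  linarith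

/-- The result of two regularized integrations by parts. -/
lemma sphInt_regOp_regOp (G : CInfSph d) :
    sphInt (G * sphExp (ε⁻¹ • v)) = (ε : ℂ) ^ 2 *
      sphInt (sphReg hv hε 1 * (sphReg hv hε 1 * (regOp hv hε (regOp hv hε G) +
        (-(2 * I)) • (sphLin v * regRatio hv hε * regOp hv hε G))) *
          sphExp (ε⁻¹ • v)) := by
  rw [sphInt_regOp hv hε G, sphInt_regOp hv hε (sphReg hv hε 1 * regOp hv hε G),
    regOp_sphReg_mul]
  ring

lemma norm_regOp_regOp_le (G : CInfSph d) (θ : Sph d) :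
    ‖(regOp hv hε (regOp hv hε G) +
      (-(2 * I)) • (sphLin v * regRatio hv hε * regOp hv hε G)).1 θ‖ ≤
    4 * (d + 11) ^ 2 * (‖G.1 θ‖ + ‖(gradField v G).1 θ‖ + ‖(gradField v (gradField v G)).1 θ‖) := by
  have h1 := norm_regRatio_le hv hε θ
  have h2 := norm_sphLin_le v θ
  rw [hv] at h2
  have h3 := norm_regCoef_le hv hε θ
  have h4 := norm_gradField_regCoef_le hv hε θ
  set q := (regRatio hv hε).1 θ
  set t := (sphLin v).1 θ
  set k := (regCoef hv hε).1 θ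
  set k' := (gradField v (regCoef hv hε)).1 θ
  set g := G.1 θ
  set g₁ := (gradField v G).1 θ
  set g₂ := (gradField v (gradField v G)).1 θ
  set D : ℝ := d + 11 with hD
  have hD1 : 11 ≤ D := by rw [hD]; linarith [Nat.cast_nonneg (α := ℝ) d]
  have e : (regOp hv hε (regOp hv hε G) +
      (-(2 * I)) • (sphLin v * regRatio hv hε * regOp hv hε G)).1 θ =
      -g₂ + (-I) * (k' * g) + (-I) * (k * g₁) + k * (-I * g₁) + k * (k * g) +
        (-(2 * I)) * (t * q * (-I * g₁)) +
        (-(2 * I)) * (t * q * (k * g)) := by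
    simp only [regOp, gradField_add, gradField_smul, gradField_mul, add_apply,
      smul_apply, mul_apply]
    linear_combination g₂ * Complex.I_sq
  rw [e]
  have n1 : ‖t * q‖ ≤ 1 := by
    rw [norm_mul]
    exact mul_le_one₀ h2 (norm_nonneg _) h1
  have i1 : ‖k' * g‖ ≤ D * ‖g‖ := by rw [norm_mul]; gcongr
  have i2 : ∀ x, ‖k * x‖ ≤ D * ‖x‖ := fun x => by rw [norm_mul]; gcongr
  have i3 : ∀ x, ‖t * q * x‖ ≤ ‖x‖ := fun x => by
    rw [norm_mul]; exact mul_le_of_le_one_left (norm_nonneg _) n1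
  have nI : ∀ x, ‖-I * x‖ = ‖x‖ := fun x => by simp
  have n2I : ∀ x, ‖-(2 * I) * x‖ = 2 * ‖x‖ := fun x => by simp
  have a1 := norm_add_le (-g₂ + (-I) * (k' * g) + (-I) * (k * g₁) +
    k * (-I * g₁) + k * (k * g) + (-(2 * I)) * (t * q * (-I * g₁)))
    ((-(2 * I)) * (t * q * (k * g)))
  have a2 := norm_add_le (-g₂ + (-I) * (k' * g) + (-I) * (k * g₁) +
    k * (-I * g₁) + k * (k * g)) ((-(2 * I)) * (t * q * (-I * g₁)))
  have a3 := norm_add_le (-g₂ + (-I) * (k' * g) + (-I) * (k * g₁) +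
    k * (-I * g₁)) (k * (k * g))
  have a4 := norm_add_le (-g₂ + (-I) * (k' * g) + (-I) * (k * g₁))
    (k * (-I * g₁))
  have a5 := norm_add_le (-g₂ + (-I) * (k' * g)) ((-I) * (k * g₁))
  have a6 := norm_add_le (-g₂) ((-I) * (k' * g))
  rw [norm_neg, nI] at a6
  rw [nI] at a5
  have b1 := i2 g₁
  have b2 := i2 (-I * g₁)
  rw [nI] at b2
  have b3 : ‖k * (k * g)‖ ≤ D * (D * ‖g‖) :=
    (i2 _).trans (mul_le_mul_of_nonneg_left (i2 g) (by linarith))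
  have b4 := i3 (-I * g₁)
  have b5 := (i3 (k * g)).trans (i2 g)
  rw [nI] at b4
  rw [n2I] at a1 a2
  have hg := norm_nonneg g
  have hg1 := norm_nonneg g₁
  have hg2 := norm_nonneg g₂
  have f0 : D ≤ D ^ 2 := by nlinarith
  have f1 : D * ‖g‖ ≤ D ^ 2 * ‖g‖ := mul_le_mul_of_nonneg_right f0 hg
  have f2 : D * ‖g₁‖ ≤ D ^ 2 * ‖g₁‖ := mul_le_mul_of_nonneg_right f0 hg1
  have f3 : 1 * ‖g₂‖ ≤ D ^ 2 * ‖g₂‖ := mul_le_mul_of_nonneg_right (by linarith) hg2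
  have f4 : 1 * ‖g₁‖ ≤ D ^ 2 * ‖g₁‖ := mul_le_mul_of_nonneg_right (by linarith) hg1
  have f5 : 0 ≤ D ^ 2 * ‖g₂‖ := by positivity
  linarith

lemma lTwoSq_sphReg_mul (f : CInfSph d) :
    lTwoSq (sphReg hv hε (5 / 8) * f) = regSq v ε (5 / 4) f := by
  unfold lTwoSq regSq
  congr 1
  funext θ
  have hg := regP_pos hv hε θ
  rw [mul_apply, norm_mul, mul_pow, sphReg_apply, norm_real, norm_of_nonneg
    (Real.rpow_nonneg hg.le _), ← rpow_natCast, ← Real.rpow_mul hg.le]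
  norm_num

lemma sphReg_sq_le (θ : Sph d) : ‖(sphReg hv hε 1).1 θ‖ * ‖(sphReg hv hε 1).1 θ‖ ≤
    ε ^ (-(3 / 4) : ℝ) * (‖(sphReg hv hε (5 / 8)).1 θ‖ * ‖(sphReg hv hε (5 / 8)).1 θ‖) := by
  have hg := regP_pos hv hε θ
  have hgε : ε ≤ regP v ε θ := by
    have := inner_sq_le_one hv θ
    unfold regP; linarith
  have h : ∀ b : ℝ, ‖(sphReg hv hε b).1 θ‖ * ‖(sphReg hv hε b).1 θ‖ = regP v ε θ ^ (-(2 * b)) := by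
    intro b
    rw [sphReg_apply, norm_real, norm_of_nonneg (Real.rpow_nonneg hg.le _),
      ← rpow_add hg]
    congr 1; ring
  rw [h, h]
  have h2 : regP v ε θ ^ (-(2 * 1) : ℝ) = regP v ε θ ^ (-(3 / 4) : ℝ) * regP v ε θ ^ (-(2 * (5 / 8)) : ℝ) := by
    rw [← rpow_add hg]; norm_num
  rw [h2]
  refine mul_le_mul_of_nonneg_right ?_ (Real.rpow_nonneg hg.le _)
  exact Real.rpow_le_rpow_of_nonpos hε hgε (by norm_num)

end Reg

/-- In dimension `d ≥ 4` the oscillatory integrals decay like `λ^{-5/4}`. -/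
theorem norm_sphInt_mul_sphExp_decay (hd : 4 ≤ d) : ∃ C : ℝ, 0 ≤ C ∧ ∀ (v : Euc d) (l : ℝ)
    (f g : CInfSph d), ‖v‖ = 1 → 1 ≤ l → ‖sphInt (f * g * sphExp (l • v))‖ ≤
      C * l ^ (-(5 / 4) : ℝ) * (√(sobTwoSq 4 f) * √(sobTwoSq 4 g)) := by
  obtain ⟨CH, hCH, hardy⟩ := regSq_five_fourths_le hd
  obtain ⟨C₁, hC₁, h₁⟩ := sobTwoSq_gradField_le (d := d) 2
  obtain ⟨C₂, hC₂, h₂⟩ := sobTwoSq_gradField_le (d := d) 3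
  set E := CH * (1 + C₁ + C₁ * C₂) with hE
  have hE0 : 0 ≤ E := by positivity
  refine ⟨4 * (d + 11) ^ 2 * (2 * (9 * E)), by positivity, fun v l f g hv hl => ?_⟩
  have hl0 : 0 < l := by linarith
  set ε := l⁻¹ with hε'
  have hε : 0 < ε := inv_pos.2 hl0
  have hε1 : ε ≤ 1 := inv_le_one_of_one_le₀ hl
  have hlε : l = ε⁻¹ := (inv_inv l).symm
  set X : CInfSph d → CInfSph d := gradField v with hX
  set S := sphReg hv hε (5 / 8) with hS
  -- the weighted norms of the derivatives along the gradient field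
  have hm : ∀ f : CInfSph d, sobTwoSq 2 f ≤ sobTwoSq 4 f := fun f =>
    wordSum_mono lTwoSq_nonneg (by norm_num) f
  have hm3 : ∀ f : CInfSph d, sobTwoSq 3 f ≤ sobTwoSq 4 f := fun f =>
    wordSum_mono lTwoSq_nonneg (by norm_num) f
  have w0 : ∀ f : CInfSph d, lTwoSq (S * f) ≤ E * sobTwoSq 4 f := fun f => by
    rw [hS, lTwoSq_sphReg_mul]
    refine (hardy v ε f hv hε hε1).trans ?_
    rw [hE, mul_assoc]
    refine mul_le_mul_of_nonneg_left ?_ hCH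
    have := sobTwoSq_nonneg 4 f
    nlinarith [hm f, mul_nonneg hC₁ hC₂, mul_nonneg hC₁ this, mul_nonneg (mul_nonneg hC₁ hC₂) this]
  have w1 : ∀ f : CInfSph d, lTwoSq (S * X f) ≤ E * sobTwoSq 4 f := fun f => by
    rw [hS, lTwoSq_sphReg_mul]
    refine (hardy v ε (X f) hv hε hε1).trans ?_
    rw [hE, mul_assoc]
    refine mul_le_mul_of_nonneg_left ?_ hCH
    have := sobTwoSq_nonneg 4 f
    have := (h₁ v f hv).trans (mul_le_mul_of_nonneg_left (hm3 f) hC₁)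
    nlinarith [mul_nonneg hC₁ hC₂, mul_nonneg (mul_nonneg hC₁ hC₂) (sobTwoSq_nonneg 4 f)]
  have w2 : ∀ f : CInfSph d, lTwoSq (S * X (X f)) ≤ E * sobTwoSq 4 f := fun f => by
    rw [hS, lTwoSq_sphReg_mul]
    refine (hardy v ε (X (X f)) hv hε hε1).trans ?_
    rw [hE, mul_assoc]
    refine mul_le_mul_of_nonneg_left ?_ hCH
    have h0 := sobTwoSq_nonneg 4 f
    have h3 := (h₁ v (X f) hv).trans (mul_le_mul_of_nonneg_left (h₂ v f hv) hC₁)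
    nlinarith [mul_nonneg hC₁ h0]
  set A := √(sobTwoSq 4 f)
  set B := √(sobTwoSq 4 g)
  have hpair : ∀ a b : CInfSph d, lTwoSq (S * a) ≤ E * sobTwoSq 4 f →
      lTwoSq (S * b) ≤ E * sobTwoSq 4 g → lOne ((S * a) * (S * b)) ≤ E * (A * B) := by
    intro a b ha hb
    refine (lOne_mul_le _ _).trans ?_
    calc _ ≤ √(E * sobTwoSq 4 f) * √(E * sobTwoSq 4 g) := by gcongr
      _ = √E * √E * (A * B) := by
          rw [Real.sqrt_mul hE0, Real.sqrt_mul hE0]; ring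
      _ = _ := by rw [Real.mul_self_sqrt hE0]
  -- pointwise bound
  set K := regOp hv hε (regOp hv hε (f * g)) +
        (-(2 * I)) • (sphLin v * regRatio hv hε * regOp hv hε (f * g)) with hK
  set c := 4 * ((d : ℝ) + 11) ^ 2 with hc
  have hc0 : 0 ≤ c := by positivity
  set T : Sph d → ℝ := fun θ => ∑ a : Fin 3, ∑ b : Fin 3,
    ‖((S * ![f, X f, X (X f)] a) * (S * ![g, X g, X (X g)] b)).1 θ‖ with hT
  have hpt : ∀ θ, ‖(sphReg hv hε 1 * (sphReg hv hε 1 * K) * sphExp (ε⁻¹ • v)).1 θ‖ ≤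
      ε ^ (-(3 / 4) : ℝ) * (c * 2) * T θ := by
    intro θ
    have k1 := norm_regOp_regOp_le hv hε (f * g) θ
    have k2 := sphReg_sq_le hv hε θ
    rw [← hK] at k1
    simp only [mul_apply, norm_mul, norm_sphExp_apply, mul_one]
    set s := ‖S.1 θ‖
    set a₀ := ‖f.1 θ‖
    set a₁ := ‖(X f).1 θ‖ with ha₁
    set a₂ := ‖(X (X f)).1 θ‖ with ha₂
    set b₀ := ‖g.1 θ‖
    set b₁ := ‖(X g).1 θ‖ with hb₁
    set b₂ := ‖(X (X g)).1 θ‖ with hb₂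
    have hTθ : T θ = s * s * ((a₀ + a₁ + a₂) * (b₀ + b₁ + b₂)) := by
      simp only [hT, Fin.sum_univ_three, mul_apply, norm_mul, Matrix.cons_val]
      simp only [← ha₁, ← ha₂, ← hb₁, ← hb₂]
      ring
    have k3 : ‖(f * g).1 θ‖ + ‖(gradField v (f * g)).1 θ‖ +
        ‖(gradField v (gradField v (f * g))).1 θ‖ ≤ 2 * ((a₀ + a₁ + a₂) * (b₀ + b₁ + b₂)) := by
      have u1 : ‖(gradField v (f * g)).1 θ‖ ≤ a₁ * b₀ + a₀ * b₁ := by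
        rw [gradField_mul, add_apply, mul_apply, mul_apply]
        refine (norm_add_le _ _).trans ?_
        rw [norm_mul, norm_mul]
      have u2 : ‖(gradField v (gradField v (f * g))).1 θ‖ ≤
          (a₂ * b₀ + a₁ * b₁) + (a₁ * b₁ + a₀ * b₂) := by
        rw [gradField_mul, gradField_add, gradField_mul, gradField_mul]
        simp only [add_apply, mul_apply]
        refine (norm_add_le _ _).trans (add_le_add ((norm_add_le _ _).trans ?_)
          ((norm_add_le _ _).trans ?_)) <;> rw [norm_mul, norm_mul]
      have u0 : ‖(f * g).1 θ‖ = a₀ * b₀ := by rw [mul_apply, norm_mul]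
      have p0 : 0 ≤ a₀ := norm_nonneg _
      have p1 : 0 ≤ a₁ := norm_nonneg _
      have p2 : 0 ≤ a₂ := norm_nonneg _
      have q0 : 0 ≤ b₀ := norm_nonneg _
      have q1 : 0 ≤ b₁ := norm_nonneg _
      have q2 : 0 ≤ b₂ := norm_nonneg _
      have := mul_nonneg p0 q0
      have := mul_nonneg p0 q1
      have := mul_nonneg p0 q2
      have := mul_nonneg p1 q0
      have := mul_nonneg p1 q1
      have := mul_nonneg p1 q2
      have := mul_nonneg p2 q0
      have := mul_nonneg p2 q1
      have := mul_nonneg p2 q2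
      linarith
    have k4 : ‖K.1 θ‖ ≤ c * (2 * ((a₀ + a₁ + a₂) * (b₀ + b₁ + b₂))) :=
      k1.trans (mul_le_mul_of_nonneg_left k3 hc0)
    rw [hTθ, ← mul_assoc]
    refine (mul_le_mul k2 k4 (norm_nonneg _) (by positivity)).trans (le_of_eq ?_)
    ring
  have hTi : Integrable T (surf d) := integrable_finsetSum _ fun a _ =>
    integrable_finsetSum _ fun b _ => (CInfSph.integrable _).norm
  have hTb : ∫ θ, T θ ∂(surf d) ≤ 9 * E * (A * B) := by
    simp only [hT]
    rw [integral_finsetSum _ fun a _ => integrable_finsetSum _ fun b _ =>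
      (CInfSph.integrable _).norm]
    have : ∀ a : Fin 3, ∫ θ, ∑ b : Fin 3,
        ‖((S * ![f, X f, X (X f)] a) * (S * ![g, X g, X (X g)] b)).1 θ‖ ∂(surf d) ≤
        3 * (E * (A * B)) := by
      intro a
      rw [integral_finsetSum _ fun b _ => (CInfSph.integrable _).norm]
      have hb : ∀ b : Fin 3, ∫ θ,
        ‖((S * ![f, X f, X (X f)] a) * (S * ![g, X g, X (X g)] b)).1 θ‖ ∂(surf d) ≤
          E * (A * B) := by
        intro b
        refine hpair _ _ ?_ ?_
        · fin_cases a
          · exact w0 f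
          · exact w1 f
          · exact w2 f
        · fin_cases b
          · exact w0 g
          · exact w1 g
          · exact w2 g
      refine (sum_le_sum fun b _ => hb b).trans (le_of_eq ?_)
      simp
    refine (sum_le_sum fun a _ => this a).trans (le_of_eq ?_)
    simp; ring
  rw [hlε, sphInt_regOp_regOp hv hε, norm_mul, norm_pow, norm_real,
    norm_of_nonneg hε.le]
  have hfin : ‖sphInt (sphReg hv hε 1 * (sphReg hv hε 1 * K) * sphExp (ε⁻¹ • v))‖ ≤
      ε ^ (-(3 / 4) : ℝ) * (c * 2) * (9 * E * (A * B)) := by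
    refine (norm_integral_le_of_norm_le (hTi.const_mul _) (Eventually.of_forall hpt)).trans ?_
    rw [integral_const_mul]
    exact mul_le_mul_of_nonneg_left hTb (by positivity)
  have hpow : ε ^ 2 * ε ^ (-(3 / 4) : ℝ) = ε⁻¹ ^ (-(5 / 4) : ℝ) := by
    rw [Real.inv_rpow hε.le, ← Real.rpow_neg hε.le, ← rpow_natCast, ← rpow_add hε]
    norm_num
  calc _ ≤ ε ^ 2 * (ε ^ (-(3 / 4) : ℝ) * (c * 2) * (9 * E * (A * B))) :=
        mul_le_mul_of_nonneg_left hfin (by positivity)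
    _ = (ε ^ 2 * ε ^ (-(3 / 4) : ℝ)) * (c * 2 * (9 * E * (A * B))) := by ring
    _ = _ := by rw [hpow]; ring

end Decay



variable {d : ℕ}

/-! ### Dual norms and approximation of Sobolev distributions by smooth functions -/

lemma norm_le_of_dualNorm {k : ℕ} {u : CInfSph d →ₗ[ℂ] ℂ} (hu : dualNorm k u < ⊤) (φ : CInfSph d) :
    ‖u φ‖ ≤ (dualNorm k u).toReal * √(sobTwoSq k φ) := by
  set D := (dualNorm k u).toReal with hD
  have hD0 : 0 ≤ D := ENNReal.toReal_nonneg
  have key : ∀ ψ : CInfSph d, sobTwoSq k ψ ≤ 1 → ‖u ψ‖ ≤ D := fun ψ hψ => by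
    have h1 : ‖u ψ‖ₑ ≤ dualNorm k u :=
      le_iSup₂ (f := fun (φ : CInfSph d) (_ : sobSqFun k φ ≤ 1) => ‖u φ‖ₑ) ψ (by
        rw [sobSqFun_eq]; exact ENNReal.ofReal_le_one.2 hψ)
    have h2 := ENNReal.toReal_mono hu.ne h1
    simpa using h2
  set S := √(sobTwoSq k φ) with hS
  have hS0 : 0 ≤ S := sqrt_nonneg _
  have hSsq : sobTwoSq k φ = S ^ 2 := (Real.sq_sqrt (sobTwoSq_nonneg k φ)).symm
  have h3 : ∀ ε : ℝ, 0 < ε → ‖u φ‖ ≤ D * (S + ε) := fun ε hε => by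
    have hp : 0 < S + ε := by linarith
    have h4 := key ((((S + ε)⁻¹ : ℝ) : ℂ) • φ) (by
      rw [sobTwoSq_smul, hSsq, norm_real, norm_of_nonneg (by positivity), ← mul_pow]
      refine pow_le_one₀ (by positivity) ?_
      rw [inv_mul_le_iff₀ hp]; linarith)
    rw [map_smul, smul_eq_mul, norm_mul, norm_real, norm_of_nonneg (by positivity),
      inv_mul_le_iff₀ hp] at h4
    linarith
  have h5 : Tendsto (fun ε : ℝ => D * (S + ε)) (𝓝[>] 0) (𝓝 (D * (S + 0))) :=
    ((continuous_const.mul (continuous_const.add continuous_id)).tendsto 0).mono_left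
      nhdsWithin_le_nhds
  rw [add_zero] at h5
  exact ge_of_tendsto h5 (eventually_mem_nhdsWithin.mono fun ε hε => h3 ε hε)

lemma dualNorm_le {k : ℕ} {u : CInfSph d →ₗ[ℂ] ℂ} {D : ℝ} (hD : 0 ≤ D)
    (h : ∀ φ, ‖u φ‖ ≤ D * √(sobTwoSq k φ)) : dualNorm k u ≤ ENNReal.ofReal D := by
  refine iSup₂_le fun φ hφ => ?_
  rw [sobSqFun_eq, ENNReal.ofReal_le_one] at hφ
  rw [← ofReal_norm]
  refine ENNReal.ofReal_le_ofReal ((h φ).trans (mul_le_of_le_one_right hD ?_))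
  exact Real.sqrt_le_one.2 hφ

/-- The restrictions to the sphere of the polynomials of degree at most `n`. -/
def sphPoly (d : ℕ) : ℕ → Submodule ℂ (CInfSph d)
  | 0 => Submodule.span ℂ {1}
  | n + 1 => sphPoly d n ⊔ ⨆ i : Fin d, (sphPoly d n).map
      ({ toFun := fun f => sphLin (EuclideanSpace.single i (1 : ℝ)) * f
         map_add' := fun f g => ext' fun θ => by simp [mul_add]
         map_smul' := fun c f => ext' fun θ => by simp [mul_left_comm] } :
        CInfSph d →ₗ[ℂ] CInfSph d)

lemma sphPoly_le_succ (n : ℕ) : sphPoly d n ≤ sphPoly d (n + 1) := le_sup_left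

lemma sphPoly_mono : Monotone (sphPoly d) := monotone_nat_of_le_succ sphPoly_le_succ

instance sphPoly_finite (n : ℕ) : FiniteDimensional ℂ (sphPoly d n) := by
  induction n with
  | zero => rw [sphPoly]; infer_instance
  | succ n ih => rw [sphPoly]; infer_instance

lemma sphLin_single_mul_mem {n : ℕ} (i : Fin d) {f : CInfSph d} (hf : f ∈ sphPoly d n) :
    sphLin (EuclideanSpace.single i (1 : ℝ)) * f ∈ sphPoly d (n + 1) :=
  (le_sup_right : _ ≤ sphPoly d (n + 1))
    ((le_iSup (fun _ : Fin d => (sphPoly d n).map _) i) ⟨f, hf, rfl⟩)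

lemma sphLin_eq_sum (v : Euc d) :
    sphLin v = ∑ i, ((v i : ℝ) : ℂ) • sphLin (EuclideanSpace.single i (1 : ℝ)) := by
  refine ext' fun θ => ?_
  simp [sphLin_apply, PiLp.inner_apply, mul_comm]

lemma sphLin_mul_mem {n : ℕ} (v : Euc d) {f : CInfSph d} (hf : f ∈ sphPoly d n) :
    sphLin v * f ∈ sphPoly d (n + 1) := by
  have : sphLin v * f =
      ∑ i, ((v i : ℝ) : ℂ) • (sphLin (EuclideanSpace.single i (1 : ℝ)) * f) := by
    rw [sphLin_eq_sum]
    refine ext' fun θ => ?_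
    simp [sum_mul, mul_assoc]
  rw [this]
  exact Submodule.sum_mem _ fun i _ => Submodule.smul_mem _ _ (sphLin_single_mul_mem i hf)

lemma sphPoly_induction {P : ℕ → CInfSph d → Prop} (h1 : P 0 1)
    (hadd : ∀ n f g, P n f → P n g → P n (f + g)) (hsmul : ∀ n (c : ℂ) f, P n f → P n (c • f))
    (hsucc : ∀ n f, P n f → P (n + 1) f)
    (hmul : ∀ n i f, f ∈ sphPoly d n → P n f → P (n + 1) (sphLin (EuclideanSpace.single i (1 : ℝ)) * f))
    {n : ℕ} {f : CInfSph d} (hf : f ∈ sphPoly d n) : P n f := by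
  have h0 : ∀ n, P n 1 → P n 0 := fun n h => by simpa using hsmul n 0 1 h
  have hone : ∀ n, P n 1 := fun n => by
    induction n with
    | zero => exact h1
    | succ n ih => exact hsucc n _ ih
  induction n generalizing f with
  | zero =>
    obtain ⟨c, rfl⟩ := Submodule.mem_span_singleton.1 hf
    exact hsmul _ _ _ h1
  | succ n ih =>
    obtain ⟨a, ha, b, hb, rfl⟩ := Submodule.mem_sup.1 hf
    refine hadd _ _ _ (hsucc _ _ (ih ha)) ?_
    refine Submodule.iSup_induction _ (motive := fun b => P (n + 1) b) hb ?_ (h0 _ (hone _))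
      (fun x y hx hy => hadd _ _ _ hx hy)
    rintro i _ ⟨y, hy, rfl⟩
    exact hmul n i y hy (ih hy)

lemma one_mem_sphPoly (n : ℕ) : (1 : CInfSph d) ∈ sphPoly d n :=
  sphPoly_mono (Nat.zero_le n) (Submodule.mem_span_singleton_self _)

lemma rotDerivSph_mem_sphPoly (i j : Fin d) {n : ℕ} {f : CInfSph d} (hf : f ∈ sphPoly d n) :
    rotDerivSph i j f ∈ sphPoly d n := by
  refine sphPoly_induction (P := fun n f => rotDerivSph i j f ∈ sphPoly d n) ?_ ?_ ?_ ?_ ?_ hf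
  · rw [rotDerivSph_one]; exact Submodule.zero_mem _
  · intro n f g hf hg; rw [map_add]; exact Submodule.add_mem _ hf hg
  · intro n c f hf; rw [map_smul]; exact Submodule.smul_mem _ _ hf
  · intro n f hf; exact sphPoly_le_succ n hf
  · intro n l f hf h
    rw [rotDerivSph_mul, rotDerivSph_sphLin]
    exact Submodule.add_mem _ (sphLin_mul_mem _ hf) (sphLin_mul_mem _ h)

lemma sphConj_mem_sphPoly {n : ℕ} {f : CInfSph d} (hf : f ∈ sphPoly d n) :
    sphConj f ∈ sphPoly d n := by
  refine sphPoly_induction (P := fun n f => sphConj f ∈ sphPoly d n) ?_ ?_ ?_ ?_ ?_ hf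
  · have : sphConj (1 : CInfSph d) = 1 := ext' fun θ => by simp
    rw [this]; exact one_mem_sphPoly 0
  · intro n f g hf hg
    have : sphConj (f + g) = sphConj f + sphConj g := ext' fun θ => by simp
    rw [this]; exact Submodule.add_mem _ hf hg
  · intro n c f hf
    have : sphConj (c • f) = (starRingEnd ℂ c) • sphConj f := ext' fun θ => by simp
    rw [this]; exact Submodule.smul_mem _ _ hf
  · intro n f hf; exact sphPoly_le_succ n hf
  · intro n l f hf h
    have : sphConj (sphLin (EuclideanSpace.single l (1 : ℝ)) * f) =
        sphLin (EuclideanSpace.single l (1 : ℝ)) * sphConj f :=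
      ext' fun θ => by simp [sphLin_apply]
    rw [this]; exact sphLin_mul_mem _ h

lemma mul_mem_sphPoly {m n : ℕ} {f g : CInfSph d} (hf : f ∈ sphPoly d m) (hg : g ∈ sphPoly d n) :
    f * g ∈ sphPoly d (m + n) := by
  refine sphPoly_induction (P := fun m f => f * g ∈ sphPoly d (m + n)) ?_ ?_ ?_ ?_ ?_ hf
  · rw [one_mul, zero_add]; exact hg
  · intro m f f' hf hf'
    have : (f + f') * g = f * g + f' * g := ext' fun θ => by simp [add_mul]
    rw [this]; exact Submodule.add_mem _ hf hf'
  · intro m c f hf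
    have : (c • f) * g = c • (f * g) := ext' fun θ => by simp [mul_assoc]
    rw [this]; exact Submodule.smul_mem _ _ hf
  · intro m f hf; exact sphPoly_mono (by omega) hf
  · intro m l f hf h
    rw [mul_assoc, show m + 1 + n = (m + n) + 1 by ring]; exact sphLin_mul_mem _ h

lemma exists_sphPoly_near (φ : CInfSph d) {ε : ℝ} (hε : 0 < ε) :
    ∃ n, ∃ q ∈ sphPoly d n, ∀ θ, ‖φ.1 θ - q.1 θ‖ ≤ ε := by
  let A : StarSubalgebra ℂ C(Sph d, ℂ) :=
    { carrier := {f | ∃ n, ∃ q ∈ sphPoly d n, ∀ θ, f θ = q.1 θ}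
      mul_mem' := by
        rintro f g ⟨m, p, hp, hfp⟩ ⟨n, q, hq, hgq⟩
        exact ⟨m + n, p * q, mul_mem_sphPoly hp hq, fun θ => by simp [hfp, hgq]⟩
      add_mem' := by
        rintro f g ⟨m, p, hp, hfp⟩ ⟨n, q, hq, hgq⟩
        exact ⟨m + n, p + q, Submodule.add_mem _ (sphPoly_mono (by omega) hp)
          (sphPoly_mono (by omega) hq), fun θ => by simp [hfp, hgq]⟩
      algebraMap_mem' := fun c =>
        ⟨0, c • 1, Submodule.smul_mem _ _ (one_mem_sphPoly 0), fun θ => by simp⟩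
      star_mem' := by
        rintro f ⟨m, p, hp, hfp⟩
        exact ⟨m, sphConj p, sphConj_mem_sphPoly hp, fun θ => by simp [hfp]⟩ }
  have hA : A.topologicalClosure = ⊤ := by
    refine ContinuousMap.starSubalgebra_topologicalClosure_eq_top_of_separatesPoints A ?_
    intro θ θ' hne
    have : ∃ i, θ.1 i ≠ θ'.1 i := by
      by_contra! h
      exact hne (Subtype.ext (by ext i; exact h i))
    obtain ⟨i, hi⟩ := this
    refine ⟨_, ⟨⟨(sphLin (EuclideanSpace.single i (1 : ℝ))).1, CInfSph.continuous _⟩,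
      ⟨1, sphLin (EuclideanSpace.single i (1 : ℝ)) * 1,
        sphLin_mul_mem _ (one_mem_sphPoly 0), fun θ => by simp⟩, rfl⟩, ?_⟩
    simpa [sphLin_apply, EuclideanSpace.inner_single_left] using hi
  have hφ : (⟨φ.1, CInfSph.continuous φ⟩ : C(Sph d, ℂ)) ∈ A.topologicalClosure := by
    rw [hA]; trivial
  have hφ' : (⟨φ.1, CInfSph.continuous φ⟩ : C(Sph d, ℂ)) ∈ closure (A : Set C(Sph d, ℂ)) := hφ
  obtain ⟨f, ⟨n, q, hq, hfq⟩, hf⟩ := Metric.mem_closure_iff.1 hφ' ε hε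
  refine ⟨n, q, hq, fun θ => ?_⟩
  have h2 := (ContinuousMap.dist_apply_le_dist (f := ⟨φ.1, CInfSph.continuous φ⟩) (g := f) θ).trans
    hf.le
  rw [dist_eq_norm, hfq] at h2
  exact h2

instance : (surf d).IsOpenPosMeasure := by unfold surf; infer_instance

lemma eq_zero_of_lTwoSq {f : CInfSph d} (h : lTwoSq f = 0) : f = 0 := by
  have hc : Continuous fun θ => ‖f.1 θ‖ ^ 2 := (CInfSph.continuous f).norm.pow 2
  have h1 := (integral_eq_zero_iff_of_nonneg (fun θ => by positivity) (integrable_norm_sq f)).1 h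
  have h2 := (hc.ae_eq_iff_eq (surf d) continuous_const).1 h1
  refine ext' fun θ => ?_
  have h3 : ‖f.1 θ‖ ^ 2 = 0 := congrFun h2 θ
  simpa using h3

lemma sphInt_mul_sphConj (f : CInfSph d) : sphInt (f * sphConj f) = (lTwoSq f : ℂ) := by
  rw [sphInt_apply, lTwoSq, ← integral_complex_ofReal]
  congr 1; funext θ
  simp [Complex.mul_conj, Complex.normSq_eq_norm_sq]

/-- `p` is the polynomial of degree at most `n` that represents `u` on such polynomials. -/
def IsPolyProj (n : ℕ) (u : CInfSph d →ₗ[ℂ] ℂ) (p : CInfSph d) : Prop :=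
  p ∈ sphPoly d n ∧ ∀ q ∈ sphPoly d n, u q = sphInt (p * q)

/-- The pairing `(f, g) ↦ ∫ f g`. -/
def sphPair (d : ℕ) : CInfSph d →ₗ[ℂ] CInfSph d →ₗ[ℂ] ℂ :=
  LinearMap.mk₂ ℂ (fun f g => sphInt (f * g))
    (fun f f' g => by
      rw [← map_add]; congr 1; exact ext' fun θ => by simp [add_mul])
    (fun c f g => by
      rw [← map_smul]; congr 1; exact ext' fun θ => by simp [mul_assoc])
    (fun f g g' => by
      rw [← map_add]; congr 1; exact ext' fun θ => by simp [mul_add])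
    (fun c f g => by
      rw [← map_smul]; congr 1; exact ext' fun θ => by simp [mul_left_comm])

@[simp] lemma sphPair_apply (f g : CInfSph d) : sphPair d f g = sphInt (f * g) := rfl

lemma exists_bilin_eq {V : Type*} [AddCommGroup V] [Module ℂ V] [FiniteDimensional ℂ V]
    (B : V →ₗ[ℂ] V →ₗ[ℂ] ℂ) (hB : ∀ p, (∀ q, B p q = 0) → p = 0) (l : V →ₗ[ℂ] ℂ) :
    ∃ p, ∀ q, B p q = l q := by
  have hT : Function.Injective B :=
    (injective_iff_map_eq_zero B).2 fun p hp => hB p fun q => by rw [hp]; rfl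
  obtain ⟨p, hp⟩ := (LinearMap.injective_iff_surjective_of_finrank_eq_finrank (f := B)
    (Subspace.dual_finrank_eq (K := ℂ) (V := V)).symm).1 hT l
  exact ⟨p, fun q => LinearMap.congr_fun hp q⟩

lemma exists_isPolyProj (n : ℕ) (u : CInfSph d →ₗ[ℂ] ℂ) : ∃ p, IsPolyProj n u p := by
  obtain ⟨p, hp⟩ := exists_bilin_eq (V := sphPoly d n)
    ((sphPair d).domRestrict₁₂ (sphPoly d n) (sphPoly d n)) (fun p hp => by
      have h1 : sphInt (p.1 * sphConj p.1) = 0 := hp ⟨sphConj p.1, sphConj_mem_sphPoly p.2⟩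
      rw [sphInt_mul_sphConj] at h1
      exact Subtype.ext (eq_zero_of_lTwoSq (by exact_mod_cast h1)))
    (u ∘ₗ (sphPoly d n).subtype)
  exact ⟨p.1, p.2, fun q hq => (hp ⟨q, hq⟩).symm⟩

lemma IsPolyProj.rotDerivSph {n : ℕ} {u : CInfSph d →ₗ[ℂ] ℂ} {p : CInfSph d}
    (h : IsPolyProj n u p) (i j : Fin d) :
    IsPolyProj n (-(u ∘ₗ rotDerivSph i j)) (TorusFlow.rotDerivSph i j p) :=
  ⟨rotDerivSph_mem_sphPoly i j h.1, fun q hq => by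
    rw [LinearMap.neg_apply, LinearMap.comp_apply, h.2 _ (rotDerivSph_mem_sphPoly i j hq),
      integral_mul_rotDerivSph, neg_neg]⟩

lemma IsPolyProj.lTwoSq_le {n : ℕ} {u : CInfSph d →ₗ[ℂ] ℂ} {p : CInfSph d}
    (h : IsPolyProj n u p) : ENNReal.ofReal (lTwoSq p) ≤ dualNorm 0 u ^ 2 := by
  rcases eq_or_ne (dualNorm 0 u) ⊤ with ht | ht
  · rw [ht]; simp
  have h1 := norm_le_of_dualNorm (lt_top_iff_ne_top.2 ht) (sphConj p)
  have h2 : sobTwoSq 0 (sphConj p) = lTwoSq p := by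
    change lTwoSq _ = _
    simp [lTwoSq]
  rw [h.2 _ (sphConj_mem_sphPoly h.1), sphInt_mul_sphConj, h2, norm_real,
    norm_of_nonneg (lTwoSq_nonneg p)] at h1
  have hn := lTwoSq_nonneg p
  have h3 : √(lTwoSq p) ≤ (dualNorm 0 u).toReal := by
    rcases hn.eq_or_lt with h0 | h0
    · rw [← h0, Real.sqrt_zero]; exact ENNReal.toReal_nonneg
    · have hs := Real.sqrt_pos.2 h0
      have : √(lTwoSq p) * √(lTwoSq p) ≤ (dualNorm 0 u).toReal * √(lTwoSq p) := by
        rwa [Real.mul_self_sqrt hn]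
      exact le_of_mul_le_mul_right this hs
  rw [← Real.sq_sqrt hn, ENNReal.ofReal_pow (sqrt_nonneg _)]
  exact pow_le_pow_left' ((ENNReal.ofReal_le_ofReal h3).trans ENNReal.ofReal_toReal_le) 2

lemma IsPolyProj.sobTwoSq_le {n : ℕ} (k : ℕ) {u : CInfSph d →ₗ[ℂ] ℂ} {p : CInfSph d}
    (h : IsPolyProj n u p) : ENNReal.ofReal (sobTwoSq k p) ≤ sobSqDist k u := by
  induction k generalizing u p with
  | zero => exact h.lTwoSq_le
  | succ k ih =>
    have h1 : ∀ i j, 0 ≤ sobTwoSq k (TorusFlow.rotDerivSph i j p) := fun i j => sobTwoSq_nonneg _ _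
    change ENNReal.ofReal (lTwoSq p + ∑ i, ∑ j, sobTwoSq k (TorusFlow.rotDerivSph i j p)) ≤
      dualNorm 0 u ^ 2 + _
    rw [ENNReal.ofReal_add (lTwoSq_nonneg p)
      (sum_nonneg fun i _ => sum_nonneg fun j _ => h1 i j),
      ENNReal.ofReal_sum_of_nonneg fun i _ => sum_nonneg fun j _ => h1 i j]
    refine add_le_add h.lTwoSq_le (sum_le_sum fun i _ => ?_)
    rw [ENNReal.ofReal_sum_of_nonneg fun j _ => h1 i j]
    exact sum_le_sum fun j _ => ih (h.rotDerivSph i j)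

lemma dualNorm_zero_sq_le_sobSqDist (k : ℕ) (u : CInfSph d →ₗ[ℂ] ℂ) :
    dualNorm 0 u ^ 2 ≤ sobSqDist k u := by
  cases k with
  | zero => exact le_rfl
  | succ k => exact le_self_add

lemma dualNorm_zero_lt_top {k : ℕ} {u : CInfSph d →ₗ[ℂ] ℂ} (h : sobSqDist k u < ⊤) :
    dualNorm 0 u < ⊤ := by
  have := (dualNorm_zero_sq_le_sobSqDist k u).trans_lt h
  by_contra hc
  rw [not_lt_top_iff.1 hc] at this
  simp at this

lemma sqrt_lTwoSq_le_of_bound {f : CInfSph d} {ε : ℝ} (hε : 0 ≤ ε) (h : ∀ θ, ‖f.1 θ‖ ≤ ε) :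
    √(lTwoSq f) ≤ ε * √((surf d).real univ) := by
  rw [← Real.sqrt_sq hε, ← Real.sqrt_mul (by positivity)]
  refine sqrt_le_sqrt ?_
  have : lTwoSq f ≤ ∫ _, ε ^ 2 ∂(surf d) :=
    integral_mono (integrable_norm_sq f) (integrable_const _)
      fun θ => pow_le_pow_left₀ (norm_nonneg _) (h θ) 2
  rwa [integral_const, smul_eq_mul, mul_comm] at this

/-- A distribution in `H^k(𝕊^{d-1})` is a weak limit of smooth functions with norms bounded by
its norm. -/
theorem exists_smooth_approx {k : ℕ} {u : CInfSph d →ₗ[ℂ] ℂ} (h : sobSqDist k u < ⊤) :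
    ∃ p : ℕ → CInfSph d, (∀ n, sobTwoSq k (p n) ≤ (sobSqDist k u).toReal) ∧
      ∀ φ, Tendsto (fun n => sphInt (p n * φ)) atTop (𝓝 (u φ)) := by
  choose p hp using fun n => exists_isPolyProj n u
  have h0 := dualNorm_zero_lt_top h
  set D := (dualNorm 0 u).toReal
  have hD : 0 ≤ D := ENNReal.toReal_nonneg
  have hpD : ∀ n, √(lTwoSq (p n)) ≤ D := fun n => by
    have h1 := ENNReal.toReal_mono (ENNReal.pow_lt_top h0).ne (hp n).lTwoSq_le
    rw [ENNReal.toReal_ofReal (lTwoSq_nonneg _), ENNReal.toReal_pow] at h1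
    exact Real.sqrt_le_iff.2 ⟨hD, h1⟩
  refine ⟨p, fun n => ?_, fun φ => ?_⟩
  · have h1 := ENNReal.toReal_mono h.ne ((hp n).sobTwoSq_le k)
    rwa [ENNReal.toReal_ofReal (sobTwoSq_nonneg _ _)] at h1
  rw [Metric.tendsto_atTop]
  intro ε hε
  set m := √((surf d).real univ)
  have hm : 0 ≤ m := sqrt_nonneg _
  have hpos : 0 < 2 * D * m + 1 := by positivity
  obtain ⟨n₀, q, hq, hφq⟩ := exists_sphPoly_near φ (div_pos hε hpos)
  refine ⟨n₀, fun n hn => ?_⟩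
  have h3 : √(lTwoSq (φ - q)) ≤ ε / (2 * D * m + 1) * m :=
    sqrt_lTwoSq_le_of_bound (div_pos hε hpos).le fun θ => by simpa using hφq θ
  have h4 : ‖u (φ - q)‖ ≤ D * (ε / (2 * D * m + 1) * m) :=
    (norm_le_of_dualNorm h0 (φ - q)).trans (mul_le_mul_of_nonneg_left h3 hD)
  have h5 : ‖sphInt (p n * (φ - q))‖ ≤ D * (ε / (2 * D * m + 1) * m) :=
    (norm_sphInt_le _).trans ((lOne_mul_le _ _).trans
      (mul_le_mul (hpD n) h3 (sqrt_nonneg _) hD))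
  have h6 : sphInt (p n * φ) - u φ = sphInt (p n * (φ - q)) - u (φ - q) := by
    rw [map_sub u, (hp n).2 q (sphPoly_mono hn hq)]
    change sphPair d (p n) φ - _ = sphPair d (p n) (φ - q) - (_ - sphPair d (p n) q)
    rw [map_sub]; ring
  rw [dist_eq_norm, h6]
  calc _ ≤ _ := norm_sub_le _ _
    _ ≤ D * (ε / (2 * D * m + 1) * m) + D * (ε / (2 * D * m + 1) * m) := add_le_add h5 h4
    _ = ε * ((2 * D * m) / (2 * D * m + 1)) := by ring
    _ < ε := by
      refine mul_lt_of_lt_one_right hε ?_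
      rw [div_lt_one hpos]; linarith


variable {d : ℕ}

/-! ### The flow on smooth functions -/

lemma CInf.ext' {f g : CInf d} (h : ∀ x θ, f.1 (torusMk x, θ) = g.1 (torusMk x, θ)) : f = g := by
  refine Subtype.ext (funext fun ⟨y, θ⟩ => ?_)
  obtain ⟨x, rfl⟩ := torusMk_surjective y
  exact h x θ

@[simp] lemma CInf.add_apply (f g : CInf d) (p : ST d) : (f + g).1 p = f.1 p + g.1 p := rfl
@[simp] lemma CInf.sub_apply (f g : CInf d) (p : ST d) : (f - g).1 p = f.1 p - g.1 p := rfl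
@[simp] lemma CInf.zero_apply (p : ST d) : (0 : CInf d).1 p = 0 := rfl
@[simp] lemma CInf.smul_apply (c : ℂ) (f : CInf d) (p : ST d) : (c • f).1 p = c * f.1 p := rfl
@[simp] lemma CInf.sum_apply {ι : Type*} (s : Finset ι) (f : ι → CInf d) (p : ST d) :
    (∑ i ∈ s, f i).1 p = ∑ i ∈ s, (f i).1 p := by
  simp

lemma hasDerivAt_transDeriv (f : CInf d) (j : Fin d) (p : ST d) : HasDerivAt
    (fun t : ℝ => f.1 (p.1 + torusMk (t • EuclideanSpace.single j (1 : ℝ)), p.2))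
    ((transDeriv j f).1 p) 0 := by
  obtain ⟨g, hg, h⟩ := f.2
  obtain ⟨y, θ⟩ := p
  obtain ⟨x, rfl⟩ := torusMk_surjective y
  exact (hasDerivAt_shift hg h _ x θ).differentiableAt.hasDerivAt

lemma hasDerivAt_rotDeriv (f : CInf d) (i j : Fin d) (p : ST d) : HasDerivAt
    (fun t : ℝ => f.1 (p.1, sphCurve i j t p.2)) ((rotDeriv i j f).1 p) 0 := by
  obtain ⟨g, hg, h⟩ := f.2
  obtain ⟨y, θ⟩ := p
  obtain ⟨x, rfl⟩ := torusMk_surjective y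
  exact (hasDerivAt_rot hg h i j x θ).differentiableAt.hasDerivAt

section Lift

variable {f : CInf d} {g : Euc d × Euc d → ℂ} (hg : ContDiff ℝ ∞ g)
  (h : ∀ (x : Euc d) (θ : Sph d), f.1 (torusMk x, θ) = g (x, (θ : Euc d)))

lemma transDeriv_lift (hg : ContDiff ℝ ∞ g)
    (h : ∀ (x : Euc d) (θ : Sph d), f.1 (torusMk x, θ) = g (x, (θ : Euc d)))
    (j : Fin d) (x : Euc d) (θ : Sph d) : (transDeriv j f).1 (torusMk x, θ) =
    fderiv ℝ g (x, θ) (EuclideanSpace.single j (1 : ℝ), 0) :=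
  (hasDerivAt_shift hg h _ x θ).deriv

lemma rotDeriv_lift (hg : ContDiff ℝ ∞ g)
    (h : ∀ (x : Euc d) (θ : Sph d), f.1 (torusMk x, θ) = g (x, (θ : Euc d)))
    (i j : Fin d) (x : Euc d) (θ : Sph d) : (rotDeriv i j f).1 (torusMk x, θ) =
    fderiv ℝ g (x, θ) (0, rotField i j θ) :=
  (hasDerivAt_rot hg h i j x θ).deriv

lemma geodDeriv_lift (hg : ContDiff ℝ ∞ g)
    (h : ∀ (x : Euc d) (θ : Sph d), f.1 (torusMk x, θ) = g (x, (θ : Euc d)))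
    (x : Euc d) (θ : Sph d) : (geodDeriv f).1 (torusMk x, θ) = fderiv ℝ g (x, θ) (θ, 0) :=
  (hasDerivAt_shift hg h _ x θ).deriv

end Lift

lemma flow_mk (t : ℝ) (x : Euc d) (θ : Sph d) :
    flow t (torusMk x, θ) = (torusMk (x + t • (θ : Euc d)), θ) := by
  simp [flow, torusMk_add]

lemma flowPull_apply (t : ℝ) (f : CInf d) (p : ST d) : (flowPull t f).1 p = f.1 (flow t p) := rfl

lemma hasDerivAt_flow (f : CInf d) (p : ST d) (t : ℝ) :
    HasDerivAt (fun t => f.1 (flow t p)) ((geodDeriv f).1 (flow t p)) t := by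
  obtain ⟨g, hg, h⟩ := f.2
  obtain ⟨y, θ⟩ := p
  obtain ⟨x, rfl⟩ := torusMk_surjective y
  simp only [flow_mk, geodDeriv_lift hg h, h]
  have h1 : HasDerivAt (fun t : ℝ => (x + t • (θ : Euc d), (θ : Euc d))) ((θ : Euc d), (0 : Euc d)) t := by
    refine HasDerivAt.prodMk ?_ (hasDerivAt_const _ _)
    simpa using ((hasDerivAt_id t).smul_const (θ : Euc d)).const_add x
  exact ((hg.differentiable (by simp) _).hasFDerivAt).comp_hasDerivAt t h1

/-- Multiplication by a function on the sphere. -/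
def sphMul (a : CInfSph d) : CInf d →ₗ[ℂ] CInf d where
  toFun f := ⟨fun p => a.1 p.2 * f.1 p, by
    obtain ⟨g, hg, h⟩ := f.2
    obtain ⟨b, hb, h'⟩ := a.2
    exact ⟨fun p => b p.2 * g p, (hb.comp contDiff_snd).mul hg, fun x θ => by simp only [h, h']⟩⟩
  map_add' f f' := CInf.ext' fun x θ => by simp [mul_add]
  map_smul' c f := CInf.ext' fun x θ => by simp [mul_left_comm]

@[simp] lemma sphMul_apply (a : CInfSph d) (f : CInf d) (p : ST d) :
    (sphMul a f).1 p = a.1 p.2 * f.1 p := rfl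

lemma transDeriv_sphMul (j : Fin d) (a : CInfSph d) (f : CInf d) :
    transDeriv j (sphMul a f) = sphMul a (transDeriv j f) :=
  CInf.ext' fun x θ => (hasDerivAt_transDeriv (sphMul a f) j (torusMk x, θ)).unique
    ((hasDerivAt_transDeriv f j (torusMk x, θ)).const_mul (a.1 θ))

lemma rotDeriv_sphMul (i j : Fin d) (a : CInfSph d) (f : CInf d) :
    rotDeriv i j (sphMul a f) = sphMul (rotDerivSph i j a) f + sphMul a (rotDeriv i j f) :=
  CInf.ext' fun x θ => (hasDerivAt_rotDeriv (sphMul a f) i j (torusMk x, θ)).unique (by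
    refine ((hasDerivAt_sphCurve_apply a i j θ).mul
      (hasDerivAt_rotDeriv f i j (torusMk x, θ))).congr_deriv ?_
    simp [sphCurve_zero])

/-- The coordinate function `θ_i` on the sphere. -/
def sphCoord (i : Fin d) : CInfSph d := sphLin (EuclideanSpace.single i (1 : ℝ))

@[simp] lemma sphCoord_apply (i : Fin d) (θ : Sph d) : (sphCoord i).1 θ = ((θ.1 i : ℝ) : ℂ) := by
  simp [sphCoord, sphLin_apply, EuclideanSpace.inner_single_left]

/-- The field `θ_i ∂_{x_j} - θ_j ∂_{x_i}`. -/
def mixDeriv (i j : Fin d) : CInf d →ₗ[ℂ] CInf d :=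
  sphMul (sphCoord i) ∘ₗ transDeriv j - sphMul (sphCoord j) ∘ₗ transDeriv i

lemma mixDeriv_lift {f : CInf d} {g : Euc d × Euc d → ℂ} (hg : ContDiff ℝ ∞ g)
    (h : ∀ (x : Euc d) (θ : Sph d), f.1 (torusMk x, θ) = g (x, (θ : Euc d)))
    (i j : Fin d) (x : Euc d) (θ : Sph d) : (mixDeriv i j f).1 (torusMk x, θ) =
    fderiv ℝ g (x, θ) (rotField i j θ, 0) := by
  have h1 : (rotField i j (θ : Euc d), (0 : Euc d)) =
      θ.1 i • (EuclideanSpace.single j (1 : ℝ), (0 : Euc d)) -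
      θ.1 j • (EuclideanSpace.single i (1 : ℝ), (0 : Euc d)) := by
    ext <;> simp [rotField]
  rw [h1, map_sub, map_smul, map_smul, ← transDeriv_lift hg h, ← transDeriv_lift hg h]
  simp [mixDeriv]

lemma geodDeriv_eq_sum (f : CInf d) :
    geodDeriv f = ∑ j, sphMul (sphCoord j) (transDeriv j f) := by
  obtain ⟨g, hg, h⟩ := f.2
  refine CInf.ext' fun x θ => ?_
  have h1 : ((θ : Euc d), (0 : Euc d)) =
      ∑ j, θ.1 j • (EuclideanSpace.single j (1 : ℝ), (0 : Euc d)) := by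
    refine Prod.ext ?_ ?_
    · ext k
      simp [Prod.fst_sum, Pi.single_apply]
    · simp [Prod.snd_sum]
  rw [geodDeriv_lift hg h, h1, map_sum, CInf.sum_apply]
  refine sum_congr rfl fun j _ => ?_
  rw [map_smul, ← transDeriv_lift hg h]
  simp

lemma transDeriv_flowPull (j : Fin d) (t : ℝ) (f : CInf d) :
    transDeriv j (flowPull t f) = flowPull t (transDeriv j f) :=
  CInf.ext' fun x θ => (hasDerivAt_transDeriv (flowPull t f) j (torusMk x, θ)).unique (by
    have := hasDerivAt_transDeriv f j (flow t (torusMk x, θ))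
    simp only [flowPull_apply, flow] at this ⊢
    simpa only [add_right_comm] using this)

lemma sphMul_flowPull (a : CInfSph d) (t : ℝ) (f : CInf d) :
    sphMul a (flowPull t f) = flowPull t (sphMul a f) := rfl

lemma flowPull_flowPull (s t : ℝ) (f : CInf d) : flowPull s (flowPull t f) = flowPull (s + t) f := by
  refine CInf.ext' fun x θ => ?_
  rw [flowPull_apply, flow_mk, flowPull_apply, flow_mk, flowPull_apply, flow_mk, add_smul, add_assoc]

lemma flowPull_zero (f : CInf d) : flowPull 0 f = f :=
  CInf.ext' fun x θ => by rw [flowPull_apply, flow_mk, zero_smul, add_zero]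

lemma rotDeriv_flowPull (i j : Fin d) (t : ℝ) (f : CInf d) :
    rotDeriv i j (flowPull t f) =
      flowPull t (rotDeriv i j f) + (t : ℂ) • flowPull t (mixDeriv i j f) := by
  obtain ⟨g, hg, h⟩ := f.2
  refine CInf.ext' fun x θ => (hasDerivAt_rotDeriv (flowPull t f) i j (torusMk x, θ)).unique ?_
  simp only [flowPull_apply, flow_mk, CInf.add_apply, CInf.smul_apply]
  have h1 := hasDerivAt_along hg h (γ := fun s => x + t • (sphCurve i j s θ : Euc d))
    (((hasDerivAt_sphCurve i j θ).const_smul t).const_add x) (hasDerivAt_sphCurve i j θ) rfl rfl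
  refine h1.congr_deriv ?_
  simp only [sphCurve_zero]
  rw [rotDeriv_lift hg h, mixDeriv_lift hg h, ← Complex.real_smul, ← map_smul, ← map_add]
  congr 1
  simp

lemma rotDeriv_geodDeriv (i j : Fin d) (f : CInf d) :
    rotDeriv i j (geodDeriv f) = geodDeriv (rotDeriv i j f) + mixDeriv i j f := by
  have hcomm : ∀ l, rotDeriv i j (transDeriv l f) = transDeriv l (rotDeriv i j f) := by
    intro l
    obtain ⟨g, hg, h⟩ := f.2
    refine CInf.ext' fun x θ => ?_
    have hd : ContDiff ℝ ∞ (fderiv ℝ g) := hg.fderiv_right (by simp)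
    have h1 := rotDeriv_lift (f := transDeriv l f)
      (g := fun p => fderiv ℝ g p (EuclideanSpace.single l (1 : ℝ), 0))
      (hd.clm_apply contDiff_const) (transDeriv_lift hg h l) i j x θ
    have h2 := transDeriv_lift (f := rotDeriv i j f)
      (g := fun p => fderiv ℝ g p (0, rotField i j p.2))
      (hd.clm_apply (contDiff_const.prodMk ((rotField_contDiff i j).comp contDiff_snd)))
      (rotDeriv_lift hg h i j) l x θ
    rw [h1, h2]
    have hd' := hd.differentiable (by simp) (x, (θ : Euc d))
    have hr : DifferentiableAt ℝ (fun p : Euc d × Euc d => ((0 : Euc d), rotField i j p.2)) (x, (θ : Euc d)) :=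
      ((contDiff_const.prodMk ((rotField_contDiff i j).comp contDiff_snd)).differentiable
        (n := ∞) (by simp)) _
    rw [fderiv_clm_apply hd' (differentiableAt_const _), fderiv_clm_apply hd' hr]
    have hs : IsSymmSndFDerivAt ℝ g (x, (θ : Euc d)) :=
      hg.contDiffAt.isSymmSndFDerivAt (by simp; exact WithTop.coe_le_coe.2 (le_top : (2 : ℕ∞) ≤ ⊤))
    have h3 : fderiv ℝ (fun p : Euc d × Euc d => ((0 : Euc d), rotField i j p.2)) (x, (θ : Euc d))
        (EuclideanSpace.single l (1 : ℝ), 0) = 0 := by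
      have h4 : HasFDerivAt (fun p : Euc d × Euc d => ((0 : Euc d), rotField i j p.2))
          ((0 : Euc d × Euc d →L[ℝ] Euc d).prod ((fderiv ℝ (rotField i j) (θ : Euc d)).comp
            (ContinuousLinearMap.snd ℝ (Euc d) (Euc d)))) (x, (θ : Euc d)) :=
        (hasFDerivAt_const _ _).prodMk
          (HasFDerivAt.comp (x, (θ : Euc d)) (g := rotField i j)
            (((rotField_contDiff i j).differentiable (by simp)) _).hasFDerivAt hasFDerivAt_snd)
      rw [h4.fderiv]
      simp
    simp [h3, hs.eq (0, rotField i j (θ : Euc d)) (EuclideanSpace.single l (1 : ℝ), 0)]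
  rw [geodDeriv_eq_sum, geodDeriv_eq_sum, map_sum]
  simp only [rotDeriv_sphMul, hcomm, sum_add_distrib]
  rw [add_comm]
  congr 1
  refine CInf.ext' fun x θ => ?_
  simp only [CInf.sum_apply, sphMul_apply, sphCoord, rotDerivSph_sphLin, sphLin_apply, inner_rotVec,
    mixDeriv, LinearMap.sub_apply, LinearMap.comp_apply, CInf.sub_apply,
    EuclideanSpace.inner_single_left]
  simp [sub_mul, apply_ite Complex.ofReal, ite_mul]

lemma geodDeriv_flowPull (t : ℝ) (f : CInf d) :
    geodDeriv (flowPull t f) = flowPull t (geodDeriv f) := by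
  simp only [geodDeriv_eq_sum, map_sum, transDeriv_flowPull, sphMul_flowPull]

lemma flow_zero (p : ST d) : flow 0 p = p := by
  obtain ⟨y, θ⟩ := p
  obtain ⟨x, rfl⟩ := torusMk_surjective y
  rw [flow_mk, zero_smul, add_zero]

lemma transDeriv_comm (i j : Fin d) (f : CInf d) :
    transDeriv i (transDeriv j f) = transDeriv j (transDeriv i f) := by
  obtain ⟨g, hg, h⟩ := f.2
  refine CInf.ext' fun x θ => ?_
  have hd : ContDiff ℝ ∞ (fderiv ℝ g) := hg.fderiv_right (by simp)
  have hl := fun i j => transDeriv_lift (f := transDeriv j f)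
    (g := fun p => fderiv ℝ g p (EuclideanSpace.single j (1 : ℝ), 0))
    (hd.clm_apply contDiff_const) (transDeriv_lift hg h j) i x θ
  have hd' := hd.differentiable (by simp) (x, (θ : Euc d))
  have hs : IsSymmSndFDerivAt ℝ g (x, (θ : Euc d)) :=
    hg.contDiffAt.isSymmSndFDerivAt (by simp; exact WithTop.coe_le_coe.2 (le_top : (2 : ℕ∞) ≤ ⊤))
  rw [hl, hl, fderiv_clm_apply hd' (differentiableAt_const _),
    fderiv_clm_apply hd' (differentiableAt_const _)]
  simp [hs.eq (EuclideanSpace.single i (1 : ℝ), 0) (EuclideanSpace.single j (1 : ℝ), 0)]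


variable {d : ℕ}

/-! ### Growth of the `C^k` norms along the flow -/

instance [NeZero d] : Nonempty (Sph d) :=
  ⟨⟨EuclideanSpace.single 0 1, by simp⟩⟩

lemma CkBound.nonneg [NeZero d] {k : ℕ} {f : CInf d} {B : ℝ} (h : CkBound k f B) : 0 ≤ B :=
  (norm_nonneg _).trans (h.zero (Classical.arbitrary _))

lemma CkBound.le_bound {k : ℕ} {f : CInf d} {B B' : ℝ} (h : CkBound k f B) (hB : B ≤ B') :
    CkBound k f B' := by
  induction k generalizing f with
  | zero => exact fun p => (h p).trans hB
  | succ k ih => exact ⟨fun p => (h.1 p).trans hB, fun j => ih (h.2.1 j), fun i j => ih (h.2.2 i j)⟩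

lemma CkBound.add {k : ℕ} {f g : CInf d} {B B' : ℝ} (h : CkBound k f B) (h' : CkBound k g B') :
    CkBound k (f + g) (B + B') := by
  induction k generalizing f g with
  | zero => exact fun p => (norm_add_le _ _).trans (add_le_add (h p) (h' p))
  | succ k ih =>
    refine ⟨fun p => (norm_add_le _ _).trans (add_le_add (h.1 p) (h'.1 p)), fun j => ?_,
      fun i j => ?_⟩
    · rw [map_add]; exact ih (h.2.1 j) (h'.2.1 j)
    · rw [map_add]; exact ih (h.2.2 i j) (h'.2.2 i j)

lemma CkBound.smul {k : ℕ} {f : CInf d} {B : ℝ} (c : ℂ) (h : CkBound k f B) :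
    CkBound k (c • f) (‖c‖ * B) := by
  have hc : ∀ {f : CInf d} p, ‖f.1 p‖ ≤ B → ‖(c • f).1 p‖ ≤ ‖c‖ * B := fun p hp => by
    rw [CInf.smul_apply, norm_mul]; exact mul_le_mul_of_nonneg_left hp (norm_nonneg c)
  induction k generalizing f with
  | zero => exact fun p => hc p (h p)
  | succ k ih =>
    refine ⟨fun p => hc p (h.1 p), fun j => ?_, fun i j => ?_⟩
    · rw [map_smul]; exact ih (h.2.1 j)
    · rw [map_smul]; exact ih (h.2.2 i j)

lemma CkBound.zero_fun (k : ℕ) : CkBound k (0 : CInf d) 0 := by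
  induction k with
  | zero => intro p; simp
  | succ k ih => exact ⟨fun p => by simp, fun j => by rwa [map_zero], fun i j => by rwa [map_zero]⟩

lemma CkBound.sum {ι : Type*} {k : ℕ} (s : Finset ι) {f : ι → CInf d} {B : ι → ℝ}
    (h : ∀ i ∈ s, CkBound k (f i) (B i)) : CkBound k (∑ i ∈ s, f i) (∑ i ∈ s, B i) := by
  classical
  induction s using Finset.induction_on with
  | empty => simpa using CkBound.zero_fun k
  | insert a s ha ih =>
    rw [Finset.sum_insert ha, Finset.sum_insert ha]
    exact (h a (Finset.mem_insert_self a s)).add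
      (ih fun i hi => h i (Finset.mem_insert_of_mem hi))

lemma CkBound.sub {k : ℕ} {f g : CInf d} {B B' : ℝ} (h : CkBound k f B) (h' : CkBound k g B') :
    CkBound k (f - g) (B + B') := by
  have h1 := h.add (h'.smul (-1))
  have h2 : f + (-1 : ℂ) • g = f - g := CInf.ext' fun x θ => by simp [sub_eq_add_neg]
  rwa [h2, norm_neg, norm_one, one_mul] at h1

lemma CkBound.exists (k : ℕ) (f : CInf d) : ∃ B : ℝ, 0 ≤ B ∧ CkBound k f B := by
  induction k generalizing f with
  | zero =>
    obtain ⟨C, hC⟩ := isCompact_univ.exists_bound_of_continuousOn (f := f.1)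
      (CInf.continuous f).continuousOn
    exact ⟨max C 0, le_max_right _ _, fun p => (hC p (mem_univ p)).trans (le_max_left _ _)⟩
  | succ k ih =>
    obtain ⟨C, hC0, hC⟩ := isCompact_univ.exists_bound_of_continuousOn (f := f.1)
      (CInf.continuous f).continuousOn |>.imp fun C h => And.intro (le_max_right C 0)
        fun p => (h p (mem_univ p)).trans (le_max_left C 0)
    choose b hb hb' using fun j : Fin d => ih (transDeriv j f)
    choose c hc hc' using fun p : Fin d × Fin d => ih (rotDeriv p.1 p.2 f)
    have hsb : 0 ≤ ∑ j, b j := sum_nonneg fun j _ => hb j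
    have hsc : 0 ≤ ∑ p, c p := sum_nonneg fun p _ => hc p
    refine ⟨max C 0 + ∑ j, b j + ∑ p, c p, by positivity, fun p => (hC p).trans (by linarith),
      fun j => (hb' j).le_bound ?_, fun i j => (hc' (i, j)).le_bound ?_⟩
    · have := single_le_sum (fun j _ => hb j) (Finset.mem_univ j)
      linarith
    · have := single_le_sum (fun p _ => hc p) (Finset.mem_univ (i, j))
      linarith

lemma CkBound.sphMul [NeZero d] (k : ℕ) : ∃ C : ℝ, 0 ≤ C ∧ ∀ (a : CInfSph d) (f : CInf d) (A B : ℝ),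
    SphBound k a A → CkBound k f B → CkBound k (TorusFlow.sphMul a f) (C * (A * B)) := by
  have h0 : ∀ (a : CInfSph d) (f : CInf d) (A B : ℝ), (∀ θ, ‖a.1 θ‖ ≤ A) → (∀ p, ‖f.1 p‖ ≤ B) →
      ∀ p, ‖(TorusFlow.sphMul a f).1 p‖ ≤ A * B := fun a f A B ha hf p => by
    rw [sphMul_apply, norm_mul]
    exact mul_le_mul (ha _) (hf _) (norm_nonneg _) ((norm_nonneg _).trans (ha p.2))
  induction k with
  | zero => exact ⟨1, zero_le_one, fun a f A B ha hf => by rw [one_mul]; exact h0 a f A B ha hf⟩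
  | succ k ih =>
    obtain ⟨C, hC, h⟩ := ih
    refine ⟨1 + (C + C), by positivity, fun a f A B ha hf => ?_⟩
    have hA : 0 ≤ A := (norm_nonneg _).trans (ha.zero (Classical.arbitrary _))
    have hB := hf.nonneg
    have hAB := mul_nonneg hA hB
    have hCAB := mul_nonneg hC hAB
    refine ⟨fun p => (h0 a f A B ha.zero (fun p => hf.zero p) p).trans (by linarith), fun j => ?_,
      fun i j => ?_⟩
    · rw [transDeriv_sphMul]
      exact (h _ _ _ _ ha.of_succ (hf.2.1 j)).le_bound (by linarith)
    · rw [rotDeriv_sphMul]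
      exact ((h _ _ _ _ (ha.2 i j) hf.of_succ).add (h _ _ _ _ ha.of_succ (hf.2.2 i j))).le_bound
        (by linarith)

lemma sphBound_sphCoord (k : ℕ) (i : Fin d) : SphBound k (sphCoord i) 1 := by
  have := sphBound_sphLin k (EuclideanSpace.single i (1 : ℝ))
  rwa [PiLp.norm_single, norm_one] at this

lemma CkBound.mixDeriv [NeZero d] (k : ℕ) : ∃ C : ℝ, 0 ≤ C ∧ ∀ (f : CInf d) (B : ℝ) (i j : Fin d),
    CkBound (k + 1) f B → CkBound k (TorusFlow.mixDeriv i j f) (C * B) := by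
  obtain ⟨C, hC, h⟩ := CkBound.sphMul (d := d) k
  refine ⟨C + C, by positivity, fun f B i j hf => ?_⟩
  have := (h _ _ _ _ (sphBound_sphCoord k i) (hf.2.1 j)).sub
    (h _ _ _ _ (sphBound_sphCoord k j) (hf.2.1 i))
  exact this.le_bound (by linarith)

lemma CkBound.geodDeriv [NeZero d] (k : ℕ) : ∃ C : ℝ, 0 ≤ C ∧ ∀ (f : CInf d) (B : ℝ),
    CkBound (k + 1) f B → CkBound k (TorusFlow.geodDeriv f) (C * B) := by
  obtain ⟨C, hC, h⟩ := CkBound.sphMul (d := d) k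
  refine ⟨d * C, by positivity, fun f B hf => ?_⟩
  rw [geodDeriv_eq_sum]
  have := CkBound.sum Finset.univ fun j _ => h _ _ _ _ (sphBound_sphCoord k j) (hf.2.1 j)
  exact this.le_bound (by simp; linarith)

lemma CkBound.flowPull [NeZero d] (k : ℕ) : ∃ C : ℝ, 0 ≤ C ∧ ∀ (t : ℝ) (f : CInf d) (B : ℝ),
    CkBound k f B → CkBound k (TorusFlow.flowPull t f) (C * (1 + |t|) ^ k * B) := by
  induction k with
  | zero => exact ⟨1, zero_le_one, fun t f B hf p => by
      rw [pow_zero, one_mul, one_mul]; exact hf (flow t p)⟩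
  | succ k ih =>
    obtain ⟨C, hC, h⟩ := ih
    obtain ⟨D, hD, hm⟩ := CkBound.mixDeriv (d := d) k
    refine ⟨1 + C + C * D, by positivity, fun t f B hf => ?_⟩
    have hB := hf.nonneg
    have h1 : (1 : ℝ) ≤ (1 + |t|) := by have := abs_nonneg t; linarith
    have h2 : (1 : ℝ) ≤ (1 + |t|) ^ k := one_le_pow₀ h1
    have h3 : (1 + |t|) ^ k ≤ (1 + |t|) ^ (k + 1) := pow_le_pow_right₀ h1 (by omega)
    have h4 : |t| * (1 + |t|) ^ k ≤ (1 + |t|) ^ (k + 1) := by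
      rw [pow_succ, mul_comm ((1 + |t|) ^ k)]
      exact mul_le_mul_of_nonneg_right (by linarith) (by positivity)
    have h5 : (1 : ℝ) ≤ (1 + |t|) ^ (k + 1) := h2.trans h3
    set P := (1 + |t|) ^ (k + 1)
    have hPB : B ≤ P * B := le_mul_of_one_le_left hB h5
    have hCP : C * (1 + |t|) ^ k * B ≤ C * P * B := by gcongr
    have hCDP : 0 ≤ C * D * P * B := by positivity
    have hCP0 : 0 ≤ C * P * B := by positivity
    refine ⟨fun p => (hf.1 (flow t p)).trans ?_, fun j => ?_, fun i j => ?_⟩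
    · nlinarith
    · rw [transDeriv_flowPull]
      exact (h t _ _ (hf.2.1 j)).le_bound (by nlinarith)
    · rw [rotDeriv_flowPull]
      refine ((h t _ _ (hf.2.2 i j)).add ((h t _ _ (hm _ _ i j hf)).smul (t : ℂ))).le_bound ?_
      rw [norm_real, norm_eq_abs]
      have : |t| * (C * (1 + |t|) ^ k * (D * B)) ≤ C * D * P * B := by
        calc _ = C * D * B * (|t| * (1 + |t|) ^ k) := by ring
          _ ≤ C * D * B * P := by gcongr
          _ = _ := by ring
      nlinarith

lemma norm_flow_sub_le {f : CInf d} {B : ℝ} (hB : ∀ p, ‖(TorusFlow.geodDeriv f).1 p‖ ≤ B) (t : ℝ)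
    (p : ST d) : ‖f.1 (flow t p) - f.1 p‖ ≤ B * |t| := by
  have h := (convex_univ (𝕜 := ℝ) (E := ℝ)).norm_image_sub_le_of_norm_hasDerivWithin_le
    (f := fun t => f.1 (flow t p)) (fun s _ => (hasDerivAt_flow f p s).hasDerivWithinAt)
    (fun s _ => hB _) (mem_univ 0) (mem_univ t)
  simpa [flow_zero] using h

lemma CkBound.flowPull_sub [NeZero d] (k : ℕ) : ∃ C : ℝ, 0 ≤ C ∧ ∀ (t : ℝ) (f : CInf d) (B : ℝ),
    |t| ≤ 1 → CkBound (k + 1) f B → CkBound k (TorusFlow.flowPull t f - f) (C * |t| * B) := by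
  obtain ⟨G, hG, hg⟩ := CkBound.geodDeriv (d := d) 0
  have h0 : ∀ (t : ℝ) (f : CInf d) (B : ℝ), CkBound 1 f B →
      ∀ p, ‖(TorusFlow.flowPull t f - f).1 p‖ ≤ G * |t| * B := fun t f B hf p =>
    (norm_flow_sub_le (hg f B hf) t p).trans (by linarith)
  induction k with
  | zero => exact ⟨G, hG, fun t f B _ hf => h0 t f B hf⟩
  | succ k ih =>
    obtain ⟨C, hC, h⟩ := ih
    obtain ⟨D, hD, hm⟩ := CkBound.mixDeriv (d := d) k
    obtain ⟨F, hF, hfl⟩ := CkBound.flowPull (d := d) k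
    refine ⟨G + C + F * 2 ^ k * D, by positivity, fun t f B ht hf => ?_⟩
    have hB := hf.nonneg
    have p1 : 0 ≤ G * |t| * B := by positivity
    have p2 : 0 ≤ C * |t| * B := by positivity
    have p3 : 0 ≤ F * 2 ^ k * D * |t| * B := by positivity
    refine ⟨fun p => (h0 t f B (hf.mono (by omega)) p).trans (by linarith), fun j => ?_,
      fun i j => ?_⟩
    · rw [map_sub, transDeriv_flowPull]
      exact (h t _ _ ht (hf.2.1 j)).le_bound (by linarith)
    · rw [map_sub, rotDeriv_flowPull, add_sub_right_comm]
      refine ((h t _ _ ht (hf.2.2 i j)).add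
        ((hfl t _ _ (hm _ _ i j hf.of_succ)).smul (t : ℂ))).le_bound ?_
      rw [norm_real, norm_eq_abs]
      have : |t| * (F * (1 + |t|) ^ k * (D * B)) ≤ F * 2 ^ k * D * |t| * B := by
        calc _ = F * D * |t| * B * (1 + |t|) ^ k := by ring
          _ ≤ F * D * |t| * B * 2 ^ k := by gcongr; linarith
          _ = _ := by ring
      linarith

lemma CkBound.flowPull_taylor [NeZero d] (k : ℕ) : ∃ C : ℝ, 0 ≤ C ∧ ∀ (t : ℝ) (f : CInf d) (B : ℝ),
    |t| ≤ 1 → CkBound (k + 2) f B →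
    CkBound k (TorusFlow.flowPull t f - f - (t : ℂ) • TorusFlow.geodDeriv f) (C * t ^ 2 * B) := by
  obtain ⟨G, hG, hg⟩ := CkBound.geodDeriv (d := d) 1
  obtain ⟨G', hG', hg'⟩ := CkBound.geodDeriv (d := d) 0
  have h0 : ∀ (t : ℝ) (f : CInf d) (B : ℝ), CkBound 2 f B →
      ∀ p, ‖(TorusFlow.flowPull t f - f - (t : ℂ) • TorusFlow.geodDeriv f).1 p‖ ≤
        G' * G * t ^ 2 * B := fun t f B hf p => by
    have h1 : ∀ s ∈ Icc (-|t|) |t|, ‖(TorusFlow.geodDeriv f).1 (flow s p) -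
        (TorusFlow.geodDeriv f).1 p‖ ≤ G' * G * B * |t| := fun s hs => by
      refine (norm_flow_sub_le (hg' _ _ (hg f B hf)) s p).trans ?_
      have hB : 0 ≤ B := hf.nonneg
      calc G' * (G * B) * |s| = G' * G * B * |s| := by ring
        _ ≤ G' * G * B * |t| := by exact mul_le_mul_of_nonneg_left (abs_le.2 hs) (by positivity)
    have h := (convex_Icc (-|t|) |t|).norm_image_sub_le_of_norm_hasDerivWithin_le
      (f := fun s : ℝ => f.1 (flow s p) - s • (TorusFlow.geodDeriv f).1 p)
      (f' := fun s : ℝ => (TorusFlow.geodDeriv f).1 (flow s p) - (TorusFlow.geodDeriv f).1 p)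
      (fun s _ => ((hasDerivAt_flow f p s).sub
        (by simpa using (hasDerivAt_id s).smul_const ((TorusFlow.geodDeriv f).1 p))).hasDerivWithinAt)
      h1 (x := 0) (y := t) (by simp) ⟨neg_abs_le t, le_abs_self t⟩
    simp only [flow_zero, zero_smul, sub_zero, norm_eq_abs] at h
    have h3 : G' * G * B * |t| * |t| = G' * G * t ^ 2 * B := by
      rw [mul_assoc (G' * G * B), abs_mul_abs_self]; ring
    rw [← h3]
    refine le_trans (le_of_eq (congrArg norm ?_)) h
    simp only [CInf.sub_apply, CInf.smul_apply, flowPull_apply, Complex.real_smul]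
    ring
  induction k with
  | zero => exact ⟨G' * G, by positivity, fun t f B _ hf => h0 t f B hf⟩
  | succ k ih =>
    obtain ⟨C, hC, h⟩ := ih
    obtain ⟨D, hD, hm⟩ := CkBound.mixDeriv (d := d) (k + 1)
    obtain ⟨F, hF, hfl⟩ := CkBound.flowPull_sub (d := d) k
    refine ⟨G' * G + C + F * D, by positivity, fun t f B ht hf => ?_⟩
    have hB := hf.nonneg
    have p1 : 0 ≤ G' * G * t ^ 2 * B := by positivity
    have p2 : 0 ≤ C * t ^ 2 * B := by positivity
    have p3 : 0 ≤ F * D * t ^ 2 * B := by positivity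
    refine ⟨fun p => (h0 t f B (hf.mono (by omega)) p).trans (by linarith), fun j => ?_,
      fun i j => ?_⟩
    · have hc : transDeriv j (TorusFlow.geodDeriv f) = TorusFlow.geodDeriv (transDeriv j f) := by
        rw [geodDeriv_eq_sum, geodDeriv_eq_sum, map_sum]
        refine sum_congr rfl fun l _ => ?_
        rw [transDeriv_sphMul, transDeriv_comm]
      rw [map_sub, map_sub, map_smul, transDeriv_flowPull, hc]
      exact (h t _ _ ht (hf.2.1 j)).le_bound (by linarith)
    · have he : rotDeriv i j (TorusFlow.flowPull t f - f - (t : ℂ) • TorusFlow.geodDeriv f) =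
          (TorusFlow.flowPull t (rotDeriv i j f) - rotDeriv i j f -
            (t : ℂ) • TorusFlow.geodDeriv (rotDeriv i j f)) +
          (t : ℂ) • (TorusFlow.flowPull t (TorusFlow.mixDeriv i j f) - TorusFlow.mixDeriv i j f) := by
        rw [map_sub, map_sub, map_smul, rotDeriv_flowPull, rotDeriv_geodDeriv, smul_add, smul_sub]
        abel
      rw [he]
      refine ((h t _ _ ht (hf.2.2 i j)).add
        ((hfl t _ _ ht (hm _ _ i j (hf.mono (by omega)))).smul (t : ℂ))).le_bound ?_
      rw [norm_real, norm_eq_abs]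
      have : |t| * (F * |t| * (D * B)) = F * D * t ^ 2 * B := by
        rw [← sq_abs t]; ring
      linarith

/-! ### Flow integrals of distributions -/

lemma DistST.exists_bound [NeZero d] (u : DistST d) : ∃ (k : ℕ) (C : ℝ), 0 ≤ C ∧
    ∀ φ B, CkBound k φ B → ‖u.1 φ‖ ≤ C * B := by
  obtain ⟨k, C, h⟩ := u.2
  refine ⟨k, |C|, abs_nonneg C, fun φ B hB => (h φ B hB).trans ?_⟩
  exact mul_le_mul_of_nonneg_right (le_abs_self C) hB.nonneg

lemma hasDerivAt_dist_flowPull [NeZero d] (u : DistST d) (φ : CInf d) (t : ℝ) :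
    HasDerivAt (fun t => u.1 (flowPull t φ)) (u.1 (flowPull t (geodDeriv φ))) t := by
  obtain ⟨k, C, hC, hu⟩ := DistST.exists_bound u
  obtain ⟨D, hD, ht⟩ := CkBound.flowPull_taylor (d := d) k
  obtain ⟨B, hB0, hB⟩ := CkBound.exists (k + 2) (flowPull t φ)
  rw [hasDerivAt_iff_isLittleO_nhds_zero]
  have hO : (fun h : ℝ => u.1 (flowPull (t + h) φ) - u.1 (flowPull t φ) -
      h • u.1 (flowPull t (geodDeriv φ))) =O[𝓝 0] fun h : ℝ => h ^ 2 := by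
    refine Asymptotics.IsBigO.of_bound (C * D * B) ?_
    filter_upwards [Metric.ball_mem_nhds (0 : ℝ) one_pos] with h hh
    have hh' : |h| ≤ 1 := by simpa using (mem_ball_zero_iff.1 hh).le
    have h1 := hu _ _ (ht h _ _ hh' hB)
    rw [map_sub, map_sub, map_smul, flowPull_flowPull, geodDeriv_flowPull, add_comm h t,
      smul_eq_mul] at h1
    rw [Complex.real_smul, norm_of_nonneg (sq_nonneg h)]
    linarith
  exact hO.trans_isLittleO (Asymptotics.isLittleO_pow_id one_lt_two)

lemma continuous_dist_flowPull [NeZero d] (u : DistST d) (φ : CInf d) :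
    Continuous fun t => u.1 (flowPull t φ) :=
  continuous_iff_continuousAt.2 fun t => (hasDerivAt_dist_flowPull u φ t).continuousAt

/-- Amplitudes that decay faster than every power of `t`, in the mean. -/
def IsRapid (a : ℝ → ℂ) : Prop :=
  ∀ k : ℕ, IntegrableOn (fun t : ℝ => a t * ((1 + t : ℝ) : ℂ) ^ k) (Ioi 0)

lemma norm_dist_flowPull_le [NeZero d] (u : DistST d) : ∃ (k : ℕ) (C : ℝ), 0 ≤ C ∧
    ∀ φ B, CkBound k φ B → ∀ t, 0 ≤ t → ‖u.1 (flowPull t φ)‖ ≤ C * B * (1 + t) ^ k := by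
  obtain ⟨k, C, hC, hu⟩ := DistST.exists_bound u
  obtain ⟨D, hD, ht⟩ := CkBound.flowPull (d := d) k
  refine ⟨k, C * D, by positivity, fun φ B hB t ht0 => (hu _ _ (ht t φ B hB)).trans (le_of_eq ?_)⟩
  rw [abs_of_nonneg ht0]; ring

lemma norm_rapid {a : ℝ → ℂ} {k : ℕ} {t : ℝ} (ht : 0 ≤ t) :
    ‖a t * ((1 + t : ℝ) : ℂ) ^ k‖ = ‖a t‖ * (1 + t) ^ k := by
  rw [norm_mul, norm_pow, norm_real, norm_of_nonneg (by linarith)]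

lemma IsRapid.integrableOn {a : ℝ → ℂ} (ha : IsRapid a) : IntegrableOn a (Ioi 0) := by
  simpa using ha 0

lemma IsRapid.integrableOn_flow [NeZero d] {a : ℝ → ℂ} (ha : IsRapid a) (u : DistST d)
    (φ : CInf d) : IntegrableOn (fun t : ℝ => a t * u.1 (flowPull t φ)) (Ioi 0) := by
  obtain ⟨k, C, hC, hu⟩ := norm_dist_flowPull_le u
  obtain ⟨B, hB0, hB⟩ := CkBound.exists k φ
  refine Integrable.mono' ((ha k).norm.const_mul (C * B)) ?_ ?_
  · exact ha.integrableOn.aestronglyMeasurable.mul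
      (continuous_dist_flowPull u φ).aestronglyMeasurable
  · refine (ae_restrict_iff' measurableSet_Ioi).2 (.of_forall fun t ht => ?_)
    have ht' : (0 : ℝ) ≤ t := le_of_lt ht
    rw [norm_rapid ht', norm_mul]
    calc ‖a t‖ * ‖u.1 (flowPull t φ)‖ ≤ ‖a t‖ * (C * B * (1 + t) ^ k) := by
          gcongr; exact hu φ B hB t ht'
      _ = C * B * (‖a t‖ * (1 + t) ^ k) := by ring

/-- The operator `u ↦ ∫_0^∞ a(t) e^{-tV*} u dt` on distributions. -/
def flowOp [NeZero d] {a : ℝ → ℂ} (ha : IsRapid a) : DistST d →ₗ[ℂ] DistST d where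
  toFun u := ⟨{ toFun := fun φ => ∫ t in Ioi (0 : ℝ), a t * u.1 (flowPull t φ)
                map_add' := fun φ ψ => by
                  rw [← integral_add (ha.integrableOn_flow u φ) (ha.integrableOn_flow u ψ)]
                  simp only [map_add, mul_add]
                map_smul' := fun c φ => by
                  rw [RingHom.id_apply, smul_eq_mul, ← integral_const_mul]
                  simp only [map_smul, smul_eq_mul, mul_left_comm] }, by
    obtain ⟨k, C, hC, hu⟩ := norm_dist_flowPull_le u
    refine ⟨k, C * ∫ t in Ioi (0 : ℝ), ‖a t * ((1 + t : ℝ) : ℂ) ^ k‖, fun φ B hB => ?_⟩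
    rw [mul_right_comm, ← integral_const_mul]
    refine norm_integral_le_of_norm_le ((ha k).norm.const_mul (C * B))
      ((ae_restrict_iff' measurableSet_Ioi).2 (.of_forall fun t ht => ?_))
    have ht' : (0 : ℝ) ≤ t := le_of_lt ht
    rw [norm_rapid ht', norm_mul]
    calc ‖a t‖ * ‖u.1 (flowPull t φ)‖ ≤ ‖a t‖ * (C * B * (1 + t) ^ k) := by
          gcongr; exact hu φ B hB t ht'
      _ = C * B * (‖a t‖ * (1 + t) ^ k) := by ring⟩
  map_add' u v := Subtype.ext (LinearMap.ext fun φ => by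
    change ∫ t in Ioi (0 : ℝ), a t * (u.1 (flowPull t φ) + v.1 (flowPull t φ)) = _
    simp only [mul_add]
    exact integral_add (ha.integrableOn_flow u φ) (ha.integrableOn_flow v φ))
  map_smul' c u := Subtype.ext (LinearMap.ext fun φ => by
    change ∫ t in Ioi (0 : ℝ), a t * (c * u.1 (flowPull t φ)) =
      c * ∫ t in Ioi (0 : ℝ), a t * u.1 (flowPull t φ)
    rw [← integral_const_mul]
    simp only [mul_left_comm])

lemma flowOp_apply [NeZero d] {a : ℝ → ℂ} (ha : IsRapid a) (u : DistST d) (φ : CInf d) :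
    (flowOp ha u).1 φ = ∫ t in Ioi (0 : ℝ), a t * u.1 (flowPull t φ) := rfl

lemma isFlowIntegral_flowOp [NeZero d] {a : ℝ → ℂ} (ha : IsRapid a) (u : DistST d) :
    IsFlowIntegral a u (flowOp ha u) :=
  fun φ => ⟨ha.integrableOn_flow u φ, rfl⟩

lemma tendsto_one_add_pow_mul_exp (k : ℕ) {c : ℝ} (hc : 0 < c) :
    Tendsto (fun t : ℝ => (1 + t) ^ k * Real.exp (-c * t)) atTop (𝓝 0) := by
  have h1 : Tendsto (fun x : ℝ => Real.exp c * (x ^ k * Real.exp (-c * x))) atTop (𝓝 0) := by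
    have := (Real.tendsto_pow_mul_exp_neg_atTop_nhds_zero k).comp
      (tendsto_id.const_mul_atTop hc)
    have := (this.const_mul (Real.exp c * (c ^ k)⁻¹))
    rw [mul_zero] at this
    refine this.congr fun x => ?_
    simp only [Function.comp_apply, id_eq, mul_pow]
    field_simp
  have h2 := h1.comp (tendsto_atTop_add_const_left atTop (1 : ℝ) tendsto_id)
  refine h2.congr fun t => ?_
  simp only [Function.comp_apply, id_eq]
  rw [mul_left_comm, ← Real.exp_add]
  congr 2; ring

lemma isRapid_exp {s : ℂ} (hs : 0 < s.re) : IsRapid fun t : ℝ => exp (-s * t) := by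
  intro k
  have hcont : Continuous fun t : ℝ => exp (-s * t) * ((1 + t : ℝ) : ℂ) ^ k := by fun_prop
  have h0 : IntegrableOn (fun t : ℝ => (1 + t) ^ k * Real.exp (-s.re * t)) (Ioi 0) := by
    refine integrable_of_isBigO_exp_neg (a := 0) (b := s.re / 2) (half_pos hs)
      (by fun_prop) ?_
    have h1 := tendsto_one_add_pow_mul_exp k (half_pos hs)
    refine Asymptotics.IsBigO.of_bound 1 ?_
    filter_upwards [h1.eventually (gt_mem_nhds one_pos), eventually_ge_atTop 0] with t ht ht0
    rw [norm_of_nonneg (Real.exp_pos _).le, one_mul, norm_of_nonneg (by positivity)]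
    have h2 : -s.re * t = -(s.re / 2) * t + -(s.re / 2) * t := by ring
    rw [h2, Real.exp_add, ← mul_assoc]
    exact mul_le_of_le_one_left (Real.exp_pos _).le ht.le
  refine Integrable.mono' h0 hcont.aestronglyMeasurable
    ((ae_restrict_iff' measurableSet_Ioi).2 (.of_forall fun t ht => ?_))
  have ht' : (0 : ℝ) ≤ t := le_of_lt ht
  rw [norm_rapid (a := fun t : ℝ => exp (-s * t)) ht', Complex.norm_exp, mul_comm]
  simp

lemma isRapid_of_support {a : ℝ → ℂ} (ha : ContinuousOn a (Ici 0)) {R : ℝ}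
    (h : ∀ t, R ≤ t → a t = 0) : IsRapid a := by
  intro k
  have h1 : ContinuousOn (fun t : ℝ => a t * ((1 + t : ℝ) : ℂ) ^ k) (Ici 0) :=
    ha.mul (by fun_prop)
  have h2 : IntegrableOn (fun t : ℝ => a t * ((1 + t : ℝ) : ℂ) ^ k) (Icc 0 R) :=
    (h1.mono Icc_subset_Ici_self).integrableOn_Icc
  refine (integrableOn_union.2 ⟨h2, (integrableOn_zero (s := Ioi R)).congr_fun (fun t ht => ?_)
    measurableSet_Ioi⟩).mono_set fun t ht => ?_
  · simp [h t (le_of_lt ht)]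
  · rcases le_or_gt t R with h | h
    · exact Or.inl ⟨le_of_lt ht, h⟩
    · exact Or.inr h

lemma IsRapid.sub {a b : ℝ → ℂ} (ha : IsRapid a) (hb : IsRapid b) : IsRapid fun t => a t - b t := by
  intro k
  simp only [sub_mul]
  exact (ha k).sub (hb k)

lemma tendsto_exp_mul_dist_flowPull [NeZero d] {s : ℂ} (hs : 0 < s.re) (u : DistST d) (φ : CInf d) :
    Tendsto (fun t : ℝ => exp (-s * t) * u.1 (flowPull t φ)) atTop (𝓝 0) := by
  obtain ⟨k, C, hC, hu⟩ := norm_dist_flowPull_le u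
  obtain ⟨B, hB0, hB⟩ := CkBound.exists k φ
  have h1 := (tendsto_one_add_pow_mul_exp k hs).const_mul (C * B)
  rw [mul_zero] at h1
  refine squeeze_zero_norm' ?_ h1
  filter_upwards [eventually_ge_atTop 0] with t ht
  rw [norm_mul, Complex.norm_exp]
  have h2 : (-s * (t : ℂ)).re = -s.re * t := by simp
  rw [h2]
  calc _ ≤ Real.exp (-s.re * t) * (C * B * (1 + t) ^ k) := by gcongr; exact hu φ B hB t ht
    _ = _ := by ring

lemma hasDerivAt_exp_mul_dist_flowPull [NeZero d] (s : ℂ) (u : DistST d) (φ : CInf d) (t : ℝ) :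
    HasDerivAt (fun t : ℝ => exp (-s * t) * u.1 (flowPull t φ))
      (-(exp (-s * t) * u.1 (flowPull t (s • φ - geodDeriv φ)))) t := by
  have h1 : HasDerivAt (fun t : ℝ => exp (-s * t)) (exp (-s * t) * (-s)) t := by
    have := ((Complex.ofRealCLM.hasDerivAt (x := t)).const_mul (-s)).cexp
    simpa using this
  refine (h1.mul (hasDerivAt_dist_flowPull u φ t)).congr_deriv ?_
  simp only [map_sub, map_smul, smul_eq_mul]
  ring

lemma solvesTransport_iff [NeZero d] {s : ℂ} (hs : 0 < s.re) (u w : DistST d) :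
    SolvesTransport s u w ↔ w = flowOp (isRapid_exp hs) u := by
  have key : ∀ φ, ∫ t in Ioi (0 : ℝ), exp (-s * t) *
      u.1 (flowPull t (s • φ - geodDeriv φ)) = u.1 φ := fun φ => by
    have h := integral_Ioi_of_hasDerivAt_of_tendsto'
      (f := fun t : ℝ => -(exp (-s * t) * u.1 (flowPull t φ))) (a := 0) (m := -0)
      (fun t _ => (hasDerivAt_exp_mul_dist_flowPull s u φ t).neg)
      (by simpa using (isRapid_exp hs).integrableOn_flow u (s • φ - geodDeriv φ))
      (tendsto_exp_mul_dist_flowPull hs u φ).neg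
    simpa [flowPull_zero] using h
  constructor
  · intro hw
    refine Subtype.ext (LinearMap.ext fun φ => ?_)
    have h := integral_Ioi_of_hasDerivAt_of_tendsto'
      (f := fun t : ℝ => -(exp (-s * t) * w.1 (flowPull t φ))) (a := 0) (m := -0)
      (fun t _ => (hasDerivAt_exp_mul_dist_flowPull s w φ t).neg)
      (by simpa using (isRapid_exp hs).integrableOn_flow w (s • φ - geodDeriv φ))
      (tendsto_exp_mul_dist_flowPull hs w φ).neg
    rw [flowOp_apply]
    have h2 : ∀ t, w.1 (flowPull t (s • φ - geodDeriv φ)) = u.1 (flowPull t φ) := fun t => by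
      rw [map_sub, map_smul, ← geodDeriv_flowPull]
      exact hw (flowPull t φ)
    simp only [h2] at h
    simpa [flowPull_zero] using h.symm
  · rintro rfl φ
    exact key φ


variable {d : ℕ}

/-! ### Smoothness of parametric integrals -/

section Param

variable {α : Type*} [MeasurableSpace α] {μ : Measure α} [IsFiniteMeasure μ] {s : α → Euc d}

lemma hasFDerivAt_integral_param {E : Type} [NormedAddCommGroup E] [NormedSpace ℝ E]
    (hs : Measurable s) {R : ℝ} (hR : ∀ y, ‖s y‖ ≤ R) {g : Euc d × Euc d → E}
    (hg : ContDiff ℝ ∞ g) (v : Euc d) :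
    HasFDerivAt (fun v => ∫ y, g (s y, v) ∂μ)
      (∫ y, (fderiv ℝ g (s y, v)).comp (ContinuousLinearMap.inr ℝ (Euc d) (Euc d)) ∂μ) v := by
  have hd : ContDiff ℝ ∞ (fderiv ℝ g) := hg.fderiv_right (by simp)
  have hd' : Continuous fun p : Euc d × Euc d =>
      (fderiv ℝ g p).comp (ContinuousLinearMap.inr ℝ (Euc d) (Euc d)) :=
    hd.continuous.clm_comp continuous_const
  have hK : IsCompact (Metric.closedBall (0 : Euc d) R ×ˢ Metric.closedBall v 1) :=
    (isCompact_closedBall _ _).prod (isCompact_closedBall _ _)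
  obtain ⟨C, hC⟩ := hK.exists_bound_of_continuousOn hd'.continuousOn
  obtain ⟨C', hC'⟩ := hK.exists_bound_of_continuousOn hg.continuous.continuousOn
  have hmem : ∀ y, ∀ w ∈ Metric.ball v 1,
      (s y, w) ∈ Metric.closedBall (0 : Euc d) R ×ˢ Metric.closedBall v 1 := fun y w hw =>
    ⟨by simpa using hR y, Metric.ball_subset_closedBall hw⟩
  have hmeas : ∀ {F : Type} [NormedAddCommGroup F] {k : Euc d × Euc d → F} (w : Euc d),
      Continuous k → AEStronglyMeasurable (fun y => k (s y, w)) μ := by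
    intro F _ k w hk
    have h1 : Continuous fun x : Euc d => k (x, w) := hk.comp (by fun_prop)
    exact (h1.stronglyMeasurable.comp_measurable hs).aestronglyMeasurable
  refine hasFDerivAt_integral_of_dominated_of_fderiv_le (bound := fun _ => C)
    (Metric.ball_mem_nhds v one_pos) (.of_forall fun w => hmeas w hg.continuous)
    (Integrable.mono' (integrable_const C') (hmeas v hg.continuous)
      (.of_forall fun y => hC' _ (hmem y v (Metric.mem_ball_self one_pos))))
    (hmeas v hd') (.of_forall fun y w hw => hC _ (hmem y w hw)) (integrable_const C)
    (.of_forall fun y w _ => ?_)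
  have h1 : HasFDerivAt (fun w : Euc d => (s y, w)) (ContinuousLinearMap.inr ℝ (Euc d) (Euc d)) w :=
    (hasFDerivAt_const _ _).prodMk (hasFDerivAt_id _)
  exact ((hg.differentiable (by simp) (s y, w)).hasFDerivAt).comp w h1

lemma contDiff_integral_param (hs : Measurable s) {R : ℝ} (hR : ∀ y, ‖s y‖ ≤ R) (n : ℕ)
    {E : Type} [NormedAddCommGroup E] [NormedSpace ℝ E] {g : Euc d × Euc d → E}
    (hg : ContDiff ℝ ∞ g) : ContDiff ℝ n (fun v => ∫ y, g (s y, v) ∂μ) := by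
  induction n generalizing E with
  | zero =>
    exact contDiff_zero.2 (continuous_iff_continuousAt.2 fun v =>
      (hasFDerivAt_integral_param hs hR hg v).continuousAt)
  | succ n ih =>
    have h1 := hasFDerivAt_integral_param (μ := μ) hs hR hg
    push_cast
    refine contDiff_succ_iff_fderiv.2 ⟨fun v => (h1 v).differentiableAt, fun h => ?_, ?_⟩
    · exact absurd h (by simp)
    · have h2 : fderiv ℝ (fun v => ∫ y, g (s y, v) ∂μ) = fun v => ∫ y,
          (fderiv ℝ g (s y, v)).comp (ContinuousLinearMap.inr ℝ (Euc d) (Euc d)) ∂μ :=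
        funext fun v => (h1 v).fderiv
      rw [h2]
      exact ih (g := fun p => (fderiv ℝ g p).comp (ContinuousLinearMap.inr ℝ (Euc d) (Euc d)))
        ((hg.fderiv_right (by simp)).clm_comp contDiff_const)

end Param

/-! ### Fourier coefficients of smooth functions -/

/-- A bounded measurable section of the projection `ℝ^d → 𝕋^d`. -/
def torusSec (y : Torus d) : Euc d :=
  WithLp.toLp 2 fun i => (AddCircle.equivIoc (2 * π) 0 (y i) : ℝ)

lemma torusMk_torusSec (y : Torus d) : torusMk (torusSec y) = y := by
  funext i
  exact (AddCircle.equivIoc (2 * π) 0).symm_apply_apply (y i)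

lemma measurable_torusSec : Measurable (torusSec : Torus d → Euc d) := by
  refine (PiLp.continuous_toLp 2 _).measurable.comp (measurable_pi_lambda _ fun i => ?_)
  exact measurable_subtype_coe.comp
    ((AddCircle.measurableEquivIoc (2 * π) 0).measurable.comp (measurable_pi_apply i))

lemma norm_torusSec_le (y : Torus d) : ‖torusSec y‖ ≤ √(d * (2 * π) ^ 2) := by
  rw [EuclideanSpace.norm_eq]
  refine sqrt_le_sqrt ?_
  calc _ ≤ ∑ i : Fin d, (2 * π) ^ 2 := sum_le_sum fun i _ => ?_
    _ = _ := by simp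
  have h := (AddCircle.equivIoc (2 * π) 0 (y i)).2
  refine pow_le_pow_left₀ (norm_nonneg _) ?_ 2
  rw [norm_eq_abs]
  change |(AddCircle.equivIoc (2 * π) 0 (y i) : ℝ)| ≤ _
  rw [abs_of_pos h.1]
  simpa using h.2

lemma torusMean_lift {f : CInf d} {g : Euc d × Euc d → ℂ}
    (h : ∀ (x : Euc d) (θ : Sph d), f.1 (torusMk x, θ) = g (x, (θ : Euc d))) (θ : Sph d) :
    ∫ y : Torus d, f.1 (y, θ) = ∫ y : Torus d, g (torusSec y, (θ : Euc d)) := by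
  congr 1; funext y
  rw [← h, torusMk_torusSec]

lemma integrable_slice (f : CInf d) (θ : Sph d) : Integrable (fun y : Torus d => f.1 (y, θ)) :=
  ((CInf.continuous f).comp (by fun_prop : Continuous fun y : Torus d => (y, θ))
    ).integrable_of_hasCompactSupport (HasCompactSupport.of_compactSpace _)

/-- The integral over the torus of a smooth function on `S𝕋^d`. -/
def torusInt : CInf d →ₗ[ℂ] CInfSph d where
  toFun f := ⟨fun θ => ∫ y : Torus d, f.1 (y, θ), by
    obtain ⟨g, hg, h⟩ := f.2
    exact ⟨fun v => ∫ y : Torus d, g (torusSec y, v), contDiff_infty.2 fun n =>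
      contDiff_integral_param measurable_torusSec norm_torusSec_le n hg, torusMean_lift h⟩⟩
  map_add' f f' := ext' fun θ => integral_add (integrable_slice f θ) (integrable_slice f' θ)
  map_smul' c f := ext' fun θ => integral_const_mul c _

lemma torusInt_apply (f : CInf d) (θ : Sph d) : (torusInt f).1 θ = ∫ y : Torus d, f.1 (y, θ) := rfl

lemma torusInt_rotDeriv (i j : Fin d) (f : CInf d) :
    torusInt (rotDeriv i j f) = rotDerivSph i j (torusInt f) := by
  obtain ⟨g, hg, h⟩ := f.2
  refine ext' fun θ => ?_
  rw [rotDerivSph_eq_fderiv (f := torusInt f) (g := fun v => ∫ y : Torus d, g (torusSec y, v))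
    (contDiff_infty.2 fun n => contDiff_integral_param measurable_torusSec norm_torusSec_le n hg)
    (torusMean_lift h), (hasFDerivAt_integral_param measurable_torusSec norm_torusSec_le hg _).fderiv,
    torusInt_apply, ContinuousLinearMap.integral_apply]
  · congr 1; funext y
    have := rotDeriv_lift hg h i j (torusSec y) θ
    rw [torusMk_torusSec] at this
    simpa using this
  · have hd' : Continuous fun p : Euc d × Euc d =>
      (fderiv ℝ g p).comp (ContinuousLinearMap.inr ℝ (Euc d) (Euc d)) :=
      (hg.continuous_fderiv (by simp)).clm_comp continuous_const
    obtain ⟨C, hC⟩ := ((isCompact_closedBall (0 : Euc d) (√(d * (2 * π) ^ 2))).prod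
      (isCompact_singleton (x := (θ : Euc d)))).exists_bound_of_continuousOn hd'.continuousOn
    have h1 : Continuous fun x : Euc d => (fderiv ℝ g (x, (θ : Euc d))).comp
      (ContinuousLinearMap.inr ℝ (Euc d) (Euc d)) := hd'.comp (by fun_prop)
    exact Integrable.mono' (integrable_const C)
      (h1.stronglyMeasurable.comp_measurable measurable_torusSec).aestronglyMeasurable
      (.of_forall fun y => hC (torusSec y, (θ : Euc d)) ⟨by simpa using norm_torusSec_le y, rfl⟩)

lemma hasDerivAt_shift_at (f : CInf d) (j : Fin d) (p : ST d) (t : ℝ) : HasDerivAt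
    (fun t : ℝ => f.1 (p.1 + torusMk (t • EuclideanSpace.single j (1 : ℝ)), p.2))
    ((transDeriv j f).1 (p.1 + torusMk (t • EuclideanSpace.single j (1 : ℝ)), p.2)) t := by
  have h := hasDerivAt_transDeriv f j (p.1 + torusMk (t • EuclideanSpace.single j (1 : ℝ)), p.2)
  have h2 := HasDerivAt.comp_sub_const t t (by simpa using h)
  refine h2.congr_of_eventuallyEq (.of_forall fun s => ?_)
  simp only [add_assoc, ← torusMk_add, ← add_smul, add_sub_cancel]

lemma torusInt_transDeriv (j : Fin d) (f : CInf d) : torusInt (transDeriv j f) = 0 := by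
  refine ext' fun θ => ?_
  obtain ⟨B, hB0, hB⟩ := CkBound.exists 0 (transDeriv j f)
  have h1 : HasDerivAt (fun t : ℝ => ∫ y : Torus d,
      f.1 (y + torusMk (t • EuclideanSpace.single j (1 : ℝ)), θ))
      (∫ y : Torus d, (transDeriv j f).1
        (y + torusMk ((0 : ℝ) • EuclideanSpace.single j (1 : ℝ)), θ)) 0 := by
    have hm : ∀ (f : CInf d) (a : Torus d),
        AEStronglyMeasurable (fun y : Torus d => f.1 (y + a, θ)) volume := fun f a =>
      ((CInf.continuous f).comp (by fun_prop : Continuous fun y : Torus d => (y + a, θ))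
        ).aestronglyMeasurable
    refine (hasDerivAt_integral_of_dominated_loc_of_deriv_le (bound := fun _ => B) univ_mem
      (.of_forall fun t => hm f _) ?_ (hm _ _)
      (.of_forall fun y t _ => hB _) (integrable_const B)
      (.of_forall fun y t _ => hasDerivAt_shift_at f j (y, θ) t)).2
    exact (integrable_slice f θ).comp_add_right _
  have h2 : (fun t : ℝ => ∫ y : Torus d,
      f.1 (y + torusMk (t • EuclideanSpace.single j (1 : ℝ)), θ)) = fun _ =>
      ∫ y : Torus d, f.1 (y, θ) :=
    funext fun t => integral_add_right_eq_self (fun y : Torus d => f.1 (y, θ)) _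
  rw [h2] at h1
  have h3 := h1.unique (hasDerivAt_const _ _)
  have h0 : torusMk (0 : Euc d) = 0 := by funext i; simp [torusMk]
  simpa [h0, torusInt_apply] using h3

lemma torusChar_add (ξ η : Fin d → ℤ) (x : Torus d) :
    torusChar (ξ + η) x = torusChar ξ x * torusChar η x := by
  simp [torusChar, Finset.prod_mul_distrib]

lemma torusChar_zero (x : Torus d) : torusChar 0 x = 1 := by simp [torusChar]

@[simp] lemma norm_torusChar (ξ : Fin d → ℤ) (x : Torus d) : ‖torusChar ξ x‖ = 1 := by
  rw [torusChar, norm_prod]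
  exact Finset.prod_eq_one fun i _ => Circle.norm_coe _

lemma torusChar_neg (ξ : Fin d → ℤ) (x : Torus d) :
    torusChar (-ξ) x = (starRingEnd ℂ) (torusChar ξ x) := by
  simp [torusChar]

lemma continuous_torusChar (ξ : Fin d → ℤ) : Continuous (torusChar ξ : Torus d → ℂ) :=
  continuous_finsetProd _ fun i _ => (map_continuous (fourier (ξ i))).comp (continuous_apply i)

lemma torusChar_add_arg (ξ : Fin d → ℤ) (x y : Torus d) :
    torusChar ξ (x + y) = torusChar ξ x * torusChar ξ y := by
  obtain ⟨a, rfl⟩ := torusMk_surjective x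
  obtain ⟨b, rfl⟩ := torusMk_surjective y
  rw [← torusMk_add, torusChar_mk, torusChar_mk, torusChar_mk, ← Complex.exp_add, ← mul_add,
    ← Complex.ofReal_add, ← sum_add_distrib]
  simp [mul_add]

/-- Multiplication by the character `e^{i ξ · x}`. -/
def charMul (ξ : Fin d → ℤ) : CInf d →ₗ[ℂ] CInf d where
  toFun f := ⟨fun p => torusChar ξ p.1 * f.1 p, by
    obtain ⟨g, hg, h⟩ := f.2
    obtain ⟨c, hc, h'⟩ := (charTensor ξ (1 : CInfSph d)).2
    refine ⟨fun p => c p * g p, hc.mul hg, fun x θ => ?_⟩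
    change _ = c (x, (θ : Euc d)) * g (x, (θ : Euc d))
    rw [← h, ← h']
    simp [charTensor]⟩
  map_add' f f' := CInf.ext' fun x θ => by simp [mul_add]
  map_smul' c f := CInf.ext' fun x θ => by simp [mul_left_comm]

@[simp] lemma charMul_apply (ξ : Fin d → ℤ) (f : CInf d) (p : ST d) :
    (charMul ξ f).1 p = torusChar ξ p.1 * f.1 p := rfl

@[simp] lemma charTensor_apply (ξ : Fin d → ℤ) (f : CInfSph d) (p : ST d) :
    (charTensor ξ f).1 p = torusChar ξ p.1 * f.1 p.2 := rfl

lemma rotDeriv_charMul (i j : Fin d) (ξ : Fin d → ℤ) (f : CInf d) :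
    rotDeriv i j (charMul ξ f) = charMul ξ (rotDeriv i j f) :=
  CInf.ext' fun x θ => (hasDerivAt_rotDeriv (charMul ξ f) i j (torusMk x, θ)).unique
    ((hasDerivAt_rotDeriv f i j (torusMk x, θ)).const_mul (torusChar ξ (torusMk x)))

lemma rotDeriv_charTensor (i j : Fin d) (ξ : Fin d → ℤ) (f : CInfSph d) :
    rotDeriv i j (charTensor ξ f) = charTensor ξ (rotDerivSph i j f) :=
  CInf.ext' fun x θ => (hasDerivAt_rotDeriv (charTensor ξ f) i j (torusMk x, θ)).unique
    ((hasDerivAt_sphCurve_apply f i j θ).const_mul (torusChar ξ (torusMk x)))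

lemma hasDerivAt_torusChar (ξ : Fin d → ℤ) (j : Fin d) (x : Torus d) : HasDerivAt
    (fun t : ℝ => torusChar ξ (x + torusMk (t • EuclideanSpace.single j (1 : ℝ))))
    (I * ξ j * torusChar ξ x) 0 := by
  have h : ∀ t : ℝ, torusChar ξ (x + torusMk (t • EuclideanSpace.single j (1 : ℝ))) =
      torusChar ξ x * exp (I * ξ j * t) := fun t => by
    rw [torusChar_add_arg, torusChar_mk]
    congr 2
    simp [mul_assoc]
  simp only [h]
  have h1 := ((Complex.ofRealCLM.hasDerivAt (x := (0 : ℝ))).const_mul (I * ξ j)).cexp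
  have h2 := h1.const_mul (torusChar ξ x)
  simpa [mul_comm, mul_left_comm, mul_assoc] using h2

lemma transDeriv_charMul (j : Fin d) (ξ : Fin d → ℤ) (f : CInf d) :
    transDeriv j (charMul ξ f) = charMul ξ (transDeriv j f) +
      (I * ξ j : ℂ) • charMul ξ f :=
  CInf.ext' fun x θ => (hasDerivAt_transDeriv (charMul ξ f) j (torusMk x, θ)).unique (by
    refine ((hasDerivAt_torusChar ξ j (torusMk x)).mul
      (hasDerivAt_transDeriv f j (torusMk x, θ))).congr_deriv ?_
    have h0 : torusMk (0 : Euc d) = 0 := by funext i; simp [torusMk]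
    simp [h0]; ring)

lemma transDeriv_charTensor (j : Fin d) (ξ : Fin d → ℤ) (f : CInfSph d) :
    transDeriv j (charTensor ξ f) = (I * ξ j : ℂ) • charTensor ξ f :=
  CInf.ext' fun x θ => (hasDerivAt_transDeriv (charTensor ξ f) j (torusMk x, θ)).unique (by
    refine ((hasDerivAt_torusChar ξ j (torusMk x)).mul_const (f.1 θ)).congr_deriv ?_
    simp; ring)

/-- The coefficient `θ ↦ ∫ e^{i ξ · y} f(y, θ) dy`. -/
def fcoef (ξ : Fin d → ℤ) : CInf d →ₗ[ℂ] CInfSph d := torusInt ∘ₗ charMul ξ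

lemma fcoef_apply (ξ : Fin d → ℤ) (f : CInf d) (θ : Sph d) :
    (fcoef ξ f).1 θ = ∫ y : Torus d, torusChar ξ y * f.1 (y, θ) := rfl

lemma fcoef_rotDeriv (ξ : Fin d → ℤ) (i j : Fin d) (f : CInf d) :
    fcoef ξ (rotDeriv i j f) = rotDerivSph i j (fcoef ξ f) := by
  simp only [fcoef, LinearMap.comp_apply, ← rotDeriv_charMul, torusInt_rotDeriv]

lemma fcoef_transDeriv (ξ : Fin d → ℤ) (j : Fin d) (f : CInf d) :
    fcoef ξ (transDeriv j f) = (-(I * ξ j) : ℂ) • fcoef ξ f := by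
  have h := congrArg torusInt (transDeriv_charMul j ξ f)
  rw [torusInt_transDeriv, map_add, map_smul] at h
  refine ext' fun θ => ?_
  have h1 := congrArg (fun F : CInfSph d => F.1 θ) h
  simp only [add_apply, smul_apply, CInfSph.zero_apply] at h1 ⊢
  change (torusInt (charMul ξ (transDeriv j f))).1 θ = _ * (torusInt (charMul ξ f)).1 θ
  linear_combination -h1

lemma volume_torus_real : (volume : Measure (Torus d)).real univ = (2 * π) ^ d := by
  rw [Measure.real, MeasureTheory.volume_pi, Measure.pi_univ]
  simp only [AddCircle.measure_univ, Finset.prod_const, card_univ, Fintype.card_fin]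
  rw [ENNReal.toReal_pow, ENNReal.toReal_ofReal (by positivity)]

lemma sphBound_fcoef (k : ℕ) (ξ : Fin d → ℤ) {f : CInf d} {B : ℝ} (h : CkBound k f B) :
    SphBound k (fcoef ξ f) ((2 * π) ^ d * B) := by
  have h0 : ∀ {f : CInf d}, (∀ p, ‖f.1 p‖ ≤ B) → ∀ θ, ‖(fcoef ξ f).1 θ‖ ≤ (2 * π) ^ d * B := by
    intro f hf θ
    rw [fcoef_apply]
    have := norm_integral_le_of_norm_le_const (μ := (volume : Measure (Torus d)))
      (f := fun y => torusChar ξ y * f.1 (y, θ)) (C := B)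
      (.of_forall fun y => by simpa using hf (y, θ))
    rwa [volume_torus_real, mul_comm B] at this
  induction k generalizing f with
  | zero => exact h0 h
  | succ k ih =>
    exact ⟨h0 h.1, fun i j => by rw [← fcoef_rotDeriv]; exact ih (h.2.2 i j)⟩

/-- The operator `1 - Δ_x`. -/
def oneSubLap : CInf d →ₗ[ℂ] CInf d :=
  LinearMap.id - ∑ j, transDeriv j ∘ₗ transDeriv j

lemma oneSubLap_apply (f : CInf d) : oneSubLap f = f - ∑ j, transDeriv j (transDeriv j f) := by
  simp [oneSubLap]

lemma fcoef_oneSubLap (ξ : Fin d → ℤ) (f : CInf d) :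
    fcoef ξ (oneSubLap f) = ((1 + latSq ξ : ℝ) : ℂ) • fcoef ξ f := by
  rw [oneSubLap_apply, map_sub, map_sum]
  simp only [fcoef_transDeriv, smul_smul]
  rw [← Finset.sum_smul]
  refine ext' fun θ => ?_
  simp only [sub_apply, smul_apply, latSq]
  push_cast
  have : ∀ j, -(I * (ξ j : ℂ)) * -(I * (ξ j : ℂ)) = -((ξ j : ℂ) ^ 2) := fun j => by
    linear_combination ((ξ j : ℂ) ^ 2) * Complex.I_sq
  simp only [this, Finset.sum_neg_distrib]
  ring

lemma CkBound.oneSubLap {k : ℕ} {f : CInf d} {B : ℝ} (h : CkBound (k + 2) f B) :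
    CkBound k (TorusFlow.oneSubLap f) ((1 + d) * B) := by
  rw [oneSubLap_apply]
  have := (h.mono (by omega : k ≤ k + 2)).sub
    (CkBound.sum Finset.univ fun j _ => (h.2.1 j).2.1 j)
  refine this.le_bound (le_of_eq ?_)
  simp; ring

lemma latSq_nonneg (ξ : Fin d → ℤ) : 0 ≤ latSq ξ := sum_nonneg fun _ _ => sq_nonneg _

/-- Decay of the Fourier coefficients of a smooth function. -/
lemma sphBound_fcoef_decay (k m : ℕ) (ξ : Fin d → ℤ) {f : CInf d} {B : ℝ}
    (h : CkBound (k + 2 * m) f B) :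
    SphBound k (fcoef ξ f) ((2 * π) ^ d * (1 + d) ^ m * B * ((1 + latSq ξ) ^ m)⁻¹) := by
  have hpos : 0 < 1 + latSq ξ := by have := latSq_nonneg ξ; linarith
  induction m generalizing f B with
  | zero => simpa using sphBound_fcoef k ξ h
  | succ m ih =>
    have h1 := ih (CkBound.oneSubLap (k := k + 2 * m) h)
    rw [fcoef_oneSubLap] at h1
    have h2 := h1.smul (((1 + latSq ξ : ℝ) : ℂ)⁻¹)
    rw [smul_smul, inv_mul_cancel₀ (by exact_mod_cast hpos.ne'), one_smul] at h2
    refine h2.le_bound (le_of_eq ?_)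
    rw [norm_inv, norm_real, norm_of_nonneg hpos.le]
    have := hpos.ne'
    rw [pow_succ (1 + (d : ℝ)), pow_succ (1 + latSq ξ)]
    field_simp



variable {d : ℕ}

/-! ### Fourier inversion on the torus -/

lemma integral_torusChar (ξ : Fin d → ℤ) :
    ∫ y : Torus d, torusChar ξ y = if ξ = 0 then ((2 * π : ℝ) : ℂ) ^ d else 0 := by
  split_ifs with h
  · subst h
    simp only [torusChar_zero, integral_const, volume_torus_real]
    simp
  · obtain ⟨i, hi⟩ := Function.ne_iff.1 h
    have hi' : (ξ i : ℂ) ≠ 0 := by exact_mod_cast hi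
    have h1 := integral_add_right_eq_self (μ := (volume : Measure (Torus d)))
      (fun y : Torus d => torusChar ξ y)
      (torusMk (EuclideanSpace.single i (π / ξ i)))
    have h2 : torusChar ξ (torusMk (EuclideanSpace.single i (π / ξ i))) = -1 := by
      rw [torusChar_mk, ← Complex.exp_pi_mul_I]
      congr 1
      simp
      field_simp
    simp only [torusChar_add_arg, h2, mul_neg_one, integral_neg] at h1
    exact self_eq_neg.1 h1.symm

/-- The star subalgebra of trigonometric polynomials. -/
def trigPoly (d : ℕ) : StarSubalgebra ℂ C(Torus d, ℂ) where
  carrier := {f | ∃ (s : Finset (Fin d → ℤ)) (c : (Fin d → ℤ) → ℂ),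
    ∀ x, f x = ∑ ξ ∈ s, c ξ * torusChar ξ x}
  mul_mem' := by
    classical
    rintro f g ⟨s, c, hf⟩ ⟨t, b, hg⟩
    refine ⟨(s ×ˢ t).image fun p => p.1 + p.2, fun η =>
      ∑ p ∈ (s ×ˢ t).filter fun p => p.1 + p.2 = η, c p.1 * b p.2, fun x => ?_⟩
    rw [ContinuousMap.mul_apply, hf, hg, Finset.sum_mul_sum, ← Finset.sum_product',
      ← Finset.sum_fiberwise_of_maps_to (t := (s ×ˢ t).image fun p => p.1 + p.2)
        (g := fun p => p.1 + p.2) (fun p hp => Finset.mem_image_of_mem _ hp)]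
    refine sum_congr rfl fun η _ => ?_
    rw [sum_mul]
    refine sum_congr rfl fun p hp => ?_
    rw [← (Finset.mem_filter.1 hp).2, torusChar_add]
    ring
  add_mem' := by
    classical
    rintro f g ⟨s, c, hf⟩ ⟨t, b, hg⟩
    refine ⟨s ∪ t, fun ξ => (if ξ ∈ s then c ξ else 0) + if ξ ∈ t then b ξ else 0, fun x => ?_⟩
    simp only [add_mul, sum_add_distrib, ContinuousMap.add_apply, hf, hg, ite_mul, zero_mul,
      Finset.sum_ite_mem]
    rw [Finset.inter_eq_right.2 Finset.subset_union_left,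
      Finset.inter_eq_right.2 Finset.subset_union_right]
  algebraMap_mem' := fun c => ⟨{0}, fun _ => c, fun x => by simp [torusChar_zero]⟩
  star_mem' := by
    classical
    rintro f ⟨s, c, hf⟩
    refine ⟨s.image Neg.neg, fun ξ => starRingEnd ℂ (c (-ξ)), fun x => ?_⟩
    rw [Finset.sum_image (fun a _ b _ h => neg_injective h)]
    simp [hf, torusChar_neg]

lemma trigPoly_closure (d : ℕ) : (trigPoly d).topologicalClosure = ⊤ := by
  refine ContinuousMap.starSubalgebra_topologicalClosure_eq_top_of_separatesPoints _ ?_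
  intro x y hne
  obtain ⟨i, hi⟩ := Function.ne_iff.1 hne
  refine ⟨_, ⟨⟨torusChar (Pi.single i 1), continuous_torusChar _⟩,
    ⟨{Pi.single i 1}, fun _ => 1, fun x => by simp⟩, rfl⟩, ?_⟩
  have h : ∀ z : Torus d, torusChar (Pi.single i 1) z = (z i).toCircle := fun z => by
    rw [torusChar, Finset.prod_eq_single i]
    · simp
    · intro j _ hj
      simp [Pi.single_eq_of_ne hj]
    · simp
  simp only [ContinuousMap.coe_mk, h]
  intro hc
  exact hi (AddCircle.injective_toCircle Real.two_pi_pos.ne' (Subtype.ext hc))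

lemma eq_zero_of_torus_coef {F : Torus d → ℂ} (hF : Continuous F)
    (h : ∀ ξ, ∫ y : Torus d, torusChar ξ y * F y = 0) : F = 0 := by
  have hint : ∀ {G : Torus d → ℂ}, Continuous G → Integrable G volume := fun hG =>
    hG.integrable_of_hasCompactSupport (HasCompactSupport.of_compactSpace _)
  have h0 : ∀ ε : ℝ, 0 < ε → ‖∫ y : Torus d, (starRingEnd ℂ) (F y) * F y‖ ≤ ε * ∫ y : Torus d, ‖F y‖ := by
    intro ε hε
    have hmem : (⟨fun y => (starRingEnd ℂ) (F y), by fun_prop⟩ : C(Torus d, ℂ)) ∈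
        closure (trigPoly d : Set C(Torus d, ℂ)) := by
      have h1 := trigPoly_closure d
      have h2 : (⟨fun y => (starRingEnd ℂ) (F y), by fun_prop⟩ : C(Torus d, ℂ)) ∈
        (trigPoly d).topologicalClosure := by rw [h1]; trivial
      exact h2
    obtain ⟨P, ⟨s, c, hP⟩, hPF⟩ := Metric.mem_closure_iff.1 hmem ε hε
    have h3 : ∫ y : Torus d, P y * F y = 0 := by
      simp only [hP, sum_mul, mul_assoc]
      rw [integral_finsetSum]
      · simp only [integral_const_mul, h, mul_zero, Finset.sum_const_zero]
      · intro ξ _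
        exact (hint ((continuous_torusChar ξ).mul hF)).const_mul _
    have h4 : ∫ y : Torus d, (starRingEnd ℂ) (F y) * F y =
        ∫ y : Torus d, ((starRingEnd ℂ) (F y) - P y) * F y := by
      simp only [sub_mul]
      rw [integral_sub (hint (by fun_prop)) (hint (by fun_prop)), h3, sub_zero]
    rw [h4, ← integral_const_mul]
    refine norm_integral_le_of_norm_le ((hint hF).norm.const_mul ε) (.of_forall fun y => ?_)
    rw [norm_mul]
    refine mul_le_mul_of_nonneg_right ?_ (norm_nonneg _)
    have := (ContinuousMap.dist_apply_le_dist
      (f := ⟨fun y => (starRingEnd ℂ) (F y), by fun_prop⟩) (g := P) y).trans hPF.le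
    rwa [dist_eq_norm] at this
  have h1 : ‖∫ y : Torus d, (starRingEnd ℂ) (F y) * F y‖ ≤ 0 := by
    have ht : Tendsto (fun ε : ℝ => ε * ∫ y : Torus d, ‖F y‖) (𝓝[>] 0) (𝓝 (0 * ∫ y : Torus d, ‖F y‖)) :=
      ((continuous_id.mul continuous_const).tendsto 0).mono_left nhdsWithin_le_nhds
    rw [zero_mul] at ht
    exact ge_of_tendsto ht (eventually_mem_nhdsWithin.mono fun ε hε => h0 ε hε)
  have h2 : ∫ y : Torus d, ‖F y‖ ^ 2 = 0 := by
    have h3 : ∀ y, (starRingEnd ℂ) (F y) * F y = ((‖F y‖ ^ 2 : ℝ) : ℂ) := fun y => by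
      rw [mul_comm, Complex.mul_conj, Complex.normSq_eq_norm_sq]
    simp only [h3, integral_complex_ofReal] at h1
    exact_mod_cast norm_le_zero_iff.1 h1
  have hc : Continuous fun y => ‖F y‖ ^ 2 := hF.norm.pow 2
  have h3 := (integral_eq_zero_iff_of_nonneg (fun y => by positivity)
    (hc.integrable_of_hasCompactSupport (HasCompactSupport.of_compactSpace _))).1 h2
  have h4 := (hc.ae_eq_iff_eq volume continuous_const).1 h3
  funext y
  have h5 : ‖F y‖ ^ 2 = 0 := congrFun h4 y
  simpa using h5

lemma summable_int_inv : Summable fun n : ℤ => (1 + (n : ℝ) ^ 2)⁻¹ := by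
  have h : Summable fun n : ℕ => (1 + (n : ℝ) ^ 2)⁻¹ := by
    refine Summable.of_nonneg_of_le (fun n => by positivity) (fun n => ?_)
      ((summable_nat_add_iff 1).2 (Real.summable_one_div_nat_pow.2 one_lt_two)|>.mul_left 2)
    push_cast
    rw [mul_one_div, inv_eq_one_div, div_le_div_iff₀ (by positivity) (by positivity)]
    nlinarith [sq_nonneg ((n : ℝ) - 1)]
  refine Summable.of_nat_of_neg (by simpa using h) (by simpa using h)

lemma summable_latSq (d : ℕ) : Summable fun ξ : Fin d → ℤ => ((1 + latSq ξ) ^ d)⁻¹ := by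
  classical
  have hS := summable_int_inv
  have hpos : ∀ n : ℤ, 0 ≤ (1 + (n : ℝ) ^ 2)⁻¹ := fun n => by positivity
  refine summable_of_sum_le (c := (∑' n : ℤ, (1 + (n : ℝ) ^ 2)⁻¹) ^ d)
    (fun ξ => by have := latSq_nonneg ξ; positivity) fun s => ?_
  have h1 : ∀ ξ : Fin d → ℤ, ((1 + latSq ξ) ^ d)⁻¹ ≤ ∏ i, (1 + (ξ i : ℝ) ^ 2)⁻¹ := fun ξ => by
    rw [Finset.prod_inv_distrib]
    refine inv_anti₀ (Finset.prod_pos fun i _ => by positivity) ?_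
    calc ∏ i, (1 + (ξ i : ℝ) ^ 2) ≤ ∏ _i : Fin d, (1 + latSq ξ) := by
          refine Finset.prod_le_prod (fun i _ => by positivity) fun i _ => ?_
          have : (ξ i : ℝ) ^ 2 ≤ latSq ξ :=
            single_le_sum (f := fun i => (ξ i : ℝ) ^ 2) (fun i _ => sq_nonneg _)
              (Finset.mem_univ i)
          linarith
      _ = _ := by simp
  have h2 : s ⊆ Fintype.piFinset fun i => s.image fun ξ => ξ i := fun ξ hξ =>
    Fintype.mem_piFinset.2 fun i => Finset.mem_image_of_mem _ hξ
  calc ∑ ξ ∈ s, ((1 + latSq ξ) ^ d)⁻¹ ≤ ∑ ξ ∈ s, ∏ i, (1 + (ξ i : ℝ) ^ 2)⁻¹ :=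
        sum_le_sum fun ξ _ => h1 ξ
    _ ≤ ∑ ξ ∈ Fintype.piFinset (fun i => s.image fun ξ => ξ i), ∏ i, (1 + ((ξ i : ℤ) : ℝ) ^ 2)⁻¹ :=
        Finset.sum_le_sum_of_subset_of_nonneg h2 fun ξ _ _ =>
          Finset.prod_nonneg fun i _ => hpos _
    _ = ∏ i, ∑ n ∈ s.image (fun ξ => ξ i), (1 + ((n : ℤ) : ℝ) ^ 2)⁻¹ :=
        (Finset.prod_univ_sum _ (fun _ (n : ℤ) => (1 + (n : ℝ) ^ 2)⁻¹)).symm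
    _ ≤ ∏ _i : Fin d, ∑' n : ℤ, (1 + (n : ℝ) ^ 2)⁻¹ :=
        Finset.prod_le_prod (fun i _ => sum_nonneg fun n _ => hpos n) fun i _ =>
          hS.sum_le_tsum _ fun n _ => hpos n
    _ = _ := by simp

/-- The constant of the decay of Fourier coefficients. -/
lemma hasSum_fcoef (f : CInf d) (p : ST d) :
    HasSum (fun ξ => (((2 * π : ℝ) : ℂ) ^ d)⁻¹ * (torusChar (-ξ) p.1 * (fcoef ξ f).1 p.2))
      (f.1 p) := by
  obtain ⟨B, hB0, hB⟩ := CkBound.exists (0 + 2 * d) f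
  obtain ⟨y, θ⟩ := p
  set T : (Fin d → ℤ) → Torus d → ℂ := fun ξ y =>
    (((2 * π : ℝ) : ℂ) ^ d)⁻¹ * (torusChar (-ξ) y * (fcoef ξ f).1 θ) with hT
  set D : ℝ := (2 * π) ^ d * (1 + d) ^ d * B
  have hpi : ((2 * π : ℝ) : ℂ) ^ d ≠ 0 :=
    pow_ne_zero _ (by exact_mod_cast Real.two_pi_pos.ne')
  have hTb : ∀ ξ y, ‖T ξ y‖ ≤ ‖(((2 * π : ℝ) : ℂ) ^ d)⁻¹‖ * (D * ((1 + latSq ξ) ^ d)⁻¹) :=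
    fun ξ y => by
      rw [hT]
      simp only [norm_mul, norm_torusChar, one_mul]
      exact mul_le_mul_of_nonneg_left ((sphBound_fcoef_decay 0 d ξ hB).zero θ) (norm_nonneg _)
  have hsum : Summable fun ξ : Fin d → ℤ =>
      ‖(((2 * π : ℝ) : ℂ) ^ d)⁻¹‖ * (D * ((1 + latSq ξ) ^ d)⁻¹) :=
    ((summable_latSq d).mul_left _).mul_left _
  have hTc : ∀ ξ, Continuous (T ξ) := fun ξ =>
    continuous_const.mul ((continuous_torusChar _).mul continuous_const)
  have hcont : Continuous fun y => ∑' ξ, T ξ y := continuous_tsum hTc hsum hTb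
  have hfc : Continuous fun y => f.1 (y, θ) := (CInf.continuous f).comp (by fun_prop)
  have hzero : (fun y => f.1 (y, θ) - ∑' ξ, T ξ y) = 0 := by
    refine eq_zero_of_torus_coef (hfc.sub hcont) fun η => ?_
    have hint : ∀ {G : Torus d → ℂ}, Continuous G → Integrable G volume := fun hG =>
      hG.integrable_of_hasCompactSupport (HasCompactSupport.of_compactSpace _)
    have h1 : HasSum (fun ξ => ∫ y : Torus d, torusChar η y * T ξ y)
        (∫ y : Torus d, torusChar η y * ∑' ξ, T ξ y) := by
      simp only [← tsum_mul_left]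
      refine hasSum_integral_of_summable_integral_norm
        (fun ξ => hint ((continuous_torusChar η).mul (hTc ξ))) ?_
      refine Summable.of_nonneg_of_le (fun ξ => integral_nonneg fun y => norm_nonneg _) (fun ξ => ?_)
        (hsum.mul_left ((2 * π) ^ d))
      refine (integral_mono (hint ((continuous_torusChar η).mul (hTc ξ))).norm (integrable_const
        (‖(((2 * π : ℝ) : ℂ) ^ d)⁻¹‖ * (D * ((1 + latSq ξ) ^ d)⁻¹))) fun y => ?_).trans
        (le_of_eq ?_)
      · simpa using hTb ξ y
      · rw [integral_const, smul_eq_mul, volume_torus_real]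
    have h2 : ∀ ξ, ∫ y : Torus d, torusChar η y * T ξ y = if ξ = η then (fcoef η f).1 θ else 0 := by
      intro ξ
      have h3 : ∀ y, torusChar η y * T ξ y =
          ((((2 * π : ℝ) : ℂ) ^ d)⁻¹ * (fcoef ξ f).1 θ) * torusChar (η + -ξ) y := fun y => by
        rw [torusChar_add, hT]; ring
      simp only [h3, integral_const_mul, integral_torusChar]
      by_cases h4 : ξ = η
      · subst h4
        rw [if_pos (by simp), if_pos rfl, mul_right_comm, inv_mul_cancel₀ hpi, one_mul]
      · rw [if_neg h4, if_neg, mul_zero]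
        rw [add_neg_eq_zero]; exact fun h => h4 h.symm
    simp only [h2] at h1
    have h5 := h1.unique (hasSum_ite_eq η _)
    simp only [mul_sub]
    have h8 := integral_sub (hint ((continuous_torusChar η).mul hfc))
      (hint ((continuous_torusChar η).mul hcont))
    simp only [Pi.mul_apply] at h8
    rw [h8, h5, ← fcoef_apply, sub_self]
  have h6 := congrFun hzero y
  have h7 : f.1 (y, θ) = ∑' ξ, T ξ y := sub_eq_zero.1 h6
  change HasSum (fun ξ => T ξ y) (f.1 (y, θ))
  rw [h7]
  exact (Summable.of_norm_bounded hsum fun ξ => hTb ξ y).hasSum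

/-- The remainder of the Fourier series of a smooth function. -/
def fourierRem (s : Finset (Fin d → ℤ)) (f : CInf d) : CInf d :=
  f - (((2 * π : ℝ) : ℂ) ^ d)⁻¹ • ∑ ξ ∈ s, charTensor (-ξ) (fcoef ξ f)

lemma transDeriv_fourierRem (j : Fin d) (s : Finset (Fin d → ℤ)) (f : CInf d) :
    transDeriv j (fourierRem s f) = fourierRem s (transDeriv j f) := by
  simp only [fourierRem, map_sub, map_smul, map_sum, transDeriv_charTensor, fcoef_transDeriv]
  congr 3
  funext ξ
  congr 1
  simp

lemma rotDeriv_fourierRem (i j : Fin d) (s : Finset (Fin d → ℤ)) (f : CInf d) :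
    rotDeriv i j (fourierRem s f) = fourierRem s (rotDeriv i j f) := by
  simp only [fourierRem, map_sub, map_smul, map_sum, rotDeriv_charTensor, fcoef_rotDeriv]

lemma ckBound_fourierRem (k : ℕ) (s : Finset (Fin d → ℤ)) {f : CInf d} {B : ℝ}
    (h : CkBound (k + 2 * d) f B) : CkBound k (fourierRem s f)
      ((1 + d) ^ d * B * ∑' ξ : {ξ // ξ ∉ s}, ((1 + latSq ξ.1) ^ d)⁻¹) := by
  have h0 : ∀ {f : CInf d}, CkBound (0 + 2 * d) f B → ∀ p, ‖(fourierRem s f).1 p‖ ≤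
      (1 + d) ^ d * B * ∑' ξ : {ξ // ξ ∉ s}, ((1 + latSq ξ.1) ^ d)⁻¹ := by
    intro f hf p
    have hsum := (((summable_latSq d).subtype (fun ξ => ξ ∉ s)).mul_left ((1 + d) ^ d * B))
    have h1 := (s.hasSum_compl_iff.2 (by
      have := hasSum_fcoef f p
      rwa [← sub_add_cancel (f.1 p) (∑ ξ ∈ s, (((2 * π : ℝ) : ℂ) ^ d)⁻¹ *
        (torusChar (-ξ) p.1 * (fcoef ξ f).1 p.2))] at this))
    have h2 : (fourierRem s f).1 p = f.1 p - ∑ ξ ∈ s, (((2 * π : ℝ) : ℂ) ^ d)⁻¹ *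
        (torusChar (-ξ) p.1 * (fcoef ξ f).1 p.2) := by
      rw [fourierRem, CInf.sub_apply, CInf.smul_apply, CInf.sum_apply, mul_sum]
      rfl
    rw [h2, ← h1.tsum_eq, ← tsum_mul_left]
    refine tsum_of_norm_bounded hsum.hasSum fun ξ => ?_
    have h3 := (sphBound_fcoef_decay 0 d ξ.1 hf).zero p.2
    have hpi : (0 : ℝ) < (2 * π) ^ d := by positivity
    rw [norm_mul, norm_mul, norm_torusChar, one_mul, norm_inv, norm_pow, norm_real,
      norm_of_nonneg (by positivity), inv_mul_le_iff₀ hpi]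
    refine h3.trans (le_of_eq ?_)
    simp only [Function.comp_apply]
    ring
  induction k generalizing f with
  | zero => exact h0 h
  | succ k ih =>
    have e : k + 1 + 2 * d = (k + 2 * d) + 1 := by ring
    rw [e] at h
    refine ⟨h0 (h.mono (by omega)), fun j => ?_, fun i j => ?_⟩
    · rw [transDeriv_fourierRem]; exact ih (h.2.1 j)
    · rw [rotDeriv_fourierRem]; exact ih (h.2.2 i j)

/-- The Fourier expansion of the pairing of a distribution with a smooth function. -/
theorem hasSum_dist [NeZero d] (u : DistST d) (f : CInf d) :
    HasSum (fun ξ => (((2 * π) ^ (-(d : ℝ) / 2) : ℝ) : ℂ) * fourierCoef ξ u (fcoef ξ f))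
      (u.1 f) := by
  obtain ⟨k, C, hC, hu⟩ := DistST.exists_bound u
  obtain ⟨B, hB0, hB⟩ := CkBound.exists (k + 2 * d) f
  have h1 : ∀ ξ, (((2 * π) ^ (-(d : ℝ) / 2) : ℝ) : ℂ) * fourierCoef ξ u (fcoef ξ f) =
      (((2 * π : ℝ) : ℂ) ^ d)⁻¹ * u.1 (charTensor (-ξ) (fcoef ξ f)) := fun ξ => by
    change _ * ((((2 * π) ^ (-(d : ℝ) / 2) : ℝ) : ℂ) * u.1 (charTensor (-ξ) (fcoef ξ f))) = _
    rw [← mul_assoc, ← Complex.ofReal_mul, ← rpow_add two_pi_pos,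
      show -(d : ℝ) / 2 + -(d : ℝ) / 2 = -d by ring, Real.rpow_neg Real.two_pi_pos.le,
      rpow_natCast]
    push_cast; rfl
  simp only [h1]
  change Tendsto _ _ _
  rw [tendsto_iff_norm_sub_tendsto_zero]
  have h2 := (tendsto_tsum_compl_atTop_zero fun ξ : Fin d → ℤ => ((1 + latSq ξ) ^ d)⁻¹).const_mul
    (C * ((1 + d) ^ d * B))
  rw [mul_zero] at h2
  refine squeeze_zero (fun _ => norm_nonneg _) (fun s => ?_) h2
  have h3 := hu _ _ (ckBound_fourierRem k s hB)
  rw [fourierRem, map_sub, map_smul, map_sum, smul_eq_mul, mul_sum, norm_sub_rev] at h3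
  rw [mul_assoc]
  exact h3


variable {d : ℕ}

/-! ### Amplitude integrals of distributions on the sphere -/

lemma IsSqSeminorm.add_le_two {F : Type*} [AddCommGroup F] [Module ℂ F] {S : F → ℝ≥0∞}
    (hS : IsSqSeminorm S) (u v : F) : S (u + v) ≤ 2 * (S u + S v) := by
  have hsq : ∀ a : ℝ≥0∞, (a ^ (1 / 2 : ℝ)) ^ (2 : ℝ) = a := fun a => by
    rw [← ENNReal.rpow_mul]; norm_num
  have h1 := ENNReal.rpow_le_rpow (hS.add_le u v) (by norm_num : (0 : ℝ) ≤ 2)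
  rw [hsq] at h1
  refine h1.trans ((ENNReal.rpow_add_le_mul_rpow_add_rpow _ _ (by norm_num : (1 : ℝ) ≤ 2)).trans
    (le_of_eq ?_))
  rw [hsq, hsq]
  norm_num

/-- The derivative of a distribution on the sphere along `θ_i ∂_j - θ_j ∂_i`. -/
def rotForm (i j : Fin d) (u : CInfSph d →ₗ[ℂ] ℂ) : CInfSph d →ₗ[ℂ] ℂ := -(u ∘ₗ rotDerivSph i j)

@[simp] lemma rotForm_apply (i j : Fin d) (u : CInfSph d →ₗ[ℂ] ℂ) (f : CInfSph d) :
    rotForm i j u f = -u (rotDerivSph i j f) := rfl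

/-- The product of a distribution on the sphere with a smooth function. -/
def mulForm (a : CInfSph d) (u : CInfSph d →ₗ[ℂ] ℂ) : CInfSph d →ₗ[ℂ] ℂ where
  toFun f := u (a * f)
  map_add' f g := by
    rw [← map_add]; congr 1; exact ext' fun θ => by simp [mul_add]
  map_smul' c f := by
    rw [RingHom.id_apply, ← map_smul]; congr 1; exact ext' fun θ => by simp [mul_left_comm]

@[simp] lemma mulForm_apply (a : CInfSph d) (u : CInfSph d →ₗ[ℂ] ℂ) (f : CInfSph d) :
    mulForm a u f = u (a * f) := rfl

lemma sobSqDist_succ (k : ℕ) (u : CInfSph d →ₗ[ℂ] ℂ) :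
    sobSqDist (k + 1) u = dualNorm 0 u ^ 2 + ∑ i, ∑ j, sobSqDist k (rotForm i j u) := rfl

lemma sobSqDist_rotForm_le (k : ℕ) (u : CInfSph d →ₗ[ℂ] ℂ) (i j : Fin d) :
    sobSqDist k (rotForm i j u) ≤ sobSqDist (k + 1) u := by
  rw [sobSqDist_succ]
  refine le_trans ?_ le_add_self
  refine le_trans ?_ (single_le_sum (f := fun i => ∑ j, sobSqDist k (rotForm i j u))
    (fun _ _ => zero_le) (Finset.mem_univ i))
  exact single_le_sum (f := fun j => sobSqDist k (rotForm i j u))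
    (fun _ _ => zero_le) (Finset.mem_univ j)

lemma sobSqDist_le_succ (k : ℕ) (u : CInfSph d →ₗ[ℂ] ℂ) :
    sobSqDist k u ≤ sobSqDist (k + 1) u := by
  induction k generalizing u with
  | zero => exact le_self_add
  | succ k ih =>
    rw [sobSqDist_succ, sobSqDist_succ (k + 1)]
    exact add_le_add le_rfl (sum_le_sum fun i _ => sum_le_sum fun j _ => ih _)

lemma dualNorm_mulForm_le {a : CInfSph d} {B : ℝ} (hB : 0 ≤ B) (ha : ∀ θ, ‖a.1 θ‖ ≤ B)
    {u : CInfSph d →ₗ[ℂ] ℂ} (hu : dualNorm 0 u < ⊤) :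
    dualNorm 0 (mulForm a u) ≤ ENNReal.ofReal B * dualNorm 0 u := by
  have h : dualNorm 0 (mulForm a u) ≤ ENNReal.ofReal (B * (dualNorm 0 u).toReal) := by
    refine dualNorm_le (by positivity) fun f => ?_
    refine (norm_le_of_dualNorm hu (a * f)).trans ?_
    have h1 : √(sobTwoSq 0 (a * f)) ≤ B * √(sobTwoSq 0 f) := by
      refine (sqrt_le_sqrt (lTwoSq_mul_le_of_bound ha f)).trans (le_of_eq ?_)
      rw [Real.sqrt_mul (by positivity), Real.sqrt_sq hB]
      rfl
    calc _ ≤ (dualNorm 0 u).toReal * (B * √(sobTwoSq 0 f)) := by gcongr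
      _ = _ := by ring
  rwa [ENNReal.ofReal_mul hB, ENNReal.ofReal_toReal hu.ne] at h

lemma rotForm_mulForm (i j : Fin d) (a : CInfSph d) (u : CInfSph d →ₗ[ℂ] ℂ) :
    rotForm i j (mulForm a u) = mulForm a (rotForm i j u) + mulForm (rotDerivSph i j a) u := by
  refine LinearMap.ext fun f => ?_
  simp [rotDerivSph_mul]

lemma sobSqDist_mulForm_le (k : ℕ) : ∃ C : ℝ≥0∞, C ≠ ⊤ ∧ ∀ (a : CInfSph d) (B : ℝ)
    (u : CInfSph d →ₗ[ℂ] ℂ), 0 ≤ B → SphBound k a B → sobSqDist k u < ⊤ →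
    sobSqDist k (mulForm a u) ≤ C * ENNReal.ofReal B ^ 2 * sobSqDist k u := by
  induction k with
  | zero =>
    refine ⟨1, ENNReal.one_ne_top, fun a B u hB ha hu => ?_⟩
    have := pow_le_pow_left' (dualNorm_mulForm_le hB ha (dualNorm_zero_lt_top hu)) 2
    rw [mul_pow] at this
    rw [one_mul]; exact this
  | succ k ih =>
    obtain ⟨C, hC, h⟩ := ih
    refine ⟨1 + d * (d * (2 * (C + C))), by finiteness, fun a B u hB ha hu => ?_⟩
    have h1 : sobSqDist k u < ⊤ := (sobSqDist_le_succ k u).trans_lt hu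
    rw [sobSqDist_succ]
    set b := ENNReal.ofReal B ^ 2
    have h2 : dualNorm 0 (mulForm a u) ^ 2 ≤ b * sobSqDist (k + 1) u := by
      have := pow_le_pow_left' (dualNorm_mulForm_le hB ha.zero (dualNorm_zero_lt_top hu)) 2
      rw [mul_pow] at this
      exact this.trans (mul_le_mul_right (dualNorm_zero_sq_le_sobSqDist _ _) _)
    have h3 : ∀ i j, sobSqDist k (rotForm i j (mulForm a u)) ≤
        2 * (C + C) * (b * sobSqDist (k + 1) u) := fun i j => by
      rw [rotForm_mulForm]
      refine ((isSqSeminorm_sobSqDist k).add_le_two _ _).trans ?_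
      have e1 := h a B (rotForm i j u) hB ha.of_succ ((sobSqDist_rotForm_le k u i j).trans_lt hu)
      have e2 := h (rotDerivSph i j a) B u hB (ha.2 i j) h1
      rw [mul_assoc 2, mul_assoc] at *
      refine mul_le_mul_right ?_ _
      rw [add_mul]
      refine add_le_add (e1.trans ?_) (e2.trans ?_)
      · exact mul_le_mul_right (mul_le_mul_right (sobSqDist_rotForm_le k u i j) _) _
      · exact mul_le_mul_right (mul_le_mul_right (sobSqDist_le_succ k u) _) _
    calc _ ≤ b * sobSqDist (k + 1) u + ∑ _i : Fin d, ∑ _j : Fin d,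
          2 * (C + C) * (b * sobSqDist (k + 1) u) :=
          add_le_add h2 (sum_le_sum fun i _ => sum_le_sum fun j _ => h3 i j)
      _ = _ := by simp; ring

lemma lTwoSq_sphExp_mul (v : Euc d) (f : CInfSph d) : lTwoSq (sphExp v * f) = lTwoSq f := by
  simp [lTwoSq]

lemma norm_form_sphExp_mul_le {u : CInfSph d →ₗ[ℂ] ℂ} (hu : dualNorm 0 u < ⊤) (v : Euc d)
    (f : CInfSph d) : ‖u (sphExp v * f)‖ ≤ (dualNorm 0 u).toReal * √(lTwoSq f) := by
  have := norm_le_of_dualNorm hu (sphExp v * f)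
  change _ ≤ _ * √(lTwoSq _) at this
  rwa [lTwoSq_sphExp_mul] at this

lemma continuous_form_sphExp {u : CInfSph d →ₗ[ℂ] ℂ} (hu : dualNorm 0 u < ⊤) (η : Euc d)
    (f : CInfSph d) : Continuous fun t : ℝ => u (sphExp (t • η) * f) := by
  obtain ⟨B, hB0, hB⟩ := CInfSph.exists_bound f
  set m := √((surf d).real univ)
  set D := (dualNorm 0 u).toReal
  have hD : 0 ≤ D := ENNReal.toReal_nonneg
  have key : ∀ t s : ℝ, ‖u (sphExp (t • η) * f) - u (sphExp (s • η) * f)‖ ≤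
      D * (‖η‖ * B * m) * |t - s| := fun t s => by
    rw [← map_sub]
    refine (norm_le_of_dualNorm hu _).trans ?_
    rw [mul_assoc]
    refine mul_le_mul_of_nonneg_left ?_ hD
    refine (sqrt_lTwoSq_le_of_bound (ε := |t - s| * ‖η‖ * B) (by positivity) fun θ => ?_).trans
      (le_of_eq (by ring))
    simp only [sub_apply, mul_apply]
    rw [← sub_mul, norm_mul]
    refine mul_le_mul ?_ (hB θ) (norm_nonneg _) (by positivity)
    simp only [sphExp_apply, real_inner_smul_left]
    set x : ℝ := inner ℝ η (θ : Euc d)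
    have h1 : exp (-(I * ((t * x : ℝ) : ℂ))) -
        exp (-(I * ((s * x : ℝ) : ℂ))) =
        exp (-(I * ((s * x : ℝ) : ℂ))) *
          (exp (I * ((-((t - s) * x) : ℝ) : ℂ)) - 1) := by
      rw [mul_sub, ← Complex.exp_add, mul_one]
      congr 2
      push_cast; ring
    have h2 : ‖exp (-(I * ((s * x : ℝ) : ℂ)))‖ = 1 := by
      rw [Complex.norm_exp]; simp
    rw [h1, norm_mul, h2, one_mul]
    refine (Real.norm_exp_I_mul_ofReal_sub_one_le).trans ?_
    rw [norm_neg, norm_mul, norm_eq_abs]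
    refine mul_le_mul_of_nonneg_left ?_ (abs_nonneg _)
    have := abs_real_inner_le_norm η (θ : Euc d)
    rwa [sph_norm, mul_one] at this
  refine (LipschitzWith.of_dist_le_mul (K := ⟨D * (‖η‖ * B * m), by positivity⟩)
    fun t s => ?_).continuous
  rw [dist_eq_norm, Real.dist_eq]
  exact key t s

lemma integrableOn_form {a : ℝ → ℂ} (ha : IntegrableOn a (Ioi 0)) {u : CInfSph d →ₗ[ℂ] ℂ}
    (hu : dualNorm 0 u < ⊤) (η : Euc d) (f : CInfSph d) :
    IntegrableOn (fun t : ℝ => a t * u (sphExp (t • η) * f)) (Ioi 0) := by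
  refine Integrable.mono' (ha.norm.mul_const ((dualNorm 0 u).toReal * √(lTwoSq f)))
    (ha.aestronglyMeasurable.mul (continuous_form_sphExp hu η f).aestronglyMeasurable)
    (.of_forall fun t => ?_)
  rw [norm_mul]
  exact mul_le_mul_of_nonneg_left (norm_form_sphExp_mul_le hu _ f) (norm_nonneg _)

/-- The distribution `∫_0^∞ a(t) e^{-i t ⟨η, θ⟩} u dt` on the sphere. -/
def modeForm {a : ℝ → ℂ} (ha : IntegrableOn a (Ioi 0)) (η : Euc d) {u : CInfSph d →ₗ[ℂ] ℂ}
    (hu : dualNorm 0 u < ⊤) : CInfSph d →ₗ[ℂ] ℂ where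
  toFun f := ∫ t in Ioi (0 : ℝ), a t * u (sphExp (t • η) * f)
  map_add' f g := by
    rw [← integral_add (integrableOn_form ha hu η f) (integrableOn_form ha hu η g)]
    congr 1; funext t
    have : sphExp (t • η) * (f + g) = sphExp (t • η) * f + sphExp (t • η) * g :=
      ext' fun θ => by simp [mul_add]
    rw [this, map_add, mul_add]
  map_smul' c f := by
    rw [RingHom.id_apply, smul_eq_mul, ← integral_const_mul]
    congr 1; funext t
    have : sphExp (t • η) * (c • f) = c • (sphExp (t • η) * f) :=
      ext' fun θ => by simp [mul_left_comm]
    rw [this, map_smul, smul_eq_mul, mul_left_comm]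

lemma modeForm_apply {a : ℝ → ℂ} (ha : IntegrableOn a (Ioi 0)) (η : Euc d)
    {u : CInfSph d →ₗ[ℂ] ℂ} (hu : dualNorm 0 u < ⊤) (f : CInfSph d) :
    modeForm ha η hu f = ∫ t in Ioi (0 : ℝ), a t * u (sphExp (t • η) * f) := rfl

lemma dualNorm_modeForm_le {a : ℝ → ℂ} (ha : IntegrableOn a (Ioi 0)) (η : Euc d)
    {u : CInfSph d →ₗ[ℂ] ℂ} (hu : dualNorm 0 u < ⊤) :
    dualNorm 0 (modeForm ha η hu) ≤ ENNReal.ofReal (∫ t in Ioi (0 : ℝ), ‖a t‖) * dualNorm 0 u := by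
  have hA : 0 ≤ ∫ t in Ioi (0 : ℝ), ‖a t‖ := integral_nonneg fun _ => norm_nonneg _
  have h : dualNorm 0 (modeForm ha η hu) ≤
      ENNReal.ofReal ((∫ t in Ioi (0 : ℝ), ‖a t‖) * (dualNorm 0 u).toReal) := by
    refine dualNorm_le (by positivity) fun f => ?_
    rw [modeForm_apply, mul_assoc, ← integral_mul_const]
    refine norm_integral_le_of_norm_le (ha.norm.mul_const _) (.of_forall fun t => ?_)
    rw [norm_mul]
    exact mul_le_mul_of_nonneg_left (norm_form_sphExp_mul_le hu _ f) (norm_nonneg _)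
  rwa [ENNReal.ofReal_mul hA, ENNReal.ofReal_toReal hu.ne] at h

lemma rotVec_smul (c : ℝ) (v : Euc d) (i j : Fin d) : rotVec (c • v) i j = c • rotVec v i j := by
  simp [rotVec, smul_sub, smul_smul]

lemma sphLin_smul (c : ℝ) (v : Euc d) : sphLin (c • v) = (c : ℂ) • sphLin v :=
  ext' fun θ => by simp [sphLin_apply, real_inner_smul_left]

lemma rotForm_modeForm {a : ℝ → ℂ} (ha : IntegrableOn a (Ioi 0))
    (ha' : IntegrableOn (fun t : ℝ => -I * t * a t) (Ioi 0)) (η : Euc d)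
    {u : CInfSph d →ₗ[ℂ] ℂ} (hu : dualNorm 0 u < ⊤) (i j : Fin d)
    (hu' : dualNorm 0 (rotForm i j u) < ⊤)
    (hu'' : dualNorm 0 (mulForm (sphLin (rotVec η i j)) u) < ⊤) :
    rotForm i j (modeForm ha η hu) = modeForm ha η hu' + modeForm ha' η hu'' := by
  refine LinearMap.ext fun f => ?_
  rw [rotForm_apply, LinearMap.add_apply, modeForm_apply, modeForm_apply, modeForm_apply,
    ← integral_add (integrableOn_form ha hu' η f) (integrableOn_form ha' hu'' η f), ← integral_neg]
  congr 1; funext t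
  rw [rotForm_apply, mulForm_apply, rotDerivSph_mul, rotDerivSph_sphExp, rotVec_smul, sphLin_smul]
  have h1 : (-I) • ((t : ℂ) • sphLin (rotVec η i j) * sphExp (t • η)) * f =
      (-I * t) • (sphLin (rotVec η i j) * (sphExp (t • η) * f)) :=
    ext' fun θ => by simp; ring
  rw [h1, map_add, map_smul, smul_eq_mul]
  ring

theorem sobSqDist_modeForm_le (k : ℕ) : ∃ C : ℝ≥0∞, C ≠ ⊤ ∧ ∀ (a : ℝ → ℂ)
    (ha : IntegrableOn a (Ioi (0 : ℝ)) volume) (η : Euc d) (u : CInfSph d →ₗ[ℂ] ℂ)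
    (hu : dualNorm 0 u < ⊤) (A : ℝ),
    IntegrableOn (fun t => a t * ((1 + t : ℝ) : ℂ) ^ k) (Ioi 0) →
    (∫ t in Ioi (0 : ℝ), ‖a t * ((1 + t : ℝ) : ℂ) ^ k‖) ≤ A → sobSqDist k u < ⊤ →
    sobSqDist k (modeForm ha η hu) ≤
      C * (ENNReal.ofReal (1 + ‖η‖ ^ 2) ^ k * ENNReal.ofReal A ^ 2 * sobSqDist k u) := by
  have h0 : ∀ (k : ℕ) (a : ℝ → ℂ) (ha : IntegrableOn a (Ioi (0 : ℝ)) volume) (η : Euc d) (u : CInfSph d →ₗ[ℂ] ℂ)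
      (hu : dualNorm 0 u < ⊤) (A : ℝ), IntegrableOn (fun t => a t * ((1 + t : ℝ) : ℂ) ^ k) (Ioi 0) →
      (∫ t in Ioi (0 : ℝ), ‖a t * ((1 + t : ℝ) : ℂ) ^ k‖) ≤ A →
      dualNorm 0 (modeForm ha η hu) ^ 2 ≤ ENNReal.ofReal A ^ 2 * dualNorm 0 u ^ 2 := by
    intro k a ha η u hu A hk hA
    rw [← mul_pow]
    refine pow_le_pow_left' ((dualNorm_modeForm_le ha η hu).trans
      (mul_le_mul_left (ENNReal.ofReal_le_ofReal (le_trans ?_ hA)) _)) 2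
    refine setIntegral_mono_on ha.norm hk.norm measurableSet_Ioi fun t ht => ?_
    have ht' : (0 : ℝ) ≤ t := le_of_lt ht
    rw [norm_rapid ht']
    exact le_mul_of_one_le_right (norm_nonneg _) (one_le_pow₀ (by linarith))
  induction k with
  | zero =>
    refine ⟨1, ENNReal.one_ne_top, fun a ha η u hu A hk hA hs => ?_⟩
    rw [one_mul, pow_zero, one_mul]
    exact h0 0 a ha η u hu A hk hA
  | succ k ih =>
    obtain ⟨C, hC, h⟩ := ih
    obtain ⟨D, hD, hm⟩ := sobSqDist_mulForm_le (d := d) k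
    refine ⟨1 + d * (d * (2 * (C + C * D))), by finiteness, fun a ha η u hu A hk hA hs => ?_⟩
    have hint : ∀ b : ℝ → ℂ, AEStronglyMeasurable b (volume.restrict (Ioi 0)) →
        (∀ t, 0 < t → ‖b t‖ ≤ ‖a t‖ * (1 + t)) →
        IntegrableOn (fun t => b t * ((1 + t : ℝ) : ℂ) ^ k) (Ioi 0) ∧
        ∫ t in Ioi (0 : ℝ), ‖b t * ((1 + t : ℝ) : ℂ) ^ k‖ ≤ A := by
      intro b hb hba
      have hle : ∀ t ∈ Ioi (0 : ℝ), ‖b t * ((1 + t : ℝ) : ℂ) ^ k‖ ≤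
          ‖a t * ((1 + t : ℝ) : ℂ) ^ (k + 1)‖ := fun t ht => by
        have ht' : (0 : ℝ) < t := ht
        rw [norm_rapid ht'.le, norm_rapid ht'.le, pow_succ', ← mul_assoc]
        exact mul_le_mul_of_nonneg_right (hba t ht') (by positivity)
      have h1 : IntegrableOn (fun t => b t * ((1 + t : ℝ) : ℂ) ^ k) (Ioi 0) :=
        Integrable.mono' hk.norm (hb.mul (by fun_prop))
          ((ae_restrict_iff' measurableSet_Ioi).2 (Eventually.of_forall hle))
      exact ⟨h1, (setIntegral_mono_on h1.norm hk.norm measurableSet_Ioi hle).trans hA⟩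
    obtain ⟨a1, a2⟩ := hint a ha.aestronglyMeasurable fun t ht =>
      le_mul_of_one_le_right (norm_nonneg _) (by linarith)
    have hbm : AEStronglyMeasurable (fun t : ℝ => -I * t * a t) (volume.restrict (Ioi 0)) :=
      AEStronglyMeasurable.mul (by fun_prop) ha.aestronglyMeasurable
    have hbn : ∀ t : ℝ, 0 < t → ‖-I * t * a t‖ ≤ ‖a t‖ * (1 + t) := fun t ht => by
      rw [norm_mul, norm_mul, norm_neg, Complex.norm_I, one_mul, norm_real,
        norm_of_nonneg ht.le, mul_comm]
      exact mul_le_mul_of_nonneg_left (by linarith) (norm_nonneg _)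
    obtain ⟨b1, b2⟩ := hint _ hbm hbn
    have hb0 : IntegrableOn (fun t : ℝ => -I * t * a t) (Ioi 0) :=
      Integrable.mono' b1.norm hbm ((ae_restrict_iff' measurableSet_Ioi).2
        (.of_forall fun t ht => by
          have ht' : (0 : ℝ) ≤ t := le_of_lt ht
          rw [norm_rapid (a := fun t : ℝ => -I * t * a t) ht']
          exact le_mul_of_one_le_right (norm_nonneg _) (one_le_pow₀ (by linarith))))
    set E := ENNReal.ofReal (1 + ‖η‖ ^ 2)
    have hE : 1 ≤ E := ENNReal.one_le_ofReal.2 (by nlinarith [norm_nonneg η])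
    set S := E ^ (k + 1) * ENNReal.ofReal A ^ 2 * sobSqDist (k + 1) u with hS
    have h2 : dualNorm 0 (modeForm ha η hu) ^ 2 ≤ S := by
      refine (h0 _ a ha η u hu A hk hA).trans ?_
      refine mul_le_mul' ?_ (dualNorm_zero_sq_le_sobSqDist _ _)
      exact le_mul_of_one_le_left' (one_le_pow₀ hE)
    have h3 : ∀ i j, sobSqDist k (rotForm i j (modeForm ha η hu)) ≤ 2 * (C + C * D) * S := by
      intro i j
      have r1 : sobSqDist k (rotForm i j u) < ⊤ := (sobSqDist_rotForm_le k u i j).trans_lt hs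
      have r0 : sobSqDist k u < ⊤ := (sobSqDist_le_succ k u).trans_lt hs
      have hℓ : SphBound k (sphLin (rotVec η i j)) ‖η‖ :=
        (sphBound_sphLin k _).le_bound (norm_rotVec_le η i j)
      have r2 := hm _ _ u (norm_nonneg η) hℓ r0
      have r3 : sobSqDist k (mulForm (sphLin (rotVec η i j)) u) < ⊤ :=
        r2.trans_lt (by finiteness)
      rw [rotForm_modeForm ha hb0 η hu i j (dualNorm_zero_lt_top r1) (dualNorm_zero_lt_top r3)]
      refine ((isSqSeminorm_sobSqDist k).add_le_two _ _).trans ?_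
      have e1 := h a ha η _ (dualNorm_zero_lt_top r1) A a1 a2 r1
      have e2 := h _ hb0 η _ (dualNorm_zero_lt_top r3) A b1 b2 r3
      rw [mul_assoc 2, add_mul]
      refine mul_le_mul_right (add_le_add (e1.trans (mul_le_mul_right ?_ _)) (e2.trans ?_)) _
      · refine mul_le_mul' (mul_le_mul_left (pow_le_pow_right₀ hE (by omega)) _)
          (sobSqDist_rotForm_le k u i j)
      · rw [mul_assoc C]
        refine mul_le_mul_right ?_ _
        have hη : ENNReal.ofReal ‖η‖ ^ 2 ≤ E := by
          rw [← ENNReal.ofReal_pow (norm_nonneg _)]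
          exact ENNReal.ofReal_le_ofReal (by linarith)
        calc _ ≤ E ^ k * ENNReal.ofReal A ^ 2 * (D * ENNReal.ofReal ‖η‖ ^ 2 * sobSqDist k u) :=
              mul_le_mul_right r2 _
          _ ≤ E ^ k * ENNReal.ofReal A ^ 2 * (D * E * sobSqDist (k + 1) u) := by
              gcongr
              exact sobSqDist_le_succ k u
          _ = D * S := by rw [hS]; ring
    rw [sobSqDist_succ]
    calc _ ≤ S + ∑ _i : Fin d, ∑ _j : Fin d, 2 * (C + C * D) * S :=
          add_le_add h2 (sum_le_sum fun i _ => sum_le_sum fun j _ => h3 i j)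
      _ = _ := by simp; ring


variable {d : ℕ}

/-! ### The Fourier coefficients of a flow integral -/

/-- The vector `ξ ∈ ℤ^d` of `ℝ^d`. -/
def latVec (ξ : Fin d → ℤ) : Euc d := WithLp.toLp 2 fun i => (ξ i : ℝ)

lemma inner_latVec (ξ : Fin d → ℤ) (x : Euc d) : inner ℝ (latVec ξ) x = ∑ i, (ξ i : ℝ) * x i := by
  simp [latVec, PiLp.inner_apply, mul_comm]

lemma norm_latVec_sq (ξ : Fin d → ℤ) : ‖latVec ξ‖ ^ 2 = latSq ξ := by
  rw [EuclideanSpace.norm_sq_eq, latSq]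
  simp [latVec]

lemma norm_latVec (ξ : Fin d → ℤ) : ‖latVec ξ‖ = latNorm ξ := by
  rw [latNorm, ← norm_latVec_sq, Real.sqrt_sq (norm_nonneg _)]

lemma flowPull_charTensor (t : ℝ) (ξ : Fin d → ℤ) (f : CInfSph d) :
    flowPull t (charTensor (-ξ) f) = charTensor (-ξ) (sphExp (t • latVec ξ) * f) := by
  refine CInf.ext' fun x θ => ?_
  rw [flowPull_apply, flow_mk, charTensor_apply, charTensor_apply, torusChar_mk, torusChar_mk,
    mul_apply, sphExp_apply, ← mul_assoc, ← Complex.exp_add, real_inner_smul_left,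
    inner_latVec]
  congr 2
  have : ∑ i, (((-ξ) i : ℤ) : ℝ) * (x + t • (θ : Euc d)) i =
      ∑ i, (((-ξ) i : ℤ) : ℝ) * x i - t * ∑ i, (ξ i : ℝ) * (θ : Euc d) i := by
    rw [mul_sum, ← sum_sub_distrib]
    refine sum_congr rfl fun i _ => ?_
    simp; ring
  rw [this]
  push_cast; ring

lemma fourierCoef_apply (ξ : Fin d → ℤ) (u : DistST d) (f : CInfSph d) :
    fourierCoef ξ u f =
      (((2 * π) ^ (-(d : ℝ) / 2) : ℝ) : ℂ) * u.1 (charTensor (-ξ) f) := rfl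

lemma fourierCoef_flowOp_apply [NeZero d] {a : ℝ → ℂ} (ha : IsRapid a) (ξ : Fin d → ℤ)
    (u : DistST d) (f : CInfSph d) : fourierCoef ξ (flowOp ha u) f =
      ∫ t in Ioi (0 : ℝ), a t * fourierCoef ξ u (sphExp (t • latVec ξ) * f) := by
  rw [fourierCoef_apply, flowOp_apply, ← integral_const_mul]
  congr 1; funext t
  rw [fourierCoef_apply, flowPull_charTensor]
  ring

lemma fourierCoef_flowOp [NeZero d] {a : ℝ → ℂ} (ha : IsRapid a) (ξ : Fin d → ℤ)
    (u : DistST d) (hu : dualNorm 0 (fourierCoef ξ u) < ⊤) :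
    fourierCoef ξ (flowOp ha u) = modeForm ha.integrableOn (latVec ξ) hu :=
  LinearMap.ext fun f => by rw [fourierCoef_flowOp_apply, modeForm_apply]

lemma one_add_latSq_pos (ξ : Fin d → ℤ) : 0 < 1 + latSq ξ := by
  have := latSq_nonneg ξ; linarith

lemma sphSobSq_lt_top_of_anisoSq {M : ℤ} {N : ℝ} {u : DistST d} (hu : anisoSq M N u < ⊤)
    (ξ : Fin d → ℤ) : sphSobSq M (fourierCoef ξ u) < ⊤ := by
  have h := (ENNReal.le_tsum ξ).trans_lt hu
  refine (ENNReal.lt_top_of_mul_ne_top_right h.ne ?_)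
  exact (ENNReal.ofReal_pos.2 (Real.rpow_pos_of_pos (one_add_latSq_pos ξ) _)).ne'

theorem anisoSq_flowOp_le [NeZero d] (k : ℕ) : ∃ K : ℝ, 0 ≤ K ∧ ∀ (a : ℝ → ℂ) (ha : IsRapid a)
    (σ : ℝ) (u : DistST d) (A : ℝ), (∫ t in Ioi (0 : ℝ), ‖a t * ((1 + t : ℝ) : ℂ) ^ k‖) ≤ A →
    anisoSq k σ u < ⊤ →
    anisoSq k (σ - k) (flowOp ha u) ≤ ENNReal.ofReal (K * A) ^ 2 * anisoSq k σ u := by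
  obtain ⟨C, hC, h⟩ := sobSqDist_modeForm_le (d := d) k
  refine ⟨√C.toReal, sqrt_nonneg _, fun a ha σ u A hA hu => ?_⟩
  have hK : ENNReal.ofReal (√C.toReal * A) ^ 2 = C * ENNReal.ofReal A ^ 2 := by
    rw [ENNReal.ofReal_mul (sqrt_nonneg _), mul_pow, ← ENNReal.ofReal_pow (sqrt_nonneg _),
      Real.sq_sqrt ENNReal.toReal_nonneg, ENNReal.ofReal_toReal hC]
  rw [hK, anisoSq, anisoSq, ← ENNReal.tsum_mul_left]
  refine ENNReal.tsum_le_tsum fun ξ => ?_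
  have hs : sobSqDist k (fourierCoef ξ u) < ⊤ := sphSobSq_lt_top_of_anisoSq hu ξ
  rw [fourierCoef_flowOp ha ξ u (dualNorm_zero_lt_top hs)]
  refine (mul_le_mul_right (h a ha.integrableOn _ _ _ A (ha k) hA hs) _).trans (le_of_eq ?_)
  have hp := one_add_latSq_pos ξ
  rw [norm_latVec_sq, ← ENNReal.ofReal_pow hp.le]
  change _ = _ * (_ * sobSqDist k _)
  have e : (1 + latSq ξ) ^ σ = (1 + latSq ξ) ^ (σ - k) * (1 + latSq ξ) ^ k := by
    rw [← rpow_natCast, ← rpow_add hp]; ring_nf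
  rw [e, ENNReal.ofReal_mul (by positivity)]
  ring

/-! ### Bounded operators between anisotropic spaces -/

section
variable {M M' : ℤ} {N N' : ℝ}

lemma aniso_norm_le {u : Aniso d M N} {v : Aniso d M' N'} {K : ℝ} (hK : 0 ≤ K)
    (h : anisoSq M' N' (v : DistST d) ≤ ENNReal.ofReal K ^ 2 * anisoSq M N (u : DistST d)) :
    ‖v‖ ≤ K * ‖u‖ := by
  rw [aniso_norm_def, aniso_norm_def]
  have h1 := ENNReal.rpow_le_rpow h (by norm_num : (0 : ℝ) ≤ 1 / 2)
  rw [ENNReal.mul_rpow_of_nonneg _ _ (by norm_num), ← ENNReal.rpow_natCast,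
    ← ENNReal.rpow_mul] at h1
  norm_num at h1
  have h2 := ENNReal.toReal_mono (ENNReal.mul_ne_top ENNReal.ofReal_ne_top
    (ENNReal.rpow_ne_top_of_nonneg (by norm_num) u.2.ne)) h1
  rw [ENNReal.toReal_mul, ENNReal.toReal_ofReal hK] at h2
  convert h2 using 2

/-- The bounded operator between anisotropic spaces induced by an operator on distributions. -/
def anisoCLM (T : DistST d →ₗ[ℂ] DistST d) (h : ∃ K : ℝ, 0 ≤ K ∧ ∀ u, anisoSq M N u < ⊤ →
    anisoSq M' N' (T u) ≤ ENNReal.ofReal K ^ 2 * anisoSq M N u) :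
    Aniso d M N →L[ℂ] Aniso d M' N' :=
  (LinearMap.mkContinuousOfExistsBound
    { toFun := fun u => (⟨T u, by
        obtain ⟨K, _, hK⟩ := h
        exact (hK u u.2).trans_lt (ENNReal.mul_lt_top (by finiteness) u.2)⟩ : Aniso d M' N')
      map_add' := fun u v => Subtype.ext (map_add T _ _)
      map_smul' := fun c u => Subtype.ext (map_smul T _ _) }
    (by
      obtain ⟨K, hK0, hK⟩ := h
      refine ⟨K, fun u => ?_⟩
      exact aniso_norm_le hK0 (hK u u.2)))

lemma coe_anisoCLM (T : DistST d →ₗ[ℂ] DistST d) (h : ∃ K : ℝ, 0 ≤ K ∧ ∀ u, anisoSq M N u < ⊤ →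
    anisoSq M' N' (T u) ≤ ENNReal.ofReal K ^ 2 * anisoSq M N u) (u : Aniso d M N) :
    ((anisoCLM T h u : Aniso d M' N') : DistST d) = T u := rfl

end

lemma differentiableAt_of_norm_le_sq {F : Type*} [SeminormedAddCommGroup F] [NormedSpace ℂ F]
    {f : ℂ → F} {f' : F} {s : ℂ} {C : ℝ}
    (h : ∀ s', ‖s' - s‖ ≤ 1 → ‖f s' - f s - (s' - s) • f'‖ ≤ C * ‖s' - s‖ ^ 2) :
    DifferentiableAt ℂ f s := by
  refine HasFDerivAt.differentiableAt (f' := ContinuousLinearMap.toSpanSingleton ℂ f')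
    (HasFDerivAtFilter.of_isLittleO ?_)
  rw [Filter.prod_pure, Asymptotics.isLittleO_map]
  have h1 : (fun s' => f s' - f s - (s' - s) • f') =O[𝓝 s] fun s' => ‖s' - s‖ ^ 2 := by
    refine Asymptotics.IsBigO.of_bound C ?_
    filter_upwards [Metric.closedBall_mem_nhds s one_pos] with s' hs'
    rw [norm_pow, norm_norm]
    exact h s' (by simpa [dist_eq_norm] using hs')
  exact h1.trans_isLittleO (Asymptotics.isLittleO_pow_sub_sub s one_lt_two)

/-! ### The short time part of the resolvent -/

lemma norm_exp_sub_one_sub_le (z : ℂ) :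
    ‖exp z - 1 - z‖ ≤ ‖z‖ ^ 2 * Real.exp ‖z‖ := by
  have h := Complex.norm_exp_sub_sum_le_norm_mul_exp z 2
  simpa [Finset.sum_range_succ, sub_sub] using h

lemma isRapid_cutoff_mul {χ b : ℝ → ℂ} (hχ : ContinuousOn χ (Ici 0)) {R : ℝ}
    (hR : ∀ t, R ≤ t → χ t = 0) (hb : Continuous b) : IsRapid fun t => χ t * b t :=
  isRapid_of_support (hχ.mul hb.continuousOn) (R := R) fun t ht => by rw [hR t ht, zero_mul]

/-- The operator `∫_0^∞ χ(t) e^{-st} e^{-tV*} dt` on distributions, for a cutoff `χ`. -/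
def shortRes [NeZero d] {χ : ℝ → ℂ} (hχ : ContinuousOn χ (Ici 0)) {R : ℝ}
    (hR : ∀ t, R ≤ t → χ t = 0) (s : ℂ) : DistST d →ₗ[ℂ] DistST d :=
  flowOp (isRapid_cutoff_mul hχ hR (b := fun t : ℝ => exp (-s * t)) (by fun_prop))

lemma exists_anisoSq_flowOp_le [NeZero d] {a : ℝ → ℂ} (ha : IsRapid a) (k : ℕ) (σ : ℝ) :
    ∃ K : ℝ, 0 ≤ K ∧ ∀ u : DistST d, anisoSq (k : ℤ) σ u < ⊤ →
      anisoSq (k : ℤ) (σ - k) (flowOp ha u) ≤ ENNReal.ofReal K ^ 2 * anisoSq (k : ℤ) σ u := by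
  obtain ⟨K, hK, h⟩ := anisoSq_flowOp_le (d := d) k
  exact ⟨K * ∫ t in Ioi (0 : ℝ), ‖a t * ((1 + t : ℝ) : ℂ) ^ k‖,
      mul_nonneg hK (integral_nonneg fun _ => norm_nonneg _), fun u hu => h a ha σ u _ le_rfl hu⟩

/-- The operator `∫_0^∞ a(t) e^{-tV*} dt` between anisotropic spaces. -/
def flowCLM [NeZero d] {a : ℝ → ℂ} (ha : IsRapid a) (k : ℕ) (σ : ℝ) :
    Aniso d (k : ℤ) σ →L[ℂ] Aniso d (k : ℤ) (σ - k) :=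
  anisoCLM (flowOp ha) (exists_anisoSq_flowOp_le ha k σ)

lemma coe_flowCLM [NeZero d] {a : ℝ → ℂ} (ha : IsRapid a) (k : ℕ) (σ : ℝ) (u : Aniso d (k : ℤ) σ) :
    (flowCLM ha k σ u : DistST d) = flowOp ha u := rfl

lemma exists_norm_flowCLM_le [NeZero d] (k : ℕ) (σ : ℝ) : ∃ K : ℝ, 0 ≤ K ∧ ∀ (a : ℝ → ℂ)
    (ha : IsRapid a) (A : ℝ), (∫ t in Ioi (0 : ℝ), ‖a t * ((1 + t : ℝ) : ℂ) ^ k‖) ≤ A →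
    ‖flowCLM (d := d) ha k σ‖ ≤ K * A := by
  obtain ⟨K, hK, h⟩ := anisoSq_flowOp_le (d := d) k
  refine ⟨K, hK, fun a ha A hA => ?_⟩
  have hA0 : 0 ≤ K * A := mul_nonneg hK ((integral_nonneg fun _ => norm_nonneg _).trans hA)
  refine ContinuousLinearMap.opNorm_le_bound _ hA0 fun u => aniso_norm_le hA0 ?_
  rw [coe_flowCLM]
  exact h a ha σ u A hA u.2

lemma flowOp_sub_sub [NeZero d] {a b c : ℝ → ℂ} (ha : IsRapid a) (hb : IsRapid b)
    (hc : IsRapid c) (z : ℂ) (hd : IsRapid fun t => a t - b t - z * c t) (u : DistST d) :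
    flowOp ha u - flowOp hb u - z • flowOp hc u = flowOp hd u := by
  refine Subtype.ext (LinearMap.ext fun φ => ?_)
  change (flowOp ha u).1 φ - (flowOp hb u).1 φ - z * (flowOp hc u).1 φ = (flowOp hd u).1 φ
  have h1 := ha.integrableOn_flow u φ
  have h2 := hb.integrableOn_flow u φ
  have h3 := (hc.integrableOn_flow u φ).const_mul z
  simp only [flowOp_apply]
  rw [← integral_const_mul, ← integral_sub h1 h2]
  refine (integral_sub (h1.sub h2) h3).symm.trans ?_
  congr 1; funext t; simp only [Pi.sub_apply]; ring

lemma flowCLM_sub_sub [NeZero d] {a b c : ℝ → ℂ} (ha : IsRapid a) (hb : IsRapid b)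
    (hc : IsRapid c) (z : ℂ) (hd : IsRapid fun t => a t - b t - z * c t) (k : ℕ) (σ : ℝ) :
    flowCLM (d := d) ha k σ - flowCLM (d := d) hb k σ - z • flowCLM (d := d) hc k σ =
      flowCLM (d := d) hd k σ :=
  ContinuousLinearMap.ext fun u => Subtype.ext (flowOp_sub_sub ha hb hc z hd u.1)

lemma norm_exp_taylor_le {t : ℝ} (ht : 0 ≤ t) {s s' : ℂ} (hs' : ‖s' - s‖ ≤ 1) :
    ‖exp (-s' * t) - exp (-s * t) - (s' - s) * (-t * exp (-s * t))‖ ≤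
      ‖exp (-s * t) * (t ^ 2 * exp t)‖ * ‖s' - s‖ ^ 2 := by
  have e2 : exp (-s' * t) - exp (-s * t) - (s' - s) * (-t * exp (-s * t)) =
      exp (-s * t) * (exp (-(s' - s) * t) - 1 - -(s' - s) * t) := by
    rw [mul_sub, mul_sub, ← Complex.exp_add]
    ring_nf
  rw [e2, norm_mul, norm_mul, mul_assoc]
  refine mul_le_mul_of_nonneg_left ((norm_exp_sub_one_sub_le _).trans ?_) (norm_nonneg _)
  have h3 : ‖-(s' - s) * (t : ℂ)‖ = ‖s' - s‖ * t := by
    rw [norm_mul, norm_neg, norm_real, norm_of_nonneg ht]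
  have h4 : ‖(t : ℂ) ^ 2 * exp t‖ = t ^ 2 * Real.exp t := by
    rw [norm_mul, norm_pow, norm_real, norm_of_nonneg ht, Complex.norm_exp]; simp
  rw [h3, h4, mul_pow]
  calc _ ≤ ‖s' - s‖ ^ 2 * t ^ 2 * Real.exp t := by
        gcongr; exact mul_le_of_le_one_left ht hs'
    _ = _ := by ring

set_option maxHeartbeats 1000000 in
lemma differentiable_flowCLM [NeZero d] {χ : ℝ → ℂ} (hχ : ContinuousOn χ (Ici 0)) {R : ℝ}
    (hR : ∀ t, R ≤ t → χ t = 0) (k : ℕ) (σ : ℝ) : Differentiable ℂ fun s : ℂ =>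
      flowCLM (d := d) (isRapid_cutoff_mul hχ hR (b := fun t : ℝ => exp (-s * t))
        (by fun_prop)) k σ := by
  intro s
  obtain ⟨K, hK, h⟩ := exists_norm_flowCLM_le (d := d) k σ
  have hd0 : ∀ s : ℂ, IsRapid fun t : ℝ => χ t * exp (-s * t) := fun s =>
    isRapid_cutoff_mul hχ hR (b := fun t : ℝ => exp (-s * t)) (by fun_prop)
  have hd1 := isRapid_cutoff_mul hχ hR (b := fun t : ℝ => -t * exp (-s * t)) (by fun_prop)
  have hχ' := isRapid_cutoff_mul hχ hR
    (b := fun t : ℝ => exp (-s * t) * (t ^ 2 * exp t)) (by fun_prop)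
  refine differentiableAt_of_norm_le_sq (f' := flowCLM (d := d) hd1 k σ) (C := K * ∫ t in Ioi (0 : ℝ),
    ‖χ t * (exp (-s * t) * (t ^ 2 * exp t)) * ((1 + t : ℝ) : ℂ) ^ k‖)
    fun s' hs' => ?_
  have hb : IsRapid fun t : ℝ => χ t * exp (-s' * t) - χ t * exp (-s * t) -
      (s' - s) * (χ t * (-t * exp (-s * t))) := by
    have := isRapid_cutoff_mul hχ hR (b := fun t : ℝ => exp (-s' * t) -
      exp (-s * t) - (s' - s) * (-t * exp (-s * t))) (by fun_prop)
    convert this using 2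
    ring
  rw [flowCLM_sub_sub (hd0 s') (hd0 s) hd1 (s' - s) hb, mul_assoc]
  refine h _ hb _ ?_
  rw [← integral_mul_const]
  refine setIntegral_mono_on (hb k).norm ((hχ' k).norm.mul_const _) measurableSet_Ioi fun t ht => ?_
  have ht' : (0 : ℝ) ≤ t := le_of_lt ht
  have e : χ t * exp (-s' * t) - χ t * exp (-s * t) -
      (s' - s) * (χ t * (-t * exp (-s * t))) = χ t * (exp (-s' * t) -
      exp (-s * t) - (s' - s) * (-t * exp (-s * t))) := by ring
  have h3 := norm_exp_taylor_le ht' hs'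
  rw [e, norm_mul (χ t * _), norm_mul (χ t * _), norm_mul (χ t), norm_mul (χ t)]
  calc _ ≤ ‖χ t‖ * (‖exp (-s * t) * (t ^ 2 * exp t)‖ * ‖s' - s‖ ^ 2) *
        ‖((1 + t : ℝ) : ℂ) ^ k‖ := by gcongr
    _ = _ := by ring

theorem exists_differentiable_shortRes [NeZero d] {χ : ℝ → ℂ} (hχ : ContinuousOn χ (Ici 0)) {R : ℝ}
    (hR : ∀ t, R ≤ t → χ t = 0) (k : ℕ) (σ : ℝ) :
    ∃ B : ℂ → Aniso d (k : ℤ) σ →L[ℂ] Aniso d (k : ℤ) (σ - k), Differentiable ℂ B ∧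
      ∀ (s : ℂ) (u : Aniso d (k : ℤ) σ), (B s u : DistST d) = shortRes hχ hR s (u : DistST d) :=
  ⟨_, differentiable_flowCLM hχ hR k σ, fun _ _ => rfl⟩


variable {d : ℕ}

/-! ### Completeness of the anisotropic spaces of negative order -/

lemma sphSobSq_neg (k : ℕ) (u : CInfSph d →ₗ[ℂ] ℂ) : sphSobSq (-(k : ℤ)) u = dualNorm k u ^ 2 := by
  cases k <;> rfl

lemma exists_sobTwoSq_le_of_sphBound (k : ℕ) : ∃ C : ℝ, 0 ≤ C ∧ ∀ (f : CInfSph d) (B : ℝ), 0 ≤ B →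
    SphBound k f B → √(sobTwoSq k f) ≤ C * B := by
  have key : ∃ C : ℝ, 0 ≤ C ∧ ∀ (f : CInfSph d) (B : ℝ), 0 ≤ B → SphBound k f B →
      sobTwoSq k f ≤ C * B ^ 2 := by
    set m := (surf d).real univ
    have h0 : ∀ (f : CInfSph d) (B : ℝ), 0 ≤ B → (∀ θ, ‖f.1 θ‖ ≤ B) → lTwoSq f ≤ m * B ^ 2 := by
      intro f B hB h
      have h1 := sqrt_lTwoSq_le_of_bound hB h
      have h2 := pow_le_pow_left₀ (sqrt_nonneg _) h1 2
      rw [Real.sq_sqrt (lTwoSq_nonneg f), mul_pow, Real.sq_sqrt measureReal_nonneg] at h2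
      linarith
    induction k with
    | zero => exact ⟨m, measureReal_nonneg, fun f B hB h => h0 f B hB h⟩
    | succ k ih =>
      obtain ⟨C, hC, ih⟩ := ih
      refine ⟨m + d * (d * C), by positivity, fun f B hB h => ?_⟩
      have h2 : ∑ i, ∑ j, sobTwoSq k (rotDerivSph i j f) ≤ ∑ _i : Fin d, ∑ _j : Fin d, C * B ^ 2 :=
        sum_le_sum fun i _ => sum_le_sum fun j _ => ih _ B hB (h.2 i j)
      simp only [sum_const, card_univ, Fintype.card_fin, nsmul_eq_mul] at h2
      calc sobTwoSq (k + 1) f = lTwoSq f + ∑ i, ∑ j, sobTwoSq k (rotDerivSph i j f) := rfl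
        _ ≤ m * B ^ 2 + d * (d * (C * B ^ 2)) := add_le_add (h0 f B hB h.zero) h2
        _ = _ := by ring
  obtain ⟨C, hC, h⟩ := key
  refine ⟨√C, sqrt_nonneg _, fun f B hB hf => ?_⟩
  rw [← Real.sqrt_sq hB, ← Real.sqrt_mul hC]
  exact sqrt_le_sqrt (h f B hB hf)

lemma dualNorm_le_of_anisoSq {k : ℕ} {σ : ℝ} (hσ : 0 ≤ σ) (u : Aniso d (-(k : ℤ)) σ)
    (ξ : Fin d → ℤ) : dualNorm k (fourierCoef ξ (u : DistST d)) ≤ ENNReal.ofReal ‖u‖ := by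
  have h1 : dualNorm k (fourierCoef ξ (u : DistST d)) ^ 2 ≤ anisoSq (-(k : ℤ)) σ (u : DistST d) := by
    refine le_trans ?_ (ENNReal.le_tsum ξ)
    rw [sphSobSq_neg]
    refine le_mul_of_one_le_left' (ENNReal.one_le_ofReal.2 (Real.one_le_rpow ?_ hσ))
    linarith [latSq_nonneg ξ]
  rw [aniso_norm_def, ENNReal.ofReal_toReal (ENNReal.rpow_ne_top_of_nonneg (by norm_num) u.2.ne)]
  have h2 := ENNReal.rpow_le_rpow h1 (by norm_num : (0 : ℝ) ≤ 1 / 2)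
  rw [← ENNReal.rpow_natCast, ← ENNReal.rpow_mul] at h2
  norm_num at h2
  convert h2 using 2

theorem exists_norm_dist_le_aniso [NeZero d] (k : ℕ) {σ : ℝ} (hσ : 0 ≤ σ) : ∃ (m : ℕ) (C : ℝ),
    0 ≤ C ∧ ∀ (u : Aniso d (-(k : ℤ)) σ) (φ : CInf d) (B : ℝ), CkBound m φ B →
      ‖(u : DistST d).1 φ‖ ≤ C * ‖u‖ * B := by
  obtain ⟨C, hC, h⟩ := exists_sobTwoSq_le_of_sphBound (d := d) k
  set c₀ : ℝ := (2 * π) ^ (-(d : ℝ) / 2)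
  set D : ℝ := C * ((2 * π) ^ d * (1 + d) ^ d)
  have hD : 0 ≤ D := by positivity
  have hc0 : 0 ≤ c₀ := by positivity
  have hsum := summable_latSq d
  refine ⟨k + 2 * d, c₀ * D * ∑' ξ : Fin d → ℤ, ((1 + latSq ξ) ^ d)⁻¹,
    mul_nonneg (by positivity) (tsum_nonneg fun ξ => ?_), fun u φ B hB => ?_⟩
  · have := one_add_latSq_pos ξ; positivity
  have hB0 := hB.nonneg
  rw [← (hasSum_dist (u : DistST d) φ).tsum_eq]
  refine (tsum_of_norm_bounded ((hsum.hasSum).mul_left (c₀ * D * ‖u‖ * B)) fun ξ => ?_).trans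
    (le_of_eq (by ring))
  have hd : dualNorm k (fourierCoef ξ (u : DistST d)) < ⊤ :=
    (dualNorm_le_of_anisoSq hσ u ξ).trans_lt ENNReal.ofReal_lt_top
  have h1 := norm_le_of_dualNorm hd (fcoef ξ φ)
  have h2 : (dualNorm k (fourierCoef ξ (u : DistST d))).toReal ≤ ‖u‖ :=
    ENNReal.toReal_le_of_le_ofReal (norm_nonneg _) (dualNorm_le_of_anisoSq hσ u ξ)
  have hp := one_add_latSq_pos ξ
  have h3 := h _ _ (by positivity) (sphBound_fcoef_decay k d ξ hB)
  rw [norm_mul, norm_real, norm_of_nonneg hc0]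
  calc _ ≤ c₀ * (‖u‖ * (C * ((2 * π) ^ d * (1 + d) ^ d * B * ((1 + latSq ξ) ^ d)⁻¹))) := by
        gcongr
        exact h1.trans (by gcongr)
    _ = _ := by ring

lemma anisoSq_le_of_tendsto {k : ℕ} {σ : ℝ} {w : ℕ → DistST d} {u : DistST d} {E : ℝ≥0∞}
    (h : ∀ φ, Tendsto (fun n => (w n).1 φ) atTop (𝓝 (u.1 φ)))
    (hE : ∀ᶠ n in atTop, anisoSq (-(k : ℤ)) σ (w n) ≤ E) : anisoSq (-(k : ℤ)) σ u ≤ E := by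
  have h1 : ∀ ξ, dualNorm k (fourierCoef ξ u) ^ 2 ≤
      liminf (fun n => dualNorm k (fourierCoef ξ (w n)) ^ 2) atTop := by
    intro ξ
    have hsq : ∀ a : ℝ≥0∞, (a ^ 2) ^ (1 / 2 : ℝ) = a := fun a => by
      rw [← ENNReal.rpow_natCast, ← ENNReal.rpow_mul]; norm_num
    have hsq' : ∀ a : ℝ≥0∞, (a ^ (1 / 2 : ℝ)) ^ 2 = a := fun a => by
      rw [← ENNReal.rpow_natCast, ← ENNReal.rpow_mul]; norm_num
    set L := liminf (fun n => dualNorm k (fourierCoef ξ (w n)) ^ 2) atTop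
    rw [← hsq' L]
    refine pow_le_pow_left' (iSup₂_le fun f hf => ?_) 2
    rw [← hsq ‖_‖ₑ]
    refine ENNReal.rpow_le_rpow ?_ (by norm_num)
    have ht : Tendsto (fun n => ‖fourierCoef ξ (w n) f‖ₑ ^ 2) atTop
        (𝓝 (‖fourierCoef ξ u f‖ₑ ^ 2)) :=
      ENNReal.Tendsto.pow ((h (charTensor (-ξ) f)).const_mul _).enorm
    rw [← ht.liminf_eq]
    exact liminf_le_liminf (.of_forall fun n => pow_le_pow_left'
      (le_iSup₂ (f := fun (f : CInfSph d) (_ : sobSqFun k f ≤ 1) => ‖fourierCoef ξ (w n) f‖ₑ) f hf) 2)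
  have h2 : anisoSq (-(k : ℤ)) σ u ≤ liminf (fun n => anisoSq (-(k : ℤ)) σ (w n)) atTop := by
    simp only [anisoSq, sphSobSq_neg, ← lintegral_count]
    refine le_trans (lintegral_mono fun ξ => ?_) (lintegral_liminf_le fun n => Measurable.of_discrete)
    rw [ENNReal.liminf_const_mul_of_ne_top ENNReal.ofReal_ne_top]
    exact mul_le_mul_right (h1 ξ) _
  refine h2.trans ?_
  exact liminf_le_of_frequently_le' hE.frequently

lemma anisoSq_eq_norm {M : ℤ} {σ : ℝ} (u : Aniso d M σ) :
    anisoSq M σ (u : DistST d) = ENNReal.ofReal ‖u‖ ^ 2 := by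
  rw [aniso_norm_def, ENNReal.ofReal_toReal (ENNReal.rpow_ne_top_of_nonneg (by norm_num) u.2.ne),
    ← ENNReal.rpow_natCast, ← ENNReal.rpow_mul]
  norm_num

lemma aniso_norm_le_of_sq {M : ℤ} {σ : ℝ} {u : Aniso d M σ} {E : ℝ} (hE : 0 ≤ E)
    (h : anisoSq M σ (u : DistST d) ≤ ENNReal.ofReal E ^ 2) : ‖u‖ ≤ E := by
  rw [anisoSq_eq_norm] at h
  have := (ENNReal.pow_le_pow_left_iff two_ne_zero).1 h
  exact (ENNReal.ofReal_le_ofReal_iff hE).1 this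

theorem completeSpace_aniso_neg [NeZero d] (k : ℕ) {σ : ℝ} (hσ : 0 ≤ σ) :
    CompleteSpace (Aniso d (-(k : ℤ)) σ) := by
  obtain ⟨m, C, hC, hb⟩ := exists_norm_dist_le_aniso (d := d) k hσ
  refine Metric.complete_of_cauchySeq_tendsto fun u hu => ?_
  have h1 : ∀ φ : CInf d, ∃ l : ℂ, Tendsto (fun n => (u n : DistST d).1 φ) atTop (𝓝 l) := by
    intro φ
    obtain ⟨B, hB0, hB⟩ := CkBound.exists m φ
    have hl : LipschitzWith ⟨C * B, by positivity⟩
        (fun v : Aniso d (-(k : ℤ)) σ => (v : DistST d).1 φ) :=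
      LipschitzWith.of_dist_le_mul fun v v' => by
        rw [dist_eq_norm, dist_eq_norm]
        have := hb (v - v') φ B hB
        calc _ ≤ C * ‖v - v'‖ * B := this
          _ = C * B * ‖v - v'‖ := by ring
    exact cauchySeq_tendsto_of_complete (hu.map hl.uniformContinuous)
  choose l hl using h1
  obtain ⟨R, hR⟩ := hu.norm_bddAbove
  have hR' : ∀ n, ‖u n‖ ≤ R := fun n => hR ⟨n, rfl⟩
  have hR0 : 0 ≤ R := (norm_nonneg _).trans (hR' 0)
  let v : DistST d := ⟨
    { toFun := l
      map_add' := fun φ ψ => tendsto_nhds_unique (hl (φ + ψ))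
        (((hl φ).add (hl ψ)).congr fun n => (map_add _ _ _).symm)
      map_smul' := fun c φ => tendsto_nhds_unique (hl (c • φ))
        (((hl φ).const_mul c).congr fun n => (map_smul (u n : DistST d).1 c φ).symm) },
    m, C * R, fun φ B hB => le_of_tendsto (hl φ).norm (.of_forall fun n =>
      (hb (u n) φ B hB).trans (by gcongr; exacts [hB.nonneg, hR' n]))⟩
  have hv : anisoSq (-(k : ℤ)) σ v < ⊤ := by
    refine (anisoSq_le_of_tendsto (E := ENNReal.ofReal R ^ 2) hl (.of_forall fun n => ?_)).trans_lt
      (by finiteness)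
    rw [anisoSq_eq_norm]
    exact pow_le_pow_left' (ENNReal.ofReal_le_ofReal (hR' n)) 2
  refine ⟨⟨v, hv⟩, Metric.tendsto_atTop.2 fun ε hε => ?_⟩
  obtain ⟨n₀, hn₀⟩ := Metric.cauchySeq_iff.1 hu (ε / 2) (half_pos hε)
  refine ⟨n₀, fun n hn => ?_⟩
  rw [dist_comm, dist_eq_norm]
  refine lt_of_le_of_lt (aniso_norm_le_of_sq (half_pos hε).le ?_) (half_lt_self hε)
  refine anisoSq_le_of_tendsto (w := fun j => (u j - u n : Aniso d (-(k : ℤ)) σ))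
    (fun φ => (hl φ).sub_const _) ?_
  filter_upwards [eventually_ge_atTop n₀] with j hj
  rw [anisoSq_eq_norm]
  refine pow_le_pow_left' (ENNReal.ofReal_le_ofReal ?_) 2
  have := hn₀ j hj n hn
  rw [dist_eq_norm] at this
  exact this.le

/-! ### Extension to the boundary of locally Hölder functions -/

lemma exists_continuousOn_extension {E : Type*} [SeminormedAddCommGroup E] [CompleteSpace E]
    {A Ω : Set ℂ} (hΩ : Ω ⊆ closure A) (f : ℂ → E) {α : ℝ} (hα : 0 < α)
    (h : ∀ x ∈ Ω, ∃ ε C : ℝ, 0 < ε ∧ ∀ s ∈ A ∩ Metric.ball x ε, ∀ s' ∈ A ∩ Metric.ball x ε,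
      ‖f s - f s'‖ ≤ C * ‖s - s'‖ ^ α) :
    ∃ g : ℂ → E, (∀ s ∈ A, g s = f s) ∧ ContinuousOn g Ω := by
  classical
  have hmod : ∀ (C : ℝ) (x y : ℂ),
      Tendsto (fun p : ℂ × ℂ => C * ‖p.1 - p.2‖ ^ α) (𝓝 x ×ˢ 𝓝 y) (𝓝 (C * ‖x - y‖ ^ α)) := by
    intro C x y
    have hc : Continuous fun p : ℂ × ℂ => C * ‖p.1 - p.2‖ ^ α :=
      continuous_const.mul ((continuous_fst.sub continuous_snd).norm.rpow_const
        fun _ => Or.inr hα.le)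
    rw [← nhds_prod_eq]
    exact hc.tendsto (x, y)
  have hn : ∀ (x : ℂ) (ε : ℝ), 0 < ε → ∀ z ∈ Metric.ball x ε, A ∩ Metric.ball x ε ∈ 𝓝[A] z :=
    fun x ε hε z hz => inter_mem self_mem_nhdsWithin
      (mem_nhdsWithin_of_mem_nhds (Metric.isOpen_ball.mem_nhds hz))
  have hlim : ∀ x ∈ Ω, ∃ y, Tendsto f (𝓝[A] x) (𝓝 y) := by
    intro x hx
    have : (𝓝[A] x).NeBot := mem_closure_iff_nhdsWithin_neBot.1 (hΩ hx)
    rw [← cauchy_map_iff_exists_tendsto]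
    obtain ⟨ε, C, hε, hC⟩ := h x hx
    refine (cauchy_map_iff.2 ⟨inferInstance, ?_⟩)
    rw [Metric.uniformity_eq_comap_nhds_zero, tendsto_comap_iff]
    have hp := hmod C x x
    rw [sub_self, norm_zero, Real.zero_rpow hα.ne', mul_zero] at hp
    refine squeeze_zero' (.of_forall fun _ => dist_nonneg) ?_
      (hp.mono_left (Filter.prod_mono nhdsWithin_le_nhds nhdsWithin_le_nhds))
    have hx := hn x ε hε x (Metric.mem_ball_self hε)
    filter_upwards [prod_mem_prod hx hx] with p hp
    simp only [Function.comp_apply]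
    rw [dist_eq_norm]
    exact hC _ hp.1 _ hp.2
  choose! y hy using hlim
  set g : ℂ → E := fun s => if s ∈ A then f s else y s
  have hzero : ∀ (C : ℝ) (x : ℂ), Tendsto (fun s => C * ‖s - x‖ ^ α) (𝓝 x) (𝓝 0) := fun C x => by
    have := (hmod C x x).comp (tendsto_id.prodMk (tendsto_const_nhds (x := x)))
    simpa [Function.comp_def, Real.zero_rpow hα.ne'] using this
  have hg : ∀ x ∈ Ω, Tendsto f (𝓝[A] x) (𝓝 (g x)) := by
    intro x hx
    by_cases hxA : x ∈ A
    · simp only [g, if_pos hxA]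
      obtain ⟨ε, C, hε, hC⟩ := h x hx
      have hxb := Metric.mem_ball_self (x := x) hε
      rw [tendsto_iff_norm_sub_tendsto_zero]
      refine squeeze_zero' (.of_forall fun _ => norm_nonneg _) ?_
        ((hzero C x).mono_left nhdsWithin_le_nhds)
      filter_upwards [hn x ε hε x hxb] with s hs using hC s hs x ⟨hxA, hxb⟩
    · simp only [g, if_neg hxA]
      exact hy x hx
  refine ⟨g, fun s hs => if_pos hs, fun x hx => ?_⟩
  obtain ⟨ε, C, hε, hC⟩ := h x hx
  have hxb := Metric.mem_ball_self (x := x) hε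
  refine tendsto_iff_norm_sub_tendsto_zero.2 (squeeze_zero' (.of_forall fun _ =>
    norm_nonneg _) ?_ ((hzero C x).mono_left nhdsWithin_le_nhds))
  filter_upwards [self_mem_nhdsWithin, mem_nhdsWithin_of_mem_nhds
    (Metric.isOpen_ball.mem_nhds hxb)] with s hs hsb
  have n1 : (𝓝[A] s).NeBot := mem_closure_iff_nhdsWithin_neBot.1 (hΩ hs)
  have n2 : (𝓝[A] x).NeBot := mem_closure_iff_nhdsWithin_neBot.1 (hΩ hx)
  refine le_of_tendsto_of_tendsto (((hg s hs).comp tendsto_fst).sub ((hg x hx).comp tendsto_snd)).norm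
    ((hmod C s x).mono_left (Filter.prod_mono nhdsWithin_le_nhds nhdsWithin_le_nhds)) ?_
  filter_upwards [prod_mem_prod (hn x ε hε s hsb) (hn x ε hε x hxb)] with p hp
    using hC _ hp.1 _ hp.2


variable {d : ℕ}

/-! ### The long time amplitude -/

lemma iteratedDeriv_affine (α β : ℂ) (k : ℕ) : iteratedDeriv k (fun t : ℝ => α + β * t) =
    fun t : ℝ => if k = 0 then α + β * t else if k = 1 then β else 0 := by
  induction k with
  | zero => simp
  | succ k ih =>
    rw [iteratedDeriv_succ, ih]
    funext t
    rcases k with _ | k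
    · have : HasDerivAt (fun t : ℝ => α + β * t) β t := by
        simpa using ((Complex.ofRealCLM.hasDerivAt (x := t)).const_mul β).const_add α
      simpa using this.deriv
    · rcases k with _ | k <;> simp

lemma isAmp_of_affine {N : ℕ} (hN : 4 ≤ N) {a : ℝ → ℂ} (ha : ContDiff ℝ ∞ a)
    (h0 : ∃ δ : ℝ, 0 < δ ∧ ∀ t, t < δ → a t = 0) {R : ℝ} {α β : ℂ}
    (hR : ∀ t, R < t → a t = α + β * t) : IsAmp N a := by
  have hcont : ∀ k : ℕ, Continuous (iteratedDeriv k a) := fun k =>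
    ha.continuous_iteratedDeriv k (by exact_mod_cast le_top)
  have heq : ∀ (k : ℕ) (t : ℝ), R < t → iteratedDeriv k a t =
      if k = 0 then α + β * t else if k = 1 then β else 0 := fun k t ht => by
    have h1 : a =ᶠ[𝓝 t] fun t : ℝ => α + β * t := by
      filter_upwards [Ioi_mem_nhds ht] with x hx using hR x hx
    rw [h1.iteratedDeriv_eq, iteratedDeriv_affine]
  have hg : ∀ k : ℕ, ∃ C : ℝ, 0 ≤ C ∧ ∀ t, 0 ≤ t → ‖iteratedDeriv k a t‖ ≤ C * (1 + t) := by
    intro k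
    obtain ⟨C, hC⟩ := isCompact_Icc.exists_bound_of_continuousOn (s := Icc 0 R)
      (hcont k).continuousOn
    refine ⟨max C 0 + ‖α‖ + ‖β‖, by positivity, fun t ht => ?_⟩
    rcases le_or_gt t R with htR | htR
    · have := (hC t ⟨ht, htR⟩).trans (le_max_left C 0)
      nlinarith [norm_nonneg α, norm_nonneg β, le_max_right C 0,
        mul_nonneg (le_max_right C 0) ht, mul_nonneg (norm_nonneg α) ht,
        mul_nonneg (norm_nonneg β) ht]
    · rw [heq k t htR]
      have h2 : ‖α + β * t‖ ≤ ‖α‖ + ‖β‖ * t := (norm_add_le _ _).trans (by simp [abs_of_nonneg ht])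
      have h3 := norm_nonneg α
      have h4 := norm_nonneg β
      have h5 := le_max_right C 0
      have : 0 ≤ (max C 0 + ‖α‖) * t := by positivity
      split_ifs
      · nlinarith
      · nlinarith
      · rw [norm_zero]; positivity
  choose C hC0 hC using hg
  have hgrowth : ∃ C : ℝ, 0 ≤ C ∧ ∀ k, k ≤ N → ∀ t, 0 ≤ t → ‖iteratedDeriv k a t‖ ≤ C * (1 + t) := by
    refine ⟨∑ k ∈ Finset.range (N + 1), C k, sum_nonneg fun k _ => hC0 k,
      fun k hk t ht => (hC k t ht).trans (mul_le_mul_of_nonneg_right ?_ (by linarith))⟩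
    exact single_le_sum (fun k _ => hC0 k) (Finset.mem_range.2 (by omega))
  refine ⟨ha, h0, hgrowth, ?_, ?_⟩
  · refine (isRapid_of_support (R := R + 1) (hcont N).continuousOn fun t ht => ?_).integrableOn.norm
    rw [heq N t (by linarith), if_neg (by omega), if_neg (by omega)]
  · obtain ⟨δ, hδ, hz⟩ := h0
    have hm : Measurable fun t : ℝ => ‖a t‖ * (t ^ N)⁻¹ :=
      ha.continuous.measurable.norm.mul ((measurable_id.pow_const N).inv)
    have h2 : IntegrableOn (fun t => ‖a t‖ * (t ^ N)⁻¹) (Ioi (δ / 2)) := by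
      have hrp : IntegrableOn (fun t : ℝ => t ^ (1 - N : ℝ)) (Ioi (δ / 2)) :=
        integrableOn_Ioi_rpow_of_lt (by
          have : (4 : ℝ) ≤ N := by exact_mod_cast hN
          linarith) (half_pos hδ)
      refine Integrable.mono' (hrp.const_mul (C 0 * (1 + 2 / δ))) hm.aestronglyMeasurable
        ((ae_restrict_iff' measurableSet_Ioi).2 (.of_forall fun t ht => ?_))
      have ht' : δ / 2 < t := ht
      have ht0 : 0 < t := (half_pos hδ).trans ht'
      rw [norm_of_nonneg (by positivity), sub_eq_add_neg, rpow_add ht0, Real.rpow_one,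
        Real.rpow_neg ht0.le, rpow_natCast]
      have h3 := hC 0 t ht0.le
      rw [iteratedDeriv_zero] at h3
      have h4 : 1 + t ≤ (1 + 2 / δ) * t := by
        have : 1 ≤ 2 / δ * t := by rw [div_mul_eq_mul_div, le_div_iff₀ hδ]; linarith
        linarith
      have h5 := hC0 0
      calc _ ≤ C 0 * ((1 + 2 / δ) * t) * (t ^ N)⁻¹ := by gcongr; exact h3.trans (by gcongr)
        _ = _ := by ring
    refine (integrableOn_union.2 ⟨(integrableOn_zero (s := Iio δ)).congr_fun (fun t ht => ?_)
      measurableSet_Iio, h2⟩).mono_set fun t _ => ?_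
    · simp [hz t ht]
    · rcases lt_or_ge t δ with h | h
      · exact Or.inl h
      · exact Or.inr (show δ / 2 < t by linarith)

/-- A smooth cutoff near `0` on the half line. -/
structure IsCutoff (χ : ℝ → ℂ) : Prop where
  smooth : ContDiffOn ℝ ∞ χ (Ici 0)
  supp : ∃ R : ℝ, ∀ t : ℝ, R ≤ t → χ t = 0
  one : ∃ δ : ℝ, 0 < δ ∧ ∀ t : ℝ, 0 ≤ t → t < δ → χ t = 1

/-- The function `1 - χ` on the half line, extended by zero. -/
def longAmp (χ : ℝ → ℂ) (t : ℝ) : ℂ := if t ≤ 0 then 0 else 1 - χ t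

lemma longAmp_of_pos {χ : ℝ → ℂ} {t : ℝ} (ht : 0 < t) : longAmp χ t = 1 - χ t := if_neg ht.not_ge

lemma IsCutoff.longAmp_eq_zero {χ : ℝ → ℂ} (hχ : IsCutoff χ) :
    ∃ δ : ℝ, 0 < δ ∧ ∀ t, t < δ → longAmp χ t = 0 := by
  obtain ⟨δ, hδ, h⟩ := hχ.one
  refine ⟨δ, hδ, fun t ht => ?_⟩
  unfold longAmp
  split_ifs with h0
  · rfl
  · rw [h t (not_le.1 h0).le ht, sub_self]

lemma IsCutoff.contDiff_longAmp {χ : ℝ → ℂ} (hχ : IsCutoff χ) : ContDiff ℝ ∞ (longAmp χ) := by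
  obtain ⟨δ, hδ, h⟩ := hχ.longAmp_eq_zero
  rw [contDiff_iff_contDiffAt]
  intro t
  rcases lt_or_ge t δ with ht | ht
  · refine (contDiffAt_const (c := (0 : ℂ))).congr_of_eventuallyEq ?_
    filter_upwards [Iio_mem_nhds ht] with x hx using h x hx
  · have ht0 : 0 < t := hδ.trans_le ht
    refine (contDiffAt_const.sub (hχ.smooth.contDiffAt (Ici_mem_nhds ht0))).congr_of_eventuallyEq
      (f := fun t => 1 - χ t) ?_
    filter_upwards [Ioi_mem_nhds ht0] with x hx using longAmp_of_pos hx

lemma IsCutoff.exists_longAmp_eq_one {χ : ℝ → ℂ} (hχ : IsCutoff χ) :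
    ∃ R : ℝ, ∀ t, R < t → longAmp χ t = 1 := by
  obtain ⟨R, h⟩ := hχ.supp
  refine ⟨max R 0, fun t ht => ?_⟩
  rw [longAmp_of_pos ((le_max_right _ _).trans_lt ht), h t ((le_max_left _ _).trans ht.le), sub_zero]

lemma IsCutoff.isAmp {χ : ℝ → ℂ} (hχ : IsCutoff χ) {N : ℕ} (hN : 4 ≤ N) : IsAmp N (longAmp χ) := by
  obtain ⟨R, hR⟩ := hχ.exists_longAmp_eq_one
  exact isAmp_of_affine hN hχ.contDiff_longAmp hχ.longAmp_eq_zero (R := R) (α := 1) (β := 0) fun t ht => by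
    simp [hR t ht]

lemma IsCutoff.isAmp_mul {χ : ℝ → ℂ} (hχ : IsCutoff χ) {N : ℕ} (hN : 4 ≤ N) :
    IsAmp N fun t => t * longAmp χ t := by
  obtain ⟨R, hR⟩ := hχ.exists_longAmp_eq_one
  obtain ⟨δ, hδ, h⟩ := hχ.longAmp_eq_zero
  exact isAmp_of_affine hN (Complex.ofRealCLM.contDiff.mul hχ.contDiff_longAmp)
    ⟨δ, hδ, fun t ht => by simp [h t ht]⟩ (R := R) (α := 0) (β := 1) fun t ht => by simp [hR t ht]

lemma IsCutoff.exists_norm_longAmp_le {χ : ℝ → ℂ} (hχ : IsCutoff χ) :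
    ∃ C : ℝ, 0 ≤ C ∧ ∀ t, 0 ≤ t → ‖longAmp χ t‖ ≤ C := by
  obtain ⟨R, hR⟩ := hχ.exists_longAmp_eq_one
  obtain ⟨C, hC⟩ := isCompact_Icc.exists_bound_of_continuousOn (s := Icc 0 R)
    hχ.contDiff_longAmp.continuous.continuousOn
  refine ⟨max C 1, by positivity, fun t ht => ?_⟩
  rcases le_or_gt t R with h | h
  · exact (hC t ⟨ht, h⟩).trans (le_max_left _ _)
  · rw [hR t h, norm_one]; exact le_max_right _ _

lemma IsCutoff.isRapid {χ : ℝ → ℂ} (hχ : IsCutoff χ) {b : ℝ → ℂ} (hb : Continuous b) :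
    IsRapid fun t => χ t * b t := by
  obtain ⟨R, hR⟩ := hχ.supp
  exact isRapid_cutoff_mul hχ.smooth.continuousOn hR hb

lemma IsCutoff.isRapid_long {χ : ℝ → ℂ} (hχ : IsCutoff χ) {s : ℂ} (hs : 0 < s.re) :
    IsRapid fun t : ℝ => (1 - χ t) * exp (-s * t) := by
  have := (isRapid_exp hs).sub (hχ.isRapid (b := fun t : ℝ => exp (-s * t)) (by fun_prop))
  convert this using 2
  ring

lemma integral_exp_neg {s : ℂ} (hs : 0 < s.re) :
    ∫ t in Ioi (0 : ℝ), exp (-s * t) = 1 / s := by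
  rw [integral_exp_mul_complex_Ioi (by simpa using hs)]
  simp [neg_div_neg_eq]

lemma IsCutoff.integral_long {χ : ℝ → ℂ} (hχ : IsCutoff χ) {s : ℂ} (hs : 0 < s.re) :
    ∫ t in Ioi (0 : ℝ), longAmp χ t * exp (-s * t) =
      1 / s - ∫ t in Ioi (0 : ℝ), χ t * exp (-s * t) := by
  rw [← integral_exp_neg hs, ← integral_sub (isRapid_exp hs).integrableOn
    (hχ.isRapid (b := fun t : ℝ => exp (-s * t)) (by fun_prop)).integrableOn]
  refine setIntegral_congr_fun measurableSet_Ioi fun t ht => ?_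
  simp only [longAmp_of_pos ht]
  ring

lemma norm_exp_neg_sub_le {s s' : ℂ} (hs : 0 ≤ s.re) (hs' : 0 ≤ s'.re) {t : ℝ} (ht : 0 ≤ t) :
    ‖exp (-s * t) - exp (-s' * t)‖ ≤ t * ‖s - s'‖ := by
  have h := (convex_halfSpace_re_le (0 : ℝ)).norm_image_sub_le_of_norm_deriv_le (𝕜 := ℂ)
    (f := exp) (C := 1) (fun z _ => Complex.differentiableAt_exp) (fun z hz => by
      rw [Complex.deriv_exp, Complex.norm_exp]; exact Real.exp_le_one_iff.2 hz)
    (show (-s' * t) ∈ {z : ℂ | z.re ≤ 0} by simp; positivity)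
    (show (-s * t) ∈ {z : ℂ | z.re ≤ 0} by simp; positivity)
  refine h.trans (le_of_eq ?_)
  rw [one_mul, ← sub_mul, norm_mul, norm_real, norm_of_nonneg ht, mul_comm,
    neg_sub_neg, norm_sub_rev]

lemma norm_exp_neg_sub_le_rpow {s s' : ℂ} (hs : 0 ≤ s.re) (hs' : 0 ≤ s'.re) {t : ℝ} (ht : 0 ≤ t) :
    ‖exp (-s * t) - exp (-s' * t)‖ ≤ 2 * (t * ‖s - s'‖) ^ (1 / 8 : ℝ) := by
  have h0 : 0 ≤ t * ‖s - s'‖ := by positivity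
  rcases le_or_gt (t * ‖s - s'‖) 1 with h | h
  · have := Real.rpow_le_rpow_of_exponent_ge' h0 h (by norm_num : (0 : ℝ) ≤ 1 / 8)
      (by norm_num : (1 / 8 : ℝ) ≤ 1)
    rw [Real.rpow_one] at this
    linarith [norm_exp_neg_sub_le hs hs' ht, Real.rpow_nonneg h0 (1 / 8 : ℝ)]
  · have h1 := Real.one_le_rpow h.le (by norm_num : (0 : ℝ) ≤ 1 / 8)
    have h2 : ∀ z : ℂ, 0 ≤ z.re → ‖exp (-z * t)‖ ≤ 1 := fun z hz => by
      rw [Complex.norm_exp]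
      exact Real.exp_le_one_iff.2 (by simp; positivity)
    linarith [norm_sub_le (exp (-s * t)) (exp (-s' * t)), h2 s hs, h2 s' hs']


variable {d : ℕ}

/-! ### Bounds for the modes of the long time part -/

/-- Uniform bounds for the bilinear forms defined by the Fourier modes of `∫_0^∞ b(t) e^{-tV*} dt`. -/
def IsModeBound (d N : ℕ) (b : ℝ → ℂ) (D : ℝ) : Prop := ∀ (ξ : Fin d → ℤ) (f g : CInfSph d),
  ‖∫ t in Ioi (0 : ℝ), b t * sphInt (f * g * sphExp (t • latVec ξ))‖ ≤
    D * (1 + latSq ξ) ^ (-(N : ℝ) / 2) * (√(sobTwoSq N f) * √(sobTwoSq N g))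

lemma norm_sphInt_mul_mul_sphExp_le (f g : CInfSph d) (v : Euc d) :
    ‖sphInt (f * g * sphExp v)‖ ≤ √(lTwoSq f) * √(lTwoSq g) :=
  (norm_sphInt_mul_sphExp_le _ _).trans (lOne_mul_le f g)

lemma lTwoSq_le_sobTwoSq (k : ℕ) (f : CInfSph d) : lTwoSq f ≤ sobTwoSq k f :=
  le_wordSum lTwoSq_nonneg k f

lemma continuous_sphInt_mul_sphExp (f : CInfSph d) (v : Euc d) :
    Continuous fun t : ℝ => sphInt (f * sphExp (t • v)) := by
  simpa using continuous_sphInt_sphExp f v 1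

lemma IsModeBound.dualNorm_le [NeZero d] {N : ℕ} {b : ℝ → ℂ} {D : ℝ} (hb : IsRapid b)
    (h : IsModeBound d N b D) (hD : 0 ≤ D) (ξ : Fin d → ℤ) (u : DistST d)
    (hu : sobSqDist N (fourierCoef ξ u) < ⊤) :
    dualNorm N (fourierCoef ξ (flowOp hb u)) ≤ ENNReal.ofReal (D * (1 + latSq ξ) ^ (-(N : ℝ) / 2) *
      √(sobSqDist N (fourierCoef ξ u)).toReal) := by
  have hp := one_add_latSq_pos ξ
  refine TorusFlow.dualNorm_le (by positivity) fun f => ?_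
  obtain ⟨p, hp1, hp2⟩ := exists_smooth_approx hu
  rw [fourierCoef_flowOp_apply]
  have hlim : Tendsto (fun n => ∫ t in Ioi (0 : ℝ), b t * sphInt (p n * f * sphExp (t • latVec ξ)))
      atTop (𝓝 (∫ t in Ioi (0 : ℝ), b t * fourierCoef ξ u (sphExp (t • latVec ξ) * f))) := by
    refine tendsto_integral_of_dominated_convergence
      (fun t => ‖b t‖ * (√(sobSqDist N (fourierCoef ξ u)).toReal * √(lTwoSq f)))
      (fun n => hb.integrableOn.aestronglyMeasurable.mul
        (continuous_sphInt_mul_sphExp _ _).aestronglyMeasurable)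
      (hb.integrableOn.norm.mul_const _) (fun n => .of_forall fun t => ?_)
      (.of_forall fun t => ?_)
    · rw [norm_mul]
      refine mul_le_mul_of_nonneg_left ((norm_sphInt_mul_mul_sphExp_le _ _ _).trans ?_) (norm_nonneg _)
      gcongr
      exact (lTwoSq_le_sobTwoSq N _).trans (hp1 n)
    · refine ((hp2 (sphExp (t • latVec ξ) * f)).const_mul (b t)).congr fun n => ?_
      rw [mul_assoc (p n), mul_comm f]
  refine le_of_tendsto hlim.norm (.of_forall fun n => (h ξ (p n) f).trans ?_)
  rw [mul_assoc _ √_]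
  gcongr
  exact hp1 n

theorem IsModeBound.anisoSq_le [NeZero d] {N : ℕ} {b : ℝ → ℂ} {D : ℝ} (hb : IsRapid b)
    (h : IsModeBound d N b D) (hD : 0 ≤ D) (u : DistST d)
    (hu : anisoSq (N : ℤ) (-(N : ℝ) / 2) u < ⊤) :
    anisoSq (-(N : ℤ)) ((N : ℝ) / 2) (flowOp hb u) ≤
      ENNReal.ofReal D ^ 2 * anisoSq (N : ℤ) (-(N : ℝ) / 2) u := by
  rw [anisoSq, anisoSq, ← ENNReal.tsum_mul_left]
  refine ENNReal.tsum_le_tsum fun ξ => ?_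
  have hp := one_add_latSq_pos ξ
  have hs : sobSqDist N (fourierCoef ξ u) < ⊤ := sphSobSq_lt_top_of_anisoSq hu ξ
  rw [sphSobSq_neg]
  change _ ≤ _ * (_ * sobSqDist N _)
  refine (mul_le_mul_right (pow_le_pow_left' (h.dualNorm_le hb hD ξ u hs) 2) _).trans (le_of_eq ?_)
  conv_rhs => rw [← ENNReal.ofReal_toReal hs.ne]
  have hS : 0 ≤ (sobSqDist N (fourierCoef ξ u)).toReal := ENNReal.toReal_nonneg
  rw [← ENNReal.ofReal_pow hD, ← ENNReal.ofReal_pow (by positivity),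
    ← ENNReal.ofReal_mul (by positivity), ← ENNReal.ofReal_mul (by positivity),
    ← ENNReal.ofReal_mul (by positivity), mul_pow, Real.sq_sqrt hS]
  congr 1
  have e : (1 + latSq ξ) ^ ((N : ℝ) / 2) * ((1 + latSq ξ) ^ (-(N : ℝ) / 2)) = 1 := by
    rw [← rpow_add hp, neg_div, add_neg_cancel, Real.rpow_zero]
  linear_combination (D ^ 2 * (1 + latSq ξ) ^ (-(N : ℝ) / 2) *
    (sobSqDist N (fourierCoef ξ u)).toReal) * e

lemma one_le_latSq {ξ : Fin d → ℤ} (hξ : ξ ≠ 0) : 1 ≤ latSq ξ := by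
  obtain ⟨i, hi⟩ := Function.ne_iff.1 hξ
  have h1 : (1 : ℝ) ≤ (ξ i : ℝ) ^ 2 := by
    have : (1 : ℤ) ≤ (ξ i) ^ 2 := by
      have : ξ i ≠ 0 := hi
      have := sq_pos_of_ne_zero this
      omega
    exact_mod_cast this
  exact h1.trans (single_le_sum (f := fun i => (ξ i : ℝ) ^ 2) (fun i _ => sq_nonneg _)
    (Finset.mem_univ i))

lemma one_le_latNorm {ξ : Fin d → ℤ} (hξ : ξ ≠ 0) : 1 ≤ latNorm ξ :=
  Real.one_le_sqrt.2 (one_le_latSq hξ)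

lemma latNorm_sq (ξ : Fin d → ℤ) : latNorm ξ ^ 2 = latSq ξ := Real.sq_sqrt (latSq_nonneg ξ)

lemma exists_unit_latVec {ξ : Fin d → ℤ} (hξ : ξ ≠ 0) :
    ∃ v : Euc d, ‖v‖ = 1 ∧ ∀ t : ℝ, t • latVec ξ = (latNorm ξ * t) • v := by
  have h := one_le_latNorm hξ
  refine ⟨(latNorm ξ)⁻¹ • latVec ξ, ?_, fun t => ?_⟩
  · rw [norm_smul, norm_latVec, norm_inv, norm_of_nonneg (by linarith),
      inv_mul_cancel₀ (by linarith)]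
  · rw [smul_smul]; congr 1; field_simp

lemma finite_latSq_le (M : ℝ) : {ξ : Fin d → ℤ | latSq ξ ≤ M}.Finite := by
  rcases le_or_gt M 0 with hM | hM
  · refine (finite_singleton 0).subset fun ξ hξ => ?_
    by_contra h
    have := one_le_latSq h
    have h2 : latSq ξ ≤ M := hξ
    linarith
  have h := (summable_latSq d).tendsto_cofinite_zero
  have h1 : ∀ᶠ ξ : Fin d → ℤ in cofinite, ((1 + latSq ξ) ^ d)⁻¹ < ((1 + M) ^ d)⁻¹ :=
    h.eventually (gt_mem_nhds (by positivity))
  refine (Filter.eventually_cofinite.1 h1).subset fun ξ hξ => ?_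
  have h2 : latSq ξ ≤ M := hξ
  have h0 := latSq_nonneg ξ
  simp only [mem_ofPred_eq, not_lt]
  gcongr

lemma exists_nonresonant (s₀ : ℂ) : ∃ ε c : ℝ, 0 < ε ∧ ε ≤ 1 / 2 ∧ 0 < c ∧ ∀ ξ : Fin d → ℤ, ξ ≠ 0 →
    s₀ ^ 2 + latSq ξ ≠ 0 → ∀ s ∈ Metric.ball s₀ ε, c ≤ ‖1 + (s / latNorm ξ) ^ 2‖ := by
  set M := 2 * (‖s₀‖ + 1) ^ 2
  have hM : 0 < M := by positivity
  obtain ⟨m, hm, hmin⟩ : ∃ m : ℝ, 0 < m ∧ ∀ ξ : Fin d → ℤ, latSq ξ ≤ M → s₀ ^ 2 + latSq ξ ≠ 0 →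
      m ≤ ‖s₀ ^ 2 + (latSq ξ : ℂ)‖ := by
    set T := {ξ : Fin d → ℤ | latSq ξ ≤ M ∧ s₀ ^ 2 + (latSq ξ : ℂ) ≠ 0}
    have hT : T.Finite := (finite_latSq_le M).subset fun ξ hξ => hξ.1
    rcases T.eq_empty_or_nonempty with hE | hE
    · exact ⟨1, one_pos, fun ξ h1 h2 => (hE.subset (show ξ ∈ T from ⟨h1, h2⟩)).elim⟩
    · obtain ⟨ξ₁, h1, h2⟩ := hT.exists_minimalFor (fun ξ => ‖s₀ ^ 2 + (latSq ξ : ℂ)‖) T hE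
      refine ⟨_, norm_pos_iff.2 h1.2, fun ξ h3 h4 => ?_⟩
      rcases le_total ‖s₀ ^ 2 + (latSq ξ₁ : ℂ)‖ ‖s₀ ^ 2 + (latSq ξ : ℂ)‖ with h | h
      · exact h
      · exact h2 ⟨h3, h4⟩ h
  set K := 2 * ‖s₀‖ + 1
  have hK : 0 < K := by positivity
  refine ⟨min (1 / 2) (m / (2 * K)), min (1 / 2) (m / 2 / M), by positivity, min_le_left _ _,
    by positivity, fun ξ hξ hres s hs => ?_⟩
  have hr1 := one_le_latSq hξ
  have hr : (latNorm ξ : ℂ) ^ 2 = latSq ξ := by exact_mod_cast latNorm_sq ξ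
  have hr0 : (latSq ξ : ℂ) ≠ 0 := by exact_mod_cast (by linarith : latSq ξ ≠ 0)
  rw [Metric.mem_ball, dist_eq_norm] at hs
  have hs1 : ‖s - s₀‖ < 1 / 2 := hs.trans_le (min_le_left _ _)
  have hsn : ‖s‖ ≤ ‖s₀‖ + 1 / 2 := by
    have := norm_add_le s₀ (s - s₀)
    rw [add_sub_cancel] at this
    linarith
  rw [div_pow, hr]
  rcases le_or_gt (latSq ξ) M with h | h
  · refine (min_le_right _ _).trans ?_
    have e : 1 + s ^ 2 / (latSq ξ : ℂ) = (s₀ ^ 2 + latSq ξ + (s - s₀) * (s + s₀)) / latSq ξ := by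
      field_simp; ring
    rw [e, norm_div, norm_real, norm_of_nonneg (by linarith)]
    have h1 := hmin ξ h hres
    have h2 : ‖(s - s₀) * (s + s₀)‖ ≤ m / 2 := by
      rw [norm_mul]
      have h3 : ‖s + s₀‖ ≤ K := by
        have := norm_add_le s s₀
        simp only [K]; linarith
      have h4 : ‖s - s₀‖ ≤ m / (2 * K) := hs.le.trans (min_le_right _ _)
      calc _ ≤ m / (2 * K) * K := by gcongr
        _ = m / 2 := by field_simp
    have h5 := norm_sub_le_norm_add (s₀ ^ 2 + (latSq ξ : ℂ)) ((s - s₀) * (s + s₀))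
    gcongr
    linarith
  · refine (min_le_left _ _).trans ?_
    have h1 : ‖s ^ 2 / (latSq ξ : ℂ)‖ ≤ 1 / 2 := by
      rw [norm_div, norm_pow, norm_real, norm_of_nonneg (by linarith),
        div_le_iff₀ (by linarith)]
      have : ‖s‖ ^ 2 ≤ (‖s₀‖ + 1) ^ 2 := by gcongr; linarith
      simp only [M] at h
      linarith
    have h2 := norm_sub_le_norm_add (1 : ℂ) (s ^ 2 / (latSq ξ : ℂ))
    rw [norm_one] at h2
    linarith

lemma le_weight_of_pow_mul_le {N : ℕ} {ξ : Fin d → ℤ} (hξ : ξ ≠ 0) {X Y : ℝ} (hY : 0 ≤ Y)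
    (h : latNorm ξ ^ N * X ≤ Y) : X ≤ 2 ^ N * Y * (1 + latSq ξ) ^ (-(N : ℝ) / 2) := by
  have h1 := one_le_latNorm hξ
  have hp := one_add_latSq_pos ξ
  have h2 : (1 + latSq ξ) ^ ((N : ℝ) / 2) ≤ (2 * latNorm ξ) ^ N := by
    have : (2 * latNorm ξ) ^ N = ((2 * latNorm ξ) ^ 2) ^ ((N : ℝ) / 2) := by
      rw [← rpow_natCast _ 2, ← Real.rpow_mul (by linarith), ← rpow_natCast]
      congr 1; push_cast; ring
    rw [this]
    refine Real.rpow_le_rpow hp.le ?_ (by positivity)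
    rw [mul_pow, latNorm_sq]
    linarith [one_le_latSq hξ]
  rw [neg_div, Real.rpow_neg hp.le, ← div_eq_mul_inv, le_div_iff₀ (by positivity)]
  rcases le_or_gt X 0 with hX | hX
  · exact (mul_nonpos_of_nonpos_of_nonneg hX (by positivity)).trans (by positivity)
  calc _ ≤ X * (2 * latNorm ξ) ^ N := by gcongr
    _ = 2 ^ N * (latNorm ξ ^ N * X) := by rw [mul_pow]; ring
    _ ≤ _ := by gcongr

lemma norm_div_latNorm_le {ξ : Fin d → ℤ} (hξ : ξ ≠ 0) (s : ℂ) : ‖s / latNorm ξ‖ ≤ ‖s‖ := by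
  have h := one_le_latNorm hξ
  rw [norm_div, norm_real, norm_of_nonneg (by linarith)]
  exact div_le_self (norm_nonneg _) h


variable {d : ℕ}

/-! ### The long time part of the resolvent -/

lemma integral_long_eq_modeInt (χ : ℝ → ℂ) {ξ : Fin d → ℤ} {v : Euc d}
    (hv : ∀ t : ℝ, t • latVec ξ = (latNorm ξ * t) • v) (s : ℂ) (G : CInfSph d) :
    ∫ t in Ioi (0 : ℝ), (1 - χ t) * exp (-s * t) * sphInt (G * sphExp (t • latVec ξ)) =
      modeInt (longAmp χ) v (latNorm ξ) s G := by
  refine setIntegral_congr_fun measurableSet_Ioi fun t ht => ?_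
  simp only [longAmp_of_pos ht, hv]

lemma integral_long_zero (χ : ℝ → ℂ) (s : ℂ) (G : CInfSph d) :
    ∫ t in Ioi (0 : ℝ), (1 - χ t) * exp (-s * t) *
        sphInt (G * sphExp (t • latVec (0 : Fin d → ℤ))) =
      (∫ t in Ioi (0 : ℝ), longAmp χ t * exp (-s * t)) * sphInt G := by
  rw [← integral_mul_const]
  refine setIntegral_congr_fun measurableSet_Ioi fun t ht => ?_
  have h : G * sphExp (t • latVec (0 : Fin d → ℤ)) = G := ext' fun θ => by
    have : latVec (0 : Fin d → ℤ) = 0 := by ext; simp [latVec]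
    simp [sphExp_apply, this]
  simp only [longAmp_of_pos ht, h]

lemma norm_sphInt_mul_le_sobTwo (N : ℕ) (f g : CInfSph d) (v : Euc d) :
    ‖sphInt (f * g * sphExp v)‖ ≤ √(sobTwoSq N f) * √(sobTwoSq N g) :=
  (norm_sphInt_mul_mul_sphExp_le f g v).trans (mul_le_mul
    (sqrt_le_sqrt (lTwoSq_le_sobTwoSq N f)) (sqrt_le_sqrt (lTwoSq_le_sobTwoSq N g))
    (sqrt_nonneg _) (sqrt_nonneg _))

lemma norm_sphInt_mul_le_sobTwo' (N : ℕ) (f g : CInfSph d) :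
    ‖sphInt (f * g)‖ ≤ √(sobTwoSq N f) * √(sobTwoSq N g) := by
  have h := norm_sphInt_mul_le_sobTwo N f g 0
  have e : f * g * sphExp 0 = f * g := ext' fun θ => by simp [sphExp_apply]
  rwa [e] at h

lemma latSq_zero : latSq (0 : Fin d → ℤ) = 0 := by simp [latSq]

theorem IsCutoff.exists_isModeBound {χ : ℝ → ℂ} (hχ : IsCutoff χ) {N : ℕ} (hN : 4 ≤ N) {s : ℂ}
    (hs : 0 < s.re) : ∃ D : ℝ, 0 ≤ D ∧
      IsModeBound d N (fun t => (1 - χ t) * exp (-s * t)) D := by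
  obtain ⟨ε, c, hε, -, hc, hres⟩ := exists_nonresonant (d := d) s
  obtain ⟨C, hC, h⟩ := norm_modeInt_le (d := d) (hχ.isAmp hN) (norm_nonneg s) hc
  obtain ⟨C', hC', h'⟩ := sobOne_mul_le_sobTwo (d := d) N
  set h0 := ‖∫ t in Ioi (0 : ℝ), longAmp χ t * exp (-s * t)‖
  refine ⟨h0 + 2 ^ N * (C * C'), by positivity, fun ξ f g => ?_⟩
  have hp := one_add_latSq_pos ξ
  rcases eq_or_ne ξ 0 with rfl | hξ
  · rw [integral_long_zero, norm_mul, latSq_zero, add_zero, Real.one_rpow, mul_one]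
    refine mul_le_mul ?_ (norm_sphInt_mul_le_sobTwo' N f g) (norm_nonneg _) (by positivity)
    exact le_add_of_nonneg_right (by positivity)
  · obtain ⟨v, hv1, hv⟩ := exists_unit_latVec hξ
    rw [integral_long_eq_modeInt χ hv]
    have hr := one_le_latNorm hξ
    have hne : s ^ 2 + (latSq ξ : ℂ) ≠ 0 := by
      intro h0
      have h1 := congrArg Complex.re h0
      have h2 := congrArg Complex.im h0
      simp [pow_two] at h1 h2
      have h3 : s.im = 0 := by
        rcases mul_eq_zero.1 (by linarith : s.re * s.im = 0) with h | h
        · exact absurd h hs.ne'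
        · exact h
      rw [h3] at h1
      nlinarith [one_le_latSq hξ]
    have h1 := h v _ s (f * g) hv1 (by linarith) hs (norm_div_latNorm_le hξ s)
      (hres ξ hξ hne s (Metric.mem_ball_self hε))
    have h2 := le_weight_of_pow_mul_le hξ (mul_nonneg hC (sobOne_nonneg _ _)) h1
    calc _ ≤ 2 ^ N * (C * (C' * (√(sobTwoSq N f) * √(sobTwoSq N g)))) *
          (1 + latSq ξ) ^ (-(N : ℝ) / 2) := h2.trans (by gcongr; exact h' f g)
      _ = 2 ^ N * (C * C') * (1 + latSq ξ) ^ (-(N : ℝ) / 2) *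
          (√(sobTwoSq N f) * √(sobTwoSq N g)) := by ring
      _ ≤ _ := by gcongr; exact le_add_of_nonneg_left (norm_nonneg _)

lemma le_rpow_eighth {x : ℝ} (h0 : 0 ≤ x) (h1 : x ≤ 1) : x ≤ x ^ (1 / 8 : ℝ) := by
  simpa using Real.rpow_le_rpow_of_exponent_ge' h0 h1 (by norm_num : (0 : ℝ) ≤ 1 / 8)
    (by norm_num : (1 / 8 : ℝ) ≤ 1)

lemma IsCutoff.exists_norm_laplace_sub_le {χ : ℝ → ℂ} (hχ : IsCutoff χ) {m : ℝ} (hm : 0 < m) :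
    ∃ C : ℝ, 0 ≤ C ∧ ∀ s s' : ℂ, 0 < s.re → 0 < s'.re → m ≤ ‖s‖ → m ≤ ‖s'‖ →
      ‖(∫ t in Ioi (0 : ℝ), longAmp χ t * exp (-s * t)) -
        ∫ t in Ioi (0 : ℝ), longAmp χ t * exp (-s' * t)‖ ≤ C * ‖s - s'‖ := by
  have hA := hχ.isRapid (b := fun t : ℝ => (t : ℂ)) (by fun_prop)
  set A := ∫ t in Ioi (0 : ℝ), ‖χ t * (t : ℂ)‖
  have hA0 : 0 ≤ A := integral_nonneg fun _ => norm_nonneg _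
  refine ⟨m⁻¹ * m⁻¹ + A, by positivity, fun s s' hs hs' hms hms' => ?_⟩
  have hs0 : s ≠ 0 := norm_pos_iff.1 (hm.trans_le hms)
  have hs0' : s' ≠ 0 := norm_pos_iff.1 (hm.trans_le hms')
  have h1 : ‖1 / s - 1 / s'‖ ≤ m⁻¹ * m⁻¹ * ‖s - s'‖ := by
    have e : 1 / s - 1 / s' = s⁻¹ * s'⁻¹ * (s' - s) := by field_simp
    rw [e, norm_mul, norm_mul, norm_inv, norm_inv, norm_sub_rev s']
    gcongr
  have h2 : ‖(∫ t in Ioi (0 : ℝ), χ t * exp (-s * t)) -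
      ∫ t in Ioi (0 : ℝ), χ t * exp (-s' * t)‖ ≤ A * ‖s - s'‖ := by
    rw [← integral_sub
      (hχ.isRapid (b := fun t : ℝ => exp (-s * t)) (by fun_prop)).integrableOn
      (hχ.isRapid (b := fun t : ℝ => exp (-s' * t)) (by fun_prop)).integrableOn,
      ← integral_mul_const]
    refine norm_integral_le_of_norm_le (hA.integrableOn.norm.mul_const _)
      ((ae_restrict_iff' measurableSet_Ioi).2 (.of_forall fun t ht => ?_))
    have ht' : (0 : ℝ) ≤ t := le_of_lt ht
    rw [← mul_sub, norm_mul, norm_mul, mul_assoc, norm_real, norm_of_nonneg ht']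
    exact mul_le_mul_of_nonneg_left (norm_exp_neg_sub_le hs.le hs'.le ht') (norm_nonneg _)
  rw [hχ.integral_long hs, hχ.integral_long hs', sub_sub_sub_comm, add_mul]
  exact (norm_sub_le _ _).trans (add_le_add h1 h2)

lemma integrableOn_decay : IntegrableOn
    (fun t : ℝ => if t ≤ 1 then (1 : ℝ) else t ^ (-(9 / 8) : ℝ)) (Ioi 0) := by
  have h1 : IntegrableOn (fun t : ℝ => if t ≤ 1 then (1 : ℝ) else t ^ (-(9 / 8) : ℝ)) (Ioc 0 1) :=
    (integrableOn_const (C := (1 : ℝ)) (by simp)).congr_fun (fun t ht => (if_pos ht.2).symm)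
      measurableSet_Ioc
  have h2 : IntegrableOn (fun t : ℝ => if t ≤ 1 then (1 : ℝ) else t ^ (-(9 / 8) : ℝ)) (Ioi 1) :=
    (integrableOn_Ioi_rpow_of_lt (by norm_num) one_pos).congr_fun
      (fun t ht => (if_neg (not_le.2 ht)).symm) measurableSet_Ioi
  rw [← Ioc_union_Ioi_eq_Ioi zero_le_one]
  exact integrableOn_union.2 ⟨h1, h2⟩

/-- The threshold modes in dimension at least four. -/
lemma IsCutoff.exists_norm_resonant_le (hd : 4 ≤ d) {χ : ℝ → ℂ} (hχ : IsCutoff χ) {N : ℕ}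
    (hN : 4 ≤ N) : ∃ C : ℝ, 0 ≤ C ∧ ∀ (ξ : Fin d → ℤ) (s s' : ℂ) (f g : CInfSph d), ξ ≠ 0 →
      0 ≤ s.re → 0 ≤ s'.re →
      ‖∫ t in Ioi (0 : ℝ), ((1 - χ t) * exp (-s * t) - (1 - χ t) * exp (-s' * t)) *
        sphInt (f * g * sphExp (t • latVec ξ))‖ ≤
          C * ‖s - s'‖ ^ (1 / 8 : ℝ) * (√(sobTwoSq N f) * √(sobTwoSq N g)) := by
  obtain ⟨A, hA, hAb⟩ := hχ.exists_norm_longAmp_le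
  obtain ⟨C, hC, h⟩ := norm_sphInt_mul_sphExp_decay hd
  set q : ℝ → ℝ := fun t => if t ≤ 1 then (1 : ℝ) else t ^ (-(9 / 8) : ℝ)
  have hq0 : 0 ≤ ∫ t in Ioi (0 : ℝ), q t := setIntegral_nonneg measurableSet_Ioi fun t ht => by
    have : (0 : ℝ) < t := ht
    simp only [q]; split_ifs <;> positivity
  refine ⟨A * 2 * (1 + C) * ∫ t in Ioi (0 : ℝ), q t, by positivity,
    fun ξ s s' f g hξ hs hs' => ?_⟩
  obtain ⟨v, hv1, hv⟩ := exists_unit_latVec hξ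
  have hr := one_le_latNorm hξ
  set S := √(sobTwoSq N f) * √(sobTwoSq N g)
  have hS : 0 ≤ S := by positivity
  set δ := ‖s - s'‖ ^ (1 / 8 : ℝ)
  have hδ : 0 ≤ δ := by positivity
  have e : A * 2 * (1 + C) * (∫ t in Ioi (0 : ℝ), q t) * δ * S =
      ∫ t in Ioi (0 : ℝ), A * 2 * (1 + C) * δ * S * q t := by
    rw [integral_const_mul]; ring
  rw [e]
  refine norm_integral_le_of_norm_le (integrableOn_decay.const_mul _)
    ((ae_restrict_iff' measurableSet_Ioi).2 (.of_forall fun t ht => ?_))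
  have ht0 : (0 : ℝ) < t := ht
  rw [← mul_sub, ← longAmp_of_pos ht0, norm_mul, norm_mul]
  have h1 := hAb t ht0.le
  have h2 := norm_exp_neg_sub_le_rpow hs hs' ht0.le
  rw [Real.mul_rpow ht0.le (norm_nonneg _)] at h2
  have h3 : t ^ (1 / 8 : ℝ) * ‖sphInt (f * g * sphExp (t • latVec ξ))‖ ≤ (1 + C) * S * q t := by
    rcases le_or_gt t 1 with ht1 | ht1
    · simp only [q, if_pos ht1, mul_one]
      have h4 := norm_sphInt_mul_le_sobTwo N f g (t • latVec ξ)
      have h5 : t ^ (1 / 8 : ℝ) ≤ 1 := Real.rpow_le_one ht0.le ht1 (by norm_num)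
      calc _ ≤ 1 * S := by gcongr
        _ ≤ _ := by gcongr; linarith
    · simp only [q, if_neg (not_le.2 ht1)]
      have h4 := h v (latNorm ξ * t) f g hv1 (by nlinarith)
      rw [← hv] at h4
      have h5 : (latNorm ξ * t) ^ (-(5 / 4) : ℝ) ≤ t ^ (-(5 / 4) : ℝ) :=
        Real.rpow_le_rpow_of_nonpos ht0 (by nlinarith) (by norm_num)
      have h6 : √(sobTwoSq 4 f) * √(sobTwoSq 4 g) ≤ S :=
        mul_le_mul (sqrt_le_sqrt (wordSum_mono lTwoSq_nonneg hN f))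
          (sqrt_le_sqrt (wordSum_mono lTwoSq_nonneg hN g)) (sqrt_nonneg _)
          (sqrt_nonneg _)
      have h7 : t ^ (1 / 8 : ℝ) * t ^ (-(5 / 4) : ℝ) = t ^ (-(9 / 8) : ℝ) := by
        rw [← rpow_add ht0]; norm_num
      calc _ ≤ t ^ (1 / 8 : ℝ) * (C * t ^ (-(5 / 4) : ℝ) * S) := by
            gcongr
            exact h4.trans (by gcongr)
        _ = C * S * t ^ (-(9 / 8) : ℝ) := by rw [← h7]; ring
        _ ≤ _ := by gcongr; linarith
  calc _ ≤ A * (2 * (t ^ (1 / 8 : ℝ) * δ)) * ‖sphInt (f * g * sphExp (t • latVec ξ))‖ := by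
        gcongr
    _ = A * 2 * δ * (t ^ (1 / 8 : ℝ) * ‖sphInt (f * g * sphExp (t • latVec ξ))‖) := by ring
    _ ≤ A * 2 * δ * ((1 + C) * S * q t) := by gcongr
    _ = _ := by ring

theorem IsCutoff.exists_isModeBound_sub {χ : ℝ → ℂ} (hχ : IsCutoff χ) {N : ℕ} (hN : 4 ≤ N) {s₀ : ℂ}
    (hs₀ : s₀ ≠ 0) (hres : 4 ≤ d ∨ ∀ ξ : Fin d → ℤ, s₀ ^ 2 + (latSq ξ : ℂ) ≠ 0) :
    ∃ ε C : ℝ, 0 < ε ∧ 0 ≤ C ∧ ∀ s ∈ {s : ℂ | 0 < s.re} ∩ Metric.ball s₀ ε,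
      ∀ s' ∈ {s : ℂ | 0 < s.re} ∩ Metric.ball s₀ ε,
      IsModeBound d N (fun t => (1 - χ t) * exp (-s * t) - (1 - χ t) * exp (-s' * t))
        (C * ‖s - s'‖ ^ (1 / 8 : ℝ)) := by
  obtain ⟨ε₁, c, hε₁, hε₁', hc, hnon⟩ := exists_nonresonant (d := d) s₀
  obtain ⟨C₁, hC₁, h₁⟩ := norm_modeInt_sub_le (d := d) (hχ.isAmp hN) (hχ.isAmp_mul hN)
    (K := ‖s₀‖ + 1) (by positivity) hc
  obtain ⟨C', hC', h'⟩ := sobOne_mul_le_sobTwo (d := d) N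
  have hm : 0 < ‖s₀‖ / 2 := half_pos (norm_pos_iff.2 hs₀)
  obtain ⟨C₂, hC₂, h₂⟩ := hχ.exists_norm_laplace_sub_le hm
  obtain ⟨C₃, hC₃, h₃⟩ : ∃ C : ℝ, 0 ≤ C ∧ (4 ≤ d → ∀ (ξ : Fin d → ℤ) (s s' : ℂ) (f g : CInfSph d),
      ξ ≠ 0 → 0 ≤ s.re → 0 ≤ s'.re →
      ‖∫ t in Ioi (0 : ℝ), ((1 - χ t) * exp (-s * t) - (1 - χ t) * exp (-s' * t)) *
        sphInt (f * g * sphExp (t • latVec ξ))‖ ≤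
          C * ‖s - s'‖ ^ (1 / 8 : ℝ) * (√(sobTwoSq N f) * √(sobTwoSq N g))) := by
    by_cases hd : 4 ≤ d
    · obtain ⟨C, hC, h⟩ := hχ.exists_norm_resonant_le hd hN
      exact ⟨C, hC, fun _ => h⟩
    · exact ⟨0, le_rfl, fun h => absurd h hd⟩
  set W := (1 + ‖s₀‖ ^ 2) ^ ((N : ℝ) / 2)
  have hW : 0 ≤ W := by positivity
  set S := {s : ℂ | 0 < s.re} ∩ Metric.ball s₀ (min ε₁ (‖s₀‖ / 2))
  refine ⟨min ε₁ (‖s₀‖ / 2), C₂ + 2 ^ N * (C₁ * C') + C₃ * W, lt_min hε₁ hm, by positivity,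
    fun s hs s' hs' ξ f g => ?_⟩
  have hball : ∀ z ∈ S, 0 < z.re ∧ ‖z - s₀‖ < ε₁ ∧ ‖s₀‖ / 2 ≤ ‖z‖ ∧ ‖z‖ ≤ ‖s₀‖ + 1 := by
    intro z hz
    have h := hz.2
    rw [Metric.mem_ball, dist_eq_norm] at h
    have e1 := h.trans_le (min_le_left _ _)
    have e2 := h.trans_le (min_le_right _ _)
    refine ⟨hz.1, e1, ?_, ?_⟩
    · have := norm_sub_norm_le s₀ z
      rw [norm_sub_rev] at this
      linarith
    · have := norm_sub_norm_le z s₀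
      linarith
  have hδ1 : ‖s - s'‖ ≤ 1 := by
    have e1 := (hball s hs).2.1
    have e2 := (hball s' hs').2.1
    have := norm_sub_le (s - s₀) (s' - s₀)
    rw [sub_sub_sub_cancel_right] at this
    linarith
  have hδ := le_rpow_eighth (norm_nonneg _) hδ1
  set δ := ‖s - s'‖ ^ (1 / 8 : ℝ)
  have hδ0 : 0 ≤ δ := by positivity
  have hp := one_add_latSq_pos ξ
  set T := √(sobTwoSq N f) * √(sobTwoSq N g)
  have hT : 0 ≤ T := by positivity
  have hint : ∀ z : ℂ, 0 < z.re → IntegrableOn (fun t : ℝ => (1 - χ t) * exp (-z * t) *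
      sphInt (f * g * sphExp (t • latVec ξ))) (Ioi 0) := fun z hz => by
    have hb := (hχ.isRapid_long hz).integrableOn
    refine Integrable.mono' (hb.norm.mul_const T) (hb.aestronglyMeasurable.mul
      (continuous_sphInt_mul_sphExp _ _).aestronglyMeasurable) (.of_forall fun t => ?_)
    rw [norm_mul]
    exact mul_le_mul_of_nonneg_left (norm_sphInt_mul_le_sobTwo N f g _) (norm_nonneg _)
  have hsplit := integral_sub (hint s hs.1) (hint s' hs'.1)
  simp only [← sub_mul] at hsplit
  rcases eq_or_ne ξ 0 with rfl | hξ
  · rw [hsplit, integral_long_zero, integral_long_zero, ← sub_mul, norm_mul, latSq_zero, add_zero,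
      Real.one_rpow, mul_one]
    refine mul_le_mul ?_ (norm_sphInt_mul_le_sobTwo' N f g) (norm_nonneg _) (by positivity)
    refine (h₂ s s' hs.1 hs'.1 (hball s hs).2.2.1 (hball s' hs').2.2.1).trans ?_
    calc _ ≤ C₂ * δ := by gcongr
      _ ≤ _ := by gcongr; rw [add_assoc]; exact le_add_of_nonneg_right (by positivity)
  by_cases hr : s₀ ^ 2 + (latSq ξ : ℂ) = 0
  · have hd : 4 ≤ d := hres.resolve_right fun h => h ξ hr
    refine (h₃ hd ξ s s' f g hξ hs.1.le hs'.1.le).trans ?_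
    have hl : latSq ξ = ‖s₀‖ ^ 2 := by
      have := congrArg norm (eq_neg_of_add_eq_zero_left hr)
      rw [norm_pow, norm_neg, norm_real, norm_of_nonneg (latSq_nonneg ξ)] at this
      exact this.symm
    have hw : W * (1 + latSq ξ) ^ (-(N : ℝ) / 2) = 1 := by
      rw [hl, ← rpow_add (by positivity), neg_div, add_neg_cancel, Real.rpow_zero]
    calc C₃ * δ * T = C₃ * W * δ * (1 + latSq ξ) ^ (-(N : ℝ) / 2) * T := by
          linear_combination -(C₃ * δ * T) * hw
      _ ≤ _ := by gcongr; exact le_add_of_nonneg_left (by positivity)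
  · obtain ⟨v, hv1, hv⟩ := exists_unit_latVec hξ
    have hconv : Convex ℝ S := (convex_halfSpace_re_gt 0).inter (convex_ball _ _)
    rw [hsplit, integral_long_eq_modeInt χ hv, integral_long_eq_modeInt χ hv]
    have e1 := h₁ v (latNorm ξ) S (f * g) hv1 (by linarith [one_le_latNorm hξ]) hconv
      (fun z hz => ⟨hz.1, (norm_div_latNorm_le hξ z).trans (hball z hz).2.2.2,
        hnon ξ hξ hr z (by rw [Metric.mem_ball, dist_eq_norm]; exact (hball z hz).2.1)⟩) s hs s' hs'
    have e2 := le_weight_of_pow_mul_le hξ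
      (mul_nonneg (mul_nonneg hC₁ (sobOne_nonneg _ _)) (norm_nonneg _)) e1
    calc _ ≤ 2 ^ N * (C₁ * (C' * T) * δ) * (1 + latSq ξ) ^ (-(N : ℝ) / 2) :=
          e2.trans (by gcongr; exact h' f g)
      _ = 2 ^ N * (C₁ * C') * δ * (1 + latSq ξ) ^ (-(N : ℝ) / 2) * T := by ring
      _ ≤ _ := by gcongr; rw [add_right_comm]; exact le_add_of_nonneg_left (by positivity)

/-- The operator `∫_0^∞ (1 - χ(t)) e^{-st} e^{-tV*} dt` on distributions, for `Re s > 0`. -/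
def longRes [NeZero d] {χ : ℝ → ℂ} (hχ : IsCutoff χ) (s : ℂ) : DistST d →ₗ[ℂ] DistST d :=
  if hs : 0 < s.re then flowOp (hχ.isRapid_long hs) else 0

lemma longRes_of_pos [NeZero d] {χ : ℝ → ℂ} (hχ : IsCutoff χ) {s : ℂ} (hs : 0 < s.re) :
    (longRes hχ s : DistST d →ₗ[ℂ] DistST d) = flowOp (hχ.isRapid_long hs) := dif_pos hs

lemma flowOp_sub [NeZero d] {a b : ℝ → ℂ} (ha : IsRapid a) (hb : IsRapid b) (u : DistST d) :
    flowOp ha u - flowOp hb u = flowOp (ha.sub hb) u := by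
  refine Subtype.ext (LinearMap.ext fun φ => ?_)
  change (flowOp ha u).1 φ - (flowOp hb u).1 φ = (flowOp (ha.sub hb) u).1 φ
  simp only [flowOp_apply]
  rw [← integral_sub (ha.integrableOn_flow u φ) (hb.integrableOn_flow u φ)]
  simp only [sub_mul]

lemma exists_anisoSq_longRes_le [NeZero d] {χ : ℝ → ℂ} (hχ : IsCutoff χ) {N : ℕ} (hN : 4 ≤ N)
    (s : ℂ) : ∃ K : ℝ, 0 ≤ K ∧ ∀ u : DistST d, anisoSq (N : ℤ) (-(N : ℝ) / 2) u < ⊤ →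
      anisoSq (-(N : ℤ)) ((N : ℝ) / 2) (longRes hχ s u) ≤
        ENNReal.ofReal K ^ 2 * anisoSq (N : ℤ) (-(N : ℝ) / 2) u := by
  by_cases hs : 0 < s.re
  · obtain ⟨D, hD, h⟩ := hχ.exists_isModeBound (d := d) hN hs
    refine ⟨D, hD, fun u hu => ?_⟩
    rw [longRes_of_pos hχ hs]
    exact h.anisoSq_le _ hD u hu
  · refine ⟨0, le_rfl, fun u _ => ?_⟩
    rw [longRes, dif_neg hs, LinearMap.zero_apply, (isSqSeminorm_anisoSq _ _).map_zero]
    exact zero_le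

lemma norm_aniso_sub_le {M M' : ℤ} {σ σ' : ℝ} {T T' : Aniso d M σ →L[ℂ] Aniso d M' σ'} {K : ℝ}
    (hK : 0 ≤ K) (h : ∀ u : Aniso d M σ, anisoSq M' σ' ((T u : DistST d) - (T' u : DistST d)) ≤
      ENNReal.ofReal K ^ 2 * anisoSq M σ (u : DistST d)) : ‖T - T'‖ ≤ K :=
  ContinuousLinearMap.opNorm_le_bound _ hK fun u => aniso_norm_le hK (h u)

theorem exists_extension_longRes [NeZero d] {χ : ℝ → ℂ} (hχ : IsCutoff χ) {N : ℕ} (hN : 4 ≤ N)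
    {Ω : Set ℂ} (hΩ : ∀ s ∈ Ω, 0 ≤ s.re ∧ s ≠ 0 ∧
      (4 ≤ d ∨ ∀ ξ : Fin d → ℤ, s ^ 2 + (latSq ξ : ℂ) ≠ 0)) :
    ∃ B : ℂ → Aniso d (N : ℤ) (-(N : ℝ) / 2) →L[ℂ] Aniso d (-(N : ℤ)) ((N : ℝ) / 2),
      (∀ s : ℂ, 0 < s.re → ∀ u : Aniso d (N : ℤ) (-(N : ℝ) / 2),
        (B s u : DistST d) = longRes hχ s (u : DistST d)) ∧ ContinuousOn B Ω := by
  have hcs := completeSpace_aniso_neg (d := d) N (σ := (N : ℝ) / 2) (by positivity)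
  obtain ⟨g, hg1, hg2⟩ := exists_continuousOn_extension (A := {s : ℂ | 0 < s.re}) (Ω := Ω)
    (E := Aniso d (N : ℤ) (-(N : ℝ) / 2) →L[ℂ] Aniso d (-(N : ℤ)) ((N : ℝ) / 2))
    (fun s hs => by rw [Complex.closure_setOfPred_lt_re]; exact (hΩ s hs).1)
    (fun s => anisoCLM (longRes hχ s) (exists_anisoSq_longRes_le hχ hN s))
    (by norm_num : (0 : ℝ) < 1 / 8) (fun x hx => by
      obtain ⟨-, hx0, hx1⟩ := hΩ x hx
      obtain ⟨ε, C, hε, hC, h⟩ := hχ.exists_isModeBound_sub (d := d) hN hx0 hx1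
      refine ⟨ε, C, hε, fun s hs s' hs' => norm_aniso_sub_le (by positivity) fun u => ?_⟩
      rw [coe_anisoCLM, coe_anisoCLM, longRes_of_pos hχ hs.1, longRes_of_pos hχ hs'.1, flowOp_sub]
      exact (h s hs s' hs').anisoSq_le _ (by positivity) _ u.2)
  exact ⟨g, fun s hs u => by rw [hg1 s hs]; rfl, hg2⟩


variable {d : ℕ}

/-! ### The resolvent applied to smooth functions -/

lemma fourierCoef_toDistrib (ξ : Fin d → ℤ) (ψ : CInf d) (f : CInfSph d) :
    fourierCoef ξ (toDistrib ψ) f =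
      (((2 * π) ^ (-(d : ℝ) / 2) : ℝ) : ℂ) * sphInt (fcoef (-ξ) ψ * f) := by
  rw [fourierCoef_apply]
  congr 1
  change ∫ p, ψ.1 p * (charTensor (-ξ) f).1 p ∂((volume : Measure (Torus d)).prod (surf d)) = _
  rw [integral_prod_symm _ (CInf.integrable_mul ψ _), sphInt_apply]
  congr 1; funext θ
  rw [mul_apply, fcoef_apply, ← integral_mul_const]
  congr 1; funext y
  rw [charTensor_apply]
  ring

/-- The contribution of the frequency `ξ` to the pairing of the resolvent of `ψ` with `φ`. -/
def resMode (s : ℂ) (ξ : Fin d → ℤ) (ψ φ : CInf d) : ℂ :=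
  ∫ t in Ioi (0 : ℝ), exp (-s * t) *
    sphInt (fcoef (-ξ) ψ * fcoef ξ φ * sphExp (t • latVec ξ))

lemma hasSum_resMode [NeZero d] {s : ℂ} (hs : 0 < s.re) (ψ φ : CInf d) :
    HasSum (fun ξ => ((2 * π : ℂ) ^ d)⁻¹ * resMode s ξ ψ φ)
      ((flowOp (isRapid_exp hs) (toDistrib ψ)).1 φ) := by
  refine (hasSum_dist (flowOp (isRapid_exp hs) (toDistrib ψ)) φ).congr_fun fun ξ => ?_
  rw [fourierCoef_flowOp_apply, resMode, ← integral_const_mul, ← integral_const_mul]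
  congr 1; funext t
  rw [fourierCoef_toDistrib, mul_comm (sphExp _), ← mul_assoc (fcoef (-ξ) ψ)]
  have h : (((2 * π : ℂ)) ^ d)⁻¹ = (((2 * π) ^ (-(d : ℝ) / 2) : ℝ) : ℂ) *
      (((2 * π) ^ (-(d : ℝ) / 2) : ℝ) : ℂ) := by
    rw [← Complex.ofReal_mul, ← rpow_add two_pi_pos, add_halves,
      Real.rpow_neg Real.two_pi_pos.le, rpow_natCast]
    push_cast; ring
  rw [h]
  ring

theorem IsCutoff.exists_norm_nonresonant_le {χ : ℝ → ℂ} (hχ : IsCutoff χ) (s₀ : ℂ) :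
    ∃ ε D : ℝ, 0 < ε ∧ 0 ≤ D ∧ ∀ s : ℂ, 0 < s.re → s ∈ Metric.ball s₀ ε → ∀ ξ : Fin d → ℤ,
      s₀ ^ 2 + (latSq ξ : ℂ) ≠ 0 → ∀ f g : CInfSph d,
      ‖∫ t in Ioi (0 : ℝ), exp (-s * t) * sphInt (f * g * sphExp (t • latVec ξ))‖ ≤
        D * (√(sobTwoSq 4 f) * √(sobTwoSq 4 g)) := by
  obtain ⟨ε₁, c, hε₁, hε₁', hc, hnon⟩ := exists_nonresonant (d := d) s₀
  obtain ⟨C₁, hC₁, h₁⟩ := norm_modeInt_le (d := d) (hχ.isAmp le_rfl)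
    (K := ‖s₀‖ + 1) (by positivity) hc
  obtain ⟨C', hC', h'⟩ := sobOne_mul_le_sobTwo (d := d) 4
  have hA := hχ.isRapid (b := fun _ : ℝ => (1 : ℂ)) continuous_const
  set A := ∫ t in Ioi (0 : ℝ), ‖χ t * 1‖
  have hA0 : 0 ≤ A := integral_nonneg fun _ => norm_nonneg _
  obtain ⟨m, hm, hm'⟩ : ∃ m : ℝ, 0 < m ∧ (s₀ ≠ 0 → m = ‖s₀‖ / 2) := by
    by_cases h : s₀ = 0
    · exact ⟨1, one_pos, fun h' => absurd h h'⟩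
    · exact ⟨‖s₀‖ / 2, half_pos (norm_pos_iff.2 h), fun _ => rfl⟩
  refine ⟨min ε₁ m, m⁻¹ + (A + C₁ * C'), lt_min hε₁ hm, by positivity,
    fun s hs hsb ξ hres f g => ?_⟩
  rw [Metric.mem_ball, dist_eq_norm] at hsb
  have hb1 := hsb.trans_le (min_le_left _ _)
  have hb2 := hsb.trans_le (min_le_right _ _)
  set T := √(sobTwoSq 4 f) * √(sobTwoSq 4 g)
  have hT : 0 ≤ T := by positivity
  rcases eq_or_ne ξ 0 with rfl | hξ
  · have hs0 : s₀ ≠ 0 := by rintro rfl; simp [latSq_zero] at hres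
    have h0 := integral_long_zero (0 : ℝ → ℂ) s (f * g)
    simp only [Pi.zero_apply, sub_zero, one_mul] at h0
    have h2 : ∫ t in Ioi (0 : ℝ), longAmp 0 t * exp (-s * t) = 1 / s := by
      rw [← integral_exp_neg hs]
      refine setIntegral_congr_fun measurableSet_Ioi fun t ht => ?_
      simp [longAmp_of_pos ht]
    rw [h0, h2, norm_mul]
    refine mul_le_mul ?_ (norm_sphInt_mul_le_sobTwo' 4 f g) (norm_nonneg _) (by positivity)
    have hms : m ≤ ‖s‖ := by
      have := norm_sub_norm_le s₀ s
      rw [norm_sub_rev] at this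
      linarith [hm' hs0]
    rw [norm_div, norm_one, one_div]
    exact (inv_anti₀ hm hms).trans (le_add_of_nonneg_right (by positivity))
  · obtain ⟨v, hv1, hv⟩ := exists_unit_latVec hξ
    have hsn : ‖s‖ ≤ ‖s₀‖ + 1 := by
      have := norm_sub_norm_le s s₀
      linarith
    have e1 := h₁ v (latNorm ξ) s (f * g) hv1 (by linarith [one_le_latNorm hξ]) hs
      ((norm_div_latNorm_le hξ s).trans hsn)
      (hnon ξ hξ hres s (by rw [Metric.mem_ball, dist_eq_norm]; exact hb1))
    have e2 : ‖modeInt (longAmp χ) v (latNorm ξ) s (f * g)‖ ≤ C₁ * (C' * T) := by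
      refine le_trans ?_ (e1.trans (by gcongr; exact h' f g))
      exact le_mul_of_one_le_left (norm_nonneg _) (one_le_pow₀ (one_le_latNorm hξ))
    have hint : ∀ {b : ℝ → ℂ}, IntegrableOn b (Ioi (0 : ℝ)) volume →
        IntegrableOn (fun t : ℝ => b t * sphInt (f * g * sphExp (t • latVec ξ))) (Ioi 0) := by
      intro b hb
      refine Integrable.mono' (hb.norm.mul_const T) (hb.aestronglyMeasurable.mul
        (continuous_sphInt_mul_sphExp _ _).aestronglyMeasurable) (.of_forall fun t => ?_)
      rw [norm_mul]
      exact mul_le_mul_of_nonneg_left (norm_sphInt_mul_le_sobTwo 4 f g _) (norm_nonneg _)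
    have i1 := (hχ.isRapid (b := fun t : ℝ => exp (-s * t)) (by fun_prop)).integrableOn
    have e3 : ∫ t in Ioi (0 : ℝ), exp (-s * t) * sphInt (f * g * sphExp (t • latVec ξ)) =
        (∫ t in Ioi (0 : ℝ), χ t * exp (-s * t) * sphInt (f * g * sphExp (t • latVec ξ))) +
          modeInt (longAmp χ) v (latNorm ξ) s (f * g) := by
      rw [← integral_long_eq_modeInt χ hv, ← integral_add (hint i1)
        (hint (hχ.isRapid_long hs).integrableOn)]
      congr 1; funext t; ring
    have e4 : ‖∫ t in Ioi (0 : ℝ), χ t * exp (-s * t) *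
        sphInt (f * g * sphExp (t • latVec ξ))‖ ≤ A * T := by
      rw [← integral_mul_const]
      refine norm_integral_le_of_norm_le (hA.integrableOn.norm.mul_const _)
        ((ae_restrict_iff' measurableSet_Ioi).2 (.of_forall fun t ht => ?_))
      have ht' : (0 : ℝ) < t := ht
      rw [mul_one, norm_mul, norm_mul, norm_exp_neg_mul]
      refine mul_le_mul (mul_le_of_le_one_right (norm_nonneg _) (Real.exp_le_one_iff.2 ?_))
        (norm_sphInt_mul_le_sobTwo 4 f g _) (norm_nonneg _) (norm_nonneg _)
      have : 0 ≤ s.re * t := by positivity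
      linarith
    rw [e3]
    refine (norm_add_le _ _).trans ((add_le_add e4 e2).trans ?_)
    linarith [mul_nonneg (inv_nonneg.2 hm.le) hT]

/-- The inverse of `V + s` on distributions, for `Re s > 0`. -/
def resolvent [NeZero d] (s : ℂ) : DistST d →ₗ[ℂ] DistST d :=
  if hs : 0 < s.re then flowOp (isRapid_exp hs) else 0

lemma resolvent_of_pos [NeZero d] {s : ℂ} (hs : 0 < s.re) :
    (resolvent s : DistST d →ₗ[ℂ] DistST d) = flowOp (isRapid_exp hs) := dif_pos hs

theorem IsCutoff.isBoundedDist_sub_resMode [NeZero d] {χ : ℝ → ℂ} (hχ : IsCutoff χ) {s₀ : ℂ}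
    (R : Finset (Fin d → ℤ)) (hR : ∀ ξ, ξ ∉ R → s₀ ^ 2 + (latSq ξ : ℂ) ≠ 0) (ψ : CInf d) :
    IsBoundedDist (𝓝[{s : ℂ | 0 < s.re}] s₀) (fun s φ => (resolvent s (toDistrib ψ)).1 φ -
      ∑ ξ ∈ R, ((2 * π : ℂ) ^ d)⁻¹ * resMode s ξ ψ φ) := by
  classical
  obtain ⟨ε, D, hε, hD, h⟩ := hχ.exists_norm_nonresonant_le (d := d) s₀
  obtain ⟨C, hC, hs⟩ := exists_sobTwoSq_le_of_sphBound (d := d) 4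
  obtain ⟨P, hP0, hP⟩ := CkBound.exists (4 + 2 * 0) ψ
  have hψ : ∀ ξ, √(sobTwoSq 4 (fcoef ξ ψ)) ≤ C * ((2 * π) ^ d * P) := fun ξ => by
    have h1 := sphBound_fcoef_decay 4 0 ξ hP
    simp only [pow_zero, inv_one, mul_one] at h1
    exact hs _ _ (by positivity) h1
  set p : ℝ := ‖((2 * π : ℂ) ^ d)⁻¹‖
  set K : ℝ := p * (D * (C * ((2 * π) ^ d * P) * (C * ((2 * π) ^ d * (1 + d) ^ d))))
  have hK : 0 ≤ K := by positivity
  refine ⟨4 + 2 * d, K * ∑' ξ : Fin d → ℤ, ((1 + latSq ξ) ^ d)⁻¹, ?_⟩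
  filter_upwards [self_mem_nhdsWithin, mem_nhdsWithin_of_mem_nhds (Metric.ball_mem_nhds s₀ hε)]
    with s hs0 hsb φ B hB
  have hB0 := hB.nonneg
  rw [resolvent_of_pos hs0]
  have hsum := hasSum_resMode hs0 ψ φ
  have hfin : HasSum (fun ξ => if ξ ∈ R then ((2 * π : ℂ) ^ d)⁻¹ * resMode s ξ ψ φ else 0)
      (∑ ξ ∈ R, ((2 * π : ℂ) ^ d)⁻¹ * resMode s ξ ψ φ) := by
    have := hasSum_sum_of_ne_finset_zero (L := SummationFilter.unconditional _) (s := R) (f := fun ξ => if ξ ∈ R then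
      ((2 * π : ℂ) ^ d)⁻¹ * resMode s ξ ψ φ else 0) (fun ξ hξ => if_neg hξ)
    rwa [sum_congr rfl fun ξ hξ => if_pos hξ] at this
  rw [← (hsum.sub hfin).tsum_eq]
  refine (tsum_of_norm_bounded ((summable_latSq d).hasSum.mul_left (K * B)) fun ξ => ?_).trans
    (le_of_eq (by ring))
  have hp := one_add_latSq_pos ξ
  by_cases hξ : ξ ∈ R
  · rw [if_pos hξ, sub_self, norm_zero]
    positivity
  · rw [if_neg hξ, sub_zero, norm_mul]
    have h1 := h s hs0 hsb ξ (hR ξ hξ) (fcoef (-ξ) ψ) (fcoef ξ φ)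
    have h2 := hs _ _ (by positivity) (sphBound_fcoef_decay 4 d ξ hB)
    calc _ ≤ p * (D * (C * ((2 * π) ^ d * P) *
          (C * ((2 * π) ^ d * (1 + d) ^ d * B * ((1 + latSq ξ) ^ d)⁻¹)))) := by
          gcongr
          exact h1.trans (by gcongr; exact hψ _)
      _ = _ := by simp only [K]; ring

lemma resMode_zero {s : ℂ} (hs : 0 < s.re) (ψ φ : CInf d) :
    resMode s 0 ψ φ = 1 / s * averagePairing ψ φ := by
  have h0 := integral_long_zero (0 : ℝ → ℂ) s (fcoef (-0) ψ * fcoef 0 φ)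
  simp only [Pi.zero_apply, sub_zero, one_mul] at h0
  rw [resMode, h0, ← integral_exp_neg hs]
  congr 1
  · refine setIntegral_congr_fun measurableSet_Ioi fun t ht => ?_
    simp [longAmp_of_pos ht]
  · rw [sphInt_apply, averagePairing]
    congr 1; funext θ
    simp [fcoef_apply, torusChar_zero]

theorem isBoundedDist_resolvent_sub_average [NeZero d] {χ : ℝ → ℂ} (hχ : IsCutoff χ) (ψ : CInf d) :
    IsBoundedDist (𝓝[{s : ℂ | 0 < s.re}] 0) (fun s φ => (resolvent s (toDistrib ψ)).1 φ -
      1 / ((2 * π : ℂ) ^ d * s) * averagePairing ψ φ) := by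
  obtain ⟨k, C, h⟩ := hχ.isBoundedDist_sub_resMode (s₀ := 0) {0} (fun ξ hξ => by
    have := one_le_latSq (ξ := ξ) (by simpa using hξ)
    simp only [ne_eq, zero_pow two_ne_zero, zero_add]
    exact_mod_cast (by linarith : latSq ξ ≠ 0)) ψ
  refine ⟨k, C, ?_⟩
  filter_upwards [h, self_mem_nhdsWithin] with s hs hs0 φ B hB
  have := hs φ B hB
  rw [Finset.sum_singleton, resMode_zero hs0] at this
  convert this using 3
  rw [one_div, mul_inv, one_div]
  ring


variable {d : ℕ}

/-! ### Oscillatory integrals of functions vanishing at the poles -/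

lemma integral_regP_rpow_le {b : ℝ} (hb0 : 0 ≤ b) (hb1 : b ≤ 1) (hbd : 2 * b < d - 1) :
    ∃ C : ℝ, 0 ≤ C ∧ ∀ (v : Euc d) (ε : ℝ), ‖v‖ = 1 → 0 < ε → ε ≤ 1 →
      ∫ θ, regP v ε θ ^ (-b) ∂(surf d) ≤ C := by
  set c : ℝ := d - 1 - 2 * b
  have hc : 0 < c := by simp only [c]; linarith
  refine ⟨2 / c * (c + 1 + 1 / c) * (2 * (surf d).real univ), by positivity,
    fun v ε hv hε hε1 => ?_⟩
  have h1 := hardy_step hv hε hb0 hc (by simp only [c]; ring) (1 : CInfSph d)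
  have h0 : ∀ b', regSq v ε b' (1 : CInfSph d) = ∫ θ, regP v ε θ ^ (-b') ∂(surf d) := fun b' => by
    simp [regSq]
  have h2 : wordSum (regSq v ε (b - 1)) 1 (1 : CInfSph d) = ∫ θ, regP v ε θ ^ (1 - b) ∂(surf d) := by
    have e : wordSum (regSq v ε (b - 1)) 1 (1 : CInfSph d) = regSq v ε (b - 1) 1 +
      ∑ i, ∑ j, regSq v ε (b - 1) (rotDerivSph i j 1) := rfl
    rw [e, h0, neg_sub]
    simp [rotDerivSph_one, regSq]
  rw [h0, h2] at h1
  refine h1.trans (mul_le_mul_of_nonneg_left ?_ (by positivity))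
  have h3 := integral_mono (μ := surf d) (integrable_of_continuous_sph
    (by simpa using continuous_regP_rpow hv hε (b - 1))) (integrable_const (2 : ℝ))
    fun θ => (show regP v ε θ ^ (1 - b) ≤ 2 from ?_)
  · simpa [mul_comm] using h3
  · have hg := regP_pos hv hε θ
    calc regP v ε θ ^ (1 - b) ≤ 2 ^ (1 - b) :=
          Real.rpow_le_rpow hg.le (regP_le_two hε1 θ) (by linarith)
      _ ≤ 2 ^ (1 : ℝ) := Real.rpow_le_rpow_of_exponent_le (by norm_num) (by linarith)
      _ = 2 := by norm_num

theorem norm_sphInt_mul_sphExp_le_of_poles {b : ℝ} (hb0 : 0 ≤ b) (hb1 : b ≤ 1)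
    (hbd : 2 * b < d - 1) : ∃ C : ℝ, 0 ≤ C ∧ ∀ (v : Euc d) (F : CInfSph d) (M l : ℝ), ‖v‖ = 1 →
      0 ≤ M → 1 ≤ l → (∀ θ, ‖F.1 θ‖ + ‖(gradField v F).1 θ‖ + ‖(gradField v (gradField v F)).1 θ‖ ≤
        M * (1 - inner ℝ v (θ : Euc d) ^ 2) ^ (5 / 4 - b)) →
      ‖sphInt (F * sphExp (l • v))‖ ≤ C * M * l ^ (-(5 / 4) : ℝ) := by
  obtain ⟨C, hC, h⟩ := integral_regP_rpow_le (d := d) hb0 hb1 hbd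
  refine ⟨4 * (d + 11) ^ 2 * C, by positivity, fun v F M l hv hM hl hF => ?_⟩
  have hl0 : 0 < l := by linarith
  obtain ⟨ε, rfl⟩ : ∃ ε : ℝ, l = ε⁻¹ := ⟨l⁻¹, (inv_inv l).symm⟩
  have hε : 0 < ε := inv_pos.1 hl0
  have hε1 : ε ≤ 1 := (one_le_inv₀ hε).1 hl
  rw [sphInt_regOp_regOp hv hε, norm_mul, norm_pow, norm_real, norm_of_nonneg hε.le]
  set K := regOp hv hε (regOp hv hε F) +
        (-(2 * I)) • (sphLin v * regRatio hv hε * regOp hv hε F)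
  have hfin : ‖sphInt (sphReg hv hε 1 * (sphReg hv hε 1 * K) * sphExp (ε⁻¹ • v))‖ ≤
      4 * (d + 11) ^ 2 * M * ε ^ (-(3 / 4) : ℝ) * C := by
    refine (norm_integral_le_of_norm_le ((integrable_of_continuous_sph
      (continuous_regP_rpow hv hε b)).const_mul (4 * (d + 11) ^ 2 * M * ε ^ (-(3 / 4) : ℝ)))
      (.of_forall fun θ => ?_)).trans ?_
    · have k1 := (norm_regOp_regOp_le hv hε F θ).trans (mul_le_mul_of_nonneg_left (hF θ) (by positivity))
      have hg := regP_pos hv hε θ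
      have hin := inner_sq_le_one hv θ
      have hgε : ε ≤ regP v ε θ := by unfold regP; linarith
      have k2 : (1 - inner ℝ v (θ : Euc d) ^ 2) ^ (5 / 4 - b) ≤ regP v ε θ ^ (5 / 4 - b) :=
        Real.rpow_le_rpow (by linarith) (by unfold regP; linarith) (by linarith)
      simp only [mul_apply, norm_mul, norm_sphExp_apply, mul_one, norm_sphReg_one_le]
      have k3 : (regP v ε θ)⁻¹ * ((regP v ε θ)⁻¹ * regP v ε θ ^ (5 / 4 - b)) =
          regP v ε θ ^ (-(3 / 4) : ℝ) * regP v ε θ ^ (-b) := by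
        rw [← Real.rpow_neg_one, ← rpow_add hg, ← rpow_add hg, ← rpow_add hg]
        congr 1; ring
      have k4 : regP v ε θ ^ (-(3 / 4) : ℝ) ≤ ε ^ (-(3 / 4) : ℝ) :=
        Real.rpow_le_rpow_of_nonpos hε hgε (by norm_num)
      have hi := inv_pos.2 hg
      calc _ ≤ (regP v ε θ)⁻¹ * ((regP v ε θ)⁻¹ *
            (4 * (d + 11) ^ 2 * (M * regP v ε θ ^ (5 / 4 - b)))) := by
            gcongr
            exact k1.trans (by gcongr)
        _ = 4 * (d + 11) ^ 2 * M * ((regP v ε θ)⁻¹ * ((regP v ε θ)⁻¹ * regP v ε θ ^ (5 / 4 - b))) := by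
            ring
        _ ≤ 4 * (d + 11) ^ 2 * M * (ε ^ (-(3 / 4) : ℝ) * regP v ε θ ^ (-b)) := by rw [k3]; gcongr
        _ = _ := by ring
    · rw [integral_const_mul]
      exact mul_le_mul_of_nonneg_left (h v ε hv hε hε1) (by positivity)
  have hpow : ε ^ 2 * ε ^ (-(3 / 4) : ℝ) = ε⁻¹ ^ (-(5 / 4) : ℝ) := by
    rw [Real.inv_rpow hε.le, ← Real.rpow_neg hε.le, ← rpow_natCast, ← rpow_add hε]
    norm_num
  calc _ ≤ ε ^ 2 * (4 * (d + 11) ^ 2 * M * ε ^ (-(3 / 4) : ℝ) * C) := by gcongr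
    _ = (ε ^ 2 * ε ^ (-(3 / 4) : ℝ)) * (4 * (d + 11) ^ 2 * C * M) := by ring
    _ = _ := by rw [hpow]; ring


variable {d : ℕ}

/-! ### Growth away from a point of the sphere -/

lemma sum_rotField_eq {c w : Euc d} (hc : ‖c‖ = 1) (hw : inner ℝ c w = 0) :
    ∑ i, ∑ j, (c i * w j) • rotField i j c = w := by
  have h1 : ∑ i, c i * c i = 1 := by
    have := EuclideanSpace.real_norm_sq_eq c
    rw [hc] at this
    simp only [← pow_two, ← this]; norm_num
  have h2 : ∑ i, c i * w i = 0 := by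
    simpa [PiLp.inner_apply, mul_comm] using hw
  ext k
  simp only [rotField, WithLp.ofLp_sum, Finset.sum_apply, PiLp.smul_apply, PiLp.sub_apply,
    PiLp.single_apply, smul_eq_mul, mul_sub, sum_sub_distrib]
  simp only [mul_ite, mul_one, mul_zero, Finset.sum_ite_eq, Finset.mem_univ, if_true]
  have e1 : ∑ i, c i * w k * c i = (∑ i, c i * c i) * w k := by
    rw [sum_mul]; exact sum_congr rfl fun i _ => by ring
  have e2 : ∑ i, ∑ j, (if k = i then c i * w j * c j else 0) = (∑ i, c i * w i) * c k := by
    rw [Finset.sum_comm, sum_mul]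
    refine sum_congr rfl fun j _ => ?_
    simp only [Finset.sum_ite_eq, Finset.mem_univ, if_true]; ring
  rw [e1, e2, h1, h2]; ring

lemma norm_le_of_rotDerivSph_le (p θ : Sph d) (hτ : 0 ≤ inner ℝ (p : Euc d) (θ : Euc d))
    {f : CInfSph d} {M : ℝ} (h0 : f.1 p = 0)
    (hM : ∀ θ' : Sph d, inner ℝ (p : Euc d) (θ : Euc d) ≤ inner ℝ (p : Euc d) (θ' : Euc d) →
      ∑ i, ∑ j, ‖(rotDerivSph i j f).1 θ'‖ ≤ M) :
    ‖f.1 θ‖ ≤ 2 * M * √(1 - inner ℝ (p : Euc d) (θ : Euc d) ^ 2) := by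
  set τ := inner ℝ (p : Euc d) (θ : Euc d) with hτdef
  have hp := sph_norm p
  have hθ := sph_norm θ
  have hM0 : 0 ≤ M := le_trans (by positivity) (hM θ le_rfl)
  have hτ1 : τ ≤ 1 := by
    have := real_inner_le_norm (p : Euc d) (θ : Euc d)
    rwa [hp, hθ, one_mul] at this
  rcases hτ1.eq_or_lt with h1 | h1
  · have : (p : Euc d) = θ := (inner_eq_one_iff_of_norm_eq_one hp hθ).1 h1
    rw [← Subtype.ext this, h0, norm_zero]; positivity
  set u := Real.arccos τ
  have hu0 : 0 ≤ u := Real.arccos_nonneg τ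
  have hu2 : u ≤ π / 2 := Real.arccos_le_pi_div_two.2 hτ
  have hcos : Real.cos u = τ := Real.cos_arccos (by linarith) hτ1
  have hsin : Real.sin u = √(1 - τ ^ 2) := Real.sin_arccos τ
  have hs0 : 0 < Real.sin u := by rw [hsin]; apply Real.sqrt_pos.2; nlinarith
  set e : Euc d := (Real.sin u)⁻¹ • ((θ : Euc d) - τ • (p : Euc d))
  have hpe : inner ℝ (p : Euc d) e = 0 := by
    simp only [e, inner_smul_right, inner_sub_right, ← hτdef, real_inner_self_eq_norm_sq, hp]
    ring
  have hee : inner ℝ e e = 1 := by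
    have : inner ℝ ((θ : Euc d) - τ • (p : Euc d)) ((θ : Euc d) - τ • (p : Euc d)) =
        Real.sin u ^ 2 := by
      rw [inner_sub_left, inner_sub_right, inner_sub_right, inner_smul_left, inner_smul_left,
        inner_smul_right, inner_smul_right, real_inner_self_eq_norm_sq, real_inner_self_eq_norm_sq,
        hp, hθ, real_inner_comm, ← hτdef, Real.sin_sq, hcos]
      simp; ring
    simp only [e]
    rw [inner_smul_left, inner_smul_right, this]
    simp; field_simp
  set c : ℝ → Euc d := fun x => Real.cos x • (p : Euc d) + Real.sin x • e
  set c' : ℝ → Euc d := fun x => -Real.sin x • (p : Euc d) + Real.cos x • e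
  have hep : inner ℝ e (p : Euc d) = 0 := by rw [real_inner_comm, hpe]
  have hpp : inner ℝ (p : Euc d) (p : Euc d) = 1 := by rw [real_inner_self_eq_norm_sq, hp]; norm_num
  have hcn : ∀ x, ‖c x‖ = 1 := fun x => by
    rw [← sq_eq_sq₀ (norm_nonneg _) zero_le_one, ← real_inner_self_eq_norm_sq]
    simp only [c, inner_add_left, inner_add_right, inner_smul_left, inner_smul_right, hpe, hep, hee,
      hpp]
    simp; nlinarith [Real.sin_sq_add_cos_sq x]
  have hcn' : ∀ x, ‖c' x‖ = 1 := fun x => by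
    rw [← sq_eq_sq₀ (norm_nonneg _) zero_le_one, ← real_inner_self_eq_norm_sq]
    simp only [c', inner_add_left, inner_add_right, inner_smul_left, inner_smul_right, hpe, hep,
      hee, hpp]
    simp; nlinarith [Real.sin_sq_add_cos_sq x]
  have hcc : ∀ x, inner ℝ (c x) (c' x) = 0 := fun x => by
    simp only [c, c', inner_add_left, inner_add_right, inner_smul_left, inner_smul_right, hpe, hep,
      hee, hpp]
    simp; ring
  have hpc : ∀ x, inner ℝ (p : Euc d) (c x) = Real.cos x := fun x => by
    simp only [c, inner_add_right, inner_smul_right, hpe, hpp]; ring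
  obtain ⟨g, hg, h⟩ := f.2
  have hder : ∀ x, HasDerivAt (fun x => g (c x)) (fderiv ℝ g (c x) (c' x)) x := fun x =>
    (hg.differentiable (by simp) (c x)).hasFDerivAt.comp_hasDerivAt x
      (((Real.hasDerivAt_cos x).smul_const _).add ((Real.hasDerivAt_sin x).smul_const _))
  have hbd : ∀ x ∈ Icc 0 u, ‖fderiv ℝ g (c x) (c' x)‖ ≤ M := fun x hx => by
    refine le_trans ?_ (hM ⟨c x, by simp [hcn]⟩ ?_)
    · rw [← sum_rotField_eq (hcn x) (hcc x)]
      simp only [map_sum, map_smul]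
      refine (norm_sum_le _ _).trans (sum_le_sum fun i _ => (norm_sum_le _ _).trans
        (sum_le_sum fun j _ => ?_))
      rw [rotDerivSph_eq_fderiv hg h, norm_smul, norm_mul]
      refine mul_le_of_le_one_left (norm_nonneg _) (mul_le_one₀ ?_ (norm_nonneg _) ?_)
      · exact (PiLp.norm_apply_le _ i).trans (hcn x).le
      · exact (PiLp.norm_apply_le _ j).trans (hcn' x).le
    · rw [hpc, ← hcos]
      exact Real.cos_le_cos_of_nonneg_of_le_pi hx.1 (by linarith [Real.pi_pos]) hx.2
  have key := norm_image_sub_le_of_norm_deriv_le_segment' (f := fun x => g (c x)) (a := 0) (b := u)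
    (fun x hx => (hder x).hasDerivWithinAt) (fun x hx => hbd x ⟨hx.1, hx.2.le⟩) u ⟨hu0, le_rfl⟩
  have hcu : c u = θ := by
    simp only [c, e, smul_smul, hcos]
    rw [mul_inv_cancel₀ hs0.ne', one_smul]; abel
  have hc0 : c 0 = p := by simp [c]
  simp only [hcu, hc0, ← h, h0, sub_zero] at key
  have hj := Real.mul_le_sin hu0 hu2
  rw [← hsin]
  have hpi := Real.pi_pos
  have : u ≤ 2 * Real.sin u := by
    have h3 := Real.pi_lt_four
    have h4 : 2 / π ≥ 1 / 2 := by rw [ge_iff_le, div_le_div_iff₀ (by norm_num) hpi]; linarith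
    nlinarith
  nlinarith

/-- A function vanishing at two antipodal points, whose derivatives are `O(M)` near them. -/
lemma norm_le_of_poles {v : Euc d} {p q : Sph d} (hp : (p : Euc d) = v) (hq : (q : Euc d) = -v)
    {f : CInfSph d} {M : ℝ} (hfp : f.1 p = 0) (hfq : f.1 q = 0) (θ : Sph d)
    (hM : ∀ θ' : Sph d, 1 - inner ℝ v (θ' : Euc d) ^ 2 ≤ 1 - inner ℝ v (θ : Euc d) ^ 2 →
      ∑ i, ∑ j, ‖(rotDerivSph i j f).1 θ'‖ ≤ M) :
    ‖f.1 θ‖ ≤ 2 * M * √(1 - inner ℝ v (θ : Euc d) ^ 2) := by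
  rcases le_total 0 (inner ℝ v (θ : Euc d)) with h | h
  · have := norm_le_of_rotDerivSph_le p θ (by rwa [hp]) (M := M) hfp fun θ' h' => hM θ' (by
      rw [hp] at h'; nlinarith)
    rwa [hp] at this
  · have := norm_le_of_rotDerivSph_le q θ (by rw [hq, inner_neg_left]; linarith) (M := M) hfq
      fun θ' h' => hM θ' (by rw [hq, inner_neg_left, inner_neg_left] at h'; nlinarith)
    rwa [hq, inner_neg_left, neg_sq] at this


variable {d : ℕ}

lemma sphLin_rotVec_le {v : Euc d} (hv : ‖v‖ = 1) (i j : Fin d) (θ : Sph d) :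
    ‖(sphLin (rotVec v i j)).1 θ‖ ≤ 2 * √(1 - inner ℝ v (θ : Euc d) ^ 2) := by
  have hin := inner_sq_le_one hv θ
  have h1 := sum_rotCoef_sq v θ
  have h2 : rotCoef v i j θ ^ 2 ≤ ∑ i, ∑ j, rotCoef v i j θ ^ 2 :=
    (single_le_sum (f := fun j => rotCoef v i j θ ^ 2) (fun _ _ => sq_nonneg _)
      (Finset.mem_univ j)).trans (single_le_sum (f := fun i => ∑ j, rotCoef v i j θ ^ 2)
        (fun _ _ => sum_nonneg fun _ _ => sq_nonneg _) (Finset.mem_univ i))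
  rw [sphLin_apply, inner_rotVec, norm_real, norm_eq_abs]
  change |rotCoef v i j θ| ≤ _
  rw [h1, hv] at h2
  refine abs_le_of_sq_le_sq ?_ (by positivity)
  rw [mul_pow, Real.sq_sqrt (by linarith)]
  nlinarith

lemma norm_gradField_le_of_forall {v : Euc d} (hv : ‖v‖ = 1) {f : CInfSph d} {θ : Sph d} {m : ℝ}
    (h : ∀ i j, ‖(rotDerivSph i j f).1 θ‖ ≤ m) :
    ‖(gradField v f).1 θ‖ ≤ d ^ 2 * (√(1 - inner ℝ v (θ : Euc d) ^ 2) * m) := by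
  rw [gradField_apply, norm_mul]
  have h2 : ‖∑ i, ∑ j, (sphLin (rotVec v i j)).1 θ * (rotDerivSph i j f).1 θ‖ ≤
      ∑ _i : Fin d, ∑ _j : Fin d, 2 * √(1 - inner ℝ v (θ : Euc d) ^ 2) * m := by
    refine (norm_sum_le _ _).trans (sum_le_sum fun i _ => (norm_sum_le _ _).trans
      (sum_le_sum fun j _ => ?_))
    rw [norm_mul]
    exact mul_le_mul (sphLin_rotVec_le hv i j θ) (h i j) (norm_nonneg _) (by positivity)
  simp only [sum_const, card_univ, Fintype.card_fin, nsmul_eq_mul] at h2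
  norm_num
  linarith

lemma norm_gradField_gradField_le {v : Euc d} (hv : ‖v‖ = 1) {f : CInfSph d} {θ : Sph d} {M s : ℝ}
    (hs : √(1 - inner ℝ v (θ : Euc d) ^ 2) ≤ s) (hM : 0 ≤ M)
    (h : ∀ i j, ‖(rotDerivSph i j f).1 θ‖ ≤ M * s)
    (h2 : ∀ i j k l, ‖(rotDerivSph i j (rotDerivSph k l f)).1 θ‖ ≤ M) :
    ‖(gradField v (gradField v f)).1 θ‖ ≤
      2 * d ^ 4 * M * (√(1 - inner ℝ v (θ : Euc d) ^ 2) * s) := by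
  have hs0 : 0 ≤ s := (sqrt_nonneg _).trans hs
  refine (norm_gradField_le_of_forall hv (m := 2 * d ^ 2 * M * s) fun i j => ?_).trans
    (le_of_eq (by ring))
  have e : (rotDerivSph i j (gradField v f)).1 θ = 1 / 2 * ∑ k, ∑ l,
      ((sphLin (rotVec (rotVec v k l) i j)).1 θ * (rotDerivSph k l f).1 θ +
        (sphLin (rotVec v k l)).1 θ * (rotDerivSph i j (rotDerivSph k l f)).1 θ) := by
    simp [gradField, map_sum, rotDerivSph_mul, rotDerivSph_sphLin]
  rw [e, norm_mul]
  have h3 : ‖∑ k, ∑ l, ((sphLin (rotVec (rotVec v k l) i j)).1 θ * (rotDerivSph k l f).1 θ +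
        (sphLin (rotVec v k l)).1 θ * (rotDerivSph i j (rotDerivSph k l f)).1 θ)‖ ≤
      ∑ _k : Fin d, ∑ _l : Fin d, 3 * M * s := by
    refine (norm_sum_le _ _).trans (sum_le_sum fun k _ => (norm_sum_le _ _).trans
      (sum_le_sum fun l _ => (norm_add_le _ _).trans ?_))
    rw [norm_mul, norm_mul]
    have b1 : ‖(sphLin (rotVec (rotVec v k l) i j)).1 θ‖ ≤ 1 :=
      (norm_sphLin_le _ θ).trans (((norm_rotVec_le _ i j).trans (norm_rotVec_le v k l)).trans hv.le)
    have b2 := (sphLin_rotVec_le hv k l θ).trans (mul_le_mul_of_nonneg_left hs zero_le_two)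
    have c1 := mul_le_mul b1 (h k l) (norm_nonneg _) zero_le_one
    have c2 := mul_le_mul b2 (h2 i j k l) (norm_nonneg _) (by positivity)
    linarith
  simp only [sum_const, card_univ, Fintype.card_fin, nsmul_eq_mul] at h3
  norm_num
  have : 0 ≤ (d : ℝ) ^ 2 * M * s := by positivity
  linarith

/-! ### Subtraction of the values at the poles -/

/-- The function `G` minus the affine function of `⟨v, ·⟩` with the values `a`, `b` at `v`, `-v`. -/
def subPoles (v : Euc d) (a b : ℂ) (G : CInfSph d) : CInfSph d :=
  G + (-(a + b) / 2) • (1 : CInfSph d) + (-(a - b) / 2) • sphLin v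

lemma subPoles_apply (v : Euc d) (a b : ℂ) (G : CInfSph d) (θ : Sph d) :
    (subPoles v a b G).1 θ = G.1 θ - (a + b) / 2 - (a - b) / 2 * inner ℝ v (θ : Euc d) := by
  simp only [subPoles, add_apply, smul_apply, one_apply, sphLin_apply]
  ring

lemma sphBound_subPoles (k : ℕ) : ∃ C : ℝ, 0 ≤ C ∧ ∀ (v : Euc d) (G : CInfSph d) (B : ℝ) (a b : ℂ),
    ‖v‖ = 1 → SphBound k G B → ‖a‖ ≤ B → ‖b‖ ≤ B → SphBound k (subPoles v a b G) (C * B) := by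
  obtain ⟨B₁, hB₁, h₁⟩ := SphBound.exists k (1 : CInfSph d)
  refine ⟨2 + B₁, by positivity, fun v G B a b hv hG ha hb => ?_⟩
  refine ((hG.add (h₁.smul (-(a + b) / 2))).add ((sphBound_sphLin k v).smul (-(a - b) / 2))).le_bound ?_
  have n1 : ‖-(a + b) / 2‖ ≤ B := by
    rw [norm_div, norm_neg]; norm_num; linarith [norm_add_le a b]
  have n2 : ‖-(a - b) / 2‖ ≤ B := by
    rw [norm_div, norm_neg]; norm_num; linarith [norm_sub_le a b]
  rw [hv]
  have := mul_le_mul_of_nonneg_right n1 hB₁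
  linarith

lemma inner_pole {v : Euc d} (hv : ‖v‖ = 1) : inner ℝ v v = (1 : ℝ) := by
  rw [real_inner_self_eq_norm_sq, hv]; norm_num

lemma norm_sphInt_subPoles_three : ∃ C : ℝ, 0 ≤ C ∧ ∀ (v : Euc 3) (p q : Sph 3) (G : CInfSph 3)
    (B l : ℝ), ‖v‖ = 1 → (p : Euc 3) = v → (q : Euc 3) = -v → SphBound 2 G B → 1 ≤ l →
      ‖sphInt (subPoles v (G.1 p) (G.1 q) G * sphExp (l • v))‖ ≤ C * B * l ^ (-(5 / 4) : ℝ) := by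
  obtain ⟨C₁, hC₁, h₁⟩ := sphBound_subPoles (d := 3) 2
  obtain ⟨C₂, hC₂, h₂⟩ := norm_sphInt_mul_sphExp_le_of_poles (d := 3) (b := 3 / 4) (by norm_num)
    (by norm_num) (by norm_num)
  refine ⟨C₂ * (189 * C₁), by positivity, fun v p q G B l hv hp hq hG hl => ?_⟩
  have hB : 0 ≤ B := (norm_nonneg _).trans (hG.zero p)
  set F := subPoles v (G.1 p) (G.1 q) G
  have hF : SphBound 2 F (C₁ * B) := h₁ v G B _ _ hv hG (hG.zero p) (hG.zero q)
  have hF1 : ∀ i j θ, ‖(rotDerivSph i j F).1 θ‖ ≤ C₁ * B := fun i j θ => (hF.2 i j).zero θ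
  refine (h₂ v F (189 * C₁ * B) l hv (by positivity) hl fun θ => ?_).trans (le_of_eq (by ring))
  have hin := inner_sq_le_one hv θ
  have hFp : F.1 p = 0 := by
    rw [subPoles_apply, hp, inner_pole hv]; push_cast; ring
  have hFq : F.1 q = 0 := by
    rw [subPoles_apply, hq, inner_neg_right, inner_pole hv]; push_cast; ring
  have e1 := norm_le_of_poles hp hq hFp hFq θ (M := 9 * (C₁ * B)) fun θ' _ => by
    have : ∑ i, ∑ j, ‖(rotDerivSph i j F).1 θ'‖ ≤ ∑ _i : Fin 3, ∑ _j : Fin 3, C₁ * B :=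
      sum_le_sum fun i _ => sum_le_sum fun j _ => hF1 i j θ'
    simp only [sum_const, card_univ, Fintype.card_fin, nsmul_eq_mul] at this
    norm_num at this
    linarith
  have e2 := norm_gradField_le_of_forall hv fun i j => hF1 i j θ
  have e3 := norm_gradField_gradField_le hv (f := F) (θ := θ) (M := C₁ * B) (s := 1)
    (Real.sqrt_le_one.2 (by nlinarith)) (by positivity) (fun i j => by simpa using hF1 i j θ)
    fun i j k l => ((hF.2 k l).2 i j) θ
  rw [show (5 / 4 - 3 / 4 : ℝ) = 1 / 2 by norm_num, ← Real.sqrt_eq_rpow]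
  norm_num at e2 e3
  linarith

lemma sum_rotDerivSph_two (f : CInfSph 2) (θ : Sph 2) :
    ∑ i, ∑ j, ‖(rotDerivSph i j f).1 θ‖ = 2 * ‖(rotDerivSph 0 1 f).1 θ‖ := by
  have h : (rotDerivSph 1 0 f).1 θ = -(rotDerivSph 0 1 f).1 θ := by
    obtain ⟨g, hg, h⟩ := f.2
    rw [rotDerivSph_eq_fderiv hg h, rotDerivSph_eq_fderiv hg h, ← map_neg]
    congr 1; simp [rotField]
  simp only [Fin.sum_univ_two, rotDerivSph_self, h, norm_neg, CInfSph.zero_apply, norm_zero]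
  ring

lemma norm_rotDerivSph_two_le (f : CInfSph 2) (θ : Sph 2) (i j : Fin 2) :
    ‖(rotDerivSph i j f).1 θ‖ ≤ 2 * ‖(rotDerivSph 0 1 f).1 θ‖ := by
  rw [← sum_rotDerivSph_two]
  exact (single_le_sum (f := fun j => ‖(rotDerivSph i j f).1 θ‖) (fun _ _ => norm_nonneg _)
      (Finset.mem_univ j)).trans (single_le_sum
        (f := fun i => ∑ j, ‖(rotDerivSph i j f).1 θ‖)
        (fun _ _ => sum_nonneg fun _ _ => norm_nonneg _) (Finset.mem_univ i))

lemma sphInt_sphLin_rotVec_mul_sphExp {l : ℝ} (hl : l ≠ 0) (v : Euc d) (i j : Fin d) :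
    sphInt (sphLin (rotVec v i j) * sphExp (l • v)) = 0 ∧
      sphInt (sphLin (rotVec v i j) * sphLin v * sphExp (l • v)) = 0 := by
  have e0 : rotDerivSph i j (sphExp (l • v)) =
      (-(I * l)) • (sphLin (rotVec v i j) * sphExp (l • v)) := by
    rw [rotDerivSph_sphExp]
    refine ext' fun θ => ?_
    simp only [smul_apply, mul_apply, sphLin_apply, inner_rotVec, PiLp.smul_apply,
      smul_eq_mul]
    push_cast; ring
  have hc : -(I * l) ≠ 0 := by simp [hl]
  have h1 : sphInt (sphLin (rotVec v i j) * sphExp (l • v)) = 0 := by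
    have := integral_rotDerivSph i j (sphExp (l • v))
    rw [e0, map_smul, smul_eq_mul] at this
    exact (mul_eq_zero.1 this).resolve_left hc
  refine ⟨h1, ?_⟩
  have h2 := integral_rotDerivSph i j (sphLin v * sphExp (l • v))
  rw [rotDerivSph_mul, rotDerivSph_sphLin, e0, map_add, h1, zero_add] at h2
  have e : sphLin v * (-(I * l)) • (sphLin (rotVec v i j) * sphExp (l • v)) =
      (-(I * l)) • (sphLin (rotVec v i j) * sphLin v * sphExp (l • v)) :=
    ext' fun θ => by simp only [smul_apply, mul_apply]; ring
  rw [e, map_smul, smul_eq_mul] at h2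
  exact (mul_eq_zero.1 h2).resolve_left hc

lemma norm_sphInt_subPoles_two : ∃ C : ℝ, 0 ≤ C ∧ ∀ (v : Euc 2) (p q : Sph 2) (G : CInfSph 2)
    (B l : ℝ), ‖v‖ = 1 → (p : Euc 2) = v → (q : Euc 2) = -v → SphBound 2 G B → 1 ≤ l →
      ‖sphInt (subPoles v (G.1 p) (G.1 q) G * sphExp (l • v))‖ ≤ C * B * l ^ (-(5 / 4) : ℝ) := by
  obtain ⟨C₁, hC₁, h₁⟩ := sphBound_subPoles (d := 2) 2
  obtain ⟨C₂, hC₂, h₂⟩ := norm_sphInt_mul_sphExp_le_of_poles (d := 2) (b := 1 / 4) (by norm_num)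
    (by norm_num) (by norm_num)
  obtain ⟨C₃, hC₃, h₃⟩ := SphBound.mul (d := 2) 2
  refine ⟨C₂ * (1000 * (C₁ + 1 + C₃)), by positivity, fun v p q G B l hv hp hq hG hl => ?_⟩
  have hB : 0 ≤ B := (norm_nonneg _).trans (hG.zero p)
  set F := subPoles v (G.1 p) (G.1 q) G
  have hF : SphBound 2 F (C₁ * B) := h₁ v G B _ _ hv hG (hG.zero p) (hG.zero q)
  set w := rotVec v 0 1
  have hw1 : ‖w‖ ≤ 1 := (norm_rotVec_le v 0 1).trans hv.le
  set a := (rotDerivSph 0 1 G).1 p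
  set b := (rotDerivSph 0 1 G).1 q
  have ha : ‖a‖ ≤ B := (hG.2 0 1).zero p
  have hb : ‖b‖ ≤ B := (hG.2 0 1).zero q
  set H := F + ((a - b) / 2) • sphLin w + ((a + b) / 2) • (sphLin w * sphLin v)
  set D := C₁ * B + B + C₃ * B
  have hD : 0 ≤ D := by positivity
  have n1 : ‖(a + b) / 2‖ ≤ B := by
    rw [norm_div]; norm_num; linarith [norm_add_le a b]
  have n2 : ‖(a - b) / 2‖ ≤ B := by
    rw [norm_div]; norm_num; linarith [norm_sub_le a b]
  have hH : SphBound 2 H D := by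
    refine ((hF.add ((sphBound_sphLin 2 w).smul _)).add ((h₃ _ _ _ _ (sphBound_sphLin 2 w)
      (sphBound_sphLin 2 v)).smul _)).le_bound ?_
    rw [hv]
    have m1 := mul_le_mul n2 hw1 (norm_nonneg _) hB
    have m2 := mul_le_mul n1 (mul_le_mul_of_nonneg_left hw1 hC₃) (by positivity) hB
    rw [mul_one]
    simp only [D]
    linarith
  have hww : rotVec w 0 1 = -v := by
    ext k; fin_cases k <;> simp [w, rotVec]
  have hΩH : ∀ θ, (rotDerivSph 0 1 H).1 θ = (rotDerivSph 0 1 G).1 θ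
      - (G.1 p - G.1 q) / 2 * inner ℝ w (θ : Euc 2) - (a - b) / 2 * inner ℝ v (θ : Euc 2)
      + (a + b) / 2 * ((inner ℝ w (θ : Euc 2) : ℂ) ^ 2 - (inner ℝ v (θ : Euc 2) : ℂ) ^ 2) := by
    intro θ
    simp only [H, F, subPoles, map_add, map_smul, rotDerivSph_mul, rotDerivSph_sphLin,
      rotDerivSph_one, hww, add_apply, smul_apply, mul_apply, sphLin_apply,
      CInfSph.zero_apply, inner_neg_left]
    push_cast
    ring
  have hwv : inner ℝ w v = (0 : ℝ) := by simp only [w]; rw [inner_rotVec]; ring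
  have hvv := inner_pole hv
  have hHp : H.1 p = 0 := by
    simp only [H, F, add_apply, subPoles_apply, smul_apply, mul_apply,
      sphLin_apply, hp, hwv, hvv]
    push_cast; ring
  have hHq : H.1 q = 0 := by
    simp only [H, F, add_apply, subPoles_apply, smul_apply, mul_apply,
      sphLin_apply, hq, inner_neg_right, hwv, hvv]
    push_cast; ring
  have hΩp : (rotDerivSph 0 1 H).1 p = 0 := by
    rw [hΩH]
    simp only [hp, hwv, hvv]
    push_cast; ring
  have hΩq : (rotDerivSph 0 1 H).1 q = 0 := by
    rw [hΩH]
    simp only [hq, inner_neg_right, hwv, hvv]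
    push_cast; ring
  have e0 : ∀ θ, ‖(rotDerivSph 0 1 H).1 θ‖ ≤ 4 * D * √(1 - inner ℝ v (θ : Euc 2) ^ 2) := fun θ => by
    refine (norm_le_of_poles hp hq hΩp hΩq θ (M := 2 * D) fun θ' _ => ?_).trans (le_of_eq (by ring))
    rw [sum_rotDerivSph_two]
    exact mul_le_mul_of_nonneg_left (((hH.2 0 1).2 0 1) θ') zero_le_two
  have hint : sphInt (F * sphExp (l • v)) = sphInt (H * sphExp (l • v)) := by
    obtain ⟨i1, i2⟩ := sphInt_sphLin_rotVec_mul_sphExp (show l ≠ 0 by linarith) v 0 1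
    have : H * sphExp (l • v) = F * sphExp (l • v) + ((a - b) / 2) • (sphLin w * sphExp (l • v)) +
        ((a + b) / 2) • (sphLin w * sphLin v * sphExp (l • v)) :=
      ext' fun θ => by
        simp only [H, add_apply, smul_apply, mul_apply]; ring
    rw [this, map_add, map_add, map_smul, map_smul, i1, i2]
    simp
  rw [hint]
  refine (h₂ v H (1000 * D) l hv (by positivity) hl fun θ => ?_).trans
    (le_of_eq (by simp only [D]; ring))
  have hin := inner_sq_le_one hv θ
  set s := √(1 - inner ℝ v (θ : Euc 2) ^ 2) with hs
  have hss : s * s = 1 - inner ℝ v (θ : Euc 2) ^ 2 := Real.mul_self_sqrt (by linarith)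
  have e1 := norm_le_of_poles hp hq hHp hHq θ (M := 2 * (4 * D * s)) fun θ' h' => by
    rw [sum_rotDerivSph_two]
    exact mul_le_mul_of_nonneg_left ((e0 θ').trans
      (mul_le_mul_of_nonneg_left (sqrt_le_sqrt h') (by positivity))) zero_le_two
  have e2 := norm_gradField_le_of_forall hv fun i j => (norm_rotDerivSph_two_le H θ i j).trans
    (mul_le_mul_of_nonneg_left (e0 θ) zero_le_two)
  have e3 := norm_gradField_gradField_le hv (f := H) (θ := θ) (M := 8 * D) le_rfl (by positivity)
    (fun i j => (norm_rotDerivSph_two_le H θ i j).trans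
      ((mul_le_mul_of_nonneg_left (e0 θ) zero_le_two).trans (le_of_eq (by ring))))
    fun i j k l => (((hH.2 k l).2 i j) θ).trans (by linarith)
  rw [← hs] at e1 e2 e3
  rw [show (5 / 4 - 1 / 4 : ℝ) = 1 by norm_num, Real.rpow_one, ← hss]
  norm_num at e2 e3
  have : 0 ≤ D * (s * s) := by positivity
  linarith

lemma norm_sphInt_subPoles_le (hd : d = 2 ∨ d = 3) : ∃ C : ℝ, 0 ≤ C ∧ ∀ (v : Euc d) (p q : Sph d)
    (G : CInfSph d) (B l : ℝ), ‖v‖ = 1 → (p : Euc d) = v → (q : Euc d) = -v → SphBound 2 G B →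
      1 ≤ l → ‖sphInt (subPoles v (G.1 p) (G.1 q) G * sphExp (l • v))‖ ≤
        C * B * l ^ (-(5 / 4) : ℝ) := by
  rcases hd with rfl | rfl
  · exact norm_sphInt_subPoles_two
  · exact norm_sphInt_subPoles_three


variable {d : ℕ}

/-! ### The threshold modes -/

lemma integrableOn_one_mul_exp {s : ℂ} (hs : 0 < s.re) :
    IntegrableOn (fun t : ℝ => (1 : ℂ) * exp (-s * t)) (Ioi 0) := by
  simpa using (isRapid_exp hs).integrableOn

lemma resMode_eq_modeInt {ξ : Fin d → ℤ} {v : Euc d}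
    (hv : ∀ t : ℝ, t • latVec ξ = (latNorm ξ * t) • v) (s : ℂ) (ψ φ : CInf d) :
    resMode s ξ ψ φ = modeInt (fun _ => 1) v (latNorm ξ) s (fcoef (-ξ) ψ * fcoef ξ φ) := by
  simp [resMode, modeInt, hv]

/-- The function `⟨v, ·⟩ ↦ (s + i r ⟨v, θ⟩)⁻¹` integrated over the sphere. -/
def sphRes (v : Euc d) (r : ℝ) (s : ℂ) : ℂ :=
  ∫ θ, (s + I * r * (inner ℝ v (θ : Euc d) : ℝ))⁻¹ ∂(surf d)

lemma le_norm_symbol (v : Euc d) (r : ℝ) (s : ℂ) (θ : Sph d) :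
    s.re ≤ ‖s + I * r * (inner ℝ v (θ : Euc d) : ℝ)‖ := by
  refine le_trans (le_of_eq ?_) (Complex.re_le_norm _)
  simp

lemma symbol_ne_zero (v : Euc d) (r : ℝ) {s : ℂ} (hs : 0 < s.re) (θ : Sph d) :
    s + I * r * (inner ℝ v (θ : Euc d) : ℝ) ≠ 0 :=
  norm_pos_iff.1 (hs.trans_le (le_norm_symbol v r s θ))

lemma continuous_inv_symbol (v : Euc d) (r : ℝ) {s : ℂ} (hs : 0 < s.re) :
    Continuous fun θ : Sph d => (s + I * r * (inner ℝ v (θ : Euc d) : ℝ))⁻¹ :=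
  Continuous.inv₀ (by fun_prop) (symbol_ne_zero v r hs)

lemma modeInt_one_eq (v : Euc d) (r : ℝ) {s : ℂ} (hs : 0 < s.re) (G : CInfSph d) :
    modeInt (fun _ => 1) v r s G =
      ∫ θ, G.1 θ * (s + I * r * (inner ℝ v (θ : Euc d) : ℝ))⁻¹ ∂(surf d) := by
  rw [modeInt_eq_sphere continuous_const (integrableOn_one_mul_exp hs)]
  congr 1; funext θ
  simp only [one_mul]
  rw [integral_exp_neg (by simpa using hs), one_div]

lemma modeInt_one_one (v : Euc d) (r : ℝ) {s : ℂ} (hs : 0 < s.re) :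
    modeInt (fun _ => 1) v r s 1 = sphRes v r s := by
  simp [modeInt_one_eq v r hs, sphRes]

lemma integral_inner_mul_inv (v : Euc d) (r : ℝ) {s : ℂ} (hs : 0 < s.re) :
    I * r * ∫ θ, ((inner ℝ v (θ : Euc d) : ℝ) : ℂ) *
        (s + I * r * (inner ℝ v (θ : Euc d) : ℝ))⁻¹ ∂(surf d) =
      (surf d).real univ - s * sphRes v r s := by
  have h : ∀ θ : Sph d, I * r * (((inner ℝ v (θ : Euc d) : ℝ) : ℂ) *
      (s + I * r * (inner ℝ v (θ : Euc d) : ℝ))⁻¹) =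
      1 - s * (s + I * r * (inner ℝ v (θ : Euc d) : ℝ))⁻¹ := fun θ => by
    have := symbol_ne_zero v r hs θ
    field_simp; ring
  rw [← integral_const_mul, sphRes, ← integral_const_mul]
  simp_rw [h]
  rw [integral_sub (integrable_const _)
    ((integrable_of_continuous_sph (continuous_inv_symbol v r hs)).const_mul s)]
  simp

lemma modeInt_one_sphLin (v : Euc d) {r : ℝ} (hr : r ≠ 0) {s : ℂ} (hs : 0 < s.re) :
    modeInt (fun _ => 1) v r s (sphLin v) =
      ((surf d).real univ - s * sphRes v r s) / (I * r) := by
  have hr' : I * r ≠ 0 := by simp [hr]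
  rw [eq_div_iff hr', ← integral_inner_mul_inv v r hs, modeInt_one_eq v r hs, mul_comm]
  rfl

lemma modeInt_one_eq_subPoles (v : Euc d) {r : ℝ} (hr : r ≠ 0) {s : ℂ} (hs : 0 < s.re) (a b : ℂ)
    (G : CInfSph d) : modeInt (fun _ => 1) v r s G = modeInt (fun _ => 1) v r s (subPoles v a b G) +
      (a + b) / 2 * sphRes v r s +
      (a - b) / 2 * (((surf d).real univ - s * sphRes v r s) / (I * r)) := by
  have hi := integrableOn_one_mul_exp hs
  rw [subPoles, modeInt_add hi, modeInt_add hi, modeInt_smul, modeInt_smul, modeInt_one_one v r hs,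
    modeInt_one_sphLin v hr hs]
  ring

lemma norm_modeInt_subPoles_le (hd : d = 2 ∨ d = 3) : ∃ C : ℝ, 0 ≤ C ∧ ∀ (v : Euc d) (p q : Sph d)
    (G : CInfSph d) (B r : ℝ) (s : ℂ), ‖v‖ = 1 → (p : Euc d) = v → (q : Euc d) = -v →
      SphBound 2 G B → 1 ≤ r → 0 < s.re →
      ‖modeInt (fun _ => 1) v r s (subPoles v (G.1 p) (G.1 q) G)‖ ≤ C * B := by
  obtain ⟨C₁, hC₁, h₁⟩ := norm_sphInt_subPoles_le hd
  obtain ⟨C₂, hC₂, h₂⟩ := sphBound_subPoles (d := d) 0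
  set A := (surf d).real univ
  set K := ∫ t in Ioi (0 : ℝ), (t + 1) ^ (-(5 / 4) : ℝ)
  have hK : 0 ≤ K := setIntegral_nonneg measurableSet_Ioi fun t ht =>
    Real.rpow_nonneg (add_nonneg (le_of_lt ht) zero_le_one) _
  refine ⟨4 * (C₁ + C₂ * A) * K, by positivity, fun v p q G B r s hv hp hq hG hr hs => ?_⟩
  have hB : 0 ≤ B := (norm_nonneg _).trans (hG.zero p)
  have hF := h₂ v G B _ _ hv (hG.mono (Nat.zero_le _)) (hG.zero p) (hG.zero q)
  refine (norm_integral_le_of_norm_le ((integrableOn_add_rpow_Ioi_of_lt (a := -(5 / 4)) (c := 0)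
    (m := 1) (by norm_num) (by norm_num)).const_mul (4 * (C₁ + C₂ * A) * B))
    ((ae_restrict_iff' measurableSet_Ioi).2 (.of_forall fun t ht => ?_))).trans
    (le_of_eq (by rw [integral_const_mul]; ring))
  have ht' : (0 : ℝ) < t := ht
  have e0 : ‖(1 : ℂ) * exp (-s * t)‖ ≤ 1 := by
    rw [one_mul, norm_exp_neg_mul, Real.exp_le_one_iff]
    have : 0 ≤ s.re * t := by positivity
    linarith
  have hpow : (4 : ℝ)⁻¹ ≤ 2 ^ (-(5 / 4) : ℝ) := by
    rw [show (4 : ℝ)⁻¹ = 2 ^ (-2 : ℝ) by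
      rw [Real.rpow_neg zero_le_two, Real.rpow_two]; norm_num]
    exact Real.rpow_le_rpow_of_exponent_le (by norm_num) (by norm_num)
  rw [norm_mul]
  refine (mul_le_of_le_one_left (norm_nonneg _) e0).trans ?_
  rcases le_total t 1 with h1 | h1
  · have e1 := (norm_sphInt_mul_sphExp_le (subPoles v (G.1 p) (G.1 q) G) ((r * t) • v)).trans
      (integral_mono (CInfSph.integrable _).norm (integrable_const (C₂ * B)) fun θ => hF θ)
    have e2 : (4 : ℝ)⁻¹ ≤ (t + 1) ^ (-(5 / 4) : ℝ) := hpow.trans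
      (Real.rpow_le_rpow_of_nonpos (by linarith) (by linarith) (by norm_num))
    rw [integral_const, smul_eq_mul] at e1
    calc _ ≤ A * (C₂ * B) := e1
      _ ≤ 4 * (C₁ + C₂ * A) * B * 4⁻¹ := by
        have : 0 ≤ C₁ * B := by positivity
        linarith
      _ ≤ _ := by gcongr
  · have hl : t ≤ r * t := le_mul_of_one_le_left ht'.le hr
    have e1 := h₁ v p q G B (r * t) hv hp hq hG (h1.trans hl)
    have e2 : (r * t) ^ (-(5 / 4) : ℝ) ≤ t ^ (-(5 / 4) : ℝ) :=
      Real.rpow_le_rpow_of_nonpos ht' hl (by norm_num)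
    have e3 : (2 * t) ^ (-(5 / 4) : ℝ) ≤ (t + 1) ^ (-(5 / 4) : ℝ) :=
      Real.rpow_le_rpow_of_nonpos (by linarith) (by linarith) (by norm_num)
    rw [Real.mul_rpow zero_le_two ht'.le] at e3
    have e4 : 4⁻¹ * t ^ (-(5 / 4) : ℝ) ≤ (t + 1) ^ (-(5 / 4) : ℝ) :=
      (mul_le_mul_of_nonneg_right hpow (by positivity)).trans e3
    have e5 : 0 ≤ C₁ * B := by positivity
    have e6 : 0 ≤ C₂ * A * B * (t + 1) ^ (-(5 / 4) : ℝ) := by positivity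
    have e7 := mul_le_mul_of_nonneg_left (e2.trans (show t ^ (-(5 / 4) : ℝ) ≤
      4 * (t + 1) ^ (-(5 / 4) : ℝ) by linarith)) e5
    linarith

/-! ### The integral of the resolvent symbol over the sphere -/

lemma hasDerivAt_sphRes (v : Euc d) (r : ℝ) {s : ℂ} (hs : 0 < s.re) :
    HasDerivAt (sphRes v r)
      (∫ θ, -((s + I * r * (inner ℝ v (θ : Euc d) : ℝ)) ^ 2)⁻¹ ∂(surf d)) s := by
  have hs2 : 0 < s.re / 2 := half_pos hs
  refine (hasDerivAt_integral_of_dominated_loc_of_deriv_le (s := {w : ℂ | s.re / 2 < w.re})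
    (bound := fun _ => ((s.re / 2) ^ 2)⁻¹)
    (F := fun w (θ : Sph d) => (w + I * r * (inner ℝ v (θ : Euc d) : ℝ))⁻¹)
    (F' := fun w (θ : Sph d) => -((w + I * r * (inner ℝ v (θ : Euc d) : ℝ)) ^ 2)⁻¹)
    ((isOpen_lt continuous_const Complex.continuous_re).mem_nhds
      (show s.re / 2 < s.re by linarith)) ?_
    (integrable_of_continuous_sph (continuous_inv_symbol v r hs)) ?_ ?_ (integrable_const _) ?_).2
  · filter_upwards [(isOpen_lt continuous_const Complex.continuous_re).mem_nhds hs] with w hw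
    exact (continuous_inv_symbol v r hw).aestronglyMeasurable
  · simp_rw [← inv_pow]
    exact ((continuous_inv_symbol v r hs).pow 2).neg.aestronglyMeasurable
  · refine .of_forall fun θ w hw => ?_
    rw [norm_neg, norm_inv, norm_pow]
    exact inv_anti₀ (by positivity)
      (pow_le_pow_left₀ hs2.le ((le_of_lt hw).trans (le_norm_symbol v r w θ)) 2)
  · refine .of_forall fun θ w hw => ?_
    have := ((hasDerivAt_id w).add_const (I * r * (inner ℝ v (θ : Euc d) : ℝ))).inv
      (symbol_ne_zero v r (hs2.trans hw) θ)
    exact this.congr_deriv (by simp [neg_div])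

lemma deriv_sphRes {v : Euc d} (hv : ‖v‖ = 1) (r : ℝ) {s : ℂ} (hs : 0 < s.re) :
    (r ^ 2 + s ^ 2) * deriv (sphRes v r) s =
      ((d : ℂ) - 3) * s * sphRes v r s - ((d : ℂ) - 2) * (surf d).real univ := by
  rw [(hasDerivAt_sphRes v r hs).deriv, integral_neg]
  have hne : ∀ x : ℝ, s + I * r * x ≠ 0 := fun x h => by
    have := congrArg Complex.re h
    simp at this; linarith
  set f : CInfSph d := sphRadial (fun x : ℝ => (s + I * r * x)⁻¹)
    (ContDiff.inv (contDiff_const.add (contDiff_const.mul Complex.ofRealCLM.contDiff)) hne) v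
  have h1 := integral_gradField v f
  have h2 : ∀ θ, (gradField v f).1 θ = (1 - inner ℝ v (θ : Euc d) ^ 2 : ℝ) *
      -(I * r / (s + I * r * (inner ℝ v (θ : Euc d) : ℝ)) ^ 2) := fun θ => by
    rw [gradField_radial hv f (fun _ => rfl) θ
      (((Complex.ofRealCLM.hasDerivAt (x := inner ℝ v (θ : Euc d))).const_mul
        (I * r)).const_add s |>.inv (hne _))]
    simp [neg_div]
  have h3 : ∀ θ, I * r * (gradField v f).1 θ =
      (r ^ 2 + s ^ 2) * ((s + I * r * (inner ℝ v (θ : Euc d) : ℝ)) ^ 2)⁻¹ +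
        (1 - 2 * s * (s + I * r * (inner ℝ v (θ : Euc d) : ℝ))⁻¹) := fun θ => by
    rw [h2]
    have hw := hne (inner ℝ v (θ : Euc d))
    set x : ℂ := ((inner ℝ v (θ : Euc d) : ℝ) : ℂ) with hx
    push_cast
    rw [← hx]
    field_simp
    ring_nf
    rw [Complex.I_sq]
    ring
  have h4 : I * r * sphInt (gradField v f) = (r ^ 2 + s ^ 2) *
      (∫ θ, ((s + I * r * (inner ℝ v (θ : Euc d) : ℝ)) ^ 2)⁻¹ ∂(surf d)) +
        ((surf d).real univ - 2 * s * sphRes v r s) := by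
    have i1 := integrable_of_continuous_sph (continuous_inv_symbol v r hs)
    have i2 : Integrable (fun θ : Sph d =>
        ((s + I * r * (inner ℝ v (θ : Euc d) : ℝ)) ^ 2)⁻¹) (surf d) := by
      simp_rw [← inv_pow]
      exact integrable_of_continuous_sph ((continuous_inv_symbol v r hs).pow 2)
    rw [sphInt_apply, ← integral_const_mul]
    simp_rw [h3]
    refine (integral_add (i2.const_mul _) ((integrable_const (1 : ℂ)).sub (i1.const_mul (2 * s)))).trans ?_
    rw [integral_const_mul]
    congr 1
    refine (integral_sub (integrable_const _) (i1.const_mul _)).trans ?_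
    rw [integral_const_mul]
    simp [sphRes]
  have h5 := integral_inner_mul_inv v r hs
  have h6 : sphInt (sphLin v * f) = ∫ θ, ((inner ℝ v (θ : Euc d) : ℝ) : ℂ) *
      (s + I * r * (inner ℝ v (θ : Euc d) : ℝ))⁻¹ ∂(surf d) := rfl
  rw [← h6] at h5
  rw [h1] at h4
  linear_combination h4 - ((d : ℂ) - 1) * h5


variable {d : ℕ}

lemma surf_real_univ_two : (surf 2).real univ = 2 * π := by
  rw [surf, Measure.toSphere_real_apply_univ, measureReal_def, EuclideanSpace.volume_ball_fin_two]
  simp [Real.pi_pos.le]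

lemma surf_real_univ_three : (surf 3).real univ = 4 * π := by
  rw [surf, Measure.toSphere_real_apply_univ, measureReal_def,
    EuclideanSpace.volume_ball_fin_three]
  have : 0 ≤ π * (4 / 3) := by positivity
  simp [ENNReal.toReal_ofReal, this, mul_div_assoc]
  ring

lemma exists_eq_of_deriv_eq_zero {f : ℂ → ℂ} (h : ∀ s : ℂ, 0 < s.re → HasDerivAt f 0 s) :
    ∃ c, ∀ s : ℂ, 0 < s.re → f s = c :=
  (isOpen_lt continuous_const Complex.continuous_re).exists_is_const_of_deriv_eq_zero
    (convex_halfSpace_re_gt 0).isPreconnected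
    (fun s hs => (h s hs).differentiableAt.differentiableWithinAt) fun s hs => (h s hs).deriv

lemma re_add_I_mul (s : ℂ) (r : ℝ) : (s + I * r).re = s.re := by simp

lemma re_sub_I_mul (s : ℂ) (r : ℝ) : (s - I * r).re = s.re := by simp

lemma ne_zero_of_re_pos {w : ℂ} (h : 0 < w.re) : w ≠ 0 := fun h0 => by simp [h0] at h

lemma sphRes_three {v : Euc 3} (hv : ‖v‖ = 1) {r : ℝ} (hr : 0 < r) :
    ∃ c, ∀ s : ℂ, 0 < s.re → sphRes v r s = 2 * π / (I * r) *
      (Complex.log (s + I * r) - Complex.log (s - I * r)) + c := by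
  obtain ⟨c, hc⟩ := exists_eq_of_deriv_eq_zero (f := fun s => sphRes v r s -
      2 * π / (I * r) *
        (Complex.log (s + I * r) - Complex.log (s - I * r))) fun s hs => by
    have h1 : 0 < (s + I * r).re := by rwa [re_add_I_mul]
    have h2 : 0 < (s - I * r).re := by rwa [re_sub_I_mul]
    have d1 := (((hasDerivAt_id s).add_const (I * r)).clog (Or.inl h1)).sub
      (((hasDerivAt_id s).sub_const (I * r)).clog (Or.inl h2))
    have d2 := (hasDerivAt_sphRes v r hs).differentiableAt.hasDerivAt
    refine (d2.sub (d1.const_mul (2 * π / (I * r)))).congr_deriv ?_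
    have e := deriv_sphRes hv r hs
    rw [surf_real_univ_three] at e
    have n1 := ne_zero_of_re_pos h1
    have n2 := ne_zero_of_re_pos h2
    have hr' : (r : ℂ) ≠ 0 := by exact_mod_cast hr.ne'
    have n3 : (r : ℂ) ^ 2 + s ^ 2 = (s + I * r) * (s - I * r) := by
      ring_nf; rw [Complex.I_sq]; ring
    have e' : deriv (sphRes v r) s = -(4 * π) / ((s + I * r) * (s - I * r)) := by
      rw [eq_div_iff (mul_ne_zero n1 n2), ← n3, mul_comm, e]
      push_cast; ring
    rw [e']
    simp only [id]
    field_simp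
    ring
  exact ⟨c, fun s hs => by rw [← hc s hs]; ring⟩

lemma cpow_half_sq (z : ℂ) : (z ^ (1 / 2 : ℂ)) ^ 2 = z := by simp

lemma sphRes_two {v : Euc 2} (hv : ‖v‖ = 1) (r : ℝ) {s : ℂ} (hs : 0 < s.re) :
    sphRes v r s * ((s + I * r) ^ (1 / 2 : ℂ) * (s - I * r) ^ (1 / 2 : ℂ)) =
      2 * π := by
  obtain ⟨c, hc⟩ := exists_eq_of_deriv_eq_zero (f := fun s => sphRes v r s *
      ((s + I * r) ^ (1 / 2 : ℂ) * (s - I * r) ^ (1 / 2 : ℂ))) fun s hs => by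
    have h1 : 0 < (s + I * r).re := by rwa [re_add_I_mul]
    have h2 : 0 < (s - I * r).re := by rwa [re_sub_I_mul]
    have n1 := ne_zero_of_re_pos h1
    have n2 := ne_zero_of_re_pos h2
    have d1 := (((hasDerivAt_id s).add_const (I * r)).cpow_const (c := 1 / 2)
      (Or.inl h1)).mul (((hasDerivAt_id s).sub_const (I * r)).cpow_const (c := 1 / 2)
      (Or.inl h2))
    have d2 := (hasDerivAt_sphRes v r hs).differentiableAt.hasDerivAt
    refine (d2.mul d1).congr_deriv ?_
    have e := deriv_sphRes hv r hs
    have n3 : (r : ℂ) ^ 2 + s ^ 2 = (s + I * r) * (s - I * r) := by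
      ring_nf; rw [Complex.I_sq]; ring
    have e' : deriv (sphRes v r) s = -s * sphRes v r s /
        ((s + I * r) * (s - I * r)) := by
      rw [eq_div_iff (mul_ne_zero n1 n2), ← n3, mul_comm, e]
      push_cast; ring
    simp only [Pi.mul_apply, id]
    rw [e', Complex.cpow_sub _ _ n1, Complex.cpow_sub _ _ n2, Complex.cpow_one, Complex.cpow_one]
    field_simp
    ring
  rw [hc s hs]
  have hx : ∀ x : ℝ, 0 < x → c = (x * sphRes v r x) * ((‖1 + I * r * (x⁻¹ : ℝ)‖ : ℝ) : ℂ) :=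
    fun x hx0 => by
      have hx0' : (x : ℂ) ≠ 0 := by exact_mod_cast hx0.ne'
      have h1 : 0 < ((x : ℂ) + I * r).re := by simpa
      have h2 : (x : ℂ) - I * r = (starRingEnd ℂ) (x + I * r) := by simp; ring
      have h3 : ((x : ℂ) + I * r).arg ≠ π := fun h => by
        have := (Complex.arg_eq_pi_iff.1 h).1; linarith
      have h4 : ‖(x : ℂ) + I * r‖ = x * ‖1 + I * r * (x⁻¹ : ℝ)‖ := by
        rw [← norm_of_nonneg hx0.le, ← norm_real, ← norm_mul, norm_real,
          norm_of_nonneg hx0.le]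
        congr 1; push_cast; field_simp
      rw [← hc x (by simpa), h2, Complex.conj_cpow _ _ h3]
      have h5 : (starRingEnd ℂ) (1 / 2 : ℂ) = 1 / 2 := by rw [map_div₀, map_one, map_ofNat]
      rw [h5, Complex.mul_conj', ← Complex.ofReal_pow, ← norm_pow, cpow_half_sq, h4]
      push_cast; ring
  have t1 : Tendsto (fun x : ℝ => ((‖1 + I * r * (x⁻¹ : ℝ)‖ : ℝ) : ℂ)) atTop (𝓝 1) := by
    have hcont : Continuous fun y : ℝ => ((‖1 + I * r * (y : ℝ)‖ : ℝ) : ℂ) := by fun_prop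
    have := (hcont.tendsto 0).comp tendsto_inv_atTop_zero
    simpa [Function.comp_def] using this
  have t2 : Tendsto (fun x : ℝ => (x * sphRes v r x : ℂ)) atTop (𝓝 ((surf 2).real univ : ℝ)) := by
    rw [tendsto_iff_norm_sub_tendsto_zero]
    refine squeeze_zero' (.of_forall fun _ => norm_nonneg _)
      (g := fun x => |r| * (surf 2).real univ * x⁻¹) ?_
      (by simpa using tendsto_inv_atTop_zero.const_mul (|r| * (surf 2).real univ))
    filter_upwards [eventually_gt_atTop 0] with x hx0
    have e := integral_inner_mul_inv v r (s := x) (by simpa)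
    rw [norm_sub_rev, ← e, norm_mul, norm_mul, Complex.norm_I, one_mul, norm_real,
      norm_eq_abs, mul_assoc]
    refine mul_le_mul_of_nonneg_left ((norm_integral_le_of_norm_le (integrable_const x⁻¹)
      (.of_forall fun θ => ?_)).trans (le_of_eq (by simp))) (abs_nonneg r)
    rw [norm_mul, norm_inv]
    have k1 := norm_sphLin_le v θ
    rw [hv] at k1
    have k2 := le_norm_symbol v r (x : ℂ) θ
    refine (mul_le_of_le_one_left (by positivity) k1).trans (inv_anti₀ hx0 (by simpa using k2))
  have t3 := t2.mul t1
  have hcc := tendsto_nhds_unique ((tendsto_congr' (by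
    filter_upwards [eventually_gt_atTop 0] with x hx0 using (hx x hx0).symm)).1 t3)
    (tendsto_const_nhds (x := c))
  rw [← hcc, surf_real_univ_two]
  push_cast; ring


variable {d : ℕ}

/-- The singular part of `sphRes` at the threshold `e i r`, `e = ± 1`, as a function of the distance
`z` to the threshold. -/
def sphSing (d : ℕ) (e : ℂ) (r : ℝ) (z : ℂ) : ℂ :=
  (2 * π : ℂ) ^ d * (exp (-(e * I * π * ((d : ℂ) - 1) / 4)) *
    singProfile d z / (((2 * π) ^ (((d : ℝ) + 1) / 2) * r ^ (((d : ℝ) - 1) / 2) : ℝ) : ℂ))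

lemma norm_mul_log_le {z : ℂ} (hz : z ≠ 0) (h1 : ‖z‖ ≤ 1) : ‖z * Complex.log z‖ ≤ 1 + π := by
  have h0 : 0 < ‖z‖ := norm_pos_iff.2 hz
  have hl : ‖Complex.log z‖ ≤ |Real.log ‖z‖| + π := by
    refine (Complex.norm_le_abs_re_add_abs_im _).trans (add_le_add (by rw [Complex.log_re]) ?_)
    rw [Complex.log_im]; exact Complex.abs_arg_le_pi z
  have h2 := (Real.abs_log_mul_self_lt ‖z‖ h0 h1).le
  rw [abs_mul, abs_of_pos h0] at h2
  rw [norm_mul]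
  calc ‖z‖ * ‖Complex.log z‖ ≤ ‖z‖ * (|Real.log ‖z‖| + π) := by gcongr
    _ ≤ 1 + π := by nlinarith [Real.pi_pos]

lemma sign_mul_I_mul_mem_slitPlane {e : ℂ} (he : e = 1 ∨ e = -1) {r : ℝ} (hr : 0 < r) :
    2 * e * I * r ∈ Complex.slitPlane := by
  right
  rcases he with rfl | rfl <;> simp [hr.ne']

lemma exists_norm_sphRes_three {v : Euc 3} (hv : ‖v‖ = 1) {r : ℝ} (hr : 0 < r) {e : ℂ}
    (he : e = 1 ∨ e = -1) : ∃ C : ℝ, ∀ᶠ s in 𝓝[{s : ℂ | 0 < s.re}] (e * I * r),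
      ‖sphRes v r s - sphSing 3 e r (s - e * I * r)‖ ≤ C ∧
        ‖(s - e * I * r) * sphRes v r s‖ ≤ C := by
  obtain ⟨c, hc⟩ := sphRes_three hv hr
  have hr' : (r : ℂ) ≠ 0 := by exact_mod_cast hr.ne'
  have hpi : (π : ℂ) ≠ 0 := by exact_mod_cast Real.pi_ne_zero
  set k : ℂ := e * (2 * π / (I * r))
  have hJ : ∀ s : ℂ, 0 < s.re → sphRes v r s = k * (Complex.log (s + e * I * r) -
      Complex.log (s - e * I * r)) + c := fun s hs => by
    rw [hc s hs]
    rcases he with rfl | rfl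
    · simp [k]
    · simp only [k, neg_mul, one_mul, sub_neg_eq_add, ← sub_eq_add_neg]; ring
  have hS : ∀ z, sphSing 3 e r z = -(k * Complex.log z) := fun z => by
    have h1 : exp (-(e * I * π * (((3 : ℕ) : ℂ) - 1) / 4)) = -(e * I) := by
      rcases he with rfl | rfl
      · rw [show -(1 * I * π * (((3 : ℕ) : ℂ) - 1) / 4) =
          -(π / 2 * I) by push_cast; ring, Complex.exp_neg,
          Complex.exp_pi_div_two_mul_I]
        simp
      · rw [show -(-1 * I * π * (((3 : ℕ) : ℂ) - 1) / 4) =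
          π / 2 * I by push_cast; ring, Complex.exp_pi_div_two_mul_I]
        simp
    have h2 : (2 * π) ^ ((((3 : ℕ) : ℝ) + 1) / 2) * r ^ ((((3 : ℕ) : ℝ) - 1) / 2) =
        (2 * π) ^ 2 * r := by
      norm_num
    rw [sphSing, h1, h2, singProfile, if_neg (by norm_num)]
    simp only [k]
    have hI : I ≠ 0 := Complex.I_ne_zero
    push_cast
    field_simp
    rw [Complex.I_sq]; ring
  have hcont : ContinuousAt (fun s : ℂ => Complex.log (s + e * I * r)) (e * I * r) := by
    refine ContinuousAt.clog (by fun_prop) ?_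
    convert sign_mul_I_mul_mem_slitPlane he hr using 1; ring
  set L := ‖Complex.log (e * I * r + e * I * r)‖ + 1
  have hL := (hcont.norm.eventually_lt_const (lt_add_one _)).filter_mono
    (nhdsWithin_le_nhds (s := {s : ℂ | 0 < s.re}))
  refine ⟨‖k‖ * (L + (1 + π)) + ‖c‖, ?_⟩
  filter_upwards [hL, self_mem_nhdsWithin, mem_nhdsWithin_of_mem_nhds (Metric.closedBall_mem_nhds
    (e * I * (r : ℂ)) one_pos)] with s hs hs0 hsb
  rw [mem_closedBall_iff_norm] at hsb
  set z := s - e * I * r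
  set w := Complex.log (s + e * I * r)
  have hz : z ≠ 0 := ne_zero_of_re_pos (by
    rcases he with rfl | rfl <;> simpa [z] using hs0)
  have hw : ‖w‖ ≤ L := hs.le
  have hk := norm_nonneg k
  constructor
  · have e1 : sphRes v r s - sphSing 3 e r z = k * w + c := by rw [hJ s hs0, hS]; ring
    rw [e1]
    refine (norm_add_le _ _).trans (add_le_add ?_ le_rfl)
    rw [norm_mul]
    exact mul_le_mul_of_nonneg_left (by linarith [Real.pi_pos]) hk
  · have e1 : z * sphRes v r s = k * (z * w - z * Complex.log z) + z * c := by rw [hJ s hs0]; ring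
    rw [e1]
    refine (norm_add_le _ _).trans (add_le_add ?_ ?_)
    · rw [norm_mul]
      refine mul_le_mul_of_nonneg_left ((norm_sub_le _ _).trans
        (add_le_add ?_ (norm_mul_log_le hz hsb))) hk
      rw [norm_mul]
      exact (mul_le_of_le_one_left (norm_nonneg _) hsb).trans hw
    · rw [norm_mul]; exact mul_le_of_le_one_left (norm_nonneg _) hsb

lemma sqrt_mul_exp_eq_cpow {e : ℂ} (he : e = 1 ∨ e = -1) {r : ℝ} (hr : 0 < r) :
    (2 * e * I * r) ^ (1 / 2 : ℂ) =
      (√(2 * r) : ℝ) * exp (e * I * π / 4) := by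
  have hr2 : (0 : ℝ) < 2 * r := by positivity
  have hne : 2 * e * I * r ≠ 0 := by
    have hr' : (r : ℂ) ≠ 0 := by exact_mod_cast hr.ne'
    rcases he with rfl | rfl <;> simp [hr']
  have hlog : Complex.log (e * I) = e * I * π / 2 := by
    rcases he with rfl | rfl
    · rw [one_mul, Complex.log_I]; ring
    · rw [neg_one_mul, Complex.log_neg_I]; ring
  have heI : e * I ≠ 0 := by rcases he with rfl | rfl <;> simp
  rw [Complex.cpow_def_of_ne_zero hne, show 2 * e * I * r = ((2 * r : ℝ) : ℂ) * (e * I)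
    by push_cast; ring, Complex.log_ofReal_mul hr2 heI, hlog, add_mul, Complex.exp_add]
  congr 1
  · rw [Real.sqrt_eq_rpow, Real.rpow_def_of_pos hr2, Complex.ofReal_exp]
    congr 1; push_cast; ring
  · congr 1; ring

lemma exists_norm_sphRes_two {v : Euc 2} (hv : ‖v‖ = 1) {r : ℝ} (hr : 0 < r) {e : ℂ}
    (he : e = 1 ∨ e = -1) : ∃ C : ℝ, ∀ᶠ s in 𝓝[{s : ℂ | 0 < s.re}] (e * I * r),
      ‖sphRes v r s - sphSing 2 e r (s - e * I * r)‖ ≤ C ∧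
        ‖(s - e * I * r) * sphRes v r s‖ ≤ C := by
  have hr' : (r : ℂ) ≠ 0 := by exact_mod_cast hr.ne'
  have hpi : (π : ℂ) ≠ 0 := by exact_mod_cast Real.pi_ne_zero
  set s₀ := e * I * r
  set W : ℂ → ℂ := fun s => (s + s₀) ^ (1 / 2 : ℂ)
  have hmem : s₀ + s₀ ∈ Complex.slitPlane := by
    convert sign_mul_I_mul_mem_slitPlane he hr using 1; simp only [s₀]; ring
  have hW₀ : W s₀ = (√(2 * r) : ℝ) * exp (e * I * π / 4) := by
    rw [← sqrt_mul_exp_eq_cpow he hr]; simp only [W, s₀]; congr 1; ring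
  have hsr : ((√(2 * r) : ℝ) : ℂ) ≠ 0 := by
    exact_mod_cast (Real.sqrt_pos.2 (by positivity : 0 < 2 * r)).ne'
  have hW₀' : W s₀ ≠ 0 := by rw [hW₀]; exact mul_ne_zero hsr (Complex.exp_ne_zero _)
  have hdiff : DifferentiableAt ℂ (fun s => (W s)⁻¹) s₀ :=
    ((((hasDerivAt_id s₀).add_const s₀).cpow_const (c := 1 / 2) hmem).differentiableAt).inv hW₀'
  obtain ⟨C, hC⟩ := hdiff.isBigO_sub.bound
  have hJ : ∀ s : ℂ, 0 < s.re → sphRes v r s = 2 * π * (W s)⁻¹ * ((s - s₀) ^ (1 / 2 : ℂ))⁻¹ :=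
    fun s hs => by
    have h1 := sphRes_two hv r hs
    have hne : ∀ {w : ℂ}, 0 < w.re → w ^ (1 / 2 : ℂ) ≠ 0 := fun {w} hw h => by
      have := cpow_half_sq w
      rw [h] at this
      exact ne_zero_of_re_pos hw (by rw [← this]; ring)
    have n1 := hne (w := s + I * r) (by rwa [re_add_I_mul])
    have n2 := hne (w := s - I * r) (by rwa [re_sub_I_mul])
    have h2 : sphRes v r s = 2 * π * ((s + I * r) ^ (1 / 2 : ℂ))⁻¹ *
        ((s - I * r) ^ (1 / 2 : ℂ))⁻¹ := by
      rw [← h1]; field_simp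
    rw [h2]
    rcases he with rfl | rfl
    · simp [W, s₀]
    · simp only [W, s₀, neg_mul, one_mul, sub_neg_eq_add, ← sub_eq_add_neg]; ring
  have hS : ∀ z, sphSing 2 e r z = 2 * π * (W s₀)⁻¹ * (z ^ (1 / 2 : ℂ))⁻¹ := fun z => by
    have h1 : exp (-(e * I * π * (((2 : ℕ) : ℂ) - 1) / 4)) =
        (exp (e * I * π / 4))⁻¹ := by
      rw [← Complex.exp_neg]; congr 1; push_cast; ring
    have h2 : (2 * π) ^ ((((2 : ℕ) : ℝ) + 1) / 2) * r ^ ((((2 : ℕ) : ℝ) - 1) / 2) =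
        2 * π * √π * √(2 * r) := by
      have h2pi : (0 : ℝ) < 2 * π := two_pi_pos
      rw [show (((2 : ℕ) : ℝ) + 1) / 2 = 1 + 1 / 2 by norm_num,
        show (((2 : ℕ) : ℝ) - 1) / 2 = 1 / 2 by norm_num, rpow_add h2pi, Real.rpow_one,
        ← Real.sqrt_eq_rpow, ← Real.sqrt_eq_rpow, Real.sqrt_mul zero_le_two,
        Real.sqrt_mul zero_le_two]
      ring
    have hsp : ((√π : ℝ) : ℂ) ≠ 0 := by exact_mod_cast (Real.sqrt_pos.2 Real.pi_pos).ne'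
    rw [sphSing, h1, h2, singProfile, if_pos rfl, hW₀]
    have hexp := Complex.exp_ne_zero (e * I * π / 4)
    push_cast
    field_simp
  set D := ‖(W s₀)⁻¹‖
  refine ⟨2 * π * (|C| + D), ?_⟩
  filter_upwards [hC.filter_mono (nhdsWithin_le_nhds (s := {s : ℂ | 0 < s.re})),
    self_mem_nhdsWithin, mem_nhdsWithin_of_mem_nhds (Metric.closedBall_mem_nhds s₀ one_pos)]
    with s hs hs0 hsb
  rw [mem_closedBall_iff_norm] at hsb
  set z := s - s₀
  set Z := z ^ (1 / 2 : ℂ)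
  have hZ : Z ^ 2 = z := cpow_half_sq z
  have hz : z ≠ 0 := ne_zero_of_re_pos (by
    rcases he with rfl | rfl <;> simpa [z, s₀] using hs0)
  have hZ0 : Z ≠ 0 := fun h => hz (by rw [← hZ, h]; ring)
  have hZn : ‖Z‖ ^ 2 = ‖z‖ := by rw [← norm_pow, hZ]
  have hZ1 : ‖Z‖ ≤ 1 := by
    by_contra! h; nlinarith [norm_nonneg Z]
  have hn : ‖(2 * π : ℂ)‖ = 2 * π := by
    rw [norm_mul, norm_real, norm_of_nonneg Real.pi_pos.le]; norm_num
  have hCn : ‖(W s)⁻¹ - (W s₀)⁻¹‖ ≤ |C| * ‖z‖ :=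
    hs.trans (mul_le_mul_of_nonneg_right (le_abs_self C) (norm_nonneg _))
  have hD : 0 ≤ D := norm_nonneg _
  constructor
  · have e1 : sphRes v r s - sphSing 2 e r z =
        2 * π * (((W s)⁻¹ - (W s₀)⁻¹) * Z⁻¹) := by rw [hJ s hs0, hS]; ring
    rw [e1, norm_mul, hn]
    refine mul_le_mul_of_nonneg_left ?_ Real.two_pi_pos.le
    rw [norm_mul, norm_inv]
    have hZp : 0 < ‖Z‖ := norm_pos_iff.2 hZ0
    calc _ ≤ |C| * ‖z‖ * ‖Z‖⁻¹ := by gcongr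
      _ = |C| * ‖Z‖ := by rw [← hZn]; field_simp
      _ ≤ |C| * 1 := by gcongr
      _ ≤ |C| + D := by linarith
  · have e1 : z * sphRes v r s = 2 * π * ((W s)⁻¹ * Z) := by
      have h2 : z * Z⁻¹ = Z := by
        calc z * Z⁻¹ = Z ^ 2 * Z⁻¹ := by rw [hZ]
          _ = Z := by field_simp
      rw [hJ s hs0]
      change z * (2 * π * (W s)⁻¹ * Z⁻¹) = _
      linear_combination 2 * π * (W s)⁻¹ * h2
    rw [e1, norm_mul, hn]
    refine mul_le_mul_of_nonneg_left ?_ Real.two_pi_pos.le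
    rw [norm_mul]
    have h3 : ‖(W s)⁻¹‖ ≤ |C| + D := by
      have := norm_sub_norm_le (W s)⁻¹ (W s₀)⁻¹
      nlinarith [abs_nonneg C]
    exact (mul_le_of_le_one_right (norm_nonneg _) hZ1).trans h3

lemma exists_norm_sphRes (hd : d = 2 ∨ d = 3) {v : Euc d} (hv : ‖v‖ = 1) {r : ℝ} (hr : 0 < r) {e : ℂ}
    (he : e = 1 ∨ e = -1) : ∃ C : ℝ, ∀ᶠ s in 𝓝[{s : ℂ | 0 < s.re}] (e * I * r),
      ‖sphRes v r s - sphSing d e r (s - e * I * r)‖ ≤ C ∧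
        ‖(s - e * I * r) * sphRes v r s‖ ≤ C := by
  rcases hd with rfl | rfl
  · exact exists_norm_sphRes_two hv hr he
  · exact exists_norm_sphRes_three hv hr he


variable {d : ℕ}

/-! ### The singularities at the thresholds in dimensions two and three -/

lemma latNorm_neg (ξ : Fin d → ℤ) : latNorm (-ξ) = latNorm ξ := by simp [latNorm, latSq]

theorem exists_norm_resMode_sub_le [NeZero d] (hd : d = 2 ∨ d = 3) (ε : ℤˣ) {ξ : Fin d → ℤ}
    (hξ : ξ ≠ 0) (ψ : CInf d) : ∃ C : ℝ, ∀ᶠ s in 𝓝[{s : ℂ | 0 < s.re}]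
      (((ε : ℤ) : ℂ) * I * latNorm ξ), ∀ φ B, CkBound 2 φ B →
      ‖resMode s (-ξ) ψ φ - sphSing d ((ε : ℤ) : ℂ) (latNorm ξ)
          (s - ((ε : ℤ) : ℂ) * I * latNorm ξ) *
        ((fcoef ξ ψ).1 (latDir ε ξ hξ) * (fcoef (-ξ) φ).1 (latDir ε ξ hξ))‖ ≤ C * B := by
  set r := latNorm ξ
  have hr1 : 1 ≤ r := one_le_latNorm hξ
  have hr : 0 < r := by linarith
  have hr' : (r : ℂ) ≠ 0 := by exact_mod_cast hr.ne'
  obtain ⟨v, hv, hvt⟩ := exists_unit_latVec (neg_ne_zero.2 hξ)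
  rw [latNorm_neg] at hvt
  set p : Sph d := ⟨v, by simpa using hv⟩
  set q : Sph d := ⟨-v, by simpa using hv⟩
  set e : ℂ := ((ε : ℤ) : ℂ)
  have hvi : ∀ i, v i = -(ξ i : ℝ) / r := fun i => by
    have h1 := congrArg (fun w : Euc d => w i) (hvt r⁻¹)
    rw [mul_inv_cancel₀ hr.ne', one_smul] at h1
    rw [← h1]
    simp [latVec]; field_simp
  have hP : (e = 1 ∧ latDir ε ξ hξ = q) ∨ (e = -1 ∧ latDir ε ξ hξ = p) := by
    rcases Int.units_eq_one_or ε with h | h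
    · refine Or.inl ⟨by simp [e, h], Subtype.ext (PiLp.ext fun i => ?_)⟩
      simp [latDir, q, h, hvi, neg_div, r]
    · refine Or.inr ⟨by simp [e, h], Subtype.ext (PiLp.ext fun i => ?_)⟩
      simp [latDir, p, h, hvi, r]
  have he : e = 1 ∨ e = -1 := hP.imp And.left And.left
  obtain ⟨C₁, hC₁, h₁⟩ := norm_modeInt_subPoles_le hd
  obtain ⟨C₂, hC₂, h₂⟩ := SphBound.mul (d := d) 2
  obtain ⟨C₃, h₃⟩ := exists_norm_sphRes hd hv hr he
  obtain ⟨Q, hQ0, hQ⟩ := CkBound.exists 2 ψ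
  set A : ℝ := (surf d).real univ
  set K := C₂ * ((2 * π) ^ d * Q * (2 * π) ^ d)
  refine ⟨(C₁ + C₃ + (A + C₃)) * K, ?_⟩
  filter_upwards [h₃, self_mem_nhdsWithin] with s hs3 hs φ B hB
  set z := s - e * I * r
  set P := latDir ε ξ hξ
  set G := fcoef ξ ψ * fcoef (-ξ) φ
  have hG : SphBound 2 G (K * B) :=
    (h₂ _ _ _ _ (sphBound_fcoef 2 ξ hQ) (sphBound_fcoef 2 (-ξ) hB)).le_bound
      (le_of_eq (by simp only [K]; ring))
  have hKB : 0 ≤ K * B := (norm_nonneg _).trans (hG.zero p)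
  have hC₃ : 0 ≤ C₃ := (norm_nonneg _).trans hs3.1
  have e1 := h₁ v p q G (K * B) r s hv rfl rfl hG hr1 hs
  have e2 := resMode_eq_modeInt (v := v) (ξ := -ξ) (by rwa [latNorm_neg]) s ψ φ
  rw [neg_neg, latNorm_neg, modeInt_one_eq_subPoles v hr.ne' hs (G.1 p) (G.1 q)] at e2
  have e3 : resMode s (-ξ) ψ φ - sphSing d e r z * G.1 P =
      modeInt (fun _ => 1) v r s (subPoles v (G.1 p) (G.1 q) G) +
        G.1 P * (sphRes v r s - sphSing d e r z) +
        (G.1 p - G.1 q) / 2 * ((A - z * sphRes v r s) / (I * r)) := by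
    rw [e2]
    have hsz : s = z + e * I * r := by simp only [z]; ring
    have hI := Complex.I_ne_zero
    have e4 : (A - s * sphRes v r s) / (I * r) =
        (A - z * sphRes v r s) / (I * r) - e * sphRes v r s := by
      field_simp
      rw [hsz]; ring
    rw [e4]
    rcases hP with ⟨h, h'⟩ | ⟨h, h'⟩ <;> rw [h, h'] <;> ring
  change ‖resMode s (-ξ) ψ φ - sphSing d e r z * G.1 P‖ ≤ _
  rw [e3]
  have k1 : ‖G.1 P * (sphRes v r s - sphSing d e r z)‖ ≤ K * B * C₃ := by
    rw [norm_mul]; exact mul_le_mul (hG.zero P) hs3.1 (norm_nonneg _) hKB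
  have k2 : ‖(G.1 p - G.1 q) / 2 * ((A - z * sphRes v r s) / (I * r))‖ ≤
      K * B * (A + C₃) := by
    rw [norm_mul, norm_div, norm_div, norm_mul, Complex.norm_I, norm_real,
      norm_of_nonneg hr.le, one_mul]
    refine mul_le_mul ?_ ?_ (by positivity) hKB
    · have := norm_sub_le (G.1 p) (G.1 q)
      have := hG.zero p
      have := hG.zero q
      norm_num; linarith
    · refine (div_le_self (norm_nonneg _) hr1).trans ((norm_sub_le _ _).trans (add_le_add ?_ hs3.2))
      rw [norm_real, norm_of_nonneg measureReal_nonneg]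
  refine (norm_add_le _ _).trans ((add_le_add ((norm_add_le _ _).trans (add_le_add e1 k1)) k2).trans
    (le_of_eq (by ring)))

theorem isBoundedDist_resolvent_sub_modes [NeZero d] (hd : d = 2 ∨ d = 3) {χ : ℝ → ℂ}
    (hχ : IsCutoff χ) {ξ₀ : Fin d → ℤ} (hξ₀ : ξ₀ ≠ 0) (ε : ℤˣ) (ψ : CInf d) :
    IsBoundedDist (𝓝[{s : ℂ | 0 < s.re}] (((ε : ℤ) : ℂ) * I * latNorm ξ₀))
      (fun s φ => (resolvent s (toDistrib ψ)).1 φ -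
        exp (-(((ε : ℤ) : ℂ) * I * π * ((d : ℂ) - 1) / 4)) *
          singProfile d (s - ((ε : ℤ) : ℂ) * I * latNorm ξ₀) /
          (((2 * π) ^ (((d : ℝ) + 1) / 2) * latNorm ξ₀ ^ (((d : ℝ) - 1) / 2) : ℝ) : ℂ) *
          modePairing ε ξ₀ ψ φ) := by
  classical
  set r := latNorm ξ₀
  set e : ℂ := ((ε : ℤ) : ℂ)
  have he : e ^ 2 = 1 := by
    rcases Int.units_eq_one_or ε with h | h <;> simp [e, h]
  set X := {ξ : Fin d → ℤ // ξ ≠ 0 ∧ latNorm ξ = r}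
  have hsub : {ξ : Fin d → ℤ | ξ ≠ 0 ∧ latNorm ξ = r} ⊆ {ξ | latSq ξ ≤ latSq ξ₀} := fun ξ hξ => by
    change latSq ξ ≤ latSq ξ₀
    rw [← latNorm_sq, ← latNorm_sq, hξ.2]
  have hfin : Finite X := ((finite_latSq_le (latSq ξ₀)).subset hsub).to_subtype
  have := Fintype.ofFinite X
  set R : Finset (Fin d → ℤ) := Finset.univ.image fun η : X => -η.1
  have hinj : ∀ η ∈ (Finset.univ : Finset X), ∀ η' ∈ (Finset.univ : Finset X),
      -η.1 = -η'.1 → η = η' := fun η _ η' _ h => Subtype.ext (neg_injective h)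
  obtain ⟨k, C, h⟩ := hχ.isBoundedDist_sub_resMode (s₀ := e * I * r) R (fun ξ hξ h0 => by
    have h1 : latSq ξ = latSq ξ₀ := by
      have h2 : (latSq ξ : ℂ) = (r ^ 2 : ℝ) := by
        rw [mul_pow, mul_pow, he, Complex.I_sq] at h0
        push_cast; linear_combination h0
      rw [← latNorm_sq ξ₀]; exact_mod_cast h2
    refine hξ (Finset.mem_image.2 ⟨⟨-ξ, ?_, ?_⟩, Finset.mem_univ _, neg_neg ξ⟩)
    · rintro h3
      rw [neg_eq_zero] at h3
      have := one_le_latSq hξ₀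
      rw [← h1, h3, latSq_zero] at this
      linarith
    · rw [latNorm_neg, latNorm, h1]; rfl) ψ
  choose D hD using fun η : X => exists_norm_resMode_sub_le hd ε η.2.1 ψ
  have hD' : ∀ᶠ s in 𝓝[{s : ℂ | 0 < s.re}] (e * I * r), ∀ η : X, ∀ φ B, CkBound 2 φ B →
      ‖resMode s (-η.1) ψ φ - sphSing d e r (s - e * I * r) *
        ((fcoef η.1 ψ).1 (latDir ε η.1 η.2.1) * (fcoef (-η.1) φ).1 (latDir ε η.1 η.2.1))‖ ≤ D η * B := by
    refine eventually_all.2 fun η => ?_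
    simpa only [η.2.2] using hD η
  set c : ℂ := ((2 * π : ℂ) ^ d)⁻¹
  refine ⟨max k 2, C + ∑ η, ‖c‖ * D η, ?_⟩
  filter_upwards [h, hD'] with s hs hsD φ B hB
  have b1 := hs φ B (hB.mono (le_max_left _ _))
  have b2 := fun η => hsD η φ B (hB.mono (le_max_right _ _))
  rw [Finset.sum_image hinj] at b1
  set z := s - e * I * r
  have hpi : (2 * π : ℂ) ^ d ≠ 0 := by simp [Real.pi_ne_zero]
  have hsing : exp (-(e * I * π * ((d : ℂ) - 1) / 4)) * singProfile d z /
      (((2 * π) ^ (((d : ℝ) + 1) / 2) * r ^ (((d : ℝ) - 1) / 2) : ℝ) : ℂ) =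
        c * sphSing d e r z := by
    rw [sphSing, inv_mul_cancel_left₀ hpi]
  have hpair : modePairing ε ξ₀ ψ φ = ∑ η : X,
      (fcoef η.1 ψ).1 (latDir ε η.1 η.2.1) * (fcoef (-η.1) φ).1 (latDir ε η.1 η.2.1) := by
    rw [modePairing, finsum_eq_sum_of_fintype]
    refine sum_congr rfl fun η _ => ?_
    rw [mul_comm, fcoef_apply, fcoef_apply]
    congr 2; funext y; exact mul_comm _ _
  have hsplit : (resolvent s (toDistrib ψ)).1 φ - c * sphSing d e r z * modePairing ε ξ₀ ψ φ =
      ((resolvent s (toDistrib ψ)).1 φ - ∑ η : X, c * resMode s (-η.1) ψ φ) +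
      ∑ η : X, c * (resMode s (-η.1) ψ φ - sphSing d e r z *
        ((fcoef η.1 ψ).1 (latDir ε η.1 η.2.1) * (fcoef (-η.1) φ).1 (latDir ε η.1 η.2.1))) := by
    rw [hpair]
    simp only [mul_sub, sum_sub_distrib, mul_sum]
    rw [sub_add_sub_cancel]
    congr 1
    exact sum_congr rfl fun η _ => by ring
  rw [hsing, hsplit, add_mul, sum_mul]
  refine (norm_add_le _ _).trans (add_le_add b1 ((norm_sum_le _ _).trans
    (sum_le_sum fun η _ => ?_)))
  rw [norm_mul, mul_assoc]
  exact mul_le_mul_of_nonneg_left (b2 η) (norm_nonneg c)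

end TorusFlow

end

open TorusFlow in
theorem theorem3p3 (d N : ℕ) (hd : 2 ≤ d) (hN : ∃ k : ℕ, 1 ≤ k ∧ N = 2 * k + d)
    (χ : ℝ → ℂ) (hχ : ContDiffOn ℝ ∞ χ (Set.Ici 0))
    (hχ_supp : ∃ R : ℝ, ∀ t : ℝ, R ≤ t → χ t = 0)
    (hχ_one : ∃ δ : ℝ, 0 < δ ∧ ∀ t : ℝ, 0 ≤ t → t < δ → χ t = 1) :
    ∃ L L₀ Linf : ℂ → DistST d →ₗ[ℂ] DistST d,
      -- `L(s) = ∫_0^∞ e^{-st} e^{-tV*} dt` converges weakly for `Re s > 0` and is `(V + s)⁻¹`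
      (∀ s : ℂ, 0 < s.re → ∀ u : DistST d,
        IsFlowIntegral (fun t : ℝ => Complex.exp (-s * t)) u (L s u)) ∧
      (∀ s : ℂ, 0 < s.re → ∀ u w : DistST d, SolvesTransport s u w ↔ w = L s u) ∧
      -- the two pieces and the splitting
      (∀ (s : ℂ) (u : DistST d),
        IsFlowIntegral (fun t : ℝ => χ t * Complex.exp (-s * t)) u (L₀ s u)) ∧
      (∀ s : ℂ, 0 < s.re → ∀ u : DistST d,
        IsFlowIntegral (fun t : ℝ => (1 - χ t) * Complex.exp (-s * t)) u (Linf s u)) ∧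
      (∀ s : ℂ, 0 < s.re → L s = L₀ s + Linf s) ∧
      -- `L₀` is a holomorphic family of bounded operators on `ℂ`
      (∀ σ : ℝ, ∃ B : ℂ → Aniso d (N : ℤ) σ →L[ℂ] Aniso d (N : ℤ) (σ - N),
        Differentiable ℂ B ∧
        ∀ (s : ℂ) (u : Aniso d (N : ℤ) σ), (B s u : DistST d) = L₀ s (u : DistST d)) ∧
      -- `Linf` extends continuously, for the operator norm, to the closed half plane minus points
      (∃ B : ℂ → Aniso d (N : ℤ) (-(N : ℝ) / 2) →L[ℂ] Aniso d (-(N : ℤ)) ((N : ℝ) / 2),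
        (∀ s : ℂ, 0 < s.re → ∀ u : Aniso d (N : ℤ) (-(N : ℝ) / 2),
          (B s u : DistST d) = Linf s (u : DistST d)) ∧
        (4 ≤ d → ContinuousOn B ({s : ℂ | 0 ≤ s.re} \ {0})) ∧
        (d = 2 ∨ d = 3 → ContinuousOn B ({s : ℂ | 0 ≤ s.re} \
          {s : ℂ | ∃ ξ : Fin d → ℤ, s = Complex.I * latNorm ξ ∨ s = -(Complex.I * latNorm ξ)}))) ∧
      -- the singularity at `0`
      (∀ ψ : CInf d, IsBoundedDist (𝓝[{s : ℂ | 0 < s.re}] 0) (fun s φ =>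
        (L s (toDistrib ψ) : CInf d →ₗ[ℂ] ℂ) φ -
          1 / ((2 * Real.pi : ℂ) ^ d * s) * averagePairing ψ φ)) ∧
      -- the singularities at `± i |ξ₀|`, for `d = 2, 3`
      (d = 2 ∨ d = 3 → ∀ (ξ₀ : Fin d → ℤ), ξ₀ ≠ 0 → ∀ (ε : ℤˣ) (ψ : CInf d),
        IsBoundedDist (𝓝[{s : ℂ | 0 < s.re}] (((ε : ℤ) : ℂ) * Complex.I * latNorm ξ₀))
          (fun s φ =>
            (L s (toDistrib ψ) : CInf d →ₗ[ℂ] ℂ) φ -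
              Complex.exp (-(((ε : ℤ) : ℂ) * Complex.I * Real.pi * ((d : ℂ) - 1) / 4)) *
                singProfile d (s - ((ε : ℤ) : ℂ) * Complex.I * latNorm ξ₀) /
                (((2 * Real.pi) ^ (((d : ℝ) + 1) / 2) * latNorm ξ₀ ^ (((d : ℝ) - 1) / 2) : ℝ) : ℂ) *
                modePairing ε ξ₀ ψ φ)) := by
  have : NeZero d := ⟨by omega⟩
  obtain ⟨k, hk, hNk⟩ := hN
  have hχ' : IsCutoff χ := ⟨hχ, hχ_supp, hχ_one⟩
  obtain ⟨R, hR⟩ := hχ_supp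
  have hlat : ∀ {s : ℂ} {ξ : Fin d → ℤ}, s ^ 2 + (latSq ξ : ℂ) = 0 →
      s = Complex.I * latNorm ξ ∨ s = -(Complex.I * latNorm ξ) := fun {s ξ} h => by
    refine sq_eq_sq_iff_eq_or_eq_neg.1 ?_
    rw [mul_pow, Complex.I_sq, ← Complex.ofReal_pow, latNorm_sq]
    linear_combination h
  refine ⟨resolvent, shortRes hχ.continuousOn hR, longRes hχ', ?_, ?_,
    fun s u => isFlowIntegral_flowOp _ u, ?_, ?_,
    fun σ => exists_differentiable_shortRes hχ.continuousOn hR N σ, ?_,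
    isBoundedDist_resolvent_sub_average hχ', fun hd' ξ₀ hξ₀ ε ψ =>
      isBoundedDist_resolvent_sub_modes hd' hχ' hξ₀ ε ψ⟩
  · intro s hs u
    rw [resolvent_of_pos hs]
    exact isFlowIntegral_flowOp _ u
  · intro s hs u w
    rw [resolvent_of_pos hs]
    exact solvesTransport_iff hs u w
  · intro s hs u
    rw [longRes_of_pos hχ' hs]
    exact isFlowIntegral_flowOp _ u
  · intro s hs
    ext1 u
    have h := flowOp_sub (isRapid_exp hs)
      (isRapid_cutoff_mul hχ.continuousOn hR (b := fun t : ℝ => Complex.exp (-s * t)) (by fun_prop)) u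
    have h' : flowOp (hχ'.isRapid_long hs) u = flowOp (isRapid_exp hs) u -
        shortRes hχ.continuousOn hR s u := by
      refine Eq.trans ?_ h.symm
      congr 1
      congr 1
      funext t; ring
    rw [LinearMap.add_apply, resolvent_of_pos hs, longRes_of_pos hχ' hs, h']
    abel
  · by_cases h4 : 4 ≤ d
    · obtain ⟨B, hB, hB'⟩ := exists_extension_longRes hχ' (N := N) (by omega)
        (Ω := {s : ℂ | 0 ≤ s.re} \ {0}) fun s hs => ⟨hs.1, hs.2, Or.inl h4⟩
      exact ⟨B, hB, fun _ => hB', fun h => by omega⟩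
    · obtain ⟨B, hB, hB'⟩ := exists_extension_longRes hχ' (N := N) (by omega)
        (Ω := {s : ℂ | 0 ≤ s.re} \
          {s : ℂ | ∃ ξ : Fin d → ℤ, s = Complex.I * latNorm ξ ∨ s = -(Complex.I * latNorm ξ)})
        fun s hs => ⟨hs.1, fun h => hs.2 ⟨0, Or.inl (by simp [h, latNorm, latSq])⟩,
          Or.inr fun ξ h => hs.2 ⟨ξ, hlat h⟩⟩
      exact ⟨B, hB, fun h => absurd h h4, fun _ => hB'⟩
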